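/- **Setting.** Let $I_1,I_2,I_3,I_4$ be finite index sets, $\eta=\mathrm{diag}(1,-1,-1,-1)$, and let real masses $m_a>0$ ($a\in I_2$), $m_j$ ($j\in I_3$), $M_A$ ($A\in I_4$) be given; put $m_a=0$ for $a\in I_1$. Let $\gamma_\mu$ be $4\times4$ complex matrices with $\{\gamma_\mu,\gamma_\nu\}=2\eta_{\mu\nu}$, and put $\gamma_5=i\gamma_0\gamma_1\gamma_2\gamma_3$, $\gamma_\epsilon=\frac12(1+\epsilon\gamma_5)$, $\epsilon=\pm1$. Consider the free graded-commutative complex algebra generated by the fields $v_a^\mu,u_a,\tilde u_a$ ($a\in I_1\cup I_2$), $\Phi_a$ ($a\in I_2$), $\phi_j$ ($j\in I_3$), $\psi_{A\alpha},\bar\psi_{A\alpha}$ ($A\in I_4$, $\alpha=1,\dots,4$) and all their (symmetric) formal derivatives; $u_a,\tilde u_a,\psi,\bar\psi$ are odd and the other fields are even. Put $\Phi_a=0$ for $a\in I_1$ and $F_a^{\mu\nu}=d^\mu v_a^\nu-d^\nu v_a^\mu$. Let $d_\mu$ be the formal derivatives, and let $d_Q$ be the odd derivation commuting with $d_\mu$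 such that $$d_Qv_a^\mu=i\,d^\mu u_a,\quad d_Qu_a=0,\quad d_Q\tilde u_a=-i(d_\mu v_a^\mu+m_a\Phi_a),\quad d_Q\Phi_a=i\,m_au_a,\quad d_Q\phi_j=d_Q\psi=d_Q\bar\psi=0 .$$ Write $\cong$ for equality modulo the ideal generated by the equations of motion and their derivatives: the Klein–Gordon equations with mass $m_a$ for $v_a^\mu,u_a,\tilde u_a,\Phi_a$ and with mass $m_j$ for $\phi_j$, and the Dirac equations $i\gamma^\mu d_\mu\psi_A=M_A\psi_A$, $i\,d_\mu\bar\psi_A\gamma^\mu=-M_A\bar\psi_A$. The canonical dimension is $3/2$ for $\psi,\bar\psi$ and $1$ for the other fields, and each derivative adds $1$; the ghost number is $1$ for $u_a$, $-1$ for $\tilde u_a$ and $0$ otherwise. All expressions below are trilinear, contain $\psi$ and $\bar\psi$ equally often, and are covariant under proper orthochronous Lorentz transformations. An *interaction Lagrangian* is a Lorentz scalar $T$ of ghost number $0$ and canonical dimension $\le4$ for which there is a Lorentz vector $T^\mu$ of ghost number $1$ and canonical dimension $\le4$ with $d_QT\cong i\,d_\mu T^\mu$. **Theorem.** (1) For every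 interaction Lagrangian $T$ there are complex constants subject to the relations below, and $B$, $B^\mu$ (a Lorentz scalar and a Lorentz vector of ghost numbers $-1$ and $0$, of canonical dimension $\le3$), such that $T\cong T_{\rm int}+d_QB+i\,d_\mu B^\mu$, where (summing over repeated indices, $a,b,c\in I_1\cup I_2$ and $j,k,l\in I_3$) $$\begin{aligned} T_{\rm int}={}&f_{abc}\bigl(\tfrac12v_{a\mu}v_{b\nu}F_c^{\nu\mu}+u_av_b^\mu d_\mu\tilde u_c\bigr) +f'_{abc}\bigl(\Phi_ad_\mu\Phi_bv_c^\mu-m_b\Phi_av_{b\mu}v_c^\mu+m_b\Phi_a\tilde u_bu_c\bigr)+j_a^\mu v_{a\mu}+j_a\Phi_a\\ &+\phi_jf'_{jbc}\bigl(d_\mu\Phi_bv_c^\mu-m_bv_b^\mu v_{c\mu}+m_b\tilde u_bu_c\bigr)+\tfrac12f''_{jbc}\phi_j\Phi_b\Phi_c+\phi_jd_j\\ &-f'_{jbc}\,d_\mu\phi_j\Phi_bv_c^\mu+f'_{jkc}\phi_jd_\mu\phi_kv_c^\mu+\tfrac12f''_{jkc}\phi_j\phi_k\Phi_c+\tfrac1{3!}\lambda_{jkl}\phi_j\phi_k\phi_l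 , \end{aligned}$$ with $j_a^\mu=\sum_\epsilon\bar\psi\,t_a^\epsilon\otimes\gamma^\mu\gamma_\epsilon\psi$, $j_a=\sum_\epsilon\bar\psi\,s_a^\epsilon\otimes\gamma_\epsilon\psi$, $d_j=\sum_\epsilon\bar\psi\,s_j^\epsilon\otimes\gamma_\epsilon\psi$, where $t_a^\epsilon,s_a^\epsilon,s_j^\epsilon$ are complex $I_4\times I_4$ matrices. (2) Conversely, for all constants subject to the relations, $T_{\rm int}$ is an interaction Lagrangian, with $$\begin{aligned} T^\mu={}&f_{abc}\bigl(u_av_{b\nu}F_c^{\nu\mu}-\tfrac12u_au_bd^\mu\tilde u_c\bigr)+j_a^\mu u_a+f'_{abc}\bigl(\Phi_ad^\mu\Phi_bu_c-m_b\Phi_av_b^\mu u_c\bigr)\\ &+\phi_jf'_{jbc}\bigl(d^\mu\Phi_bu_c-m_bv_b^\mu u_c\bigr)-f'_{jbc}\,d^\mu\phi_j\Phi_bu_c+f'_{jkc}\phi_jd^\mu\phi_ku_c , \end{aligned}$$ and for $T^{\mu\nu}=\tfrac12f_{abc}u_au_bF_c^{\mu\nu}$ we have $d_QT^\mu\cong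 i\,d_\nu T^{\mu\nu}$ and $d_QT^{\mu\nu}\cong0$. The relations are: $f'_{abc}=0$ and $s_a^\epsilon=0$ for $a\in I_1$; $f_{abc}$ is completely antisymmetric; $f'_{abc}=-f'_{bac}$; $f'_{jkc}=-f'_{kjc}$; $\lambda_{jkl}$ is completely symmetric; and $$\begin{aligned} &m_bf'_{abc}-m_cf'_{acb}=m_af_{abc}&&(a\in I_2,\ b,c\in I_1\cup I_2),\\ &m_bf'_{jbc}-m_cf'_{jcb}=0&&(b\in I_2,\ c\in I_1\cup I_2),\\ &i\,(M\,t_a^\epsilon-t_a^{-\epsilon}M)=m_as_a^\epsilon&&(a\in I_1\cup I_2,\ \epsilon=\pm1),\quad M=\mathrm{diag}(M_A),\\ &f''_{jbc}=\tfrac{m_j^2}{m_c}f'_{jbc}&&(b,c\in I_2),\\ &f''_{jkc}=-\tfrac1{m_c}\bigl(m_k^2f'_{jkc}+m_j^2f'_{kjc}\bigr)=\tfrac1{m_c}(m_j^2-m_k^2)f'_{jkc}&&(c\in I_2),\\ &(m_j^2-m_k^2)f'_{jkc}=0&&(c\in I_1). \end{aligned}$$ (3) For arbitrary matrices $t_a^\epsilon,s_a^\epsilon$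 and every $a\in I_1\cup I_2$, the current relation $d_\mu j_a^\mu\cong m_aj_a$ holds if and only if $i(Mt_a^\epsilon-t_a^{-\epsilon}M)=m_as_a^\epsilon$ for $\epsilon=\pm1$. -/

import Mathlib

open scoped BigOperators

noncomputable section

namespace StandardModel

/-- The fields: `v_a^μ`, ghosts `u_a` and anti-ghosts `ũ_a` for `a ∈ I₁ ∪ I₂` (massless and massive
vector fields), scalar ghosts `Φ_a` for `a ∈ I₂` only, scalar fields `φ_j` for `j ∈ I₃`, Dirac fields
`ψ_{Aα}`, `ψ̄_{Aα}` for `A ∈ I₄`. Vector and spinor components are separate fields. -/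
inductive Field (I₁ I₂ I₃ I₄ : Type*)
  | v (a : I₁ ⊕ I₂) (μ : Fin 4)
  | u (a : I₁ ⊕ I₂)
  | ut (a : I₁ ⊕ I₂)
  | Phi (a : I₂)
  | phi (j : I₃)
  | psi (A : I₄) (α : Fin 4)
  | psibar (A : I₄) (α : Fin 4)

/-- Diagonal entries of the Minkowski metric `diag(1,-1,-1,-1)`. -/
def η (μ : Fin 4) : ℂ := if μ = 0 then 1 else -1

/-- The masses and the Dirac matrices `γ_μ` (lower index). The vector fields labelled by `I₂` are
the massive ones. -/
structure Model (I₁ I₂ I₃ I₄ : Type*) where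
  massV : I₂ → ℝ
  massS : I₃ → ℝ
  massD : I₄ → ℝ
  γ : Fin 4 → Matrix (Fin 4) (Fin 4) ℂ
  massV_pos : ∀ a, 0 < massV a
  clifford : ∀ μ ν, γ μ * γ ν + γ ν * γ μ =
    (2 * if μ = ν then η μ else 0) • (1 : Matrix (Fin 4) (Fin 4) ℂ)

section Algebra

variable {I₁ I₂ I₃ I₄ : Type*}

/-- Grassmann parity: ghosts, anti-ghosts and Dirac fields are odd. -/
def Field.odd : Field I₁ I₂ I₃ I₄ → Bool
  | .v _ _ => false
  | .u _ => true
  | .ut _ => true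
  | .Phi _ => false
  | .phi _ => false
  | .psi _ _ => true
  | .psibar _ _ => true

/-- Ghost number. -/
def Field.gh : Field I₁ I₂ I₃ I₄ → ℤ
  | .u _ => 1
  | .ut _ => -1
  | _ => 0

/-- Canonical dimension of the underived fields. -/
def Field.dim : Field I₁ I₂ I₃ I₄ → ℚ
  | .psi _ _ => 3 / 2
  | .psibar _ _ => 3 / 2
  | _ => 1

/-- Fermion number: number of `ψ` minus number of `ψ̄`. -/
def Field.fermion : Field I₁ I₂ I₃ I₄ → ℤ
  | .psi _ _ => 1
  | .psibar _ _ => -1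
  | _ => 0

/-- A jet variable: a field with a symmetric multi-index of derivatives; `J μ` is the number of
derivatives in the direction `μ`. -/
structure JetVar (I₁ I₂ I₃ I₄ : Type*) where
  field : Field I₁ I₂ I₃ I₄
  J : Fin 4 →₀ ℕ

/-- Each derivative raises the canonical dimension by one. -/
def JetVar.dim (x : JetVar I₁ I₂ I₃ I₄) : ℚ := x.field.dim + ∑ μ, (x.J μ : ℚ)

/-- The sign `(-1)^{pq}` of the exchange of elements of parity `p` and `q`. -/
def sgn (p q : Bool) : ℂ := if p && q then -1 else 1

/-- Graded commutativity of the jet variables. -/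
inductive SuperComm :
    FreeAlgebra ℂ (JetVar I₁ I₂ I₃ I₄) → FreeAlgebra ℂ (JetVar I₁ I₂ I₃ I₄) → Prop
  | swap (x y : JetVar I₁ I₂ I₃ I₄) :
      SuperComm (FreeAlgebra.ι ℂ x * FreeAlgebra.ι ℂ y)
        (sgn x.field.odd y.field.odd • (FreeAlgebra.ι ℂ y * FreeAlgebra.ι ℂ x))

variable (I₁ I₂ I₃ I₄) in
/-- The algebra of polynomials in the jet variables: the free graded commutative algebra. -/
abbrev Jet := RingQuot (SuperComm (I₁ := I₁) (I₂ := I₂) (I₃ := I₃) (I₄ := I₄))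

/-- The jet variable `d_J f` as an element of the algebra. -/
def jet (f : Field I₁ I₂ I₃ I₄) (J : Fin 4 →₀ ℕ) : Jet I₁ I₂ I₃ I₄ :=
  RingQuot.mkAlgHom ℂ SuperComm (FreeAlgebra.ι ℂ ⟨f, J⟩)

variable (I₁ I₂ I₃ I₄) in
/-- Linear combinations of jet variables of parity `p`. -/
def lin (p : Bool) : Submodule ℂ (Jet I₁ I₂ I₃ I₄) :=
  Submodule.span ℂ {y | ∃ f J, Field.odd f = p ∧ y = jet f J}

theorem jet_mem_lin (f : Field I₁ I₂ I₃ I₄) (J : Fin 4 →₀ ℕ) : jet f J ∈ lin I₁ I₂ I₃ I₄ f.odd :=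
  Submodule.subset_span ⟨f, J, rfl, rfl⟩

theorem jet_mul_jet (f g : Field I₁ I₂ I₃ I₄) (J K : Fin 4 →₀ ℕ) :
    jet f J * jet g K = sgn f.odd g.odd • (jet g K * jet f J) := by
  have h := RingQuot.mkAlgHom_rel ℂ (SuperComm.swap (⟨f, J⟩ : JetVar I₁ I₂ I₃ I₄) ⟨g, K⟩)
  simpa [jet, map_mul, map_smul] using h

theorem lin_mul_lin {p q : Bool} {y z : Jet I₁ I₂ I₃ I₄} (hy : y ∈ lin I₁ I₂ I₃ I₄ p)
    (hz : z ∈ lin I₁ I₂ I₃ I₄ q) : y * z = sgn p q • (z * y) := by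
  induction hy using Submodule.span_induction with
  | mem y hy =>
    obtain ⟨f, J, rfl, rfl⟩ := hy
    induction hz using Submodule.span_induction with
    | mem z hz =>
      obtain ⟨g, K, rfl, rfl⟩ := hz
      exact jet_mul_jet f g J K
    | zero => simp
    | add z w _ _ h1 h2 => rw [mul_add, add_mul, h1, h2, smul_add]
    | smul c z _ h => rw [mul_smul_comm, smul_mul_assoc, h, smul_comm]
  | zero => simp
  | add y w _ _ h1 h2 => rw [mul_add, add_mul, h1, h2, smul_add]
  | smul c y _ h => rw [mul_smul_comm, smul_mul_assoc, h, smul_comm]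

/-- The algebra morphism with prescribed parity preserving values on the jet variables. -/
def extendHom (F : JetVar I₁ I₂ I₃ I₄ → Jet I₁ I₂ I₃ I₄)
    (hF : ∀ x, F x ∈ lin I₁ I₂ I₃ I₄ x.field.odd) : Jet I₁ I₂ I₃ I₄ →ₐ[ℂ] Jet I₁ I₂ I₃ I₄ :=
  RingQuot.liftAlgHom ℂ ⟨FreeAlgebra.lift ℂ F, by
    rintro _ _ ⟨x, y⟩
    simpa using lin_mul_lin (hF x) (hF y)⟩

theorem sgn_cancel (p a b : Bool) : sgn p a * sgn a (xor p b) = sgn a b := by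
  cases p <;> cases a <;> cases b <;> simp [sgn]

theorem sgn_cancel_right (p a b : Bool) : sgn (xor p a) b = sgn a b * sgn p b := by
  cases p <;> cases a <;> cases b <;> simp [sgn]

/-- The algebra morphism `A ↦ (σ A, D A; 0, A)` into upper triangular matrices, where
`σ A = (-1)^{p |A|} A` and `D` is the graded derivation of parity `p` with values `δ` on the jet
variables. -/
def derivationHom (p : Bool) (δ : JetVar I₁ I₂ I₃ I₄ → Jet I₁ I₂ I₃ I₄)
    (hδ : ∀ x, δ x ∈ lin I₁ I₂ I₃ I₄ (xor p x.field.odd)) :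
    Jet I₁ I₂ I₃ I₄ →ₐ[ℂ] Matrix (Fin 2) (Fin 2) (Jet I₁ I₂ I₃ I₄) :=
  RingQuot.liftAlgHom ℂ ⟨FreeAlgebra.lift ℂ fun x =>
      !![sgn p x.field.odd • jet x.field x.J, δ x; 0, jet x.field x.J], by
    rintro _ _ ⟨x, y⟩
    have h0 := jet_mul_jet x.field y.field x.J y.J
    have h1 := lin_mul_lin (jet_mem_lin x.field x.J) (hδ y)
    have h2 := lin_mul_lin (hδ x) (jet_mem_lin y.field y.J)
    have e1 : sgn p x.field.odd • (jet x.field x.J * δ y) =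
        sgn x.field.odd y.field.odd • (δ y * jet x.field x.J) := by
      rw [h1, smul_smul, sgn_cancel]
    have e2 : δ x * jet y.field y.J =
        (sgn x.field.odd y.field.odd * sgn p y.field.odd) • (jet y.field y.J * δ x) := by
      rw [h2, sgn_cancel_right]
    ext i j
    fin_cases i <;> fin_cases j
    · simp [Matrix.mul_apply, Fin.sum_univ_two, h0, smul_smul]
      congr 1
      ring
    · simp [Matrix.mul_apply, Fin.sum_univ_two, e1, e2, smul_smul, smul_add]
      rw [add_comm]
    · simp [Matrix.mul_apply, Fin.sum_univ_two]
    · simp [Matrix.mul_apply, Fin.sum_univ_two, h0]⟩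

/-- The graded derivation of parity `p` (even: `p = false`, odd: `p = true`) with values `δ` on the
jet variables: `D (A B) = D A B + (-1)^{p |A|} A D B`. -/
def superDerivation (p : Bool) (δ : JetVar I₁ I₂ I₃ I₄ → Jet I₁ I₂ I₃ I₄)
    (hδ : ∀ x, δ x ∈ lin I₁ I₂ I₃ I₄ (xor p x.field.odd)) :
    Jet I₁ I₂ I₃ I₄ →ₗ[ℂ] Jet I₁ I₂ I₃ I₄ where
  toFun A := derivationHom p δ hδ A 0 1
  map_add' A B := by simp
  map_smul' c A := by simp

/-- The formal derivative `d_ν` (lower index). -/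
def d (ν : Fin 4) : Jet I₁ I₂ I₃ I₄ →ₗ[ℂ] Jet I₁ I₂ I₃ I₄ :=
  superDerivation false (fun x => jet x.field (x.J + Finsupp.single ν 1))
    (fun x => by simpa using jet_mem_lin x.field _)

/-- The formal derivative `d^ν` (upper index). -/
def dUp (ν : Fin 4) (A : Jet I₁ I₂ I₃ I₄) : Jet I₁ I₂ I₃ I₄ := η ν • d ν A

/-- The fields as elements of the algebra. -/
def v (a : I₁ ⊕ I₂) (μ : Fin 4) : Jet I₁ I₂ I₃ I₄ := jet (.v a μ) 0

/-- `v_{aμ}` (lower index). -/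
def vLow (a : I₁ ⊕ I₂) (μ : Fin 4) : Jet I₁ I₂ I₃ I₄ := η μ • v a μ

def u (a : I₁ ⊕ I₂) : Jet I₁ I₂ I₃ I₄ := jet (.u a) 0

def ut (a : I₁ ⊕ I₂) : Jet I₁ I₂ I₃ I₄ := jet (.ut a) 0

/-- `d_J Φ_a`, with the convention `Φ_a = 0` for `a ∈ I₁`. -/
def jetPhi (a : I₁ ⊕ I₂) (J : Fin 4 →₀ ℕ) : Jet I₁ I₂ I₃ I₄ :=
  match a with
  | .inl _ => 0
  | .inr b => jet (.Phi b) J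

def Phi (a : I₁ ⊕ I₂) : Jet I₁ I₂ I₃ I₄ := jetPhi a 0

def phi (j : I₃) : Jet I₁ I₂ I₃ I₄ := jet (.phi j) 0

def psi (A : I₄) (α : Fin 4) : Jet I₁ I₂ I₃ I₄ := jet (.psi A α) 0

def psibar (A : I₄) (α : Fin 4) : Jet I₁ I₂ I₃ I₄ := jet (.psibar A α) 0

/-- `F_a^{μν} = d^μ v_a^ν - d^ν v_a^μ`. -/
def fieldStrength (a : I₁ ⊕ I₂) (μ ν : Fin 4) : Jet I₁ I₂ I₃ I₄ := dUp μ (v a ν) - dUp ν (v a μ)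

variable (I₁ I₂ I₃ I₄) in
/-- Trilinear expressions of canonical dimension at most `w` and ghost number `g`, in which `ψ` and
`ψ̄` occur equally often. -/
def cubic (w : ℚ) (g : ℤ) : Submodule ℂ (Jet I₁ I₂ I₃ I₄) :=
  Submodule.span ℂ {A | ∃ x y z : JetVar I₁ I₂ I₃ I₄,
    A = jet x.field x.J * jet y.field y.J * jet z.field z.J ∧
    x.dim + y.dim + z.dim ≤ w ∧
    x.field.gh + y.field.gh + z.field.gh = g ∧
    x.field.fermion + y.field.fermion + z.field.fermion = 0}

end Algebra

namespace Model

variable {I₁ I₂ I₃ I₄ : Type*} (𝓜 : Model I₁ I₂ I₃ I₄)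

/-- The mass `m_a`, `a ∈ I₁ ∪ I₂`, with `m_a = 0` for `a ∈ I₁`. -/
def m (a : I₁ ⊕ I₂) : ℂ :=
  match a with
  | .inl _ => 0
  | .inr b => (𝓜.massV b : ℂ)

/-- The mass `m_j` of the scalar field `φ_j`. -/
def mS (j : I₃) : ℂ := (𝓜.massS j : ℂ)

/-- The mass `M_A` of the Dirac field `ψ_A`. -/
def mD (A : I₄) : ℂ := (𝓜.massD A : ℂ)

/-- `γ^μ` (upper index). -/
def γUp (μ : Fin 4) : Matrix (Fin 4) (Fin 4) ℂ := η μ • 𝓜.γ μ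

def γ₅ : Matrix (Fin 4) (Fin 4) ℂ := Complex.I • (𝓜.γ 0 * 𝓜.γ 1 * 𝓜.γ 2 * 𝓜.γ 3)

/-- `γ_ε = (1 + ε γ₅) / 2`, `ε = ±1`. -/
def γε (ε : ℤˣ) : Matrix (Fin 4) (Fin 4) ℂ := (1 / 2 : ℂ) • (1 + (((ε : ℤ) : ℂ)) • 𝓜.γ₅)

/-- The values of the gauge charge on the jet variables; it commutes with the formal derivatives. -/
def gaugeVar (x : JetVar I₁ I₂ I₃ I₄) : Jet I₁ I₂ I₃ I₄ :=
  match x.field with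
  | .v a μ => (Complex.I * η μ) • jet (.u a) (x.J + Finsupp.single μ 1)
  | .u _ => 0
  | .ut a => (-Complex.I) •
      ((∑ μ, jet (.v a μ) (x.J + Finsupp.single μ 1)) + 𝓜.m a • jetPhi a x.J)
  | .Phi b => (Complex.I * 𝓜.m (.inr b)) • jet (.u (.inr b)) x.J
  | .phi _ => 0
  | .psi _ _ => 0
  | .psibar _ _ => 0

theorem gaugeVar_mem (x : JetVar I₁ I₂ I₃ I₄) :
    𝓜.gaugeVar x ∈ lin I₁ I₂ I₃ I₄ (xor true x.field.odd) := by
  obtain ⟨f, J⟩ := x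
  cases f with
  | v a μ => exact Submodule.smul_mem _ _ (jet_mem_lin (.u a) _)
  | u a => exact Submodule.zero_mem _
  | ut a =>
    refine Submodule.smul_mem _ _ (Submodule.add_mem _
      (Submodule.sum_mem _ fun μ _ => jet_mem_lin (.v a μ) _) (Submodule.smul_mem _ _ ?_))
    cases a with
    | inl a => exact Submodule.zero_mem _
    | inr b => exact jet_mem_lin (.Phi b) _
  | Phi b => exact Submodule.smul_mem _ _ (jet_mem_lin (.u (.inr b)) _)
  | phi j => exact Submodule.zero_mem _
  | psi A α => exact Submodule.zero_mem _
  | psibar A α => exact Submodule.zero_mem _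

/-- The gauge charge operator `d_Q`, an odd derivation. -/
def dQ : Jet I₁ I₂ I₃ I₄ →ₗ[ℂ] Jet I₁ I₂ I₃ I₄ :=
  superDerivation true 𝓜.gaugeVar 𝓜.gaugeVar_mem

/-- The derivative `d_J` of `(□ + m²) f`. -/
def kleinGordon (f : Field I₁ I₂ I₃ I₄) (mass : ℂ) (J : Fin 4 →₀ ℕ) : Jet I₁ I₂ I₃ I₄ :=
  (∑ μ, η μ • jet f (J + Finsupp.single μ 2)) + mass ^ 2 • jet f J

/-- The equations of motion and all their formal derivatives: Klein-Gordon equations,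
`i γ^μ d_μ ψ = M ψ` and `i d_μ ψ̄ γ^μ = - M ψ̄`. -/
inductive IsEOM : Jet I₁ I₂ I₃ I₄ → Prop
  | v (a : I₁ ⊕ I₂) (μ : Fin 4) (J : Fin 4 →₀ ℕ) : IsEOM (kleinGordon (.v a μ) (𝓜.m a) J)
  | u (a : I₁ ⊕ I₂) (J : Fin 4 →₀ ℕ) : IsEOM (kleinGordon (.u a) (𝓜.m a) J)
  | ut (a : I₁ ⊕ I₂) (J : Fin 4 →₀ ℕ) : IsEOM (kleinGordon (.ut a) (𝓜.m a) J)
  | Phi (b : I₂) (J : Fin 4 →₀ ℕ) : IsEOM (kleinGordon (.Phi b) (𝓜.m (.inr b)) J)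
  | phi (j : I₃) (J : Fin 4 →₀ ℕ) : IsEOM (kleinGordon (.phi j) (𝓜.mS j) J)
  | psi (A : I₄) (α : Fin 4) (J : Fin 4 →₀ ℕ) :
      IsEOM (Complex.I • (∑ μ, ∑ β, 𝓜.γUp μ α β • jet (.psi A β) (J + Finsupp.single μ 1))
        - 𝓜.mD A • jet (.psi A α) J)
  | psibar (A : I₄) (α : Fin 4) (J : Fin 4 →₀ ℕ) :
      IsEOM (Complex.I • (∑ μ, ∑ β, 𝓜.γUp μ β α • jet (.psibar A β) (J + Finsupp.single μ 1))
        + 𝓜.mD A • jet (.psibar A α) J)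

/-- `A ≅ B`: equality modulo the equations of motion. -/
def OnShellEq (A B : Jet I₁ I₂ I₃ I₄) : Prop := A - B ∈ TwoSidedIdeal.span {E | 𝓜.IsEOM E}

/-- `Λ` is a proper orthochronous Lorentz transformation and `S` represents it on spinors. Given `Λ`,
the matrix `S` is determined up to a scalar factor, which has no effect on expressions containing
`ψ` and `ψ̄` equally often. -/
structure IsLorentzPair (Λ : Matrix (Fin 4) (Fin 4) ℝ) (S : Matrix (Fin 4) (Fin 4) ℂ) : Prop where
  lorentz : Λ.transpose * Matrix.diagonal ![1, -1, -1, -1] * Λ = Matrix.diagonal ![1, -1, -1, -1]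
  proper : Λ.det = 1
  orthochronous : 1 ≤ Λ 0 0
  unit : IsUnit S.det
  spin : ∀ μ, S⁻¹ * 𝓜.γUp μ * S = ∑ ν, (Λ μ ν : ℂ) • 𝓜.γUp ν

end Model

section Lorentz

variable {I₁ I₂ I₃ I₄ : Type*}

/-- The derivative monomial `d_J` after the substitution `d_μ ↦ (Λ⁻¹)^ν_μ d_ν`, as a polynomial in
the derivatives. -/
def lorentzDer (Λ : Matrix (Fin 4) (Fin 4) ℝ) (J : Fin 4 →₀ ℕ) : MvPolynomial (Fin 4) ℂ :=
  ∏ μ, (∑ ν, MvPolynomial.C ((Λ⁻¹ ν μ : ℝ) : ℂ) * MvPolynomial.X ν) ^ J μ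

/-- The transformed derivative monomial applied to the field `f`. -/
def lorentzJet (Λ : Matrix (Fin 4) (Fin 4) ℝ) (f : Field I₁ I₂ I₃ I₄) (J : Fin 4 →₀ ℕ) :
    Jet I₁ I₂ I₃ I₄ :=
  ∑ K ∈ (lorentzDer Λ J).support, (lorentzDer Λ J).coeff K • jet f K

/-- `v^μ ↦ Λ^μ_ν v^ν`, `ψ ↦ S ψ`, `ψ̄ ↦ ψ̄ S⁻¹`, the other fields being scalars. -/
def lorentzVar (Λ : Matrix (Fin 4) (Fin 4) ℝ) (S : Matrix (Fin 4) (Fin 4) ℂ)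
    (x : JetVar I₁ I₂ I₃ I₄) : Jet I₁ I₂ I₃ I₄ :=
  match x.field with
  | .v a μ => ∑ ν, (Λ μ ν : ℂ) • lorentzJet Λ (.v a ν) x.J
  | .u a => lorentzJet Λ (.u a) x.J
  | .ut a => lorentzJet Λ (.ut a) x.J
  | .Phi b => lorentzJet Λ (.Phi b) x.J
  | .phi j => lorentzJet Λ (.phi j) x.J
  | .psi A α => ∑ β, S α β • lorentzJet Λ (.psi A β) x.J
  | .psibar A α => ∑ β, S⁻¹ β α • lorentzJet Λ (.psibar A β) x.J

theorem lorentzJet_mem (Λ : Matrix (Fin 4) (Fin 4) ℝ) (f : Field I₁ I₂ I₃ I₄) (J : Fin 4 →₀ ℕ) :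
    lorentzJet Λ f J ∈ lin I₁ I₂ I₃ I₄ f.odd :=
  Submodule.sum_mem _ fun K _ => Submodule.smul_mem _ _ (jet_mem_lin f K)

theorem lorentzVar_mem (Λ : Matrix (Fin 4) (Fin 4) ℝ) (S : Matrix (Fin 4) (Fin 4) ℂ)
    (x : JetVar I₁ I₂ I₃ I₄) : lorentzVar Λ S x ∈ lin I₁ I₂ I₃ I₄ x.field.odd := by
  obtain ⟨f, J⟩ := x
  cases f with
  | v a μ =>
    exact Submodule.sum_mem _ fun ν _ => Submodule.smul_mem _ _ (lorentzJet_mem Λ (.v a ν) J)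
  | u a => exact lorentzJet_mem Λ (.u a) J
  | ut a => exact lorentzJet_mem Λ (.ut a) J
  | Phi b => exact lorentzJet_mem Λ (.Phi b) J
  | phi j => exact lorentzJet_mem Λ (.phi j) J
  | psi A α =>
    exact Submodule.sum_mem _ fun β _ => Submodule.smul_mem _ _ (lorentzJet_mem Λ (.psi A β) J)
  | psibar A α =>
    exact Submodule.sum_mem _ fun β _ => Submodule.smul_mem _ _ (lorentzJet_mem Λ (.psibar A β) J)

/-- The action of a Lorentz transformation on the jet algebra. -/
def lorentzHom (Λ : Matrix (Fin 4) (Fin 4) ℝ) (S : Matrix (Fin 4) (Fin 4) ℂ) :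
    Jet I₁ I₂ I₃ I₄ →ₐ[ℂ] Jet I₁ I₂ I₃ I₄ :=
  extendHom (lorentzVar Λ S) (lorentzVar_mem Λ S)

end Lorentz

/-- The constants in the interaction Lagrangian: `f` is `f_{abc}`, `fp` is `f'_{abc}`, `fSp` and
`fSpp` are `f'_{jbc}` and `f''_{jbc}`, `fSSp` and `fSSpp` are `f'_{jkc}` and `f''_{jkc}`, `lam` is
`λ_{jkl}`, and `t`, `s`, `sS` are the matrices `t_a^ε`, `s_a^ε`, `s_j^ε`. -/
structure Couplings (I₁ I₂ I₃ I₄ : Type*) where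
  f : I₁ ⊕ I₂ → I₁ ⊕ I₂ → I₁ ⊕ I₂ → ℂ
  fp : I₁ ⊕ I₂ → I₁ ⊕ I₂ → I₁ ⊕ I₂ → ℂ
  fSp : I₃ → I₁ ⊕ I₂ → I₁ ⊕ I₂ → ℂ
  fSpp : I₃ → I₁ ⊕ I₂ → I₁ ⊕ I₂ → ℂ
  fSSp : I₃ → I₃ → I₁ ⊕ I₂ → ℂ
  fSSpp : I₃ → I₃ → I₁ ⊕ I₂ → ℂ
  lam : I₃ → I₃ → I₃ → ℂ
  t : I₁ ⊕ I₂ → ℤˣ → Matrix I₄ I₄ ℂ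
  s : I₁ ⊕ I₂ → ℤˣ → Matrix I₄ I₄ ℂ
  sS : I₃ → ℤˣ → Matrix I₄ I₄ ℂ

namespace Model

section Covariance

variable {I₁ I₂ I₃ I₄ : Type*} (𝓜 : Model I₁ I₂ I₃ I₄)

/-- Lorentz invariance of a scalar expression. -/
def IsScalar (A : Jet I₁ I₂ I₃ I₄) : Prop :=
  ∀ Λ S, 𝓜.IsLorentzPair Λ S → lorentzHom Λ S A = A

/-- Lorentz covariance of an expression with one upper Lorentz index. -/
def IsVector (A : Fin 4 → Jet I₁ I₂ I₃ I₄) : Prop :=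
  ∀ Λ S, 𝓜.IsLorentzPair Λ S → ∀ μ, lorentzHom Λ S (A μ) = ∑ ν, (Λ μ ν : ℂ) • A ν

/-- The conditions on an interaction Lagrangian `T` with associated `T^μ`: trilinear, Lorentz
covariant, canonical dimension at most 4, ghost numbers 0 and 1, and `d_Q T ≅ i d_μ T^μ`. -/
structure IsInteraction (T : Jet I₁ I₂ I₃ I₄) (Tv : Fin 4 → Jet I₁ I₂ I₃ I₄) : Prop where
  mem : T ∈ cubic I₁ I₂ I₃ I₄ 4 0
  memv : ∀ μ, Tv μ ∈ cubic I₁ I₂ I₃ I₄ 4 1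
  scalar : 𝓜.IsScalar T
  vector : 𝓜.IsVector Tv
  gauge : 𝓜.OnShellEq (𝓜.dQ T) (Complex.I • ∑ μ, d μ (Tv μ))

/-- `T` and `T'` differ by a relative coboundary `d_Q B + i d_μ B^μ` modulo the equations of motion,
where `B` and `B^μ` are again trilinear and Lorentz covariant, of ghost numbers `-1` and `0` and of
canonical dimension at most 3. -/
def Cohomologous (T T' : Jet I₁ I₂ I₃ I₄) : Prop :=
  ∃ (B : Jet I₁ I₂ I₃ I₄) (Bv : Fin 4 → Jet I₁ I₂ I₃ I₄),
    B ∈ cubic I₁ I₂ I₃ I₄ 3 (-1) ∧ (∀ μ, Bv μ ∈ cubic I₁ I₂ I₃ I₄ 3 0) ∧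
    𝓜.IsScalar B ∧ 𝓜.IsVector Bv ∧
    𝓜.OnShellEq T (T' + 𝓜.dQ B + Complex.I • ∑ μ, d μ (Bv μ))

end Covariance

section Lagrangian

variable {I₁ I₂ I₃ I₄ : Type*} [Fintype I₁] [Fintype I₂] [Fintype I₃] [Fintype I₄]
  (𝓜 : Model I₁ I₂ I₃ I₄) (c : Couplings I₁ I₂ I₃ I₄)

/-- The bilinear `ψ̄ (k ⊗ Γ) ψ`. -/
def bilinear (k : Matrix I₄ I₄ ℂ) (Γ : Matrix (Fin 4) (Fin 4) ℂ) : Jet I₁ I₂ I₃ I₄ :=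
  ∑ A, ∑ B, ∑ α, ∑ β, (k A B * Γ α β) • (psibar A α * psi B β)

/-- `j_a^μ = ψ̄ t_a^ε ⊗ γ^μ γ_ε ψ` for given matrices `t_a^ε`. -/
def vectorCurrent (t : ℤˣ → Matrix I₄ I₄ ℂ) (μ : Fin 4) : Jet I₁ I₂ I₃ I₄ :=
  ∑ ε, bilinear (t ε) (𝓜.γUp μ * 𝓜.γε ε)

/-- `j_a = ψ̄ s_a^ε ⊗ γ_ε ψ` for given matrices `s_a^ε`. -/
def scalarCurrent (s : ℤˣ → Matrix I₄ I₄ ℂ) : Jet I₁ I₂ I₃ I₄ :=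
  ∑ ε, bilinear (s ε) (𝓜.γε ε)

/-- The interaction Lagrangian `T`. -/
def Tint : Jet I₁ I₂ I₃ I₄ :=
  (∑ a, ∑ b, ∑ e, c.f a b e •
    ((1 / 2 : ℂ) • (∑ μ, ∑ ν, vLow a μ * vLow b ν * fieldStrength e ν μ)
      + ∑ μ, u a * v b μ * d μ (ut e)))
  + (∑ a, ∑ b, ∑ e, c.fp a b e •
    ((∑ μ, Phi a * d μ (Phi b) * v e μ)
      - 𝓜.m b • (∑ μ, Phi a * vLow b μ * v e μ)
      + 𝓜.m b • (Phi a * ut b * u e)))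
  + (∑ a, ∑ μ, 𝓜.vectorCurrent (c.t a) μ * vLow a μ)
  + (∑ a, 𝓜.scalarCurrent (c.s a) * Phi a)
  + (∑ j, ∑ b, ∑ e, c.fSp j b e • (phi j *
    ((∑ μ, d μ (Phi b) * v e μ) - 𝓜.m b • (∑ μ, v b μ * vLow e μ) + 𝓜.m b • (ut b * u e))))
  + (1 / 2 : ℂ) • (∑ j, ∑ b, ∑ e, c.fSpp j b e • (phi j * Phi b * Phi e))
  + (∑ j, phi j * 𝓜.scalarCurrent (c.sS j))
  - (∑ j, ∑ b, ∑ e, c.fSp j b e • (∑ μ, d μ (phi j) * Phi b * v e μ))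
  + (∑ j, ∑ k, ∑ e, c.fSSp j k e • (∑ μ, phi j * d μ (phi k) * v e μ))
  + (1 / 2 : ℂ) • (∑ j, ∑ k, ∑ e, c.fSSpp j k e • (phi j * phi k * Phi e))
  + (1 / 6 : ℂ) • (∑ j, ∑ k, ∑ l, c.lam j k l • (phi j * phi k * phi l))

/-- The associated `T^μ`. -/
def Tvec (μ : Fin 4) : Jet I₁ I₂ I₃ I₄ :=
  (∑ a, ∑ b, ∑ e, c.f a b e •
    ((∑ ν, u a * vLow b ν * fieldStrength e ν μ) - (1 / 2 : ℂ) • (u a * u b * dUp μ (ut e))))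
  + (∑ a, 𝓜.vectorCurrent (c.t a) μ * u a)
  + (∑ a, ∑ b, ∑ e, c.fp a b e •
    (Phi a * dUp μ (Phi b) * u e - 𝓜.m b • (Phi a * v b μ * u e)))
  + (∑ j, ∑ b, ∑ e, c.fSp j b e •
    (phi j * (dUp μ (Phi b) * u e - 𝓜.m b • (v b μ * u e))))
  - (∑ j, ∑ b, ∑ e, c.fSp j b e • (dUp μ (phi j) * Phi b * u e))
  + (∑ j, ∑ k, ∑ e, c.fSSp j k e • (phi j * dUp μ (phi k) * u e))

/-- The associated `T^{μν}`. -/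
def Tten (μ ν : Fin 4) : Jet I₁ I₂ I₃ I₄ :=
  (1 / 2 : ℂ) • (∑ a, ∑ b, ∑ e, c.f a b e • (u a * u b * fieldStrength e μ ν))

end Lagrangian

end Model

/-- The relations between the constants. The mass matrix of the Dirac fields is diagonal, so that
`(M t)_{AB} = M_A t_{AB}` and `(t M)_{AB} = t_{AB} M_B`. -/
structure Couplings.Relations {I₁ I₂ I₃ I₄ : Type*} (𝓜 : Model I₁ I₂ I₃ I₄)
    (c : Couplings I₁ I₂ I₃ I₄) : Prop where
  fp_massless : ∀ (a : I₁) b e, c.fp (.inl a) b e = 0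
  s_massless : ∀ (a : I₁) ε, c.s (.inl a) ε = 0
  f_antisymm_left : ∀ a b e, c.f b a e = - c.f a b e
  f_antisymm_right : ∀ a b e, c.f a e b = - c.f a b e
  fp_antisymm : ∀ a b e, c.fp b a e = - c.fp a b e
  fp_mass : ∀ (a : I₂) b e, 𝓜.m b * c.fp (.inr a) b e - 𝓜.m e * c.fp (.inr a) e b =
    𝓜.m (.inr a) * c.f (.inr a) b e
  fSp_mass : ∀ j (b : I₂) e, 𝓜.m (.inr b) * c.fSp j (.inr b) e - 𝓜.m e * c.fSp j e (.inr b) = 0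
  current : ∀ a ε A B, Complex.I * (𝓜.mD A * c.t a ε A B - c.t a (-ε) A B * 𝓜.mD B) =
    𝓜.m a * c.s a ε A B
  fSpp_eq : ∀ j (b e : I₂), c.fSpp j (.inr b) (.inr e) =
    𝓜.mS j ^ 2 / 𝓜.m (.inr e) * c.fSp j (.inr b) (.inr e)
  fSSp_antisymm : ∀ j k e, c.fSSp k j e = - c.fSSp j k e
  fSSp_massless : ∀ j k (e : I₁), (𝓜.mS j ^ 2 - 𝓜.mS k ^ 2) * c.fSSp j k (.inl e) = 0
  fSSpp_eq : ∀ j k (e : I₂), c.fSSpp j k (.inr e) = - (1 / 𝓜.m (.inr e)) *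
    (𝓜.mS k ^ 2 * c.fSSp j k (.inr e) + 𝓜.mS j ^ 2 * c.fSSp k j (.inr e))
  fSSpp_eq_diff : ∀ j k (e : I₂), c.fSSpp j k (.inr e) =
    1 / 𝓜.m (.inr e) * (𝓜.mS j ^ 2 - 𝓜.mS k ^ 2) * c.fSSp j k (.inr e)
  lam_symm_left : ∀ j k l, c.lam k j l = c.lam j k l
  lam_symm_right : ∀ j k l, c.lam j l k = c.lam j k l

end StandardModel

end

open scoped BigOperators Matrix

noncomputable section

namespace StandardModel

variable {I₁ I₂ I₃ I₄ : Type*}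

local notation "𝒱" => I₁ ⊕ I₂
local notation "𝒮" => (I₁ ⊕ I₂) ⊕ I₃
local notation "𝒥" => Jet I₁ I₂ I₃ I₄
local notation "𝒳" => JetVar I₁ I₂ I₃ I₄
local notation "ℱ" => Field I₁ I₂ I₃ I₄
local notation "ℳ" => Model I₁ I₂ I₃ I₄
local notation "𝕍" => Fin 4 → ℂ
local notation "𝔻" => Fin 4 →₀ ℕ
local notation "𝕄" => Matrix (Fin 4) (Fin 4) ℂ

open Finset (sum_congr smul_sum sum_comm sum_add_distrib mul_sum sum_mul sum_const_zero
  sum_ite_eq sum_eq_zero sum_neg_distrib sum_mul_sum univ mem_univ sum_eq_single sum_sub_distrib sum_smul)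
open Complex (I)
open Submodule (smul_mem)

lemma sum_ext {ι M : Type*} [Fintype ι] [AddCommMonoid M] {f g : ι → M} (h : ∀ i, f i = g i) :
    ∑ i, f i = ∑ i, g i := Fintype.sum_congr f g h

section Algebra

lemma Jet.induction {P : 𝒥 → Prop} (hc : ∀ c : ℂ, P (algebraMap ℂ _ c))
    (hj : ∀ f J, P (jet f J)) (hmul : ∀ A B, P A → P B → P (A * B))
    (hadd : ∀ A B, P A → P B → P (A + B)) (A : 𝒥) : P A := by
  obtain ⟨a, rfl⟩ := RingQuot.mkAlgHom_surjective ℂ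
    (SuperComm (I₄ := I₄)) A
  induction a using FreeAlgebra.induction with
  | grade0 c => simpa using hc c
  | grade1 x => exact hj x.field x.J
  | mul a b ha hb => rw [map_mul]; exact hmul _ _ ha hb
  | add a b ha hb => rw [map_add]; exact hadd _ _ ha hb

lemma extendHom_jet (F : 𝒳 → 𝒥)
    (hF : ∀ x : 𝒳, F x ∈ lin _ _ _ _ x.field.odd) (f : ℱ) (J : 𝔻) :
    extendHom F hF (jet f J) = F ⟨f, J⟩ := by simp [extendHom, jet]

section Derivation

variable {p : Bool} {δ : JetVar I₁ I₂ I₃ I₄ → Jet I₁ I₂ I₃ I₄}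
  {hδ : ∀ x : JetVar I₁ I₂ I₃ I₄, δ x ∈ lin I₁ I₂ I₃ I₄ (xor p x.field.odd)}

lemma derivationHom_jet (f : ℱ) (J : 𝔻) :
    derivationHom p δ hδ (jet f J) = !![sgn p f.odd • jet f J, δ ⟨f, J⟩; 0, jet f J] := by
  simp [derivationHom, jet]

lemma derivationHom_diag (A : 𝒥) :
    derivationHom p δ hδ A 1 0 = 0 ∧ derivationHom p δ hδ A 1 1 = A := by
  induction A using Jet.induction with
  | hc c => simp [Matrix.algebraMap_matrix_apply]
  | hj f J => simp [derivationHom_jet]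
  | hmul A B hA hB => simp [Matrix.mul_apply, Fin.sum_univ_two, hA, hB]
  | hadd A B hA hB => simp [hA, hB]

lemma superDerivation_jet (f : ℱ) (J : 𝔻) :
    superDerivation p δ hδ (jet f J) = δ ⟨f, J⟩ := by simp [superDerivation, derivationHom_jet]

lemma superDerivation_lin_mul {q : Bool} {X : 𝒥} (hX : X ∈ lin _ _ _ _ q) (B : 𝒥) :
    superDerivation p δ hδ (X * B) =
      superDerivation p δ hδ X * B + sgn p q • (X * superDerivation p δ hδ B) := by
  induction hX using Submodule.span_induction with
  | mem X hX =>
    obtain ⟨f, J, rfl, rfl⟩ := hX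
    rw [superDerivation_jet]
    simp [superDerivation, Matrix.mul_apply, Fin.sum_univ_two, derivationHom_jet,
      derivationHom_diag, add_comm]
  | zero => simp
  | add X Y _ _ h1 h2 => simp only [add_mul, map_add, h1, h2, smul_add]; abel
  | smul c X _ h => simp only [smul_mul_assoc, map_smul, h, smul_add, smul_comm c]

lemma superDerivation_mem_lin {q : Bool} {X : 𝒥} (hX : X ∈ lin _ _ _ _ q) :
    superDerivation p δ hδ X ∈ lin _ _ _ _ (xor p q) := by
  induction hX using Submodule.span_induction with
  | mem X hX =>
    obtain ⟨f, J, rfl, rfl⟩ := hX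
    rw [superDerivation_jet]
    exact hδ ⟨f, J⟩
  | zero => rw [map_zero]; exact Submodule.zero_mem _
  | add X Y _ _ h1 h2 => rw [map_add]; exact add_mem h1 h2
  | smul c X _ h => rw [map_smul]; exact smul_mem _ _ h

end Derivation

lemma d_jet (ν : Fin 4) (f : ℱ) (J : 𝔻) :
    d ν (jet f J) = jet f (J + Finsupp.single ν 1) := superDerivation_jet f J

lemma d_mem_lin {q : Bool} {X : 𝒥} (hX : X ∈ lin _ _ _ _ q) (ν : Fin 4) :
    d ν X ∈ lin _ _ _ _ q := by
  have h := superDerivation_mem_lin (p := false)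
    (hδ := fun x : 𝒳 => by simpa using jet_mem_lin x.field (x.J + Finsupp.single ν 1)) hX
  rw [Bool.false_xor] at h
  exact h

lemma d_mul (ν : Fin 4) (A B : 𝒥) : d ν (A * B) = d ν A * B + A * d ν B := by
  have key : ∀ A : 𝒥, (∀ B, d ν (A * B) = d ν A * B + A * d ν B) := by
    intro A
    induction A using Jet.induction with
    | hc c =>
      intro B
      have h : d ν (algebraMap ℂ 𝒥 c) = 0 := by
        simp [d, superDerivation, Matrix.algebraMap_matrix_apply]
      rw [h, ← Algebra.smul_def, map_smul, zero_mul, zero_add, Algebra.smul_def]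
    | hj f J =>
      intro B
      have h := superDerivation_lin_mul (p := false) (hδ := fun x : 𝒳 => by
          simpa using jet_mem_lin x.field (x.J + Finsupp.single ν 1)) (jet_mem_lin f J) B
      rw [show sgn false f.odd = 1 from rfl, one_smul] at h
      exact h
    | hmul A A' hA hA' => intro B; rw [mul_assoc, hA, hA', hA]; noncomm_ring
    | hadd A A' hA hA' => intro B; rw [add_mul, map_add, hA, hA', map_add]; noncomm_ring
  exact key A B

lemma smul_mem_lin {q : Bool} {X : 𝒥} (c : ℂ) (hX : X ∈ lin _ _ _ _ q) :
    c • X ∈ lin _ _ _ _ q := smul_mem _ _ hX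

lemma commute_of_mem_lin_false {X : 𝒥} (hX : X ∈ lin _ _ _ _ false) (A : 𝒥) : Commute X A := by
  induction A using Jet.induction with
  | hc c => exact (Algebra.commutes c X).symm
  | hj f J =>
    have h := lin_mul_lin hX (jet_mem_lin f J)
    rw [show sgn false f.odd = 1 from rfl, one_smul] at h
    exact h
  | hmul A B hA hB => exact hA.mul_right hB
  | hadd A B hA hB => exact hA.add_right hB

/-! ### Coefficient functionals -/

/-- A state: a value for every jet variable. -/
abbrev State (I₁ I₂ I₃ I₄ : Type*) := JetVar I₁ I₂ I₃ I₄ → ℂ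

/-- The morphism into the dual numbers with prescribed infinitesimal values on the jet variables. -/
def evHom (f : State I₁ I₂ I₃ I₄) : 𝒥 →ₐ[ℂ] TrivSqZeroExt ℂ ℂ :=
  RingQuot.liftAlgHom ℂ ⟨FreeAlgebra.lift ℂ fun x => TrivSqZeroExt.inr (f x), by
    rintro _ _ ⟨x, y⟩
    rw [map_mul, map_smul, map_mul, FreeAlgebra.lift_ι_apply, FreeAlgebra.lift_ι_apply,
      TrivSqZeroExt.inr_mul_inr, TrivSqZeroExt.inr_mul_inr, smul_zero]⟩

/-- The value of a state on linear combinations of jet variables. -/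
def ev (f : State I₁ I₂ I₃ I₄) : 𝒥 →ₗ[ℂ] ℂ := (TrivSqZeroExt.sndHom ℂ ℂ).comp (evHom f).toLinearMap

@[simp] theorem ev_jet (f : State I₁ I₂ I₃ I₄) (g : ℱ) (J : 𝔻) :
    ev f (jet g J) = f ⟨g, J⟩ := by simp [ev, evHom, jet]

/-- Creation matrices on the Fock space of three modes of parities `P`. -/
def fockInt (P : Fin 3 → Bool) (k : Fin 3) : Matrix (Fin 8) (Fin 8) ℤ := fun i j =>
  if (i : ℕ).testBit k = false ∧ (j : ℕ) = i + 2 ^ (k : ℕ) then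
    ∏ l : Fin 3, if k < l ∧ P k = true ∧ P l = true ∧ (i : ℕ).testBit l = true then -1 else 1
  else 0

def fock (P : Fin 3 → Bool) (k : Fin 3) : Matrix (Fin 8) (Fin 8) ℂ :=
  (Int.castRingHom ℂ).mapMatrix (fockInt P k)

lemma fockInt_mul : ∀ (p q r : Bool) (k l : Fin 3), fockInt ![p, q, r] k * fockInt ![p, q, r] l =
      (if ![p, q, r] k && ![p, q, r] l then -1 else 1 : ℤ) •
        (fockInt ![p, q, r] l * fockInt ![p, q, r] k) := by decide +kernel

lemma fockInt_mul_mul : ∀ (p q r : Bool) (i j k : Fin 3),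
    (fockInt ![p, q, r] i * fockInt ![p, q, r] j * fockInt ![p, q, r] k) 0 7 =
    if i = 0 ∧ j = 1 ∧ k = 2 then 1
    else if i = 0 ∧ j = 2 ∧ k = 1 then (if q && r then -1 else 1)
    else if i = 1 ∧ j = 0 ∧ k = 2 then (if p && q then -1 else 1)
    else if i = 1 ∧ j = 2 ∧ k = 0 then (if p && xor q r then -1 else 1)
    else if i = 2 ∧ j = 0 ∧ k = 1 then (if r && xor p q then -1 else 1)
    else if i = 2 ∧ j = 1 ∧ k = 0 then (if xor (p && q) (xor (p && r) (q && r)) then -1 else 1)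
    else 0 := by decide +kernel

end Algebra

local notation "𝒬" => State I₁ I₂ I₃ I₄

section Algebra

/-- The restriction of a state to the jet variables of parity `p`. -/
def filt (p : Bool) (f : 𝒬) : 𝒬 := fun x => if x.field.odd = p then f x else 0

lemma ev_filt {p q : Bool} (f : 𝒬) {X : 𝒥}
    (hX : X ∈ lin _ _ _ _ q) : ev (filt p f) X = if q = p then ev f X else 0 := by
  induction hX using Submodule.span_induction with
  | mem X hX =>
    obtain ⟨g, J, rfl, rfl⟩ := hX
    rw [ev_jet, ev_jet]
    rfl
  | zero => simp
  | add X Y _ _ h1 h2 => rw [map_add, map_add, h1, h2]; split_ifs <;> simp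
  | smul c X _ h => rw [map_smul, map_smul, h]; split_ifs <;> simp

lemma fock_mul (p q r : Bool) (k l : Fin 3) : fock ![p, q, r] k * fock ![p, q, r] l =
      sgn (![p, q, r] k) (![p, q, r] l) • (fock ![p, q, r] l * fock ![p, q, r] k) := by
  have h := congrArg (Int.castRingHom ℂ).mapMatrix (fockInt_mul p q r k l)
  rw [map_mul, map_zsmul, map_mul] at h
  rw [fock, fock, h, sgn]
  split_ifs <;> simp

/-- The morphism from the jet algebra to operators on the Fock space of three modes given by
three states of parities `p`, `q`, `r`. -/
def fockHom (p q r : Bool) (f g h : 𝒬) : 𝒥 →ₐ[ℂ] Matrix (Fin 8) (Fin 8) ℂ :=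
  RingQuot.liftAlgHom ℂ ⟨FreeAlgebra.lift ℂ fun x =>
      ∑ k, (![filt p f, filt q g, filt r h] k x) • fock ![p, q, r] k, by
    rintro _ _ ⟨x, y⟩
    rw [map_mul, map_smul, map_mul, FreeAlgebra.lift_ι_apply, FreeAlgebra.lift_ι_apply,
      sum_mul_sum, sum_mul_sum, sum_comm, smul_sum]
    refine sum_ext fun l => ?_
    rw [smul_sum]
    refine sum_ext fun k => ?_
    rw [smul_mul_smul_comm, smul_mul_smul_comm, fock_mul, smul_smul, smul_smul]
    congr 1
    have key : ∀ (k : Fin 3) (x : 𝒳), x.field.odd ≠ ![p, q, r] k →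
        ![filt p f, filt q g, filt r h] k x = 0 := by
      intro k x hx
      fin_cases k <;> exact if_neg hx
    by_cases hk : x.field.odd = ![p, q, r] k
    · by_cases hl : y.field.odd = ![p, q, r] l
      · rw [hk, hl]; ring
      · rw [key l y hl]; ring
    · rw [key k x hk]; ring⟩

lemma fockHom_lin {p q r a : Bool} (f g h : 𝒬) {X : 𝒥} (hX : X ∈ lin _ _ _ _ a) :
    fockHom p q r f g h X = ev (filt p f) X • fock ![p, q, r] 0 + ev (filt q g) X •
      fock ![p, q, r] 1 + ev (filt r h) X • fock ![p, q, r] 2 := by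
  induction hX using Submodule.span_induction with
  | mem X hX =>
    obtain ⟨g, J, rfl, rfl⟩ := hX
    simp only [ev_jet]
    rw [fockHom, jet, RingQuot.liftAlgHom_mkAlgHom_apply, FreeAlgebra.lift_ι_apply,
      Fin.sum_univ_three]
    rfl
  | zero => simp
  | add X Y _ _ h1 h2 => simp only [map_add, h1, h2, add_smul]; abel
  | smul c X _ h => simp only [map_smul, h, smul_add, smul_assoc]

/-- The coefficient of the product of the three modes: the trilinear part of an expression,
polarized and evaluated on three states. -/
def tri (p q r : Bool) (f g h : 𝒬) : 𝒥 →ₗ[ℂ] ℂ where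
  toFun A := fockHom p q r f g h A 0 7
  map_add' A B := by simp
  map_smul' c A := by simp

lemma fock_mul_mul (p q r : Bool) (i j k : Fin 3) :
    (fock ![p, q, r] i * fock ![p, q, r] j * fock ![p, q, r] k) 0 7 =
    if i = 0 ∧ j = 1 ∧ k = 2 then 1
    else if i = 0 ∧ j = 2 ∧ k = 1 then sgn q r
    else if i = 1 ∧ j = 0 ∧ k = 2 then sgn p q
    else if i = 1 ∧ j = 2 ∧ k = 0 then sgn p q * sgn p r
    else if i = 2 ∧ j = 0 ∧ k = 1 then sgn p r * sgn q r
    else if i = 2 ∧ j = 1 ∧ k = 0 then sgn p q * sgn p r * sgn q r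
    else 0 := by
  have h : (fock ![p, q, r] i * fock ![p, q, r] j * fock ![p, q, r] k) 0 7 =
      (((fockInt ![p, q, r] i * fockInt ![p, q, r] j * fockInt ![p, q, r] k) 0 7 : ℤ) : ℂ) := by
    rw [fock, fock, fock, ← map_mul, ← map_mul]
    rfl
  rw [h, fockInt_mul_mul]
  split_ifs <;> cases p <;> cases q <;> cases r <;> simp_all [sgn]

lemma tri_mul {p q r a b c : Bool} (f g h : 𝒬) {X Y Z : 𝒥}
    (hX : X ∈ lin _ _ _ _ a) (hY : Y ∈ lin _ _ _ _ b) (hZ : Z ∈ lin _ _ _ _ c) :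
    tri p q r f g h (X * Y * Z) = ev (filt p f) X * ev (filt q g) Y * ev (filt r h) Z
      + sgn q r * (ev (filt p f) X * ev (filt r h) Y * ev (filt q g) Z)
      + sgn p q * (ev (filt q g) X * ev (filt p f) Y * ev (filt r h) Z)
      + sgn p q * sgn p r * (ev (filt q g) X * ev (filt r h) Y * ev (filt p f) Z)
      + sgn p r * sgn q r * (ev (filt r h) X * ev (filt p f) Y * ev (filt q g) Z)
      + sgn p q * sgn p r * sgn q r * (ev (filt r h) X * ev (filt q g) Y * ev (filt p f) Z) := by
  change fockHom p q r f g h (X * Y * Z) 0 7 = _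
  rw [map_mul, map_mul, fockHom_lin f g h hX, fockHom_lin f g h hY, fockHom_lin f g h hZ]
  simp only [add_mul, mul_add, smul_mul_assoc, mul_smul_comm, Matrix.add_apply,
    Matrix.smul_apply, fock_mul_mul, smul_eq_mul]
  simp
  ring

/-- A state satisfies the equations of motion. -/
def Model.OnShell (𝓜 : ℳ) (f : 𝒬) : Prop := ∀ E, 𝓜.IsEOM E → ev f E = 0

lemma Model.IsEOM.mem_lin {𝓜 : ℳ} {E : 𝒥} (h : 𝓜.IsEOM E) : ∃ p, E ∈ lin _ _ _ _ p := by
  have kg : ∀ (f : ℱ) (m : ℂ) (J : 𝔻),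
      kleinGordon f m J ∈ lin _ _ _ _ f.odd := fun f m J =>
    add_mem (sum_mem fun μ _ => smul_mem_lin _ (jet_mem_lin f _))
      (smul_mem_lin _ (jet_mem_lin f _))
  cases h with
  | v a μ J => exact ⟨_, kg _ _ _⟩
  | u a J => exact ⟨_, kg _ _ _⟩
  | ut a J => exact ⟨_, kg _ _ _⟩
  | Phi b J => exact ⟨_, kg _ _ _⟩
  | phi j J => exact ⟨_, kg _ _ _⟩
  | psi A α J =>
    exact ⟨true, Submodule.sub_mem _ (smul_mem_lin _ (sum_mem fun μ _ =>
      sum_mem fun β _ => smul_mem_lin _ (jet_mem_lin (.psi A β) _)))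
      (smul_mem_lin _ (jet_mem_lin (.psi A α) _))⟩
  | psibar A α J =>
    exact ⟨true, add_mem (smul_mem_lin _ (sum_mem fun μ _ =>
      sum_mem fun β _ => smul_mem_lin _ (jet_mem_lin (.psibar A β) _)))
      (smul_mem_lin _ (jet_mem_lin (.psibar A α) _))⟩

lemma fockHom_eq_zero {𝓜 : ℳ} {p q r : Bool} {f g h : 𝒬}
    (hf : 𝓜.OnShell f) (hg : 𝓜.OnShell g) (hh : 𝓜.OnShell h) {A : 𝒥}
    (hA : A ∈ TwoSidedIdeal.span {E | 𝓜.IsEOM E}) : fockHom p q r f g h A = 0 := by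
  have hle : TwoSidedIdeal.span {E | 𝓜.IsEOM E} ≤ TwoSidedIdeal.ker (fockHom p q r f g h) := by
    rw [TwoSidedIdeal.span_le]
    intro E hE
    obtain ⟨a, ha⟩ := Model.IsEOM.mem_lin hE
    change E ∈ TwoSidedIdeal.ker (fockHom p q r f g h)
    rw [TwoSidedIdeal.mem_ker, fockHom_lin f g h ha, ev_filt f ha, ev_filt g ha, ev_filt h ha,
      hf E hE, hg E hE, hh E hE]
    simp
  exact (TwoSidedIdeal.mem_ker _).1 (hle hA)

lemma tri_congr {𝓜 : ℳ} {p q r : Bool} {f g h : 𝒬}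
    (hf : 𝓜.OnShell f) (hg : 𝓜.OnShell g) (hh : 𝓜.OnShell h) {A B : 𝒥}
    (hAB : 𝓜.OnShellEq A B) : tri p q r f g h A = tri p q r f g h B := by
  rw [← sub_eq_zero, ← map_sub]
  change fockHom p q r f g h (A - B) 0 7 = 0
  rw [fockHom_eq_zero hf hg hh hAB]
  rfl

/-- Trilinear expressions. -/
def trilin (I₁ I₂ I₃ I₄ : Type*) : Submodule ℂ (Jet I₁ I₂ I₃ I₄) :=
  Submodule.span ℂ {A | ∃ x y z : JetVar I₁ I₂ I₃ I₄,
    A = jet x.field x.J * jet y.field y.J * jet z.field z.J}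

lemma cubic_le_trilin (w : ℚ) (g : ℤ) : cubic _ _ _ _ w g ≤ trilin I₁ I₂ I₃ I₄ :=
  Submodule.span_mono fun _ ⟨x, y, z, h, _⟩ => ⟨x, y, z, h⟩

lemma tri_superDerivation {s : Bool} {δ : 𝒳 → 𝒥}
    (hδ : ∀ x : 𝒳, δ x ∈ lin _ _ _ _ (xor s x.field.odd))
    (p q r : Bool) (f g h : 𝒬) {A : 𝒥}
    (hA : A ∈ trilin _ _ _ _) :
    tri p q r f g h (superDerivation s δ hδ A) = tri (xor s p) q r (fun x => ev f (δ x)) g h A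
      + sgn s p * tri p (xor s q) r f (fun x => ev g (δ x)) h A
      + sgn s p * sgn s q * tri p q (xor s r) f g (fun x => ev h (δ x)) A := by
  induction hA using Submodule.span_induction with
  | mem A hA =>
    obtain ⟨⟨x, J⟩, ⟨y, K⟩, ⟨z, L⟩, rfl⟩ := hA
    have hx := jet_mem_lin x J
    have hy := jet_mem_lin y K
    have hz := jet_mem_lin z L
    have h1 : δ ⟨x, J⟩ ∈ lin _ _ _ _ (xor s x.odd) := hδ ⟨x, J⟩
    have h2 : δ ⟨y, K⟩ ∈ lin _ _ _ _ (xor s y.odd) := hδ ⟨y, K⟩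
    have h3 : δ ⟨z, L⟩ ∈ lin _ _ _ _ (xor s z.odd) := hδ ⟨z, L⟩
    have e : superDerivation s δ hδ (jet x J * jet y K * jet z L) =
        δ ⟨x, J⟩ * jet y K * jet z L + sgn s x.odd • (jet x J * δ ⟨y, K⟩ * jet z L)
        + (sgn s x.odd * sgn s y.odd) • (jet x J * jet y K * δ ⟨z, L⟩) := by
      rw [mul_assoc, superDerivation_lin_mul hx, superDerivation_lin_mul hy, superDerivation_jet,
        superDerivation_jet, superDerivation_jet, mul_add, smul_add, mul_smul_comm, smul_smul,
        mul_assoc, mul_assoc, mul_assoc, add_assoc]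
    rw [e]
    simp only [map_add, map_smul, tri_mul _ _ _ hx hy hz, tri_mul _ _ _ h1 hy hz,
      tri_mul _ _ _ hx h2 hz, tri_mul _ _ _ hx hy h3, ev_filt _ hx, ev_filt _ hy, ev_filt _ hz,
      ev_filt _ h1, ev_filt _ h2, ev_filt _ h3, ev_jet, smul_eq_mul]
    generalize x.odd = a
    generalize y.odd = b
    generalize z.odd = c
    cases s
    · simp only [Bool.false_xor, show ∀ t, sgn false t = 1 from fun _ => rfl]
      ring
    · cases p <;> cases q <;> cases r <;> cases a <;> cases b <;> cases c <;> simp [sgn] <;> ring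
  | zero => simp
  | add X Y _ _ h1 h2 => simp only [map_add, h1, h2]; ring
  | smul c X _ h => simp only [map_smul, h, smul_eq_mul]; ring

end Algebra

lemma η_mul_self (μ : Fin 4) : η μ * η μ = 1 := by unfold η; split_ifs <;> norm_num

lemma η_ne_zero (μ : Fin 4) : η μ ≠ 0 := by unfold η; split_ifs <;> norm_num

lemma η_eq (μ : Fin 4) : η μ = 1 ∨ η μ = -1 := by unfold η; split_ifs <;> simp

/-- The real metric coefficients. -/
def ηr (μ : Fin 4) : ℝ := if μ = 0 then 1 else -1

lemma ηr_mul_self (μ : Fin 4) : ηr μ * ηr μ = 1 := by unfold ηr; split_ifs <;> norm_num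

lemma ηr_cast (μ : Fin 4) : ((ηr μ : ℝ) : ℂ) = η μ := by unfold ηr η; split_ifs <;> simp

lemma diagonal_eq_ηr : (Matrix.diagonal ![1, -1, -1, -1] : Matrix (Fin 4) (Fin 4) ℝ) =
    Matrix.diagonal ηr := by
  congr 1
  ext i
  fin_cases i <;> simp [ηr]

section Clifford

variable (𝓜 : Model I₁ I₂ I₃ I₄)

lemma Model.γ_sq (μ : Fin 4) : 𝓜.γ μ * 𝓜.γ μ = η μ • (1 : 𝕄) := by
  have h := 𝓜.clifford μ μ
  rw [if_pos rfl, ← two_smul ℂ, mul_smul] at h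
  exact smul_right_injective _ (two_ne_zero' ℂ) h

lemma Model.γ_anticomm {μ ν : Fin 4} (h : μ ≠ ν) : 𝓜.γ μ * 𝓜.γ ν = - (𝓜.γ ν * 𝓜.γ μ) := by
  have := 𝓜.clifford μ ν
  rw [if_neg h, mul_zero, zero_smul] at this
  exact eq_neg_of_add_eq_zero_left this

lemma Model.γ_comm_pair {μ α β : Fin 4} (hα : μ ≠ α) (hβ : μ ≠ β) :
    𝓜.γ μ * (𝓜.γ α * 𝓜.γ β) = 𝓜.γ α * 𝓜.γ β * 𝓜.γ μ := by
  rw [← mul_assoc, 𝓜.γ_anticomm hα, neg_mul, mul_assoc, 𝓜.γ_anticomm hβ, mul_neg, neg_neg,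
    mul_assoc]

lemma Model.γ_left_pair {α β : Fin 4} : 𝓜.γ α * (𝓜.γ α * 𝓜.γ β) = η α • 𝓜.γ β := by
  rw [← mul_assoc, 𝓜.γ_sq, smul_mul_assoc, one_mul]

lemma Model.γ_pair_left {α β : Fin 4} (h : α ≠ β) : 𝓜.γ α * 𝓜.γ β * 𝓜.γ α = - (η α • 𝓜.γ β) := by
  rw [mul_assoc, 𝓜.γ_anticomm h.symm, mul_neg, 𝓜.γ_left_pair]

lemma Model.γ_pair_right {α β : Fin 4} : 𝓜.γ α * 𝓜.γ β * 𝓜.γ β = η β • 𝓜.γ α := by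
  rw [mul_assoc, 𝓜.γ_sq, mul_smul_comm, mul_one]

lemma Model.γ_right_pair {α β : Fin 4} (h : α ≠ β) : 𝓜.γ β * (𝓜.γ α * 𝓜.γ β) = - (η β • 𝓜.γ α) := by
  rw [← mul_assoc, 𝓜.γ_anticomm h.symm, neg_mul, 𝓜.γ_pair_right]

lemma Model.γ_pair_sq {α β : Fin 4} (h : α ≠ β) :
    𝓜.γ α * 𝓜.γ β * (𝓜.γ α * 𝓜.γ β) = (-(η α * η β)) • (1 : 𝕄) := by
  rw [← mul_assoc, 𝓜.γ_pair_left h, neg_mul, smul_mul_assoc, 𝓜.γ_sq, smul_smul, neg_smul]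

/-- The Lorentz transformation in the coordinate plane `(α, β)` with parameter `t`. -/
def planeLorentz (α β : Fin 4) (t : ℝ) : Matrix (Fin 4) (Fin 4) ℝ := fun μ ν =>
  if μ = α ∧ ν = α ∨ μ = β ∧ ν = β then (1 - ηr α * ηr β * t ^ 2) / (1 + ηr α * ηr β * t ^ 2)
  else if μ = α ∧ ν = β then 2 * t * ηr β / (1 + ηr α * ηr β * t ^ 2)
  else if μ = β ∧ ν = α then -(2 * t * ηr α / (1 + ηr α * ηr β * t ^ 2))
  else if μ = ν then 1 else 0

/-- Its action on spinors. -/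
def Model.planeSpin (α β : Fin 4) (t : ℝ) : 𝕄 := 1 + (t : ℂ) • (𝓜.γ α * 𝓜.γ β)

lemma plane_denom_pos (α β : Fin 4) {t : ℝ} (ht : t ^ 2 < 1) : 0 < 1 + ηr α * ηr β * t ^ 2 := by
  have h : ηr α * ηr β = 1 ∨ ηr α * ηr β = -1 := by unfold ηr; split_ifs <;> norm_num
  rcases h with h | h <;> rw [h] <;> nlinarith [sq_nonneg t]

lemma Model.planeSpin_mul {α β : Fin 4} (h : α ≠ β) (t : ℝ) :
    𝓜.planeSpin α β t * 𝓜.planeSpin α β (-t) = ((1 + ηr α * ηr β * t ^ 2 : ℝ) : ℂ) • (1 : 𝕄) := by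
  simp only [Model.planeSpin, mul_add, add_mul, smul_mul_assoc, mul_smul_comm, 𝓜.γ_pair_sq h,
    mul_one, one_mul]
  push_cast [ηr_cast]
  module

lemma Model.planeSpin_inv {α β : Fin 4} (h : α ≠ β) {t : ℝ} (ht : t ^ 2 < 1) :
    (𝓜.planeSpin α β t)⁻¹ = ((1 + ηr α * ηr β * t ^ 2 : ℝ) : ℂ)⁻¹ • 𝓜.planeSpin α β (-t) := by
  refine Matrix.inv_eq_right_inv ?_
  rw [mul_smul_comm, 𝓜.planeSpin_mul h, smul_smul, inv_mul_cancel₀, one_smul]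
  exact_mod_cast (plane_denom_pos α β ht).ne'

lemma Model.planeSpin_isUnit {α β : Fin 4} (h : α ≠ β) {t : ℝ} (ht : t ^ 2 < 1) :
    IsUnit (𝓜.planeSpin α β t).det := by
  rw [← Matrix.isUnit_iff_isUnit_det]
  refine IsUnit.of_mul_eq_one (((1 + ηr α * ηr β * t ^ 2 : ℝ) : ℂ)⁻¹ • 𝓜.planeSpin α β (-t)) ?_
  rw [mul_smul_comm, 𝓜.planeSpin_mul h, smul_smul, inv_mul_cancel₀, one_smul]
  exact_mod_cast (plane_denom_pos α β ht).ne'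

lemma Model.planeSpin_comm {α β : Fin 4} (h : α ≠ β) {t : ℝ} (ht : t ^ 2 < 1) (μ : Fin 4) :
    𝓜.γUp μ * 𝓜.planeSpin α β t = 𝓜.planeSpin α β t *
      ∑ ν, ((planeLorentz α β t μ ν : ℝ) : ℂ) • 𝓜.γUp ν := by
  have hd : ((1 + ηr α * ηr β * t ^ 2 : ℝ) : ℂ) ≠ 0 := by
    exact_mod_cast (plane_denom_pos α β ht).ne'
  obtain ⟨D, hD⟩ : ∃ D : ℂ, D = 1 + η α * η β * (t : ℂ) ^ 2 := ⟨_, rfl⟩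
  have hD0 : D ≠ 0 := by rw [hD]; simpa [ηr_cast] using hd
  by_cases h1 : μ = α
  · subst h1
    rw [Finset.sum_eq_add μ β h (fun c _ hc => by
      have : planeLorentz μ β t μ c = 0 := by simp [planeLorentz, h, hc.1, hc.2, hc.1.symm]
      rw [this]; simp) (by simp) (by simp)]
    have e1 : planeLorentz μ β t μ μ = (1 - ηr μ * ηr β * t ^ 2) / (1 + ηr μ * ηr β * t ^ 2) := by
      simp [planeLorentz]
    have e2 : planeLorentz μ β t μ β = 2 * t * ηr β / (1 + ηr μ * ηr β * t ^ 2) := by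
      simp [planeLorentz, h, h.symm]
    rw [e1, e2]
    refine smul_right_injective _ hd ?_
    simp only [Model.planeSpin, Model.γUp, mul_add, add_mul, smul_mul_assoc, mul_smul_comm,
      mul_one, one_mul, 𝓜.γ_left_pair, 𝓜.γ_pair_left h, 𝓜.γ_pair_right,
      smul_add, smul_smul, smul_neg, Complex.ofReal_div]
    match_scalars <;>
    · push_cast [ηr_cast]
      rw [← hD]
      field_simp
      rw [hD]
      rcases η_eq μ with hα | hα <;> rcases η_eq β with hβ | hβ <;> rw [hα, hβ] <;> ring
  by_cases h2 : μ = β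
  · subst h2
    rw [Finset.sum_eq_add α μ h (fun c _ hc => by
      have : planeLorentz α μ t μ c = 0 := by simp [planeLorentz, hc.1, hc.2, hc.2.symm]
      rw [this]; simp) (by simp) (by simp)]
    have e1 : planeLorentz α μ t μ μ = (1 - ηr α * ηr μ * t ^ 2) / (1 + ηr α * ηr μ * t ^ 2) := by
      simp [planeLorentz]
    have e2 : planeLorentz α μ t μ α = -(2 * t * ηr α / (1 + ηr α * ηr μ * t ^ 2)) := by
      simp [planeLorentz, h, h.symm]
    rw [e1, e2]
    refine smul_right_injective _ hd ?_
    simp only [Model.planeSpin, Model.γUp, mul_add, add_mul, smul_mul_assoc, mul_smul_comm,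
      mul_one, one_mul, 𝓜.γ_pair_left h, 𝓜.γ_pair_right, 𝓜.γ_right_pair h,
      smul_add, smul_smul, smul_neg, Complex.ofReal_div, Complex.ofReal_neg]
    match_scalars <;>
    · push_cast [ηr_cast]
      rw [← hD]
      field_simp
      rw [hD]
      rcases η_eq α with hα | hα <;> rcases η_eq μ with hβ | hβ <;> rw [hα, hβ] <;> ring
  · rw [sum_eq_single μ (fun c _ hc => by
      have : planeLorentz α β t μ c = 0 := by simp [planeLorentz, h1, h2, hc.symm]
      rw [this]; simp) (by simp)]
    have e1 : planeLorentz α β t μ μ = 1 := by simp [planeLorentz, h1, h2]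
    rw [e1, Complex.ofReal_one, one_smul]
    simp only [Model.planeSpin, Model.γUp, mul_add, add_mul, smul_mul_assoc, mul_smul_comm,
      mul_one, one_mul, 𝓜.γ_comm_pair h1 h2]
    module

lemma Model.planeSpin_spin {α β : Fin 4} (h : α ≠ β) {t : ℝ} (ht : t ^ 2 < 1) (μ : Fin 4) :
    (𝓜.planeSpin α β t)⁻¹ * 𝓜.γUp μ * 𝓜.planeSpin α β t =
      ∑ ν, ((planeLorentz α β t μ ν : ℝ) : ℂ) • 𝓜.γUp ν := by
  rw [mul_assoc, 𝓜.planeSpin_comm h ht, ← mul_assoc,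
    Matrix.nonsing_inv_mul _ (𝓜.planeSpin_isUnit h ht), one_mul]

lemma planeLorentz_lorentz {α β : Fin 4} (h : α ≠ β) {t : ℝ} (ht : t ^ 2 < 1) :
    (planeLorentz α β t).transpose * Matrix.diagonal ηr * planeLorentz α β t =
      Matrix.diagonal ηr := by
  have hd := (plane_denom_pos α β ht).ne'
  ext i j
  rw [mul_assoc, Matrix.mul_apply]
  simp only [Matrix.transpose_apply, Matrix.diagonal_mul]
  rw [Fin.sum_univ_four]
  revert hd
  fin_cases α <;> fin_cases β <;> first | exact absurd rfl h | skip
  all_goals fin_cases i <;> fin_cases j <;> intro hd <;>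
      simp [planeLorentz, ηr] at hd ⊢ <;> (try field_simp) <;> (try ring)

lemma planeLorentz_det {α β : Fin 4} (h : α ≠ β) {t : ℝ} (ht : t ^ 2 < 1) :
    (planeLorentz α β t).det = 1 := by
  have hd := (plane_denom_pos α β ht).ne'
  revert hd
  fin_cases α <;> fin_cases β <;> first | exact absurd rfl h | skip
  all_goals
    intro hd
    simp [planeLorentz, ηr, Matrix.det_succ_row_zero, Fin.sum_univ_succ, Fin.succAbove] at hd ⊢
    try field_simp
    try ring

lemma planeLorentz_zero_zero {α β : Fin 4} (h : α ≠ β) {t : ℝ} (ht : t ^ 2 < 1) :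
    1 ≤ planeLorentz α β t 0 0 := by
  have hd := plane_denom_pos α β ht
  unfold planeLorentz
  split_ifs with h1 h2 h3
  · rw [le_div_iff₀ hd]
    have : ηr α * ηr β = -1 := by
      rcases h1 with ⟨h1, -⟩ | ⟨h1, -⟩
      · subst h1; simp [ηr, h.symm]
      · subst h1; simp [ηr, h]
    rw [this]
    nlinarith [sq_nonneg t]
  · exact absurd (h2.1.symm.trans h2.2) h
  · exact absurd (h3.2.symm.trans h3.1) h
  · rfl
  · exact absurd rfl ‹_›

lemma Model.isLorentzPair_plane {α β : Fin 4} (h : α ≠ β) {t : ℝ} (ht : t ^ 2 < 1) :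
    𝓜.IsLorentzPair (planeLorentz α β t) (𝓜.planeSpin α β t) where
  lorentz := by rw [diagonal_eq_ηr]; exact planeLorentz_lorentz h ht
  proper := planeLorentz_det h ht
  orthochronous := planeLorentz_zero_zero h ht
  unit := 𝓜.planeSpin_isUnit h ht
  spin := 𝓜.planeSpin_spin h ht

end Clifford

lemma lorentz_inv_apply {Λ : Matrix (Fin 4) (Fin 4) ℝ}
    (h : Λ.transpose * Matrix.diagonal ![1, -1, -1, -1] * Λ = Matrix.diagonal ![1, -1, -1, -1])
    (μ ν : Fin 4) : Λ⁻¹ μ ν = ηr μ * Λ ν μ * ηr ν := by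
  rw [diagonal_eq_ηr] at h
  have hg : (Matrix.diagonal ηr : Matrix (Fin 4) (Fin 4) ℝ) * Matrix.diagonal ηr = 1 := by
    rw [Matrix.diagonal_mul_diagonal, ← Matrix.diagonal_one]
    congr 1
    ext i
    exact ηr_mul_self i
  have : Λ⁻¹ = Matrix.diagonal ηr * Λ.transpose * Matrix.diagonal ηr := by
    refine Matrix.inv_eq_left_inv ?_
    rw [mul_assoc, mul_assoc, ← mul_assoc Λ.transpose, h, hg]
  rw [this, Matrix.mul_diagonal, Matrix.diagonal_mul, Matrix.transpose_apply]

lemma mvPolynomial_sum_support {M : Type*} [AddCommMonoid M] [Module ℂ M]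
    (P : MvPolynomial (Fin 4) ℂ) (m : (Fin 4 →₀ ℕ) → M) {s : Finset (Fin 4 →₀ ℕ)}
    (h : P.support ⊆ s) : ∑ K ∈ P.support, P.coeff K • m K = ∑ K ∈ s, P.coeff K • m K := by
  refine Finset.sum_subset h fun K _ hK => ?_
  rw [MvPolynomial.notMem_support_iff.1 hK, zero_smul]

lemma lorentzJet_zero (Λ : Matrix (Fin 4) (Fin 4) ℝ) (f : ℱ) : lorentzJet Λ f 0 = jet f 0 := by
  have : lorentzDer Λ 0 = 1 := by simp [lorentzDer]
  rw [lorentzJet, this, mvPolynomial_sum_support (s := {0}) _ _ (by simp)]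
  simp

lemma lorentzDer_single (Λ : Matrix (Fin 4) (Fin 4) ℝ) (μ : Fin 4) :
    lorentzDer Λ (Finsupp.single μ 1) =
      ∑ ν, MvPolynomial.C ((Λ⁻¹ ν μ : ℝ) : ℂ) * MvPolynomial.X ν := by
  rw [lorentzDer, Finset.prod_eq_single μ (fun κ _ h => by
    rw [Finsupp.single_eq_of_ne h, pow_zero]) (by simp), Finsupp.single_eq_same, pow_one]

lemma lorentzJet_single (Λ : Matrix (Fin 4) (Fin 4) ℝ) (f : ℱ) (μ : Fin 4) :
    lorentzJet Λ f (Finsupp.single μ 1) =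
      ∑ ν, ((Λ⁻¹ ν μ : ℝ) : ℂ) • jet f (Finsupp.single ν 1) := by
  classical
  have hc : ∀ K, (lorentzDer Λ (Finsupp.single μ 1)).coeff K =
      ∑ ν, if Finsupp.single ν 1 = K then ((Λ⁻¹ ν μ : ℝ) : ℂ) else 0 := by
    intro K
    rw [lorentzDer_single, MvPolynomial.coeff_sum]
    refine sum_ext fun ν => ?_
    rw [MvPolynomial.coeff_C_mul, MvPolynomial.coeff_X]
    simp
  rw [lorentzJet, mvPolynomial_sum_support (s := univ.image fun ν : Fin 4 => Finsupp.single ν 1)]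
  · rw [Finset.sum_image (fun a _ b _ h => by
      simpa using (Finsupp.single_left_injective one_ne_zero) h)]
    refine sum_ext fun κ => ?_
    rw [hc, sum_eq_single κ (fun ν _ hν => if_neg fun h =>
      hν ((Finsupp.single_left_injective one_ne_zero) h)) (by simp), if_pos rfl]
  · intro K hK
    rw [MvPolynomial.mem_support_iff, hc] at hK
    obtain ⟨ν, -, hν⟩ := Finset.exists_ne_zero_of_sum_ne_zero hK
    rw [Finset.mem_image]
    refine ⟨ν, mem_univ _, ?_⟩
    by_contra h
    exact hν (if_neg h)

/-- The jet variables with at most one derivative. -/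
def JetVar.Low (x : 𝒳) : Prop := x.J = 0 ∨ ∃ ρ, x.J = Finsupp.single ρ 1

lemma JetVar.low_of_sum_le {x : 𝒳} (h : ∑ μ, (x.J μ : ℚ) ≤ 1) : x.Low := by
  have h' : ∑ μ, x.J μ ≤ 1 := by exact_mod_cast h
  by_cases h0 : x.J = 0
  · exact Or.inl h0
  right
  obtain ⟨ρ, hρ⟩ := Finsupp.ne_iff.1 h0
  rw [Finsupp.zero_apply] at hρ
  refine ⟨ρ, Finsupp.ext fun κ => ?_⟩
  have h1 : x.J ρ ≤ ∑ μ, x.J μ := Finset.single_le_sum (f := x.J) (fun _ _ => Nat.zero_le _)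
    (mem_univ ρ)
  by_cases hκ : ρ = κ
  · subst hκ; rw [Finsupp.single_eq_same]; omega
  · have h2 : x.J ρ + x.J κ ≤ ∑ μ, x.J μ := by
      rw [← Finset.sum_pair hκ]
      exact Finset.sum_le_sum_of_subset (Finset.subset_univ _)
    rw [Finsupp.single_eq_of_ne (Ne.symm hκ)]
    omega

lemma Field.one_le_dim (f : ℱ) : 1 ≤ f.dim := by cases f <;> norm_num [Field.dim]

lemma JetVar.sum_J_nonneg (x : 𝒳) : 0 ≤ ∑ μ, (x.J μ : ℚ) :=
  Finset.sum_nonneg fun _ _ => Nat.cast_nonneg _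

/-- Trilinear expressions with at most one derivative on every field. -/
def lowTrilin (I₁ I₂ I₃ I₄ : Type*) : Submodule ℂ (Jet I₁ I₂ I₃ I₄) :=
  Submodule.span ℂ {A | ∃ x y z : JetVar I₁ I₂ I₃ I₄, x.Low ∧ y.Low ∧ z.Low ∧
    A = jet x.field x.J * jet y.field y.J * jet z.field z.J}

lemma cubic_le_lowTrilin (g : ℤ) : cubic _ _ _ _ 4 g ≤ lowTrilin I₁ I₂ I₃ I₄ := by
  refine Submodule.span_mono fun A ⟨x, y, z, h, hd, _⟩ => ?_
  have := x.sum_J_nonneg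
  have := y.sum_J_nonneg
  have := z.sum_J_nonneg
  have := x.field.one_le_dim
  have := y.field.one_le_dim
  have := z.field.one_le_dim
  unfold JetVar.dim at hd
  exact ⟨x, y, z, JetVar.low_of_sum_le (by linarith), JetVar.low_of_sum_le (by linarith),
    JetVar.low_of_sum_le (by linarith), h⟩

lemma lowTrilin_le_trilin : lowTrilin _ _ _ _ ≤ trilin I₁ I₂ I₃ I₄ :=
  Submodule.span_mono fun _ ⟨x, y, z, _, _, _, h⟩ => ⟨x, y, z, h⟩

/-- `f'` is the infinitesimal change of the state `f` under the Lorentz transformations in the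
plane `(α, β)`, on the jet variables with at most one derivative. -/
def Model.Rotates (𝓜 : ℳ) (α β : Fin 4) (f f' : 𝒬) : Prop :=
  ∀ x : 𝒳, x.Low → HasDerivAt (fun t : ℝ =>
    ev f (lorentzVar (planeLorentz α β t) (𝓜.planeSpin α β t) x)) (f' x) 0

lemma lorentzVar_one (x : 𝒳) (hx : x.Low) : lorentzVar 1 1 x = jet x.field x.J := by
  obtain ⟨f, J⟩ := x
  have key : ∀ f : ℱ, lorentzJet 1 f J = jet f J := by
    intro f
    rcases hx with h | ⟨ρ, h⟩
    · simp only at h; rw [h, lorentzJet_zero]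
    · simp only at h
      rw [h, lorentzJet_single]
      simp [Matrix.one_apply, apply_ite, ite_smul]
  cases f <;> simp [lorentzVar, key, Matrix.one_apply, apply_ite, ite_smul]

lemma planeLorentz_zero {α β : Fin 4} (h : α ≠ β) : planeLorentz α β 0 = 1 := by
  ext μ ν
  simp only [planeLorentz, Matrix.one_apply]
  split_ifs with h1 h2 h3 h4 h5 h6 h7 <;> (try simp) <;> grind

lemma Model.planeSpin_zero (𝓜 : ℳ) {α β : Fin 4} : 𝓜.planeSpin α β 0 = 1 := by
  simp [Model.planeSpin]

lemma Model.Rotates.filt {𝓜 : ℳ} {α β : Fin 4} {f f' : 𝒬}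
    (h : 𝓜.Rotates α β f f') (p : Bool) : 𝓜.Rotates α β (filt p f) (filt p f') := by
  intro x hx
  simp only [ev_filt _ (lorentzVar_mem _ _ x), StandardModel.filt]
  split_ifs
  · exact h x hx
  · exact hasDerivAt_const _ _

lemma tri_rotate {𝓜 : ℳ} {α β : Fin 4} (hαβ : α ≠ β) {f f' g g' h h' : 𝒬}
    (hf : 𝓜.Rotates α β f f') (hg : 𝓜.Rotates α β g g') (hh : 𝓜.Rotates α β h h')
    (p q r : Bool) {A : 𝒥} (hA : A ∈ lowTrilin _ _ _ _) :
    HasDerivAt (fun t : ℝ => tri p q r f g h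
      (lorentzHom (planeLorentz α β t) (𝓜.planeSpin α β t) A))
      (tri p q r f' g h A + tri p q r f g' h A + tri p q r f g h' A) 0 := by
  induction hA using Submodule.span_induction with
  | mem A hA =>
    obtain ⟨x, y, z, hx, hy, hz, rfl⟩ := hA
    have e : ∀ t : ℝ, tri p q r f g h (lorentzHom (planeLorentz α β t) (𝓜.planeSpin α β t)
        (jet x.field x.J * jet y.field y.J * jet z.field z.J)) = _ := fun t => by
      rw [map_mul (lorentzHom _ _), map_mul (lorentzHom _ _), lorentzHom, extendHom_jet, extendHom_jet, extendHom_jet,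
        tri_mul f g h (lorentzVar_mem _ _ _) (lorentzVar_mem _ _ _) (lorentzVar_mem _ _ _)]
    simp only [e]
    have v : ∀ (p : Bool) (f : 𝒬) (x : 𝒳), x.Low →
        ev (filt p f) (lorentzVar (planeLorentz α β 0) (𝓜.planeSpin α β 0) x) =
          ev (filt p f) (jet x.field x.J) := by
      intro p f x hx
      rw [planeLorentz_zero hαβ, Model.planeSpin_zero, lorentzVar_one x hx]
    have w : ∀ (p : Bool) (f : 𝒬) (x : 𝒳),
        filt p f x = ev (filt p f) (jet x.field x.J) := fun p f x => (ev_jet _ _ _).symm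
    have f1 := hf.filt p x hx
    have f2 := hf.filt p y hy
    have f3 := hf.filt p z hz
    have g1 := hg.filt q x hx
    have g2 := hg.filt q y hy
    have g3 := hg.filt q z hz
    have h1 := hh.filt r x hx
    have h2 := hh.filt r y hy
    have h3 := hh.filt r z hz
    refine (((((((f1.mul g2).mul h3).add ((((f1.mul h2).mul g3)).const_mul _)).add
      (((g1.mul f2).mul h3).const_mul _)).add (((g1.mul h2).mul f3).const_mul _)).add
      (((h1.mul f2).mul g3).const_mul _)).add (((h1.mul g2).mul f3).const_mul _)).congr_deriv ?_
    simp only [Pi.mul_apply, v _ _ _ hx, v _ _ _ hy, v _ _ _ hz,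
      tri_mul _ _ _ (jet_mem_lin x.field x.J) (jet_mem_lin y.field y.J) (jet_mem_lin z.field z.J), w]
    ring
  | zero => simpa using hasDerivAt_const (0 : ℝ) (0 : ℂ)
  | add X Y _ _ h1 h2 =>
    simp only [map_add]
    exact (h1.add h2).congr_deriv (by ring)
  | smul c X _ h =>
    simp only [map_smul]
    exact (h.const_mul c).congr_deriv (by simp only [smul_eq_mul]; ring)

lemma tri_rotate_eq_zero {𝓜 : ℳ} {α β : Fin 4} (hαβ : α ≠ β) {f f' g g' h h' : 𝒬}
    (hf : 𝓜.Rotates α β f f') (hg : 𝓜.Rotates α β g g') (hh : 𝓜.Rotates α β h h')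
    (p q r : Bool) {A : 𝒥} (hA : A ∈ lowTrilin _ _ _ _) (hs : 𝓜.IsScalar A) :
    tri p q r f' g h A + tri p q r f g' h A + tri p q r f g h' A = 0 := by
  refine (tri_rotate hαβ hf hg hh p q r hA).unique ?_
  refine (hasDerivAt_const (0 : ℝ) (tri p q r f g h A)).congr_of_eventuallyEq ?_
  have : ∀ᶠ t : ℝ in nhds 0, t ^ 2 < 1 :=
    (continuous_pow 2).continuousAt.eventually_lt continuousAt_const (by norm_num)
  filter_upwards [this] with t ht
  rw [hs _ _ (𝓜.isLorentzPair_plane hαβ ht)]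

/-! ### Lorentz invariant tensors -/

/-- The action of the infinitesimal Lorentz transformation in the plane `(α, β)` on an index. -/
def slot (α β : Fin 4) (F : 𝕍) (μ : Fin 4) : ℂ :=
  η μ * ((if μ = β then F α else 0) - (if μ = α then F β else 0))

lemma slot_left {α β : Fin 4} (h : α ≠ β) (F : 𝕍) : slot α β F α = -(η α * F β) := by
  simp [slot, h]

lemma slot_right {α β : Fin 4} (h : α ≠ β) (F : 𝕍) : slot α β F β = η β * F α := by
  simp [slot, h.symm]

lemma slot_other {α β μ : Fin 4} (h : μ ≠ α) (h' : μ ≠ β) (F : 𝕍) : slot α β F μ = 0 := by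
  simp [slot, h, h']

lemma invariant_one {C : Fin 4 → ℂ} (h : ∀ α β, α ≠ β → ∀ μ, slot α β C μ = 0) (μ : Fin 4) :
    C μ = 0 := by
  obtain ⟨ν, hν⟩ : ∃ ν, μ ≠ ν := by revert μ; decide
  have := h μ ν hν ν
  rw [slot_right hν] at this
  exact (mul_eq_zero.1 this).resolve_left (η_ne_zero ν)

lemma invariant_two {C : Fin 4 → Fin 4 → ℂ} (h : ∀ α β, α ≠ β → ∀ μ ν,
      slot α β (fun κ => C κ ν) μ + slot α β (fun κ => C μ κ) ν = 0) (μ ν : Fin 4) :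
    C μ ν = if μ = ν then η μ * C 0 0 else 0 := by
  split_ifs with hμ
  · subst hμ
    by_cases h0 : μ = 0
    · subst h0; simp [η]
    · have := h μ 0 h0 0 μ
      rw [slot_right h0, slot_left h0] at this
      have e := η_mul_self μ
      simp only [η, ↓reduceIte, one_mul] at this
      simp only [η] at e ⊢
      linear_combination this
  · obtain ⟨κ, h1, h2⟩ : ∃ κ, μ ≠ κ ∧ ν ≠ κ := by clear hμ; revert μ ν; decide
    have := h μ κ h1 κ ν
    rw [slot_right h1, slot_other (Ne.symm hμ) h2, add_zero] at this
    exact (mul_eq_zero.1 this).resolve_left (η_ne_zero κ)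

lemma exists_ne_three (μ ν ρ : Fin 4) : ∃ κ, μ ≠ κ ∧ ν ≠ κ ∧ ρ ≠ κ := by revert μ ν ρ; decide

lemma invariant_three {C : Fin 4 → Fin 4 → Fin 4 → ℂ}
    (h : ∀ α β, α ≠ β → ∀ μ ν ρ, slot α β (fun κ => C κ ν ρ) μ + slot α β (fun κ => C μ κ ρ) ν
      + slot α β (fun κ => C μ ν κ) ρ = 0) (μ ν ρ : Fin 4) : C μ ν ρ = 0 := by
  have h1 : ∀ μ ν ρ, μ ≠ ν → μ ≠ ρ → C μ ν ρ = 0 := by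
    intro μ ν ρ hν hρ
    obtain ⟨κ, k1, k2, k3⟩ := exists_ne_three μ ν ρ
    have := h μ κ k1 κ ν ρ
    rw [slot_right k1, slot_other hν.symm k2, slot_other hρ.symm k3, add_zero, add_zero] at this
    exact (mul_eq_zero.1 this).resolve_left (η_ne_zero κ)
  have h2 : ∀ μ ν ρ, ν ≠ μ → ν ≠ ρ → C μ ν ρ = 0 := by
    intro μ ν ρ hν hρ
    obtain ⟨κ, k1, k2, k3⟩ := exists_ne_three μ ν ρ
    have := h ν κ k2 μ κ ρ
    rw [slot_right k2, slot_other hν.symm k1, slot_other hρ.symm k3, add_zero, zero_add] at this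
    exact (mul_eq_zero.1 this).resolve_left (η_ne_zero κ)
  have h3 : ∀ μ ν, μ ≠ ν → C μ μ ν = 0 := by
    intro μ ν hν
    obtain ⟨κ, k1, k2, k3⟩ := exists_ne_three μ ν ν
    have := h ν κ k2 μ μ κ
    rw [slot_right k2, slot_other hν k1, slot_other hν k1, zero_add, zero_add] at this
    exact (mul_eq_zero.1 this).resolve_left (η_ne_zero κ)
  by_cases a : μ = ν
  · subst a
    by_cases b : μ = ρ
    · subst b
      obtain ⟨κ, k⟩ : ∃ κ, μ ≠ κ := by revert μ; decide
      have := h μ κ k κ μ μ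
      rw [slot_right k, slot_left k, slot_left k, h3 κ μ k.symm, h2 κ μ κ k k] at this
      simp only [mul_zero, neg_zero, add_zero] at this
      exact (mul_eq_zero.1 this).resolve_left (η_ne_zero κ)
    · exact h3 _ _ b
  · by_cases b : μ = ρ
    · subst b
      exact h2 _ _ _ (Ne.symm a) (Ne.symm a)
    · exact h1 _ _ _ a b

/-- The Levi-Civita symbol. -/
def lc (μ ν ρ σ : Fin 4) : ℂ :=
  ((((ν : ℤ) - μ) * (ρ - μ) * (σ - μ) * (ρ - ν) * (σ - ν) * (σ - ρ) / 12 : ℤ) : ℂ)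

lemma const_of_pairs {P : Fin 4 → Fin 4 → ℂ} (h1 : ∀ i j k, k ≠ i → k ≠ j → P i k = P j k)
    (h2 : ∀ i k l, i ≠ k → i ≠ l → P i k = P i l) {i k : Fin 4} (h : i ≠ k) : P i k = P 0 1 := by
  by_cases hk : k = 0
  · subst hk
    obtain ⟨l, l1, l2, -⟩ := exists_ne_three i 0 0
    rw [h2 i 0 l h l1, h1 i 0 l l1.symm l2.symm, h2 0 l 1 l2 (by decide)]
  · rw [h1 i 0 k h.symm hk, h2 0 k 1 (Ne.symm hk) (by decide)]

lemma eq_lc {C : Fin 4 → Fin 4 → Fin 4 → Fin 4 → ℂ}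
    (s1 : ∀ μ ν ρ σ, C μ ν ρ σ = -C ν μ ρ σ) (s2 : ∀ μ ν ρ σ, C μ ν ρ σ = -C μ ρ ν σ)
    (s3 : ∀ μ ν ρ σ, C μ ν ρ σ = -C μ ν σ ρ) (μ ν ρ σ : Fin 4) :
    C μ ν ρ σ = lc μ ν ρ σ * C 0 1 2 3 := by
  have z1 : ∀ μ ρ σ, C μ μ ρ σ = 0 := fun μ ρ σ => self_eq_neg.1 (s1 μ μ ρ σ)
  have z2 : ∀ μ ν σ, C μ ν ν σ = 0 := fun μ ν σ => self_eq_neg.1 (s2 μ ν ν σ)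
  have z3 : ∀ μ ν ρ, C μ ν ρ ρ = 0 := fun μ ν ρ => self_eq_neg.1 (s3 μ ν ρ ρ)
  have t1 : ∀ μ ν ρ σ, ν < μ → C μ ν ρ σ = -C ν μ ρ σ := fun μ ν ρ σ _ => s1 μ ν ρ σ
  have t2 : ∀ μ ν ρ σ, ρ < ν → C μ ν ρ σ = -C μ ρ ν σ := fun μ ν ρ σ _ => s2 μ ν ρ σ
  have t3 : ∀ μ ν ρ σ, σ < ρ → C μ ν ρ σ = -C μ ν σ ρ := fun μ ν ρ σ _ => s3 μ ν ρ σ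
  clear s1 s2 s3
  fin_cases μ <;> fin_cases ν <;> fin_cases ρ <;> fin_cases σ <;>
    simp (discharger := decide) [z1, z2, z3, t1, t2, t3, lc]

lemma invariant_four {C : Fin 4 → Fin 4 → Fin 4 → Fin 4 → ℂ}
    (h : ∀ α β, α ≠ β → ∀ μ ν ρ σ, slot α β (fun κ => C κ ν ρ σ) μ
      + slot α β (fun κ => C μ κ ρ σ) ν + slot α β (fun κ => C μ ν κ σ) ρ
      + slot α β (fun κ => C μ ν ρ κ) σ = 0) :
    ∃ a b c e : ℂ, ∀ μ ν ρ σ, C μ ν ρ σ =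
      a * ((if μ = ν then η μ else 0) * (if ρ = σ then η ρ else 0))
      + b * ((if μ = ρ then η μ else 0) * (if ν = σ then η ν else 0))
      + c * ((if μ = σ then η μ else 0) * (if ν = ρ then η ν else 0)) + e * lc μ ν ρ σ := by
  have ηη : ∀ μ, η μ * η μ = 1 := η_mul_self
  have hz : ∀ κ x, η κ * x = 0 → x = 0 := fun κ x hx =>
    (mul_eq_zero.1 hx).resolve_left (η_ne_zero κ)
  -- an index which occurs once, while some value does not occur
  have u1 : ∀ μ ν ρ σ κ, μ ≠ κ → ν ≠ κ → ρ ≠ κ → σ ≠ κ → ν ≠ μ → ρ ≠ μ → σ ≠ μ → C μ ν ρ σ = 0 := by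
    intro μ ν ρ σ κ k1 k2 k3 k4 n1 n2 n3
    have := h μ κ k1 κ ν ρ σ
    rw [slot_right k1, slot_other n1 k2, slot_other n2 k3, slot_other n3 k4] at this
    exact hz κ _ (by simpa using this)
  have u2 : ∀ μ ν ρ σ κ, μ ≠ κ → ν ≠ κ → ρ ≠ κ → σ ≠ κ → μ ≠ ν → ρ ≠ ν → σ ≠ ν → C μ ν ρ σ = 0 := by
    intro μ ν ρ σ κ k1 k2 k3 k4 n1 n2 n3
    have := h ν κ k2 μ κ ρ σ
    rw [slot_right k2, slot_other n1 k1, slot_other n2 k3, slot_other n3 k4] at this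
    exact hz κ _ (by simpa using this)
  have u3 : ∀ μ ν ρ σ κ, μ ≠ κ → ν ≠ κ → ρ ≠ κ → σ ≠ κ → μ ≠ ρ → ν ≠ ρ → σ ≠ ρ → C μ ν ρ σ = 0 := by
    intro μ ν ρ σ κ k1 k2 k3 k4 n1 n2 n3
    have := h ρ κ k3 μ ν κ σ
    rw [slot_right k3, slot_other n1 k1, slot_other n2 k2, slot_other n3 k4] at this
    exact hz κ _ (by simpa using this)
  have u4 : ∀ μ ν ρ σ κ, μ ≠ κ → ν ≠ κ → ρ ≠ κ → σ ≠ κ → μ ≠ σ → ν ≠ σ → ρ ≠ σ → C μ ν ρ σ = 0 := by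
    intro μ ν ρ σ κ k1 k2 k3 k4 n1 n2 n3
    have := h σ κ k4 μ ν ρ κ
    rw [slot_right k4, slot_other n1 k1, slot_other n2 k2, slot_other n3 k3] at this
    exact hz κ _ (by simpa using this)
  -- two pairs
  have pa : ∀ i k, i ≠ k → η i * η k * C i i k k = η 0 * η 1 * C 0 0 1 1 := by
    intro i k hik
    refine const_of_pairs (P := fun i k => η i * η k * C i i k k) (fun i j k ki kj => ?_)
      (fun i k l ik il => ?_) hik
    · by_cases ij : i = j
      · rw [ij]
      have := h i j ij j i k k
      rw [slot_right ij, slot_left ij, slot_other ki kj, slot_other ki kj] at this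
      linear_combination η i * η j * η k * this - η i * η k * C i i k k * ηη j
        + η j * η k * C j j k k * ηη i
    · by_cases kl : k = l
      · rw [kl]
      have := h k l kl i i l k
      rw [slot_right kl, slot_left kl, slot_other ik il, slot_other ik il] at this
      linear_combination η i * η k * η l * this - η i * η k * C i i k k * ηη l
        + η i * η l * C i i l l * ηη k
  have pb : ∀ i k, i ≠ k → η i * η k * C i k i k = η 0 * η 1 * C 0 1 0 1 := by
    intro i k hik
    refine const_of_pairs (P := fun i k => η i * η k * C i k i k) (fun i j k ki kj => ?_)
      (fun i k l ik il => ?_) hik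
    · by_cases ij : i = j
      · rw [ij]
      have := h i j ij j k i k
      rw [slot_right ij, slot_left ij, slot_other ki kj, slot_other ki kj] at this
      linear_combination η i * η j * η k * this - η i * η k * C i k i k * ηη j
        + η j * η k * C j k j k * ηη i
    · by_cases kl : k = l
      · rw [kl]
      have := h k l kl i l i k
      rw [slot_right kl, slot_left kl, slot_other ik il, slot_other ik il] at this
      linear_combination η i * η k * η l * this - η i * η k * C i k i k * ηη l
        + η i * η l * C i l i l * ηη k
  have pc : ∀ i k, i ≠ k → η i * η k * C i k k i = η 0 * η 1 * C 0 1 1 0 := by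
    intro i k hik
    refine const_of_pairs (P := fun i k => η i * η k * C i k k i) (fun i j k ki kj => ?_)
      (fun i k l ik il => ?_) hik
    · by_cases ij : i = j
      · rw [ij]
      have := h i j ij j k k i
      rw [slot_right ij, slot_left ij, slot_other ki kj, slot_other ki kj] at this
      linear_combination η i * η j * η k * this - η i * η k * C i k k i * ηη j
        + η j * η k * C j k k j * ηη i
    · by_cases kl : k = l
      · rw [kl]
      have := h k l kl i l k i
      rw [slot_right kl, slot_left kl, slot_other ik il, slot_other ik il] at this
      linear_combination η i * η k * η l * this - η i * η k * C i k k i * ηη l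
        + η i * η l * C i l l i * ηη k
  have pd : ∀ i, C i i i i = η 0 * η 1 * C 0 0 1 1 + η 0 * η 1 * C 0 1 0 1
      + η 0 * η 1 * C 0 1 1 0 := by
    intro i
    obtain ⟨j, ij, -⟩ := exists_ne_three i i i
    have := h i j ij j i i i
    rw [slot_right ij, slot_left ij, slot_left ij, slot_left ij] at this
    rw [← pa j i ij.symm, ← pb j i ij.symm, ← pc j i ij.symm]
    linear_combination η j * this - C i i i i * ηη j
  -- distinct indices
  set L : Fin 4 → Fin 4 → Fin 4 → Fin 4 → ℂ := fun μ ν ρ σ =>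
    if μ ≠ ν ∧ μ ≠ ρ ∧ μ ≠ σ ∧ ν ≠ ρ ∧ ν ≠ σ ∧ ρ ≠ σ then C μ ν ρ σ else 0 with hL
  have l1 : ∀ μ ν ρ σ, L μ ν ρ σ = -L ν μ ρ σ := by
    intro μ ν ρ σ
    simp only [hL]
    by_cases hd : μ ≠ ν ∧ μ ≠ ρ ∧ μ ≠ σ ∧ ν ≠ ρ ∧ ν ≠ σ ∧ ρ ≠ σ
    · rw [if_pos hd, if_pos (by grind)]
      have := h μ ν hd.1 ν ν ρ σ
      rw [slot_right hd.1, slot_right hd.1, slot_other (by grind) (by grind),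
        slot_other (by grind) (by grind)] at this
      exact eq_neg_of_add_eq_zero_left (hz ν _ (by linear_combination this))
    · rw [if_neg hd, if_neg (by grind), neg_zero]
  have l2 : ∀ μ ν ρ σ, L μ ν ρ σ = -L μ ρ ν σ := by
    intro μ ν ρ σ
    simp only [hL]
    by_cases hd : μ ≠ ν ∧ μ ≠ ρ ∧ μ ≠ σ ∧ ν ≠ ρ ∧ ν ≠ σ ∧ ρ ≠ σ
    · rw [if_pos hd, if_pos (by grind)]
      have n : ν ≠ ρ := hd.2.2.2.1
      have := h ν ρ n μ ρ ρ σ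
      rw [slot_right n, slot_right n, slot_other (by grind) (by grind),
        slot_other (by grind) (by grind)] at this
      exact eq_neg_of_add_eq_zero_left (hz ρ _ (by linear_combination this))
    · rw [if_neg hd, if_neg (by grind), neg_zero]
  have l3 : ∀ μ ν ρ σ, L μ ν ρ σ = -L μ ν σ ρ := by
    intro μ ν ρ σ
    simp only [hL]
    by_cases hd : μ ≠ ν ∧ μ ≠ ρ ∧ μ ≠ σ ∧ ν ≠ ρ ∧ ν ≠ σ ∧ ρ ≠ σ
    · rw [if_pos hd, if_pos (by grind)]
      have n : ρ ≠ σ := hd.2.2.2.2.2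
      have := h ρ σ n μ ν σ σ
      rw [slot_right n, slot_right n, slot_other (by grind) (by grind),
        slot_other (by grind) (by grind)] at this
      exact eq_neg_of_add_eq_zero_left (hz σ _ (by linear_combination this))
    · rw [if_neg hd, if_neg (by grind), neg_zero]
  have hl := eq_lc l1 l2 l3
  refine ⟨η 0 * η 1 * C 0 0 1 1, η 0 * η 1 * C 0 1 0 1, η 0 * η 1 * C 0 1 1 0, L 0 1 2 3,
    fun μ ν ρ σ => ?_⟩
  rw [mul_comm (L 0 1 2 3), ← hl]
  by_cases hd : μ ≠ ν ∧ μ ≠ ρ ∧ μ ≠ σ ∧ ν ≠ ρ ∧ ν ≠ σ ∧ ρ ≠ σ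
  · rw [if_neg hd.1, if_neg hd.2.1, if_neg hd.2.2.1]
    simp only [hL]
    rw [if_pos hd]
    ring
  have hL0 : L μ ν ρ σ = 0 := if_neg hd
  rw [hL0]
  by_cases e1 : μ = ν
  · subst e1
    by_cases e2 : ρ = σ
    · subst e2
      by_cases e3 : μ = ρ
      · subst e3
        simp only [↓reduceIte, ηη, mul_one]
        rw [pd]; ring
      · simp only [↓reduceIte, if_neg e3]
        linear_combination (η μ * η ρ) * pa μ ρ e3 - η μ * η μ * C μ μ ρ ρ * ηη ρ - C μ μ ρ ρ * ηη μ
    · have : C μ μ ρ σ = 0 := by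
        obtain ⟨κ, k1, k2, k3⟩ := exists_ne_three μ ρ σ
        by_cases e3 : μ = ρ
        · subst e3; exact u4 μ μ μ σ κ k1 k1 k1 k3 e2 e2 e2
        · exact u3 μ μ ρ σ κ k1 k1 k2 k3 e3 e3 (Ne.symm e2)
      rw [this, if_neg e2]
      by_cases e3 : μ = ρ
      · subst e3; simp [e2]
      · simp [e3]
  · rw [if_neg e1]
    by_cases e3 : μ = ρ
    · subst e3
      rw [if_neg (Ne.symm e1)]
      by_cases e4 : ν = σ
      · subst e4
        simp only [↓reduceIte]
        linear_combination (η μ * η ν) * pb μ ν e1 - η μ * η μ * C μ ν μ ν * ηη ν - C μ ν μ ν * ηη μ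
      · obtain ⟨κ, k1, k2, k3⟩ := exists_ne_three μ ν σ
        rw [u2 μ ν μ σ κ k1 k2 k1 k3 e1 e1 (Ne.symm e4), if_neg e4]
        ring
    · rw [if_neg e3]
      by_cases e4 : μ = σ
      · subst e4
        by_cases e5 : ν = ρ
        · subst e5
          simp only [↓reduceIte]
          linear_combination (η μ * η ν) * pc μ ν e1 - η μ * η μ * C μ ν ν μ * ηη ν
            - C μ ν ν μ * ηη μ
        · obtain ⟨κ, k1, k2, k3⟩ := exists_ne_three μ ν ρ
          rw [u2 μ ν ρ μ κ k1 k2 k3 k1 e1 (Ne.symm e5) e1, if_neg e5]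
          ring
      · have : ∃ κ, μ ≠ κ ∧ ν ≠ κ ∧ ρ ≠ κ ∧ σ ≠ κ := by
          clear * - hd
          revert μ ν ρ σ; decide
        obtain ⟨κ, k1, k2, k3, k4⟩ := this
        rw [u1 μ ν ρ σ κ k1 k2 k3 k4 (Ne.symm e1) (Ne.symm e3) (Ne.symm e4), if_neg e4]
        ring

section Clifford

variable (𝓜 : Model I₁ I₂ I₃ I₄)

lemma Matrix.trace_eq_zero_of_anticommute {A B : 𝕄} {c : ℂ} (hc : c ≠ 0)
    (hB : B * B = c • (1 : 𝕄)) (h : A * B = -(B * A)) : A.trace = 0 := by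
  have h1 : (B * A * B).trace = c * A.trace := by
    rw [Matrix.trace_mul_cycle, hB, smul_mul_assoc, one_mul, Matrix.trace_smul, smul_eq_mul]
  have h2 : (B * A * B).trace = -(c * A.trace) := by
    rw [mul_assoc, h, mul_neg, ← mul_assoc, hB, smul_mul_assoc, one_mul, Matrix.trace_neg,
      Matrix.trace_smul, smul_eq_mul]
  have : c * A.trace = 0 := self_eq_neg.1 (h1.symm.trans h2)
  exact (mul_eq_zero.1 this).resolve_left hc

lemma Matrix.exists_smul_of_idempotent {e X : 𝕄} (he : e * e = e)
    (ht : e.trace = 1) (hX : X * e = e * X) : ∃ c : ℂ, X * e = c • e := by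
  have hid : IsIdempotentElem (Matrix.toLin' e) := by
    unfold IsIdempotentElem
    rw [Module.End.mul_eq_comp, ← Matrix.toLin'_mul, he]
  have hp := (LinearMap.isProj_range_iff_isIdempotentElem _).2 hid
  have hr : Module.finrank ℂ (LinearMap.range (Matrix.toLin' e)) = 1 := by
    have := hp.trace
    rw [Matrix.trace_toLin'_eq, ht] at this
    exact_mod_cast this.symm
  obtain ⟨⟨v, hv⟩, -, hs⟩ := finrank_eq_one_iff'.1 hr
  have hev : e.mulVec v = v := by
    obtain ⟨w, rfl⟩ := hv
    rw [Matrix.toLin'_apply, Matrix.mulVec_mulVec, he]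
  have hXv : X.mulVec v ∈ LinearMap.range (Matrix.toLin' e) := by
    refine ⟨X.mulVec v, ?_⟩
    rw [Matrix.toLin'_apply, Matrix.mulVec_mulVec, ← hX, ← Matrix.mulVec_mulVec, hev]
  obtain ⟨c, hc⟩ := hs ⟨_, hXv⟩
  replace hc : c • v = X.mulVec v := congrArg Subtype.val hc
  refine ⟨c, Matrix.toLin'.injective (LinearMap.ext fun w => ?_)⟩
  obtain ⟨b, hb⟩ := hs ⟨_, ⟨w, rfl⟩⟩
  replace hb : b • v = e.mulVec w := congrArg Subtype.val hb
  rw [Matrix.toLin'_apply, Matrix.toLin'_apply, ← Matrix.mulVec_mulVec, ← hb, Matrix.mulVec_smul,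
    ← hc, Matrix.smul_mulVec, ← hb, smul_comm]

lemma Model.γ_sq_zero : 𝓜.γ 0 * 𝓜.γ 0 = 1 := by rw [𝓜.γ_sq]; simp [η]

lemma Model.γ_sq_space {i : Fin 4} (h : i ≠ 0) : 𝓜.γ i * 𝓜.γ i = -1 := by rw [𝓜.γ_sq]; simp [η, h]

/-- Rules which bring products of Dirac matrices into increasing order. -/
lemma Model.γ_order : (𝓜.γ 1 * 𝓜.γ 0 = -(𝓜.γ 0 * 𝓜.γ 1) ∧ 𝓜.γ 2 * 𝓜.γ 0 = -(𝓜.γ 0 * 𝓜.γ 2) ∧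
      𝓜.γ 3 * 𝓜.γ 0 = -(𝓜.γ 0 * 𝓜.γ 3) ∧ 𝓜.γ 2 * 𝓜.γ 1 = -(𝓜.γ 1 * 𝓜.γ 2) ∧
      𝓜.γ 3 * 𝓜.γ 1 = -(𝓜.γ 1 * 𝓜.γ 3) ∧ 𝓜.γ 3 * 𝓜.γ 2 = -(𝓜.γ 2 * 𝓜.γ 3)) ∧
    (∀ x, 𝓜.γ 1 * (𝓜.γ 0 * x) = -(𝓜.γ 0 * (𝓜.γ 1 * x)) ∧
      𝓜.γ 2 * (𝓜.γ 0 * x) = -(𝓜.γ 0 * (𝓜.γ 2 * x)) ∧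
      𝓜.γ 3 * (𝓜.γ 0 * x) = -(𝓜.γ 0 * (𝓜.γ 3 * x)) ∧
      𝓜.γ 2 * (𝓜.γ 1 * x) = -(𝓜.γ 1 * (𝓜.γ 2 * x)) ∧
      𝓜.γ 3 * (𝓜.γ 1 * x) = -(𝓜.γ 1 * (𝓜.γ 3 * x)) ∧
      𝓜.γ 3 * (𝓜.γ 2 * x) = -(𝓜.γ 2 * (𝓜.γ 3 * x))) ∧
    (𝓜.γ 0 * 𝓜.γ 0 = 1 ∧ 𝓜.γ 1 * 𝓜.γ 1 = -1 ∧ 𝓜.γ 2 * 𝓜.γ 2 = -1 ∧ 𝓜.γ 3 * 𝓜.γ 3 = -1) ∧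
    (∀ x, 𝓜.γ 0 * (𝓜.γ 0 * x) = x ∧ 𝓜.γ 1 * (𝓜.γ 1 * x) = -x ∧ 𝓜.γ 2 * (𝓜.γ 2 * x) = -x ∧
      𝓜.γ 3 * (𝓜.γ 3 * x) = -x) := by
  have a : ∀ {i j : Fin 4}, i ≠ j → 𝓜.γ i * 𝓜.γ j = -(𝓜.γ j * 𝓜.γ i) := fun h => 𝓜.γ_anticomm h
  have b : ∀ {i j : Fin 4}, i ≠ j → ∀ x, 𝓜.γ i * (𝓜.γ j * x) = -(𝓜.γ j * (𝓜.γ i * x)) :=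
    fun h x => by rw [← mul_assoc, a h, neg_mul, mul_assoc]
  have c : ∀ {i : Fin 4}, i ≠ 0 → ∀ x, 𝓜.γ i * (𝓜.γ i * x) = -x := fun h x => by
    rw [← mul_assoc, 𝓜.γ_sq_space h, neg_one_mul]
  refine ⟨⟨a (by decide), a (by decide), a (by decide), a (by decide), a (by decide),
    a (by decide)⟩, fun x => ⟨b (by decide) x, b (by decide) x, b (by decide) x, b (by decide) x,
    b (by decide) x, b (by decide) x⟩, ⟨𝓜.γ_sq_zero, 𝓜.γ_sq_space (by decide),
    𝓜.γ_sq_space (by decide), 𝓜.γ_sq_space (by decide)⟩, fun x => ⟨?_, c (by decide) x,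
    c (by decide) x, c (by decide) x⟩⟩
  rw [← mul_assoc, 𝓜.γ_sq_zero, one_mul]

/-- A matrix which commutes with the Dirac matrices is a multiple of the unit matrix. -/
lemma Model.eq_smul_one_of_commute {X : 𝕄}
    (hX : ∀ μ, X * 𝓜.γ μ = 𝓜.γ μ * X) : ∃ c : ℂ, X = c • (1 : 𝕄) := by
  have hX' : ∀ μ y, X * (𝓜.γ μ * y) = 𝓜.γ μ * (X * y) := fun μ y => by
    rw [← mul_assoc, hX, mul_assoc]
  set e : ℂ → ℂ → 𝕄 := fun s t =>
    (1 / 4 : ℂ) • ((1 + s • 𝓜.γ 0) * (1 + (t * I) • (𝓜.γ 1 * 𝓜.γ 2))) with he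
  have t0 : (𝓜.γ 0).trace = 0 :=
    Matrix.trace_eq_zero_of_anticommute (c := -1) (by norm_num) (B := 𝓜.γ 1)
      (by simp [𝓜.γ_order]) (by simp [𝓜.γ_order])
  have t12 : (𝓜.γ 1 * 𝓜.γ 2).trace = 0 :=
    Matrix.trace_eq_zero_of_anticommute (c := -1) (by norm_num) (B := 𝓜.γ 1)
      (by simp [𝓜.γ_order]) (by simp [𝓜.γ_order, mul_assoc])
  have t012 : (𝓜.γ 0 * (𝓜.γ 1 * 𝓜.γ 2)).trace = 0 :=
    Matrix.trace_eq_zero_of_anticommute (c := -1) (by norm_num) (B := 𝓜.γ 3)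
      (by simp [𝓜.γ_order]) (by simp [𝓜.γ_order, mul_assoc])
  have idem : e 1 1 * e 1 1 = e 1 1 := by
    simp only [he, mul_add, add_mul, smul_mul_assoc, mul_smul_comm, smul_add, one_mul, mul_one,
      mul_assoc, 𝓜.γ_order, smul_smul, mul_neg, smul_neg, neg_neg]
    have := Complex.I_mul_I
    match_scalars <;> first
      | ring1
      | linear_combination (-1 / 16) * this
      | linear_combination (1 / 16) * this
      | linear_combination (-1 / 8) * this
  have tr : (e 1 1).trace = 1 := by simp [he, mul_add, add_mul, Matrix.trace_smul, t0, t12, t012]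
  have comm : X * e 1 1 = e 1 1 * X := by
    simp only [he, mul_add, add_mul, smul_mul_assoc, mul_smul_comm, smul_add, one_mul, mul_one,
      mul_assoc, hX, hX']
  obtain ⟨c, hc⟩ := Matrix.exists_smul_of_idempotent idem tr comm
  refine ⟨c, ?_⟩
  have key : ∀ P Q, P * X = X * P → X * (P * e 1 1 * Q) = c • (P * e 1 1 * Q) := by
    intro P Q hP
    rw [mul_assoc, ← mul_assoc X, ← hP, mul_assoc, ← mul_assoc X, hc, smul_mul_assoc, mul_smul_comm]
  have k1 := key (𝓜.γ 1) (𝓜.γ 1) (hX 1).symm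
  have k2 := key (𝓜.γ 3) (𝓜.γ 3) (hX 3).symm
  have k3 := key (𝓜.γ 1 * 𝓜.γ 3) (𝓜.γ 1 * 𝓜.γ 3) (by simp only [mul_assoc, hX, hX'])
  have sum : e 1 1 + -(𝓜.γ 1 * e 1 1 * 𝓜.γ 1) + -(𝓜.γ 3 * e 1 1 * 𝓜.γ 3)
      + -(𝓜.γ 1 * 𝓜.γ 3 * e 1 1 * (𝓜.γ 1 * 𝓜.γ 3)) = 1 := by
    simp only [he, mul_add, add_mul, smul_mul_assoc, mul_smul_comm, smul_add, one_mul, mul_one,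
      mul_assoc, 𝓜.γ_order, smul_smul, mul_neg, neg_mul, smul_neg, neg_neg]
    module
  calc X = X * (e 1 1 + -(𝓜.γ 1 * e 1 1 * 𝓜.γ 1) + -(𝓜.γ 3 * e 1 1 * 𝓜.γ 3)
      + -(𝓜.γ 1 * 𝓜.γ 3 * e 1 1 * (𝓜.γ 1 * 𝓜.γ 3))) := by rw [sum, mul_one]
    _ = c • (e 1 1 + -(𝓜.γ 1 * e 1 1 * 𝓜.γ 1) + -(𝓜.γ 3 * e 1 1 * 𝓜.γ 3)
      + -(𝓜.γ 1 * 𝓜.γ 3 * e 1 1 * (𝓜.γ 1 * 𝓜.γ 3))) := by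
      rw [mul_add, mul_add, mul_add, mul_neg, mul_neg, mul_neg, hc, k1, k2, k3]
      module
    _ = c • 1 := by rw [sum]

/-- The commutant of the spatial rotations. -/
lemma Model.commutant_rotation {Y : 𝕄} (h12 : Y * (𝓜.γ 1 * 𝓜.γ 2) = 𝓜.γ 1 * 𝓜.γ 2 * Y)
    (h23 : Y * (𝓜.γ 2 * 𝓜.γ 3) = 𝓜.γ 2 * 𝓜.γ 3 * Y) :
    ∃ a b c d : ℂ, Y = a • (1 : 𝕄) + d • 𝓜.γ₅ + 𝓜.γ 0 * (b • (1 : 𝕄) + c • 𝓜.γ₅) := by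
  set ω := 𝓜.γ 1 * 𝓜.γ 2 * 𝓜.γ 3 with hω
  have ωω : ω * ω = 1 := by simp [hω, mul_assoc, 𝓜.γ_order]
  have ω0 : ω * 𝓜.γ 0 = -(𝓜.γ 0 * ω) := by simp [hω, mul_assoc, 𝓜.γ_order]
  have ω12 : ω * (𝓜.γ 1 * 𝓜.γ 2) = 𝓜.γ 1 * 𝓜.γ 2 * ω := by simp [hω, mul_assoc, 𝓜.γ_order]
  have ω23 : ω * (𝓜.γ 2 * 𝓜.γ 3) = 𝓜.γ 2 * 𝓜.γ 3 * ω := by simp [hω, mul_assoc, 𝓜.γ_order]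
  have z12 : 𝓜.γ 0 * (𝓜.γ 1 * 𝓜.γ 2) = 𝓜.γ 1 * 𝓜.γ 2 * 𝓜.γ 0 := by simp [mul_assoc, 𝓜.γ_order]
  have z23 : 𝓜.γ 0 * (𝓜.γ 2 * 𝓜.γ 3) = 𝓜.γ 2 * 𝓜.γ 3 * 𝓜.γ 0 := by simp [mul_assoc, 𝓜.γ_order]
  have z0 := 𝓜.γ_sq_zero
  have e1 : 𝓜.γ 1 = -(ω * (𝓜.γ 2 * 𝓜.γ 3)) := by simp [hω, mul_assoc, 𝓜.γ_order]
  have e3 : 𝓜.γ 3 = -(ω * (𝓜.γ 1 * 𝓜.γ 2)) := by simp [hω, mul_assoc, 𝓜.γ_order]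
  have e2 : 𝓜.γ 2 = -(ω * ((𝓜.γ 1 * 𝓜.γ 2) * (𝓜.γ 2 * 𝓜.γ 3))) := by simp [hω, mul_assoc, 𝓜.γ_order]
  have e5 : 𝓜.γ₅ = I • (𝓜.γ 0 * ω) := by simp [hω, Model.γ₅, mul_assoc]
  clear_value ω
  generalize hp : 𝓜.γ 1 * 𝓜.γ 2 = p at *
  generalize hq : 𝓜.γ 2 * 𝓜.γ 3 = q at *
  have scalar : ∀ Z : 𝕄, Z * 𝓜.γ 0 = 𝓜.γ 0 * Z → Z * ω = ω * Z →
      Z * p = p * Z → Z * q = q * Z → ∃ c : ℂ, Z = c • (1 : 𝕄) := by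
    intro Z k0 kω kp kq
    refine 𝓜.eq_smul_one_of_commute fun μ => ?_
    have kω' : ∀ y, Z * (ω * y) = ω * (Z * y) := fun y => by rw [← mul_assoc, kω, mul_assoc]
    have kp' : ∀ y, Z * (p * y) = p * (Z * y) := fun y => by rw [← mul_assoc, kp, mul_assoc]
    fin_cases μ
    · exact k0
    · change Z * 𝓜.γ 1 = 𝓜.γ 1 * Z
      rw [e1]; simp only [mul_neg, neg_mul, kω', kq, mul_assoc]
    · change Z * 𝓜.γ 2 = 𝓜.γ 2 * Z
      rw [e2]; simp only [mul_neg, neg_mul, kω', kp', kq, mul_assoc]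
    · change Z * 𝓜.γ 3 = 𝓜.γ 3 * Z
      rw [e3]; simp only [mul_neg, neg_mul, kω', kp, mul_assoc]
  have ω0' : ∀ y, ω * (𝓜.γ 0 * y) = -(𝓜.γ 0 * (ω * y)) := fun y => by
    rw [← mul_assoc, ω0, neg_mul, mul_assoc]
  have ωω' : ∀ y, ω * (ω * y) = y := fun y => by rw [← mul_assoc, ωω, one_mul]
  have z0' : ∀ y, 𝓜.γ 0 * (𝓜.γ 0 * y) = y := fun y => by rw [← mul_assoc, z0, one_mul]
  have ω12' : ∀ y, ω * (p * y) = p * (ω * y) := fun y => by rw [← mul_assoc, ω12, mul_assoc]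
  have ω23' : ∀ y, ω * (q * y) = q * (ω * y) := fun y => by rw [← mul_assoc, ω23, mul_assoc]
  have z12' : ∀ y, 𝓜.γ 0 * (p * y) = p * (𝓜.γ 0 * y) := fun y => by rw [← mul_assoc, z12, mul_assoc]
  have z23' : ∀ y, 𝓜.γ 0 * (q * y) = q * (𝓜.γ 0 * y) := fun y => by rw [← mul_assoc, z23, mul_assoc]
  have even : ∀ Z : 𝕄, Z * 𝓜.γ 0 = 𝓜.γ 0 * Z → Z * p = p * Z → Z * q = q * Z →
      ∃ a b : ℂ, Z = a • (1 : 𝕄) + b • 𝓜.γ 0 := by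
    intro Z k0 kp kq
    have k0' : ∀ y, Z * (𝓜.γ 0 * y) = 𝓜.γ 0 * (Z * y) := fun y => by rw [← mul_assoc, k0, mul_assoc]
    have kp' : ∀ y, Z * (p * y) = p * (Z * y) := fun y => by rw [← mul_assoc, kp, mul_assoc]
    have kq' : ∀ y, Z * (q * y) = q * (Z * y) := fun y => by rw [← mul_assoc, kq, mul_assoc]
    obtain ⟨a, ha⟩ := scalar (Z + ω * (Z * ω))
      (by simp only [add_mul, mul_add, mul_assoc, ω0, ω0', k0, k0', mul_neg, neg_neg])
      (by simp only [add_mul, mul_add, mul_assoc, ωω, ωω', mul_one]; rw [add_comm])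
      (by simp only [add_mul, mul_add, mul_assoc, ω12, ω12', kp, kp'])
      (by simp only [add_mul, mul_add, mul_assoc, ω23, ω23', kq, kq'])
    obtain ⟨b, hb⟩ := scalar ((Z - ω * (Z * ω)) * 𝓜.γ 0)
      (by simp only [sub_mul, mul_sub, mul_assoc, ω0, ω0', k0, k0', mul_neg, neg_neg])
      (by
        have e : 𝓜.γ 0 * ω = -(ω * 𝓜.γ 0) := by rw [ω0, neg_neg]
        have e' : ∀ y, 𝓜.γ 0 * (ω * y) = -(ω * (𝓜.γ 0 * y)) := fun y => by rw [ω0', neg_neg]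
        simp only [sub_mul, mul_sub, mul_assoc, ωω', e, mul_neg]
        abel)
      (by simp only [sub_mul, mul_sub, mul_assoc, ω12', kp', z12])
      (by simp only [sub_mul, mul_sub, mul_assoc, ω23', kq', z23])
    have hb' : Z - ω * (Z * ω) = b • 𝓜.γ 0 := by
      have := congrArg (· * 𝓜.γ 0) hb
      simpa only [mul_assoc, z0, mul_one, smul_mul_assoc, one_mul] using this
    refine ⟨a / 2, b / 2, ?_⟩
    have : (2 : ℂ) • Z = a • (1 : 𝕄) + b • 𝓜.γ 0 := by rw [← ha, ← hb']; module
    rw [div_eq_inv_mul, div_eq_inv_mul, mul_smul, mul_smul, ← smul_add, ← this, smul_smul]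
    norm_num
  have h12' : ∀ y, Y * (p * y) = p * (Y * y) := fun y => by rw [← mul_assoc, h12, mul_assoc]
  have h23' : ∀ y, Y * (q * y) = q * (Y * y) := fun y => by rw [← mul_assoc, h23, mul_assoc]
  obtain ⟨a, b, hab⟩ := even (Y + 𝓜.γ 0 * (Y * 𝓜.γ 0))
    (by simp only [add_mul, mul_add, mul_assoc, z0, z0', mul_one]; rw [add_comm])
    (by simp only [add_mul, mul_add, mul_assoc, h12, h12', z12, z12'])
    (by simp only [add_mul, mul_add, mul_assoc, h23, h23', z23, z23'])
  obtain ⟨c, d, hcd⟩ := even ((Y - 𝓜.γ 0 * (Y * 𝓜.γ 0)) * ω)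
    (by simp only [sub_mul, mul_sub, mul_assoc, z0', ω0, mul_neg]; abel)
    (by simp only [sub_mul, mul_sub, mul_assoc, h12', z12', ω12])
    (by simp only [sub_mul, mul_sub, mul_assoc, h23', z23', ω23])
  have hcd' : Y - 𝓜.γ 0 * (Y * 𝓜.γ 0) = c • ω + d • (𝓜.γ 0 * ω) := by
    have := congrArg (· * ω) hcd
    simpa only [mul_assoc, ωω, mul_one, smul_mul_assoc, one_mul, add_mul] using this
  refine ⟨a / 2, b / 2, -(I * c / 2), -(I * d / 2), ?_⟩
  have : (2 : ℂ) • Y = a • (1 : 𝕄) + b • 𝓜.γ 0 + (c • ω + d • (𝓜.γ 0 * ω)) := by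
    rw [← hab, ← hcd']; module
  refine smul_right_injective _ (two_ne_zero' ℂ) (this.trans ?_)
  simp only [e5, mul_add, mul_smul_comm, z0', mul_one, smul_add, smul_smul]
  have := Complex.I_mul_I
  match_scalars
  · ring
  · ring
  · linear_combination c * this
  · linear_combination d * this

lemma Model.γ₅_comm_pair {α β : Fin 4} (h : α ≠ β) :
    𝓜.γ₅ * (𝓜.γ α * 𝓜.γ β) = 𝓜.γ α * 𝓜.γ β * 𝓜.γ₅ := by
  fin_cases α <;> fin_cases β <;> first | exact absurd rfl h | skip
  all_goals simp [Model.γ₅, mul_assoc, 𝓜.γ_order]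

lemma Model.γ₅_anticomm (α : Fin 4) : 𝓜.γ₅ * 𝓜.γ α = -(𝓜.γ α * 𝓜.γ₅) := by
  fin_cases α <;> simp [Model.γ₅, mul_assoc, 𝓜.γ_order]

lemma Model.γ₅_sq : 𝓜.γ₅ * 𝓜.γ₅ = 1 := by simp [Model.γ₅, mul_assoc, 𝓜.γ_order, smul_smul]

/-- Matrices which commute with the spin group. -/
lemma Model.invariant_spin_scalar {Y : 𝕄}
    (h : ∀ α β, α ≠ β → Y * (𝓜.γ α * 𝓜.γ β) = 𝓜.γ α * 𝓜.γ β * Y) :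
    ∃ a b : ℂ, Y = a • (1 : 𝕄) + b • 𝓜.γ₅ := by
  obtain ⟨a, b, c, d, rfl⟩ := 𝓜.commutant_rotation (h 1 2 (by decide)) (h 2 3 (by decide))
  refine ⟨a, d, ?_⟩
  have h01 := h 0 1 (by decide)
  have c5 := 𝓜.γ₅_comm_pair (α := 0) (β := 1) (by decide)
  set N := b • (1 : 𝕄) + c • 𝓜.γ₅ with hN
  have hNc : N * (𝓜.γ 0 * 𝓜.γ 1) = 𝓜.γ 0 * 𝓜.γ 1 * N := by
    simp only [hN, add_mul, mul_add, smul_mul_assoc, mul_smul_comm, c5, one_mul, mul_one]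
  have key : 𝓜.γ 0 * (𝓜.γ 0 * 𝓜.γ 1) * N = 𝓜.γ 0 * 𝓜.γ 1 * 𝓜.γ 0 * N := by
    have e : (𝓜.γ 0 * N) * (𝓜.γ 0 * 𝓜.γ 1) = 𝓜.γ 0 * 𝓜.γ 1 * (𝓜.γ 0 * N) := by
      have e2 : (a • (1 : 𝕄) + d • 𝓜.γ₅) * (𝓜.γ 0 * 𝓜.γ 1) =
          𝓜.γ 0 * 𝓜.γ 1 * (a • (1 : 𝕄) + d • 𝓜.γ₅) := by
        simp only [add_mul, mul_add, smul_mul_assoc, mul_smul_comm, c5, one_mul, mul_one]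
      rw [add_mul, e2, mul_add (𝓜.γ 0 * 𝓜.γ 1) _ (𝓜.γ 0 * N)] at h01
      exact add_left_cancel h01
    rw [mul_assoc, ← hNc, ← mul_assoc, e, ← mul_assoc]
  have : 𝓜.γ 1 * N = 0 := by
    simp only [mul_assoc, 𝓜.γ_order, mul_neg, neg_mul] at key
    have h2 := add_eq_zero_iff_eq_neg.2 key
    rw [← two_smul ℂ] at h2
    exact (smul_eq_zero.1 h2).resolve_left two_ne_zero
  have : N = 0 := by
    have := congrArg (𝓜.γ 1 * ·) this
    simpa [𝓜.γ_order] using this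
  rw [this, mul_zero, add_zero]

/-- Families of matrices which transform as a vector under the spin group. -/
lemma Model.invariant_spin_vector {Γ : Fin 4 → 𝕄}
    (h : ∀ α β, α ≠ β → ∀ μ, Γ μ * (𝓜.γ α * 𝓜.γ β) - 𝓜.γ α * 𝓜.γ β * Γ μ + (2 * η μ) •
      ((if μ = β then Γ α else 0) - (if μ = α then Γ β else 0)) = 0) :
    ∃ a b : ℂ, ∀ μ, Γ μ = 𝓜.γ μ * (a • (1 : 𝕄) + b • 𝓜.γ₅) := by
  have rot : ∀ α β, α ≠ β → 0 ≠ α → 0 ≠ β → Γ 0 * (𝓜.γ α * 𝓜.γ β) = 𝓜.γ α * 𝓜.γ β * Γ 0 := by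
    intro α β hαβ hα hβ
    have := h α β hαβ 0
    rw [if_neg hβ, if_neg hα, sub_zero, smul_zero, add_zero] at this
    exact sub_eq_zero.1 this
  obtain ⟨a, b, c, d, h0⟩ := 𝓜.commutant_rotation
    (rot 1 2 (by decide) (by decide) (by decide)) (rot 2 3 (by decide) (by decide) (by decide))
  refine ⟨b, c, ?_⟩
  have cN : ∀ (x y : ℂ) (i : Fin 4), 0 ≠ i → (x • (1 : 𝕄) + y • 𝓜.γ₅) * (𝓜.γ 0 * 𝓜.γ i) =
        𝓜.γ 0 * 𝓜.γ i * (x • (1 : 𝕄) + y • 𝓜.γ₅) := by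
    intro x y i hi
    simp only [add_mul, mul_add, smul_mul_assoc, mul_smul_comm, 𝓜.γ₅_comm_pair hi, one_mul, mul_one]
  set X := b • (1 : 𝕄) + c • 𝓜.γ₅ with hX
  have space : ∀ i, 0 ≠ i → Γ i = 𝓜.γ i * X := by
    intro i hi
    have := h 0 i hi 0
    rw [if_neg hi, if_pos rfl, zero_sub, h0, add_mul, mul_add (𝓜.γ 0 * 𝓜.γ i) _ (𝓜.γ 0 * X),
      cN a d i hi, mul_assoc (𝓜.γ 0) X,
      cN b c i hi, ← mul_assoc (𝓜.γ 0) (𝓜.γ 0 * 𝓜.γ i), ← mul_assoc (𝓜.γ 0 * 𝓜.γ i) (𝓜.γ 0),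
      𝓜.γ_left_pair, 𝓜.γ_pair_left hi] at this
    have e0 : η 0 = 1 := by simp [η]
    simp only [e0, neg_mul, one_smul] at this
    refine smul_right_injective _ (two_ne_zero' ℂ) (sub_eq_zero.1 ?_).symm
    rw [← this]
    simp only [smul_neg]
    module
  intro μ
  by_cases hμ : 0 = μ
  · subst hμ
    have := h 0 1 (by decide) 1
    rw [if_pos rfl, if_neg (by decide), sub_zero, space 1 (by decide), mul_assoc,
      cN b c 1 (by decide), ← mul_assoc, ← mul_assoc (𝓜.γ 0 * 𝓜.γ 1),
      𝓜.γ_right_pair (by decide), 𝓜.γ_pair_right] at this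
    have e1 : η 1 = -1 := by simp [η]
    rw [e1] at this
    refine smul_right_injective _ (two_ne_zero' ℂ) (sub_eq_zero.1 ?_).symm
    rw [← this]
    simp only [neg_mul, smul_mul_assoc]
    module
  · exact space μ hμ

end Clifford

section

/-! ### Trilinearity in the states -/

section

variable {p q r : Bool} {A : Jet I₁ I₂ I₃ I₄} (hA : A ∈ trilin I₁ I₂ I₃ I₄)
include hA

lemma tri_add_left (a b : ℂ) (f f' g h : 𝒬) :
    tri p q r (fun x => a * f x + b * f' x) g h A = a * tri p q r f g h A + b * tri p q r f' g h A := by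
  induction hA using Submodule.span_induction with
  | mem A hA =>
    obtain ⟨x, y, z, rfl⟩ := hA
    have hx := jet_mem_lin x.field x.J
    have hy := jet_mem_lin y.field y.J
    have hz := jet_mem_lin z.field z.J
    have key : ∀ (P : Prop) [Decidable P] (u v : ℂ), (if P then a * u + b * v else 0) =
        a * (if P then u else 0) + b * (if P then v else 0) := fun P _ u v => by split_ifs <;> simp
    simp only [tri_mul _ _ _ hx hy hz, ev_filt _ hx, ev_filt _ hy, ev_filt _ hz, ev_jet, key]
    ring
  | zero => simp
  | add X Y _ _ h1 h2 => simp only [map_add, h1, h2]; ring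
  | smul c X _ h => simp only [map_smul, h, smul_eq_mul]; ring

lemma tri_swap_left (f g h : 𝒬) : tri q p r g f h A = sgn p q * tri p q r f g h A := by
  induction hA using Submodule.span_induction with
  | mem A hA =>
    obtain ⟨x, y, z, rfl⟩ := hA
    have hx := jet_mem_lin x.field x.J
    have hy := jet_mem_lin y.field y.J
    have hz := jet_mem_lin z.field z.J
    simp only [tri_mul _ _ _ hx hy hz]
    cases p <;> cases q <;> cases r <;> simp [sgn] <;> ring
  | zero => simp
  | add X Y _ _ h1 h2 => simp only [map_add, h1, h2]; ring
  | smul c X _ h => simp only [map_smul, h, smul_eq_mul]; ring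

lemma tri_swap_right (f g h : 𝒬) : tri p r q f h g A = sgn q r * tri p q r f g h A := by
  induction hA using Submodule.span_induction with
  | mem A hA =>
    obtain ⟨x, y, z, rfl⟩ := hA
    have hx := jet_mem_lin x.field x.J
    have hy := jet_mem_lin y.field y.J
    have hz := jet_mem_lin z.field z.J
    simp only [tri_mul _ _ _ hx hy hz]
    cases p <;> cases q <;> cases r <;> simp [sgn] <;> ring
  | zero => simp
  | add X Y _ _ h1 h2 => simp only [map_add, h1, h2]; ring
  | smul c X _ h => simp only [map_smul, h, smul_eq_mul]; ring

lemma tri_add_mid (a b : ℂ) (f g g' h : 𝒬) :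
    tri p q r f (fun x => a * g x + b * g' x) h A = a * tri p q r f g h A + b * tri p q r f g' h A := by
  simp only [tri_swap_left hA _ f, tri_add_left hA]
  ring

lemma tri_add_right (a b : ℂ) (f g h h' : 𝒬) :
    tri p q r f g (fun x => a * h x + b * h' x) A = a * tri p q r f g h A + b * tri p q r f g h' A := by
  simp only [tri_swap_right hA _ _ g, tri_add_mid hA]
  ring

lemma tri_zero_left (g h : 𝒬) : tri p q r (fun _ => 0) g h A = 0 := by
  simpa using tri_add_left hA 0 0 (fun _ => 0) (fun _ => 0) g h

lemma tri_zero_mid (g h : 𝒬) : tri p q r g (fun _ => 0) h A = 0 := by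
  simpa using tri_add_mid hA 0 0 g (fun _ => 0) (fun _ => 0) h

lemma tri_zero_right (g h : 𝒬) : tri p q r g h (fun _ => 0) A = 0 := by
  simpa using tri_add_right hA 0 0 g h (fun _ => 0) (fun _ => 0)

lemma tri_sum_left {ι : Type*} (s : Finset ι) (k : ι → ℂ) (f : ι → 𝒬)
    (g h : 𝒬) : tri p q r (fun x => ∑ i ∈ s, k i * f i x) g h A =
      ∑ i ∈ s, k i * tri p q r (f i) g h A := by
  classical
  induction s using Finset.induction_on with
  | empty => simpa using tri_zero_left hA g h
  | insert i s hi ih =>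
    simp only [Finset.sum_insert hi]
    have := tri_add_left (p := p) (q := q) (r := r) hA (k i) 1 (f i) (fun x => ∑ i ∈ s, k i * f i x) g h
    simp only [one_mul] at this
    rw [this, ih]

lemma tri_sum_mid {ι : Type*} (s : Finset ι) (k : ι → ℂ) (f g : 𝒬)
    (gi : ι → 𝒬) : tri p q r f (fun x => ∑ i ∈ s, k i * gi i x) g A =
      ∑ i ∈ s, k i * tri p q r f (gi i) g A := by
  simp only [tri_swap_left hA _ f, tri_sum_left hA, mul_sum]
  exact sum_congr rfl fun i _ => by ring

end

/-! ### Expansion in monomials -/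

/-- The kind of a field: vector, ghost, antighost, scalar, spinor, conjugate spinor. -/
def Field.kind : ℱ → Fin 6
  | .v _ _ => 0
  | .u _ => 1
  | .ut _ => 2
  | .Phi _ => 3
  | .phi _ => 3
  | .psi _ _ => 4
  | .psibar _ _ => 5

/-- The kind of the field, together with `true` if it is underived. -/
def JetVar.cls (x : 𝒳) : Fin 6 × Bool := (x.field.kind, decide (x.J = 0))

def kindOdd : Fin 6 → Bool := ![false, true, true, false, true, true]

lemma Field.odd_eq (f : ℱ) : f.odd = kindOdd f.kind := by cases f <;> rfl

/-- A family `e` of jet variables of class `cls`, with the dual family of states `δ`. -/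
structure Family (I₁ I₂ I₃ I₄ : Type*) (ι : Type*) [Fintype ι] where
  cls : Fin 6 × Bool
  e : ι → Jet I₁ I₂ I₃ I₄
  δ : ι → State I₁ I₂ I₃ I₄
  sum : ∀ x : JetVar I₁ I₂ I₃ I₄, x.Low → ∑ i, δ i x • e i = if x.cls = cls then jet x.field x.J else 0

variable {ι κ l : Type*} [Fintype ι] [Fintype κ] [Fintype l]

/-- The part of `A` which belongs to three given families. -/
def sector (F : Family I₁ I₂ I₃ I₄ ι) (G : Family I₁ I₂ I₃ I₄ κ) (H : Family I₁ I₂ I₃ I₄ l)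
    (A : 𝒥) : 𝒥 :=
  ∑ i, ∑ j, ∑ k, tri (kindOdd F.cls.1) (kindOdd G.cls.1) (kindOdd H.cls.1)
    (F.δ i) (G.δ j) (H.δ k) A • (F.e i * G.e j * H.e k)

/-- The number of ways to match three classes with three classes. -/
def matchings (x y z c c' c'' : Fin 6 × Bool) : ℕ :=
  (if x = c ∧ y = c' ∧ z = c'' then 1 else 0) + (if x = c ∧ z = c' ∧ y = c'' then 1 else 0)
  + (if y = c ∧ x = c' ∧ z = c'' then 1 else 0) + (if z = c ∧ x = c' ∧ y = c'' then 1 else 0)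
  + (if y = c ∧ z = c' ∧ x = c'' then 1 else 0) + (if z = c ∧ y = c' ∧ x = c'' then 1 else 0)

lemma sum_mul_mul {ι κ l : Type*} [Fintype ι] [Fintype κ] [Fintype l]
    (a : ι → ℂ) (b : κ → ℂ) (c : l → ℂ) (e : ι → 𝒥) (e' : κ → 𝒥)
    (e'' : l → 𝒥) (s : ℂ) {w : ι → κ → l → ℂ}
    (hw : ∀ i j k, w i j k = s * (a i * b j * c k)) :
    ∑ i, ∑ j, ∑ k, w i j k • (e i * e' j * e'' k) =
      s • ((∑ i, a i • e i) * (∑ j, b j • e' j) * (∑ k, c k • e'' k)) := by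
  rw [sum_mul_sum, sum_mul, smul_sum]
  refine sum_ext fun i => ?_
  rw [sum_mul, smul_sum]
  refine sum_ext fun j => ?_
  rw [mul_sum, smul_sum]
  refine sum_ext fun k => ?_
  rw [smul_mul_smul_comm, smul_mul_smul_comm, smul_smul, hw]

lemma Family.filt (F : Family I₁ I₂ I₃ I₄ ι) {x : 𝒳} (hx : x.Low) :
    ∑ i, ev (StandardModel.filt (kindOdd F.cls.1) (F.δ i)) (jet x.field x.J) • F.e i =
      if x.cls = F.cls then jet x.field x.J else 0 := by
  simp only [ev_filt _ (jet_mem_lin x.field x.J), ev_jet]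
  by_cases hc : x.cls = F.cls
  · have : x.field.odd = kindOdd F.cls.1 := by rw [Field.odd_eq, ← hc]; rfl
    simp only [if_pos this]
    exact F.sum x hx
  · rw [if_neg hc]
    by_cases ho : x.field.odd = kindOdd F.cls.1
    · simp only [if_pos ho]
      exact (F.sum x hx).trans (if_neg hc)
    · simp [if_neg ho]

lemma Field.odd_of_cls {x : 𝒳} {c : Fin 6 × Bool} (h : x.cls = c) :
    kindOdd c.1 = x.field.odd := by rw [Field.odd_eq, ← h]; rfl

lemma perm_mul {X Y Z : 𝒥} {p q r : Bool} (XY : X * Y = sgn p q • (Y * X))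
    (XZ : X * Z = sgn p r • (Z * X)) (YZ : Y * Z = sgn q r • (Z * Y)) :
    sgn r q • (X * Z * Y) = X * Y * Z ∧ sgn q p • (Y * X * Z) = X * Y * Z ∧
    (sgn r p * sgn r q) • (Z * X * Y) = X * Y * Z ∧ (sgn q p * sgn r p) • (Y * Z * X) = X * Y * Z ∧
    (sgn r q * sgn r p * sgn q p) • (Z * Y * X) = X * Y * Z := by
  have XY' : ∀ W, X * (Y * W) = sgn p q • (Y * (X * W)) := fun W => by
    rw [← mul_assoc, XY, smul_mul_assoc, mul_assoc]
  have XZ' : ∀ W, X * (Z * W) = sgn p r • (Z * (X * W)) := fun W => by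
    rw [← mul_assoc, XZ, smul_mul_assoc, mul_assoc]
  have YZ' : ∀ W, Y * (Z * W) = sgn q r • (Z * (Y * W)) := fun W => by
    rw [← mul_assoc, YZ, smul_mul_assoc, mul_assoc]
  simp only [mul_assoc, XY, XZ, YZ, YZ', mul_smul_comm, smul_mul_assoc, smul_smul]
  refine ⟨?_, ?_, ?_, ?_, ?_⟩ <;> congr 1 <;> cases p <;> cases q <;> cases r <;> norm_num [sgn]

lemma sector_mul (F : Family I₁ I₂ I₃ I₄ ι) (G : Family I₁ I₂ I₃ I₄ κ) (H : Family I₁ I₂ I₃ I₄ l)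
    {x y z : 𝒳} (hx : x.Low) (hy : y.Low) (hz : z.Low) :
    sector F G H (jet x.field x.J * jet y.field y.J * jet z.field z.J) =
      (matchings x.cls y.cls z.cls F.cls G.cls H.cls : ℂ) •
        (jet x.field x.J * jet y.field y.J * jet z.field z.J) := by
  simp only [sector, tri_mul _ _ _ (jet_mem_lin x.field x.J) (jet_mem_lin y.field y.J)
    (jet_mem_lin z.field z.J), add_smul, sum_add_distrib]
  let E1 (w : 𝒳) i := ev (filt (kindOdd F.cls.1) (F.δ i)) (jet w.field w.J)
  let E2 (w : 𝒳) i := ev (filt (kindOdd G.cls.1) (G.δ i)) (jet w.field w.J)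
  let E3 (w : 𝒳) i := ev (filt (kindOdd H.cls.1) (H.δ i)) (jet w.field w.J)
  let X := jet x.field x.J
  let Y := jet y.field y.J
  let Z := jet z.field z.J
  have XY : X * Y = sgn x.field.odd y.field.odd • (Y * X) := jet_mul_jet _ _ _ _
  have XZ : X * Z = sgn x.field.odd z.field.odd • (Z * X) := jet_mul_jet _ _ _ _
  have YZ : Y * Z = sgn y.field.odd z.field.odd • (Z * Y) := jet_mul_jet _ _ _ _
  obtain ⟨p2, p3, p4, p5, p6⟩ := perm_mul XY XZ YZ
  have pick : ∀ (u v w : 𝒳), u.Low → v.Low → w.Low → ∀ s : ℂ,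
      (u.cls = F.cls → v.cls = G.cls → w.cls = H.cls →
        s • (jet u.field u.J * jet v.field v.J * jet w.field w.J) = X * Y * Z) →
      ∀ {f : ι → κ → l → ℂ}, (∀ i j k, f i j k = s * (E1 u i * E2 v j * E3 w k)) →
      ∑ i, ∑ j, ∑ k, f i j k • (F.e i * G.e j * H.e k) =
        ((if u.cls = F.cls ∧ v.cls = G.cls ∧ w.cls = H.cls then 1 else 0 : ℕ) : ℂ) • (X * Y * Z) := by
    intro u v w hu hv hw s hs f hf
    rw [sum_mul_mul (E1 u) (E2 v) (E3 w) F.e G.e H.e s hf, F.filt hu, G.filt hv, H.filt hw]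
    by_cases a : u.cls = F.cls
    · by_cases b : v.cls = G.cls
      · by_cases d : w.cls = H.cls
        · simp [a, b, d, hs a b d]
        · simp [d]
      · simp [b]
    · simp [a]
  unfold matchings
  push_cast only [Nat.cast_add]
  simp only [add_smul]
  refine congrArg₂ _ (congrArg₂ _ (congrArg₂ _ (congrArg₂ _ (congrArg₂ _ ?_ ?_) ?_) ?_) ?_) ?_
  · exact pick x y z hx hy hz 1 (fun _ _ _ => one_smul _ _) (fun i j k => by ring)
  · refine pick x z y hx hz hy (sgn (kindOdd G.cls.1) (kindOdd H.cls.1))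
      (fun a b d => ?_) (fun i j k => by ring)
    simp only [Field.odd_of_cls b, Field.odd_of_cls d]
    exact p2
  · refine pick y x z hy hx hz (sgn (kindOdd F.cls.1) (kindOdd G.cls.1))
      (fun a b d => ?_) (fun i j k => by ring)
    simp only [Field.odd_of_cls a, Field.odd_of_cls b]
    exact p3
  · refine pick z x y hz hx hy (sgn (kindOdd F.cls.1) (kindOdd G.cls.1) * sgn (kindOdd F.cls.1) (kindOdd H.cls.1))
      (fun a b d => ?_) (fun i j k => by ring)
    simp only [Field.odd_of_cls a, Field.odd_of_cls b, Field.odd_of_cls d]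
    exact p4
  · refine pick y z x hy hz hx (sgn (kindOdd F.cls.1) (kindOdd H.cls.1) * sgn (kindOdd G.cls.1) (kindOdd H.cls.1))
      (fun a b d => ?_) (fun i j k => by ring)
    simp only [Field.odd_of_cls a, Field.odd_of_cls b, Field.odd_of_cls d]
    exact p5
  · refine pick z y x hz hy hx (sgn (kindOdd F.cls.1) (kindOdd G.cls.1) * sgn (kindOdd F.cls.1) (kindOdd H.cls.1) * sgn (kindOdd G.cls.1) (kindOdd H.cls.1))
      (fun a b d => ?_) (fun i j k => by ring)
    simp only [Field.odd_of_cls a, Field.odd_of_cls b, Field.odd_of_cls d]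
    exact p6

def kindDim : Fin 6 → ℕ := ![2, 2, 2, 2, 3, 3]

def kindGh : Fin 6 → ℤ := ![0, 1, -1, 0, 0, 0]

def kindFermion : Fin 6 → ℤ := ![0, 0, 0, 0, 1, -1]

lemma matchings_count : ∀ x y z : Fin 6 × Bool,
    kindDim x.1 + kindDim y.1 + kindDim z.1 + 2 * ((!x.2).toNat + (!y.2).toNat + (!z.2).toNat) ≤ 8 →
    kindGh x.1 + kindGh y.1 + kindGh z.1 = 0 → kindFermion x.1 + kindFermion y.1 + kindFermion z.1 = 0 →
    matchings x y z (0, true) (0, true) (0, true)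
    + 3 * matchings x y z (0, true) (0, true) (3, true)
    + 3 * matchings x y z (0, true) (3, true) (3, true)
    + matchings x y z (3, true) (3, true) (3, true)
    + 3 * matchings x y z (0, false) (0, true) (0, true)
    + 3 * matchings x y z (0, true) (0, true) (3, false)
    + 6 * matchings x y z (0, false) (0, true) (3, true)
    + 6 * matchings x y z (0, true) (3, false) (3, true)
    + 3 * matchings x y z (3, false) (3, true) (3, true)
    + 3 * matchings x y z (0, false) (3, true) (3, true)
    + 6 * matchings x y z (0, true) (1, true) (2, true)
    + 6 * matchings x y z (1, true) (2, true) (3, true)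
    + 6 * matchings x y z (1, false) (0, true) (2, true)
    + 6 * matchings x y z (2, false) (0, true) (1, true)
    + 6 * matchings x y z (0, false) (1, true) (2, true)
    + 6 * matchings x y z (1, false) (2, true) (3, true)
    + 6 * matchings x y z (2, false) (1, true) (3, true)
    + 6 * matchings x y z (3, false) (1, true) (2, true)
    + 6 * matchings x y z (5, true) (4, true) (0, true)
    + 6 * matchings x y z (5, true) (4, true) (3, true) = 6 := by decide +kernel

end

/-! ### Product states -/

/-- The state which is the product of a function of the field and a function of the multi-index. -/
def pure (φ : ℱ → ℂ) (χ : (Fin 4 →₀ ℕ) → ℂ) : 𝒬 := fun x => φ x.field * χ x.J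

/-- The action of a Lorentz transformation on the functions of multi-indices of order at most one. -/
def derAct (Λ : Matrix (Fin 4) (Fin 4) ℝ) (χ : (Fin 4 →₀ ℕ) → ℂ) (J : 𝔻) : ℂ :=
  if J = 0 then χ 0 else ∑ μ, (J μ : ℂ) * ∑ ν, ((Λ⁻¹ ν μ : ℝ) : ℂ) * χ (Finsupp.single ν 1)

def fieldAct (Λ : Matrix (Fin 4) (Fin 4) ℝ) (S : 𝕄) (φ : ℱ → ℂ) : ℱ → ℂ
  | .v a μ => ∑ ν, (Λ μ ν : ℂ) * φ (.v a ν)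
  | .u a => φ (.u a)
  | .ut a => φ (.ut a)
  | .Phi b => φ (.Phi b)
  | .phi j => φ (.phi j)
  | .psi A α => ∑ β, S α β * φ (.psi A β)
  | .psibar A α => ∑ β, S⁻¹ β α * φ (.psibar A β)

lemma derAct_single (Λ : Matrix (Fin 4) (Fin 4) ℝ) (χ : (Fin 4 →₀ ℕ) → ℂ) (ρ : Fin 4) :
    derAct Λ χ (Finsupp.single ρ 1) = ∑ ν, ((Λ⁻¹ ν ρ : ℝ) : ℂ) * χ (Finsupp.single ν 1) := by
  rw [derAct, if_neg (by simp), sum_eq_single ρ (fun b _ hb => by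
    rw [Finsupp.single_eq_of_ne hb]; simp) (by simp), Finsupp.single_eq_same, Nat.cast_one,
    one_mul]

lemma ev_pure_lorentzVar (Λ : Matrix (Fin 4) (Fin 4) ℝ) (S : 𝕄)
    (φ : ℱ → ℂ) (χ : (Fin 4 →₀ ℕ) → ℂ) {x : 𝒳} (hx : x.Low) :
    ev (pure φ χ) (lorentzVar Λ S x) = fieldAct Λ S φ x.field * derAct Λ χ x.J := by
  obtain ⟨f, J⟩ := x
  have key : ∀ f : ℱ, ev (pure φ χ) (lorentzJet Λ f J) = φ f * derAct Λ χ J := fun f => by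
    rcases hx with h | ⟨ρ, h⟩ <;> simp only at h <;> rw [h]
    · rw [lorentzJet_zero, ev_jet]; simp [pure, derAct]
    · rw [lorentzJet_single, map_sum, derAct_single, mul_sum]
      simp only [map_smul, ev_jet, pure, smul_eq_mul]
      exact sum_ext fun ν => by ring
  cases f <;> simp only [lorentzVar, fieldAct, map_sum, map_smul, key, smul_eq_mul, sum_mul,
    mul_assoc]

lemma fieldAct_one (φ : ℱ → ℂ) (f : ℱ) : fieldAct 1 1 φ f = φ f := by
  cases f <;> simp [fieldAct, Matrix.one_apply, apply_ite, ite_mul]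

lemma derAct_one (χ : (Fin 4 →₀ ℕ) → ℂ) {x : 𝒳} (hx : x.Low) : derAct 1 χ x.J = χ x.J := by
  rcases hx with h | ⟨ρ, h⟩ <;> rw [h]
  · simp [derAct]
  · rw [derAct_single]
    simp [Matrix.one_apply, apply_ite, ite_mul]

/-- Infinitesimal Lorentz transformations of functions of the field and of the multi-index. -/
def Model.FieldRot (𝓜 : ℳ) (α β : Fin 4) (φ φ' : ℱ → ℂ) : Prop :=
  ∀ f, HasDerivAt (fun t : ℝ => fieldAct (planeLorentz α β t) (𝓜.planeSpin α β t) φ f) (φ' f) 0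

def DerRot (α β : Fin 4) (χ χ' : (Fin 4 →₀ ℕ) → ℂ) : Prop :=
  ∀ J, J = 0 ∨ (∃ ρ, J = Finsupp.single ρ 1) →
    HasDerivAt (fun t : ℝ => derAct (planeLorentz α β t) χ J) (χ' J) 0

lemma Model.FieldRot.pure {𝓜 : ℳ} {α β : Fin 4} (hαβ : α ≠ β)
    {φ φ' : ℱ → ℂ} {χ χ' : (Fin 4 →₀ ℕ) → ℂ} (h : 𝓜.FieldRot α β φ φ')
    (h' : DerRot α β χ χ') : 𝓜.Rotates α β (pure φ χ)
      (fun x => φ' x.field * χ x.J + φ x.field * χ' x.J) := fun x hx => by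
  simp only [ev_pure_lorentzVar _ _ _ _ hx]
  refine ((h x.field).mul (h' x.J hx)).congr_deriv ?_
  rw [planeLorentz_zero hαβ, Model.planeSpin_zero, fieldAct_one, derAct_one χ hx]

lemma slot_mul (α β : Fin 4) (F : 𝕍) (k : ℂ) (μ : Fin 4) :
    slot α β (fun κ => F κ * k) μ = slot α β F μ * k := by simp only [slot]; split_ifs <;> ring

lemma slot_mul' (α β : Fin 4) (F : 𝕍) (k : ℂ) (μ : Fin 4) :
    slot α β (fun κ => k * F κ) μ = k * slot α β F μ := by simp only [slot]; split_ifs <;> ring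

lemma hasDerivAt_planeLorentz {α β : Fin 4} (h : α ≠ β) (ν μ : Fin 4) :
    HasDerivAt (fun t : ℝ => ((planeLorentz α β t ν μ : ℝ) : ℂ))
      (2 * slot α β (fun κ => if ν = κ then 1 else 0) μ) 0 := by
  have hd : HasDerivAt (fun t : ℝ => ηr α * ηr β * t ^ 2) 0 0 := by
    simpa using ((hasDerivAt_pow 2 (0 : ℝ)).const_mul (ηr α * ηr β))
  have hden : HasDerivAt (fun t : ℝ => 1 + ηr α * ηr β * t ^ 2) 0 0 := hd.const_add 1
  have e0 : 1 + ηr α * ηr β * (0 : ℝ) ^ 2 ≠ 0 := by norm_num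
  by_cases h1 : ν = α ∧ μ = α ∨ ν = β ∧ μ = β
  · have : HasDerivAt (fun t : ℝ => planeLorentz α β t ν μ) 0 0 := by
      simp only [planeLorentz, if_pos h1]
      exact ((hd.const_sub 1).div hden e0).congr_deriv (by simp)
    convert this.ofReal_comp using 1
    rcases h1 with ⟨rfl, rfl⟩ | ⟨rfl, rfl⟩ <;> simp [slot, h, h.symm]
  by_cases h2 : ν = α ∧ μ = β
  · obtain ⟨rfl, rfl⟩ := h2
    have : HasDerivAt (fun t : ℝ => planeLorentz ν μ t ν μ) (2 * ηr μ) 0 := by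
      have e : ∀ t : ℝ, planeLorentz ν μ t ν μ = 2 * t * ηr μ / (1 + ηr ν * ηr μ * t ^ 2) :=
        fun t => by simp [planeLorentz, h, h.symm]
      simp only [e]
      have hn : HasDerivAt (fun t : ℝ => 2 * t * ηr μ) (2 * ηr μ) 0 := by
        simpa using ((hasDerivAt_id (0 : ℝ)).const_mul 2).mul_const (ηr μ)
      exact (hn.div hden e0).congr_deriv (by simp)
    convert this.ofReal_comp using 1
    simp [slot, h.symm, ηr_cast]
  by_cases h3 : ν = β ∧ μ = α
  · obtain ⟨rfl, rfl⟩ := h3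
    have : HasDerivAt (fun t : ℝ => planeLorentz μ ν t ν μ) (-(2 * ηr μ)) 0 := by
      have e : ∀ t : ℝ, planeLorentz μ ν t ν μ = -(2 * t * ηr μ / (1 + ηr μ * ηr ν * t ^ 2)) :=
        fun t => by simp [planeLorentz, h, h.symm]
      simp only [e]
      have hn : HasDerivAt (fun t : ℝ => 2 * t * ηr μ) (2 * ηr μ) 0 := by
        simpa using ((hasDerivAt_id (0 : ℝ)).const_mul 2).mul_const (ηr μ)
      exact (hn.div hden e0).neg.congr_deriv (by simp)
    convert this.ofReal_comp using 1
    simp [slot, h, ηr_cast]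
  · have : HasDerivAt (fun t : ℝ => planeLorentz α β t ν μ) 0 0 := by
      simp only [planeLorentz, if_neg h1, if_neg h2, if_neg h3]
      exact hasDerivAt_const _ _
    convert this.ofReal_comp using 1
    clear this hd hden e0
    simp only [slot]
    split_ifs <;> first | (simp; done) | (exfalso; simp_all)

lemma eventually_sq_lt_one : ∀ᶠ t : ℝ in nhds 0, t ^ 2 < 1 :=
  (continuous_pow 2).continuousAt.eventually_lt continuousAt_const (by norm_num)

/-- The function of the multi-index which detects underived fields. -/
def der0 (J : 𝔻) : ℂ := if J = 0 then 1 else 0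

/-- The function of the multi-index which detects the derivative `d_ρ`, with lowered index. -/
def der1 (ρ : Fin 4) (J : 𝔻) : ℂ := if J = Finsupp.single ρ 1 then η ρ else 0

lemma derRot_der0 (α β : Fin 4) : DerRot α β der0 (fun _ => 0) := by
  rintro J (rfl | ⟨ρ, rfl⟩)
  · simpa [derAct, der0] using hasDerivAt_const (0 : ℝ) (1 : ℂ)
  · simpa [derAct, der0] using hasDerivAt_const (0 : ℝ) (0 : ℂ)

lemma derRot_der1 {α β : Fin 4} (h : α ≠ β) (ρ : Fin 4) :
    DerRot α β (der1 ρ) (fun J => 2 * slot α β (fun κ => der1 κ J) ρ) := by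
  rintro J (rfl | ⟨μ, rfl⟩)
  · have : ∀ κ, (0 : 𝔻) ≠ Finsupp.single κ 1 := fun κ h => by simpa using h.symm
    simpa [derAct, der1, this, slot] using hasDerivAt_const (0 : ℝ) (0 : ℂ)
  · have inj : ∀ a b : Fin 4, Finsupp.single a 1 = (Finsupp.single b 1 : 𝔻) ↔ a = b :=
      fun a b => ⟨fun h => (Finsupp.single_left_injective one_ne_zero) h, fun h => by rw [h]⟩
    have e : ∀ t : ℝ, t ^ 2 < 1 → derAct (planeLorentz α β t) (der1 ρ) (Finsupp.single μ 1) =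
        ((planeLorentz α β t μ ρ : ℝ) : ℂ) * η μ := fun t ht => by
      rw [derAct_single, sum_eq_single ρ (fun b _ hb => by
        simp [der1, inj, hb]) (by simp), lorentz_inv_apply]
      · simp only [der1, if_true]
        push_cast [ηr_cast]
        linear_combination ((planeLorentz α β t μ ρ : ℝ) : ℂ) * η μ * η_mul_self ρ
      · rw [diagonal_eq_ηr]; exact planeLorentz_lorentz h ht
    refine (((hasDerivAt_planeLorentz h μ ρ).mul_const (η μ)).congr_of_eventuallyEq
      (eventually_sq_lt_one.mono e)).congr_deriv ?_
    have : (fun κ => der1 κ (Finsupp.single μ 1)) = fun κ => (if μ = κ then 1 else 0) * η μ := by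
      funext κ
      simp only [der1, inj]
      split_ifs with h <;> simp [h]
    change _ = 2 * slot α β (fun κ => der1 κ (Finsupp.single μ 1)) ρ
    rw [this, slot_mul]
    ring

open Classical in
/-- The indicator function of a field. -/
def ind (g : ℱ) (f : ℱ) : ℂ := if f = g then 1 else 0

lemma Model.fieldRot_v (𝓜 : ℳ) {α β : Fin 4} (h : α ≠ β) (a : 𝒱)
    (μ : Fin 4) : 𝓜.FieldRot α β (ind (.v a μ)) (fun f => 2 * slot α β (fun κ => ind (.v a κ) f) μ) := fun f => by
  cases f with
  | v b ν =>
    by_cases hb : b = a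
    · subst hb
      have e : ∀ t : ℝ, fieldAct (planeLorentz α β t) (𝓜.planeSpin α β t) (ind (.v b μ))
          (.v b ν : ℱ) =
          ((planeLorentz α β t ν μ : ℝ) : ℂ) := fun t => by simp [fieldAct, ind]
      simp only [e]
      refine (hasDerivAt_planeLorentz h ν μ).congr_deriv ?_
      simp [ind]
    · simpa [fieldAct, ind, hb, slot] using hasDerivAt_const (0 : ℝ) (0 : ℂ)
  | _ => simpa [fieldAct, ind, slot] using hasDerivAt_const (0 : ℝ) (0 : ℂ)

/-- The fields which are Lorentz scalars. -/
def Field.IsSc : ℱ → Prop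
  | .u _ => True
  | .ut _ => True
  | .Phi _ => True
  | .phi _ => True
  | _ => False

lemma Model.fieldRot_scalar (𝓜 : ℳ) (α β : Fin 4) {g : ℱ}
    (hg : g.IsSc) : 𝓜.FieldRot α β (ind g) (fun _ => 0) := fun f => by
  cases f with
  | v b ν => cases g <;> simp [Field.IsSc] at hg <;>
    simpa [fieldAct, ind] using hasDerivAt_const (0 : ℝ) (0 : ℂ)
  | psi b ν => cases g <;> simp [Field.IsSc] at hg <;>
    simpa [fieldAct, ind] using hasDerivAt_const (0 : ℝ) (0 : ℂ)
  | psibar b ν => cases g <;> simp [Field.IsSc] at hg <;>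
    simpa [fieldAct, ind] using hasDerivAt_const (0 : ℝ) (0 : ℂ)
  | _ => exact hasDerivAt_const _ _

lemma Model.fieldRot_psi (𝓜 : ℳ) (α β : Fin 4) (A : I₄)
    (μ : Fin 4) : 𝓜.FieldRot α β (ind (.psi A μ))
      (fun f => ∑ κ, (𝓜.γ α * 𝓜.γ β) κ μ * ind (.psi A κ) f) := fun f => by
  cases f with
  | psi B ν =>
    by_cases hb : B = A
    · subst hb
      have e : ∀ t : ℝ, fieldAct (planeLorentz α β t) (𝓜.planeSpin α β t) (ind (.psi B μ))
          (.psi B ν : ℱ) = (1 : 𝕄) ν μ + (t : ℂ) * (𝓜.γ α * 𝓜.γ β) ν μ := fun t => by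
        simp [fieldAct, ind, Model.planeSpin]
      simp only [e]
      refine (((Complex.ofRealCLM.hasDerivAt (x := (0 : ℝ))).mul_const _).const_add _).congr_deriv ?_
      simp [ind]
    · simpa [fieldAct, ind, hb] using hasDerivAt_const (0 : ℝ) (0 : ℂ)
  | _ => simpa [fieldAct, ind] using hasDerivAt_const (0 : ℝ) (0 : ℂ)

lemma Model.fieldRot_psibar (𝓜 : ℳ) {α β : Fin 4} (h : α ≠ β) (A : I₄)
    (μ : Fin 4) : 𝓜.FieldRot α β (ind (.psibar A μ))
      (fun f => ∑ κ, -(𝓜.γ α * 𝓜.γ β) μ κ * ind (.psibar A κ) f) := fun f => by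
  cases f with
  | psibar B ν =>
    by_cases hb : B = A
    · subst hb
      have e : ∀ t : ℝ, t ^ 2 < 1 → fieldAct (planeLorentz α β t) (𝓜.planeSpin α β t)
          (ind (.psibar B μ)) (.psibar B ν : ℱ) = ((1 + ηr α * ηr β * t ^ 2 : ℝ) : ℂ)⁻¹ *
            ((1 : 𝕄) μ ν - (t : ℂ) * (𝓜.γ α * 𝓜.γ β) μ ν) := fun t ht => by
        simp [fieldAct, ind, 𝓜.planeSpin_inv h ht]
        simp [Model.planeSpin, sub_eq_add_neg]
      have hd : HasDerivAt (fun t : ℝ => ((1 + ηr α * ηr β * t ^ 2 : ℝ) : ℂ)⁻¹) 0 0 := by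
        have : HasDerivAt (fun t : ℝ => ((1 + ηr α * ηr β * t ^ 2 : ℝ) : ℂ)) 0 0 := by
          simpa using (((hasDerivAt_pow 2 (0 : ℝ)).const_mul (ηr α * ηr β)).const_add 1).ofReal_comp
        exact (this.inv (by simp)).congr_deriv (by simp)
      refine ((hd.mul (((Complex.ofRealCLM.hasDerivAt (x := (0 : ℝ))).mul_const _).const_sub
        _)).congr_of_eventuallyEq (eventually_sq_lt_one.mono e)).congr_deriv ?_
      simp [ind]
    · simpa [fieldAct, ind, hb] using hasDerivAt_const (0 : ℝ) (0 : ℂ)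
  | _ => simpa [fieldAct, ind] using hasDerivAt_const (0 : ℝ) (0 : ℂ)

/-! ### Families of states which transform as tensors -/

section

variable (𝓜 : Model I₁ I₂ I₃ I₄)

def Model.Inv (f : 𝒬) : Prop := ∀ α β, α ≠ β → 𝓜.Rotates α β f (fun _ => 0)

def Model.Vec (f : Fin 4 → 𝒬) : Prop :=
  ∀ α β, α ≠ β → ∀ μ, 𝓜.Rotates α β (f μ) (fun x => 2 * slot α β (fun κ => f κ x) μ)

def Model.Ten (f : Fin 4 → Fin 4 → 𝒬) : Prop :=
  ∀ α β, α ≠ β → ∀ μ ν, 𝓜.Rotates α β (f μ ν) (fun x =>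
    2 * slot α β (fun κ => f κ ν x) μ + 2 * slot α β (fun κ => f μ κ x) ν)

def Model.Spin (f : Fin 4 → 𝒬) : Prop :=
  ∀ α β, α ≠ β → ∀ μ, 𝓜.Rotates α β (f μ) (fun x => ∑ κ, (𝓜.γ α * 𝓜.γ β) κ μ * f κ x)

def Model.Cospin (f : Fin 4 → 𝒬) : Prop :=
  ∀ α β, α ≠ β → ∀ μ, 𝓜.Rotates α β (f μ) (fun x => ∑ κ, -(𝓜.γ α * 𝓜.γ β) μ κ * f κ x)

lemma Model.Rotates.congr {𝓜 : ℳ} {α β : Fin 4} {f f' f'' : 𝒬}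
    (h : 𝓜.Rotates α β f f') (e : ∀ x, f' x = f'' x) : 𝓜.Rotates α β f f'' :=
  fun x hx => (h x hx).congr_deriv (e x)

lemma Model.inv_scalar {g : ℱ} (hg : g.IsSc) : 𝓜.Inv (pure (ind g) der0) :=
  fun α β h => ((𝓜.fieldRot_scalar α β hg).pure h (derRot_der0 α β)).congr fun x => by ring

lemma Model.vec_scalar {g : ℱ} (hg : g.IsSc) : 𝓜.Vec (fun ρ => pure (ind g) (der1 ρ)) :=
  fun α β h ρ => ((𝓜.fieldRot_scalar α β hg).pure h (derRot_der1 h ρ)).congr fun x => by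
    simp only [pure, slot_mul']; ring

lemma Model.vec_v (a : 𝒱) : 𝓜.Vec (fun μ => pure (ind (.v a μ)) der0) :=
  fun α β h ρ => ((𝓜.fieldRot_v h a ρ).pure h (derRot_der0 α β)).congr fun x => by
    simp only [pure, slot_mul]; ring

lemma Model.ten_v (a : 𝒱) : 𝓜.Ten (fun ρ μ => pure (ind (.v a μ)) (der1 ρ)) :=
  fun α β h ρ μ => ((𝓜.fieldRot_v h a μ).pure h (derRot_der1 h ρ)).congr fun x => by
    simp only [pure, slot_mul, slot_mul']; ring

lemma Model.spin_psi (A : I₄) : 𝓜.Spin (fun μ => pure (ind (.psi A μ)) der0) :=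
  fun α β h μ => ((𝓜.fieldRot_psi α β A μ).pure h (derRot_der0 α β)).congr fun x => by
    simp only [pure, sum_mul, mul_assoc, mul_zero, add_zero]

lemma Model.cospin_psibar (A : I₄) : 𝓜.Cospin (fun μ => pure (ind (.psibar A μ)) der0) :=
  fun α β h μ => ((𝓜.fieldRot_psibar h A μ).pure h (derRot_der0 α β)).congr fun x => by
    simp only [pure, sum_mul, mul_assoc, mul_zero, add_zero]

end

section

variable {p q r : Bool} {A : Jet I₁ I₂ I₃ I₄} (hA : A ∈ lowTrilin I₁ I₂ I₃ I₄)
include hA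

lemma tri_slot_left (α β μ : Fin 4) (f : Fin 4 → 𝒬) (g h : 𝒬) :
    tri p q r (fun x => 2 * slot α β (fun κ => f κ x) μ) g h A =
      2 * slot α β (fun κ => tri p q r (f κ) g h A) μ := by
  have hA := lowTrilin_le_trilin hA
  have := tri_add_left (p := p) (q := q) (r := r) hA (2 * η μ * if μ = β then 1 else 0)
    (-(2 * η μ * if μ = α then 1 else 0)) (f α) (f β) g h
  refine Eq.trans (congrArg (fun f => tri p q r f g h A) (funext fun x => ?_)) (this.trans ?_) <;>
  · simp only [slot]; split_ifs <;> ring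

lemma tri_slot_mid (α β μ : Fin 4) (f : Fin 4 → 𝒬) (g h : 𝒬) :
    tri p q r g (fun x => 2 * slot α β (fun κ => f κ x) μ) h A =
      2 * slot α β (fun κ => tri p q r g (f κ) h A) μ := by
  simp only [tri_swap_left (lowTrilin_le_trilin hA) _ g, tri_slot_left hA,
    slot_mul']
  ring

lemma tri_slot_right (α β μ : Fin 4) (f : Fin 4 → 𝒬) (g h : 𝒬) :
    tri p q r g h (fun x => 2 * slot α β (fun κ => f κ x) μ) A =
      2 * slot α β (fun κ => tri p q r g h (f κ) A) μ := by
  simp only [tri_swap_right (lowTrilin_le_trilin hA) g _ h, tri_slot_mid hA,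
    slot_mul']
  ring

lemma tri_slot_ten (α β μ ν : Fin 4) (f : Fin 4 → Fin 4 → 𝒬) (g h : 𝒬) :
    tri p q r (fun x => 2 * slot α β (fun κ => f κ ν x) μ + 2 * slot α β (fun κ => f μ κ x) ν)
      g h A = 2 * slot α β (fun κ => tri p q r (f κ ν) g h A) μ +
        2 * slot α β (fun κ => tri p q r (f μ κ) g h A) ν := by
  have := tri_add_left (p := p) (q := q) (r := r) (lowTrilin_le_trilin hA) 1 1
    (fun x => 2 * slot α β (fun κ => f κ ν x) μ) (fun x => 2 * slot α β (fun κ => f μ κ x) ν) g h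
  simp only [one_mul] at this
  rw [this, tri_slot_left hA α β μ (fun κ => f κ ν), tri_slot_left hA α β ν (fun κ => f μ κ)]

variable {𝓜 : Model I₁ I₂ I₃ I₄} (hs : 𝓜.IsScalar A)
include hs

lemma tri_vec {f : Fin 4 → 𝒬} {g h : 𝒬} (hf : 𝓜.Vec f)
    (hg : 𝓜.Inv g) (hh : 𝓜.Inv h) (μ : Fin 4) : tri p q r (f μ) g h A = 0 := by
  refine invariant_one (C := fun μ => tri p q r (f μ) g h A) (fun α β n μ => ?_) μ
  have := tri_rotate_eq_zero n (hf α β n μ) (hg α β n) (hh α β n) p q r hA hs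
  rw [tri_slot_left hA, tri_zero_mid (lowTrilin_le_trilin hA),
    tri_zero_right (lowTrilin_le_trilin hA)] at this
  linear_combination this / 2

lemma tri_vec_vec {f g : Fin 4 → 𝒬} {h : 𝒬} (hf : 𝓜.Vec f)
    (hg : 𝓜.Vec g) (hh : 𝓜.Inv h) (μ ν : Fin 4) :
    tri p q r (f μ) (g ν) h A = if μ = ν then η μ * tri p q r (f 0) (g 0) h A else 0 := by
  refine invariant_two (C := fun μ ν => tri p q r (f μ) (g ν) h A) (fun α β n μ ν => ?_) μ ν
  have := tri_rotate_eq_zero n (hf α β n μ) (hg α β n ν) (hh α β n) p q r hA hs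
  rw [tri_slot_left hA, tri_slot_mid hA, tri_zero_right (lowTrilin_le_trilin hA)] at this
  linear_combination this / 2

lemma tri_ten {f : Fin 4 → Fin 4 → 𝒬} {g h : 𝒬} (hf : 𝓜.Ten f)
    (hg : 𝓜.Inv g) (hh : 𝓜.Inv h) (μ ν : Fin 4) :
    tri p q r (f μ ν) g h A = if μ = ν then η μ * tri p q r (f 0 0) g h A else 0 := by
  refine invariant_two (C := fun μ ν => tri p q r (f μ ν) g h A) (fun α β n μ ν => ?_) μ ν
  have := tri_rotate_eq_zero n (hf α β n μ ν) (hg α β n) (hh α β n) p q r hA hs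
  rw [tri_slot_ten hA, tri_zero_mid (lowTrilin_le_trilin hA),
    tri_zero_right (lowTrilin_le_trilin hA)] at this
  linear_combination this / 2

lemma tri_vec_vec_vec {f g h : Fin 4 → 𝒬} (hf : 𝓜.Vec f)
    (hg : 𝓜.Vec g) (hh : 𝓜.Vec h) (μ ν ρ : Fin 4) : tri p q r (f μ) (g ν) (h ρ) A = 0 := by
  refine invariant_three (C := fun μ ν ρ => tri p q r (f μ) (g ν) (h ρ) A)
    (fun α β n μ ν ρ => ?_) μ ν ρ
  have := tri_rotate_eq_zero n (hf α β n μ) (hg α β n ν) (hh α β n ρ) p q r hA hs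
  rw [tri_slot_left hA, tri_slot_mid hA, tri_slot_right hA] at this
  linear_combination this / 2

lemma tri_ten_vec {f : Fin 4 → Fin 4 → 𝒬} {g : Fin 4 → 𝒬}
    {h : 𝒬} (hf : 𝓜.Ten f) (hg : 𝓜.Vec g) (hh : 𝓜.Inv h) (μ ν ρ : Fin 4) :
    tri p q r (f μ ν) (g ρ) h A = 0 := by
  refine invariant_three (C := fun μ ν ρ => tri p q r (f μ ν) (g ρ) h A)
    (fun α β n μ ν ρ => ?_) μ ν ρ
  have := tri_rotate_eq_zero n (hf α β n μ ν) (hg α β n ρ) (hh α β n) p q r hA hs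
  rw [tri_slot_ten hA, tri_slot_mid hA, tri_zero_right (lowTrilin_le_trilin hA)] at this
  linear_combination this / 2

lemma tri_ten_vec_vec {f : Fin 4 → Fin 4 → 𝒬} {g h : Fin 4 → 𝒬}
    (hf : 𝓜.Ten f) (hg : 𝓜.Vec g) (hh : 𝓜.Vec h) :
    ∃ a b c e : ℂ, ∀ μ ν ρ σ, tri p q r (f μ ν) (g ρ) (h σ) A =
      a * ((if μ = ν then η μ else 0) * (if ρ = σ then η ρ else 0))
      + b * ((if μ = ρ then η μ else 0) * (if ν = σ then η ν else 0))
      + c * ((if μ = σ then η μ else 0) * (if ν = ρ then η ν else 0)) + e * lc μ ν ρ σ := by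
  refine invariant_four (C := fun μ ν ρ σ => tri p q r (f μ ν) (g ρ) (h σ) A)
    fun α β n μ ν ρ σ => ?_
  have := tri_rotate_eq_zero n (hf α β n μ ν) (hg α β n ρ) (hh α β n σ) p q r hA hs
  rw [tri_slot_ten hA, tri_slot_mid hA, tri_slot_right hA] at this
  linear_combination this / 2

lemma tri_spin {f g : Fin 4 → 𝒬} {h : 𝒬} (hf : 𝓜.Cospin f)
    (hg : 𝓜.Spin g) (hh : 𝓜.Inv h) : ∃ a b : ℂ, ∀ μ ν, tri p q r (f μ) (g ν) h A =
      (a • (1 : 𝕄) + b • 𝓜.γ₅) μ ν := by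
  obtain ⟨a, b, e⟩ := 𝓜.invariant_spin_scalar (Y := Matrix.of fun μ ν => tri p q r (f μ) (g ν) h A)
    fun α β n => by
      ext μ ν
      have := tri_rotate_eq_zero n (hf α β n μ) (hg α β n ν) (hh α β n) p q r hA hs
      rw [tri_sum_left (lowTrilin_le_trilin hA), tri_sum_mid (lowTrilin_le_trilin hA),
        tri_zero_right (lowTrilin_le_trilin hA)] at this
      simp only [neg_mul, sum_neg_distrib] at this
      rw [Matrix.mul_apply, Matrix.mul_apply]
      simp only [Matrix.of_apply]
      simp only [mul_comm (tri _ _ _ _ _ _ _)]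
      linear_combination this
  exact ⟨a, b, fun μ ν => by rw [← e]; rfl⟩

lemma tri_spin_vec {f g h : Fin 4 → 𝒬} (hf : 𝓜.Cospin f)
    (hg : 𝓜.Spin g) (hh : 𝓜.Vec h) : ∃ a b : ℂ, ∀ μ ν ρ, tri p q r (f μ) (g ν) (h ρ) A =
      (𝓜.γ ρ * (a • (1 : 𝕄) + b • 𝓜.γ₅)) μ ν := by
  obtain ⟨a, b, e⟩ := 𝓜.invariant_spin_vector
    (Γ := fun ρ => Matrix.of fun μ ν => tri p q r (f μ) (g ν) (h ρ) A) fun α β n ρ => by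
      ext μ ν
      have := tri_rotate_eq_zero n (hf α β n μ) (hg α β n ν) (hh α β n ρ) p q r hA hs
      rw [tri_sum_left (lowTrilin_le_trilin hA), tri_sum_mid (lowTrilin_le_trilin hA),
        tri_slot_right hA] at this
      simp only [neg_mul, sum_neg_distrib] at this
      rw [Matrix.add_apply, Matrix.sub_apply, Matrix.mul_apply, Matrix.mul_apply]
      simp only [Matrix.of_apply, Matrix.smul_apply, Matrix.sub_apply, smul_eq_mul, Matrix.zero_apply]
      simp only [mul_comm (tri _ _ _ _ _ _ _)]
      rw [← this]
      simp only [slot]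
      split_ifs <;> simp only [Matrix.of_apply, Matrix.zero_apply] <;> ring
  exact ⟨a, b, fun μ ν ρ => by rw [← e]; rfl⟩

end

/-! ### The families of jet variables -/

/-- `d_J f` for an optional field `f`. -/
def optJet (f : Option ℱ) (J : 𝔻) : 𝒥 := f.elim 0 fun f => jet f J

def optState (f : Option ℱ) (χ : (Fin 4 →₀ ℕ) → ℂ) : 𝒬 :=
  f.elim (fun _ => 0) fun f => pure (ind f) χ

/-- The underived fields of a family. -/
def Family.underived {ι : Type*} [Fintype ι] (k : Fin 6) (F : ι → Option ℱ)
    (h1 : ∀ i f, F i = some f → f.kind = k) (h2 : ∀ f, f.kind = k → ∃ i, F i = some f)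
    (h3 : ∀ i j f, F i = some f → F j = some f → i = j) : Family I₁ I₂ I₃ I₄ ι where
  cls := (k, true)
  e i := optJet (F i) 0
  δ i := optState (F i) der0
  sum x _ := by
    obtain ⟨g, J⟩ := x
    by_cases hc : (⟨g, J⟩ : 𝒳).cls = (k, true)
    · rw [if_pos hc]
      obtain ⟨hk, hJ⟩ := Prod.mk.inj hc
      have hJ : J = 0 := of_decide_eq_true hJ
      subst hJ
      obtain ⟨i, hi⟩ := h2 g hk
      rw [sum_eq_single i (fun j _ hj => ?_) (by simp)]
      · simp [hi, optJet, optState, pure, ind, der0]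
      · cases hF : F j with
        | none => simp [optJet]
        | some f =>
          have : g ≠ f := fun h => hj (h3 j i f hF (h ▸ hi))
          simp [optState, pure, ind, this]
    · rw [if_neg hc]
      refine sum_eq_zero fun i _ => ?_
      cases hF : F i with
      | none => simp [optJet]
      | some f =>
        by_cases hg : g = f
        · by_cases hJ : J = 0
          · subst hg hJ
            exact absurd (by simp [JetVar.cls, h1 i g hF]) hc
          · simp [optState, pure, der0, hJ]
        · simp [optState, pure, ind, hg]

/-- The first derivatives (with upper index) of a family of fields. -/
def Family.derived {ι : Type*} [Fintype ι] (k : Fin 6) (F : ι → Option ℱ)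
    (h1 : ∀ i f, F i = some f → f.kind = k) (h2 : ∀ f, f.kind = k → ∃ i, F i = some f)
    (h3 : ∀ i j f, F i = some f → F j = some f → i = j) : Family I₁ I₂ I₃ I₄ (ι × Fin 4) where
  cls := (k, false)
  e i := η i.2 • optJet (F i.1) (Finsupp.single i.2 1)
  δ i := optState (F i.1) (der1 i.2)
  sum x hx := by
    obtain ⟨g, J⟩ := x
    by_cases hc : (⟨g, J⟩ : 𝒳).cls = (k, false)
    · rw [if_pos hc]
      obtain ⟨hk, hJ⟩ := Prod.mk.inj hc
      have hJ : J ≠ 0 := of_decide_eq_false hJ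
      obtain ⟨ρ, rfl⟩ : ∃ ρ, J = Finsupp.single ρ 1 := hx.resolve_left hJ
      obtain ⟨i, hi⟩ := h2 g hk
      rw [sum_eq_single (i, ρ) (fun j _ hj => ?_) (by simp)]
      · simp [hi, optJet, optState, pure, ind, der1, smul_smul, η_mul_self]
      · cases hF : F j.1 with
        | none => simp [optJet]
        | some f =>
          by_cases hf : g = f
          · have hj1 : j.1 = i := h3 j.1 i f hF (hf ▸ hi)
            have hj2 : ¬ (Finsupp.single ρ 1 : 𝔻) = Finsupp.single j.2 1 := fun h =>
              hj (Prod.ext hj1 ((Finsupp.single_left_injective one_ne_zero) h).symm)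
            simp only [optState, pure, Option.elim, der1, if_neg hj2, mul_zero, zero_smul]
          · simp [optState, pure, ind, hf]
    · rw [if_neg hc]
      refine sum_eq_zero fun i _ => ?_
      cases hF : F i.1 with
      | none => simp [optJet]
      | some f =>
        by_cases hg : g = f
        · by_cases hJ : J = Finsupp.single i.2 1
          · subst hg hJ
            exact absurd (by simp [JetVar.cls, h1 i.1 g hF]) hc
          · simp [optState, pure, der1, hJ]
        · simp [optState, pure, ind, hg]

/-- The scalar fields: `Φ_a` for `a ∈ I₁ ∪ I₂` (zero for `a ∈ I₁`) and `φ_j`. -/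
def scField : 𝒮 → Option ℱ
  | .inl (.inl _) => none
  | .inl (.inr b) => some (.Phi b)
  | .inr j => some (.phi j)

lemma scField_kind (s : 𝒮) (f : ℱ) (h : scField s = some f) : f.kind = 3 := by
  rcases s with (a | b) | j <;> simp only [scField] at h <;> cases h <;> rfl

lemma scField_surj (f : ℱ) (h : f.kind = 3) : ∃ s, scField s = some f := by
  cases f with
  | Phi b => exact ⟨.inl (.inr b), rfl⟩
  | phi j => exact ⟨.inr j, rfl⟩
  | _ => exact absurd h (by simp [Field.kind])

lemma scField_inj (s t : 𝒮) (f : ℱ) (h : scField s = some f) (h' : scField t = some f) : s = t := by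
  rcases s with (a | b) | j <;> rcases t with (a' | b') | j' <;> simp only [scField] at h h' <;>
    cases h <;> cases h' <;> rfl

lemma kindDim_eq (f : ℱ) : (kindDim f.kind : ℚ) = 2 * f.dim := by
  cases f <;> first
    | (change ((2 : ℕ) : ℚ) = 2 * 1; norm_num)
    | (change ((3 : ℕ) : ℚ) = 2 * (3 / 2); norm_num)

lemma kindGh_eq (f : ℱ) : f.gh = kindGh f.kind := by cases f <;> rfl

lemma kindFermion_eq (f : ℱ) : f.fermion = kindFermion f.kind := by cases f <;> rfl

lemma JetVar.toNat_le (x : 𝒳) : ((!x.cls.2).toNat : ℚ) ≤ ∑ μ, (x.J μ : ℚ) := by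
  by_cases h : x.J = 0
  · simp [JetVar.cls, h]
  · obtain ⟨ρ, hρ⟩ := Finsupp.ne_iff.1 h
    have h1 : x.J ρ ≤ ∑ μ, x.J μ := Finset.single_le_sum (f := x.J) (fun _ _ => Nat.zero_le _)
      (mem_univ ρ)
    have h2 : 1 ≤ ∑ μ, x.J μ := by
      rw [Finsupp.zero_apply] at hρ
      omega
    simp only [JetVar.cls, h, decide_false, Bool.not_false, Bool.toNat_true]
    exact_mod_cast h2

section

variable {ι κ l : Type*} [Fintype ι] [Fintype κ] [Fintype l] (F : Family I₁ I₂ I₃ I₄ ι)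
  (G : Family I₁ I₂ I₃ I₄ κ) (H : Family I₁ I₂ I₃ I₄ l)

lemma sector_zero : sector F G H 0 = 0 := by simp only [sector, map_zero, zero_smul, sum_const_zero]

lemma sector_add (A B : 𝒥) : sector F G H (A + B) = sector F G H A + sector F G H B := by
  simp only [sector, map_add, add_smul, sum_add_distrib]

lemma sector_smul (c : ℂ) (A : 𝒥) : sector F G H (c • A) = c • sector F G H A := by
  simp only [sector, map_smul, smul_assoc, smul_sum]

end

section Families

variable [Fintype I₁] [Fintype I₂] [Fintype I₃] [Fintype I₄]

variable (I₁ I₂ I₃ I₄)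

def famV : Family I₁ I₂ I₃ I₄ (𝒱 × Fin 4) :=
  .underived 0 (fun i => some (.v i.1 i.2)) (by rintro i f ⟨⟩; rfl)
    (fun f h => by cases f <;> simp [Field.kind] at h; exact ⟨(_, _), rfl⟩)
    (by rintro ⟨i, j⟩ ⟨k, l⟩ f ⟨⟩ h; cases h; rfl)

def famDV : Family I₁ I₂ I₃ I₄ ((𝒱 × Fin 4) × Fin 4) :=
  .derived 0 (fun i => some (.v i.1 i.2)) (by rintro i f ⟨⟩; rfl)
    (fun f h => by cases f <;> simp [Field.kind] at h; exact ⟨(_, _), rfl⟩)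
    (by rintro ⟨i, j⟩ ⟨k, l⟩ f ⟨⟩ h; cases h; rfl)

def famU : Family I₁ I₂ I₃ I₄ 𝒱 :=
  .underived 1 (fun i => some (.u i)) (by rintro i f ⟨⟩; rfl)
    (fun f h => by cases f <;> simp [Field.kind] at h; exact ⟨_, rfl⟩)
    (by rintro i j f ⟨⟩ h; cases h; rfl)

def famDU : Family I₁ I₂ I₃ I₄ (𝒱 × Fin 4) :=
  .derived 1 (fun i => some (.u i)) (by rintro i f ⟨⟩; rfl)
    (fun f h => by cases f <;> simp [Field.kind] at h; exact ⟨_, rfl⟩)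
    (by rintro i j f ⟨⟩ h; cases h; rfl)

def famUt : Family I₁ I₂ I₃ I₄ 𝒱 :=
  .underived 2 (fun i => some (.ut i)) (by rintro i f ⟨⟩; rfl)
    (fun f h => by cases f <;> simp [Field.kind] at h; exact ⟨_, rfl⟩)
    (by rintro i j f ⟨⟩ h; cases h; rfl)

def famDUt : Family I₁ I₂ I₃ I₄ (𝒱 × Fin 4) :=
  .derived 2 (fun i => some (.ut i)) (by rintro i f ⟨⟩; rfl)
    (fun f h => by cases f <;> simp [Field.kind] at h; exact ⟨_, rfl⟩)
    (by rintro i j f ⟨⟩ h; cases h; rfl)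

def famS : Family I₁ I₂ I₃ I₄ 𝒮 := .underived 3 scField scField_kind scField_surj scField_inj

def famDS : Family I₁ I₂ I₃ I₄ (𝒮 × Fin 4) :=
  .derived 3 scField scField_kind scField_surj scField_inj

def famPsi : Family I₁ I₂ I₃ I₄ (I₄ × Fin 4) :=
  .underived 4 (fun i => some (.psi i.1 i.2)) (by rintro i f ⟨⟩; rfl)
    (fun f h => by cases f <;> simp [Field.kind] at h; exact ⟨(_, _), rfl⟩)
    (by rintro ⟨i, j⟩ ⟨k, l⟩ f ⟨⟩ h; cases h; rfl)

def famPsibar : Family I₁ I₂ I₃ I₄ (I₄ × Fin 4) :=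
  .underived 5 (fun i => some (.psibar i.1 i.2)) (by rintro i f ⟨⟩; rfl)
    (fun f h => by cases f <;> simp [Field.kind] at h; exact ⟨(_, _), rfl⟩)
    (by rintro ⟨i, j⟩ ⟨k, l⟩ f ⟨⟩ h; cases h; rfl)

variable {I₁ I₂ I₃ I₄}

/-- The expansion of a trilinear expression of ghost number zero in monomials. -/
lemma sum_sector {T : 𝒥} (hT : T ∈ cubic _ _ _ _ 4 0) : (6 : ℂ) • T =
    sector (famV ..) (famV ..) (famV ..) T + (3 : ℂ) • sector (famV ..) (famV ..) (famS ..) T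
    + (3 : ℂ) • sector (famV ..) (famS ..) (famS ..) T + sector (famS ..) (famS ..) (famS ..) T
    + (3 : ℂ) • sector (famDV ..) (famV ..) (famV ..) T
    + (3 : ℂ) • sector (famV ..) (famV ..) (famDS ..) T
    + (6 : ℂ) • sector (famDV ..) (famV ..) (famS ..) T
    + (6 : ℂ) • sector (famV ..) (famDS ..) (famS ..) T
    + (3 : ℂ) • sector (famDS ..) (famS ..) (famS ..) T
    + (3 : ℂ) • sector (famDV ..) (famS ..) (famS ..) T
    + (6 : ℂ) • sector (famV ..) (famU ..) (famUt ..) T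
    + (6 : ℂ) • sector (famU ..) (famUt ..) (famS ..) T
    + (6 : ℂ) • sector (famDU ..) (famV ..) (famUt ..) T
    + (6 : ℂ) • sector (famDUt ..) (famV ..) (famU ..) T
    + (6 : ℂ) • sector (famDV ..) (famU ..) (famUt ..) T
    + (6 : ℂ) • sector (famDU ..) (famUt ..) (famS ..) T
    + (6 : ℂ) • sector (famDUt ..) (famU ..) (famS ..) T
    + (6 : ℂ) • sector (famDS ..) (famU ..) (famUt ..) T
    + (6 : ℂ) • sector (famPsibar ..) (famPsi ..) (famV ..) T
    + (6 : ℂ) • sector (famPsibar ..) (famPsi ..) (famS ..) T := by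
  induction hT using Submodule.span_induction with
  | mem A hA =>
    obtain ⟨x, y, z, rfl, hd, hg, hf⟩ := hA
    have h1 := x.toNat_le
    have h2 := y.toNat_le
    have h3 := z.toNat_le
    have l1 := x.field.one_le_dim
    have l2 := y.field.one_le_dim
    have l3 := z.field.one_le_dim
    have n1 := x.sum_J_nonneg
    have n2 := y.sum_J_nonneg
    have n3 := z.sum_J_nonneg
    have d1 := kindDim_eq x.field
    have d2 := kindDim_eq y.field
    have d3 := kindDim_eq z.field
    unfold JetVar.dim at hd
    have hx : x.Low := JetVar.low_of_sum_le (by linarith)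
    have hy : y.Low := JetVar.low_of_sum_le (by linarith)
    have hz : z.Low := JetVar.low_of_sum_le (by linarith)
    rw [kindGh_eq, kindGh_eq, kindGh_eq] at hg
    rw [kindFermion_eq, kindFermion_eq, kindFermion_eq] at hf
    have key := matchings_count x.cls y.cls z.cls (by
      have : (kindDim x.cls.1 + kindDim y.cls.1 + kindDim z.cls.1 +
          2 * ((!x.cls.2).toNat + (!y.cls.2).toNat + (!z.cls.2).toNat) : ℚ) ≤ 8 := by
        change (kindDim x.field.kind + kindDim y.field.kind + kindDim z.field.kind +
          2 * ((!x.cls.2).toNat + (!y.cls.2).toNat + (!z.cls.2).toNat) : ℚ) ≤ 8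
        linarith
      exact_mod_cast this) hg hf
    simp only [sector_mul _ _ _ hx hy hz, smul_smul, ← add_smul]
    congr 1
    have := congrArg (Nat.cast (R := ℂ)) key
    push_cast at this
    exact this.symm
  | zero => simp only [sector_zero, smul_zero, add_zero]
  | add X Y _ _ h1 h2 =>
    rw [smul_add, h1, h2]
    simp only [sector_add, smul_add]
    abel
  | smul c X _ h =>
    rw [smul_comm, h]
    simp only [sector_smul, smul_add, smul_comm c]

end Families

/-! ### The normal form of a Lorentz invariant trilinear expression -/

/-- The scalar fields `Φ_a` and `φ_j`. -/
def sc (s : 𝒮) : 𝒥 := optJet (scField s) 0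

lemma d_optJet (ρ : Fin 4) (f : Option ℱ) (J : 𝔻) :
    d ρ (optJet f J) = optJet f (J + Finsupp.single ρ 1) := by
  cases f with
  | none => exact map_zero _
  | some f => exact d_jet ρ f J

lemma d_sc (ρ : Fin 4) (s : 𝒮) : d ρ (sc s : 𝒥) = optJet (scField s) (Finsupp.single ρ 1) := by rw [sc, d_optJet, zero_add]

lemma d_v (ρ : Fin 4) (a : 𝒱) (μ : Fin 4) :
    d ρ (v a μ : 𝒥) = jet (.v a μ) (Finsupp.single ρ 1) := by rw [v, d_jet, zero_add]

lemma d_u (ρ : Fin 4) (a : 𝒱) : d ρ (u a : 𝒥) = jet (.u a) (Finsupp.single ρ 1) := by rw [u, d_jet, zero_add]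

lemma d_ut (ρ : Fin 4) (a : 𝒱) : d ρ (ut a : 𝒥) = jet (.ut a) (Finsupp.single ρ 1) := by rw [ut, d_jet, zero_add]

lemma v_mem (a : 𝒱) (μ : Fin 4) : v a μ ∈ lin I₁ I₂ I₃ I₄ false := jet_mem_lin (.v a μ) 0

/-- The Lorentz invariant monomials. -/
def mA (c a b : 𝒱) : 𝒥 := ∑ ρ, ∑ μ, η μ • (d ρ (v c ρ) * v a μ * v b μ)
def mB (c a b : 𝒱) : 𝒥 := ∑ ρ, ∑ μ, η μ • (d ρ (v c μ) * v a ρ * v b μ)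
def mE (c a b : 𝒱) : 𝒥 := ∑ ρ, ∑ σ, ∑ μ, ∑ ν, (η ρ * lc ρ σ μ ν) • (d ρ (v c σ) * v a μ * v b ν)
def mK (a b : 𝒱) (s : 𝒮) : 𝒥 := ∑ μ, η μ • (v a μ * v b μ * sc s)
def mR (a : 𝒱) (t s : 𝒮) : 𝒥 := ∑ μ, v a μ * d μ (sc t) * sc s
def mD (a : 𝒱) (s t : 𝒮) : 𝒥 := ∑ μ, d μ (v a μ) * sc s * sc t
def mS (s t r : 𝒮) : 𝒥 := sc s * sc t * sc r
def mX (c a b : 𝒱) : 𝒥 := ∑ μ, d μ (v c μ) * u a * ut b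
def mY (a c b : 𝒱) : 𝒥 := ∑ μ, d μ (u a) * v c μ * ut b
def mZ (b c a : 𝒱) : 𝒥 := ∑ μ, d μ (ut b) * v c μ * u a
def mW (a b : 𝒱) (s : 𝒮) : 𝒥 := u a * ut b * sc s

/-- The states dual to the jet variables. -/
abbrev stV (a : 𝒱) (μ : Fin 4) : 𝒬 := pure (ind (.v a μ)) der0
abbrev stDV (a : 𝒱) (ρ μ : Fin 4) : 𝒬 := pure (ind (.v a μ)) (der1 ρ)
abbrev stU (a : 𝒱) : 𝒬 := pure (ind (.u a)) der0
abbrev stDU (a : 𝒱) (ρ : Fin 4) : 𝒬 := pure (ind (.u a)) (der1 ρ)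
abbrev stUt (a : 𝒱) : 𝒬 := pure (ind (.ut a)) der0
abbrev stDUt (a : 𝒱) (ρ : Fin 4) : 𝒬 := pure (ind (.ut a)) (der1 ρ)
abbrev stS (s : 𝒮) : 𝒬 := optState (scField s) der0
abbrev stDS (s : 𝒮) (ρ : Fin 4) : 𝒬 := optState (scField s) (der1 ρ)
abbrev stPsi (A : I₄) (α : Fin 4) : 𝒬 := pure (ind (.psi A α)) der0
abbrev stPsibar (A : I₄) (α : Fin 4) : 𝒬 := pure (ind (.psibar A α)) der0

section

variable (𝓜 : Model I₁ I₂ I₃ I₄)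

lemma rotates_zero (α β : Fin 4) : 𝓜.Rotates α β (fun _ => 0) (fun _ => 0) := fun x _ => by
  have : ∀ X : 𝒥, ∀ p, X ∈ lin _ _ _ _ p → ev (fun _ => 0) X = 0 := fun X p hX => by
    induction hX using Submodule.span_induction with
    | mem X hX => obtain ⟨h, J, -, rfl⟩ := hX; simp only [ev_jet]
    | zero => simp
    | add X Y _ _ h1 h2 => rw [map_add, h1, h2, add_zero]
    | smul c X _ h => rw [map_smul, h, smul_zero]
  simp only [this _ _ (lorentzVar_mem _ _ x)]
  exact hasDerivAt_const _ _

lemma scField_isSc (s : 𝒮) (f : ℱ) (h : scField s = some f) : f.IsSc := by rcases s with (a | b) | j <;> simp only [scField] at h <;> cases h <;> trivial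

lemma inv_S (s : 𝒮) : 𝓜.Inv (stS s) := by
  unfold stS
  cases h : scField (I₄ := I₄) s with
  | none => exact fun α β _ => rotates_zero 𝓜 α β
  | some f => exact 𝓜.inv_scalar (scField_isSc s f h)

lemma vec_S (s : 𝒮) : 𝓜.Vec (stDS s) := by
  unfold stDS
  cases h : scField (I₄ := I₄) s with
  | none => exact fun α β _ μ => (rotates_zero 𝓜 α β).congr fun x => by simp [slot, optState]
  | some f => exact 𝓜.vec_scalar (scField_isSc s f h)

end

section

variable {A M B N C P S R X : Type*} [Fintype A] [Fintype M] [Fintype B] [Fintype N] [Fintype C]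
  [Fintype P] [Fintype S] [Fintype R] [AddCommMonoid X]

lemma sum_pair (f : A × M → X) : ∑ p, f p = ∑ a, ∑ μ, f (a, μ) := Fintype.sum_prod_type f

lemma sum_pair_pair (f : A × M → B × N → S → X) : ∑ p, ∑ q, ∑ s, f p q s =
    ∑ a, ∑ b, ∑ s, ∑ μ, ∑ ν, f (a, μ) (b, ν) s := by
  simp only [sum_pair]
  refine sum_ext fun a => ?_
  rw [sum_comm]
  refine sum_ext fun b => ?_
  simp only [sum_comm (s := univ (α := N)) (t := univ (α := S))]
  rw [sum_comm]

lemma sum_pair_pair_pair (f : A × M → B × N → C × P → X) : ∑ p, ∑ q, ∑ s, f p q s =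
    ∑ a, ∑ b, ∑ c, ∑ μ, ∑ ν, ∑ ρ, f (a, μ) (b, ν) (c, ρ) := by
  rw [sum_pair_pair]
  simp only [sum_pair]
  refine sum_congr rfl fun a _ => sum_congr rfl fun b _ => sum_congr rfl fun c _ => ?_
  rw [sum_comm]
  refine sum_congr rfl fun μ _ => ?_
  rw [sum_comm]

lemma sum_ten (f : (A × M) × N → S → R → X) : ∑ p, ∑ s, ∑ r, f p s r =
    ∑ a, ∑ s, ∑ r, ∑ ν, ∑ μ, f ((a, μ), ν) s r := by
  simp only [sum_pair]
  refine sum_congr rfl fun a _ => ?_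
  simp only [sum_comm (s := univ (α := N)) (t := univ (α := S)),
    sum_comm (s := univ (α := N)) (t := univ (α := R))]
  rw [sum_comm]
  refine sum_congr rfl fun s _ => ?_
  rw [sum_comm]
  refine sum_congr rfl fun r _ => ?_
  rw [sum_comm]

lemma sum_ten_pair_pair (f : (A × M) × N → B × P → C × R → X) : ∑ p, ∑ q, ∑ s, f p q s =
    ∑ a, ∑ b, ∑ c, ∑ ν, ∑ μ, ∑ κ, ∑ l, f ((a, μ), ν) (b, κ) (c, l) := by
  rw [sum_ten]
  simp only [sum_pair]
  refine sum_congr rfl fun a _ => sum_congr rfl fun b _ => ?_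
  rw [sum_comm]
  refine sum_congr rfl fun c _ => ?_
  simp only [sum_comm (s := univ (α := R)) (t := univ (α := N)),
    sum_comm (s := univ (α := R)) (t := univ (α := M))]
  rw [sum_comm]
  refine sum_congr rfl fun ν _ => ?_
  rw [sum_comm]

end

section Coefficients

variable (T : Jet I₁ I₂ I₃ I₄)

/-- The coefficients of an invariant expression. -/
def cA (c a b : 𝒱) : ℂ := -tri false false false (stDV c 0 0) (stV a 1) (stV b 1) T
def cB (c a b : 𝒱) : ℂ := -tri false false false (stDV c 0 1) (stV a 0) (stV b 1) T
def cE (c a b : 𝒱) : ℂ := tri false false false (stDV c 0 1) (stV a 2) (stV b 3) T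
def cK (a b : 𝒱) (s : 𝒮) : ℂ := tri false false false (stV a 0) (stV b 0) (stS s) T
def cR (a : 𝒱) (t s : 𝒮) : ℂ := tri false false false (stV a 0) (stDS t 0) (stS s) T
def cD (a : 𝒱) (s t : 𝒮) : ℂ := tri false false false (stDV a 0 0) (stS s) (stS t) T
def cS (s t r : 𝒮) : ℂ := tri false false false (stS s) (stS t) (stS r) T
def cX (c a b : 𝒱) : ℂ := tri false true true (stDV c 0 0) (stU a) (stUt b) T
def cY (a c b : 𝒱) : ℂ := tri true false true (stDU a 0) (stV c 0) (stUt b) T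
def cZ (b c a : 𝒱) : ℂ := tri true false true (stDUt b 0) (stV c 0) (stU a) T
def cW (a b : 𝒱) (s : 𝒮) : ℂ := tri true true false (stU a) (stUt b) (stS s) T

end Coefficients

section

variable {T : Jet I₁ I₂ I₃ I₄} (hT : T ∈ lowTrilin I₁ I₂ I₃ I₄) {𝓜 : Model I₁ I₂ I₃ I₄}
  (hs : 𝓜.IsScalar T)
include hT hs

lemma tri_vvv (c a b : 𝒱) (ρ σ μ ν : Fin 4) :
    tri false false false (stDV c ρ σ) (stV a μ) (stV b ν) T =
      cA T c a b * ((if ρ = σ then η ρ else 0) * (if μ = ν then η μ else 0))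
      + cB T c a b * ((if ρ = μ then η ρ else 0) * (if σ = ν then η σ else 0))
      + cB T c b a * ((if ρ = ν then η ρ else 0) * (if σ = μ then η σ else 0))
      + cE T c a b * lc ρ σ μ ν := by
  obtain ⟨x, y, z, e, h⟩ := tri_ten_vec_vec hT hs
    (𝓜.ten_v c) (𝓜.vec_v a) (𝓜.vec_v b)
  have hA : cA T c a b = x := by rw [cA, h]; simp [η, lc]
  have hB : cB T c a b = y := by rw [cB, h]; simp [η, lc]
  have hC : cB T c b a = z := by
    rw [cB, tri_swap_right (lowTrilin_le_trilin hT), h]; simp [η, lc, sgn]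
  have hE : cE T c a b = e := by
    rw [cE, h]; simp [show (0 : Fin 4) ≠ 2 by decide, show (1 : Fin 4) ≠ 3 by decide,
      show (0 : Fin 4) ≠ 3 by decide, show (1 : Fin 4) ≠ 2 by decide]; norm_num [lc]
  rw [h, hA, hB, hC, hE]

variable [Fintype I₁] [Fintype I₂] [Fintype I₃] [Fintype I₄]

lemma sector_A : sector (famDV I₁ I₂ I₃ I₄) (famV ..) (famV ..) T =
    ∑ c, ∑ a, ∑ b, (cA T c a b • mA c a b + cB T c a b • mB c a b + cB T c b a • mB c b a
      + cE T c a b • mE c a b) := by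
  have e : sector (famDV I₁ I₂ I₃ I₄) (famV ..) (famV ..) T =
      ∑ p : (𝒱 × Fin 4) × Fin 4, ∑ q : 𝒱 × Fin 4, ∑ r : 𝒱 × Fin 4,
      tri false false false (stDV p.1.1 p.2 p.1.2) (stV q.1 q.2) (stV r.1 r.2) T •
        (η p.2 • jet (.v p.1.1 p.1.2) (Finsupp.single p.2 1) * v q.1 q.2 * v r.1 r.2) := rfl
  rw [e, sum_ten_pair_pair]
  refine sum_congr rfl fun c _ => sum_congr rfl fun a _ => sum_congr rfl fun b _ => ?_
  simp only [tri_vvv hT hs, add_smul, sum_add_distrib]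
  refine congrArg₂ _ (congrArg₂ _ (congrArg₂ _ ?_ ?_) ?_) ?_
  · simp only [mA, d_v, smul_sum, mul_ite, ite_mul, mul_zero, zero_mul, ite_smul, zero_smul,
      Finset.sum_ite_irrel, sum_const_zero, sum_ite_eq, mem_univ, if_true,
      smul_mul_assoc, smul_smul]
    refine sum_congr rfl fun ρ _ => sum_congr rfl fun μ _ => ?_
    congr 1
    linear_combination cA T c a b * η μ * η_mul_self ρ
  · simp only [mB, d_v, smul_sum, mul_ite, ite_mul, mul_zero, zero_mul, ite_smul, zero_smul,
      sum_ite_eq, mem_univ, if_true,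
      smul_mul_assoc, smul_smul]
    refine sum_congr rfl fun ρ _ => sum_congr rfl fun μ _ => ?_
    congr 1
    linear_combination cB T c a b * η μ * η_mul_self ρ
  · simp only [mB, d_v, smul_sum, mul_ite, ite_mul, mul_zero, zero_mul, ite_smul, zero_smul,
      Finset.sum_ite_irrel, sum_const_zero, sum_ite_eq, mem_univ, if_true,
      smul_mul_assoc, smul_smul]
    refine sum_congr rfl fun ρ _ => sum_congr rfl fun μ _ => ?_
    rw [mul_assoc, mul_assoc (jet _ _), (commute_of_mem_lin_false (v_mem a μ) (v b ρ)).eq]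
    simp only [← mul_assoc]
    congr 1
    linear_combination cB T c b a * η μ * η_mul_self ρ
  · simp only [mE, d_v, smul_sum, smul_mul_assoc, smul_smul]
    refine sum_congr rfl fun ρ _ => sum_congr rfl fun σ _ =>
      sum_congr rfl fun μ _ => sum_congr rfl fun ν _ => ?_
    congr 1
    ring

lemma sector_K : sector (famV I₁ I₂ I₃ I₄) (famV ..) (famS ..) T =
    ∑ a, ∑ b, ∑ s, cK T a b s • mK a b s := by
  have e : sector (famV I₁ I₂ I₃ I₄) (famV ..) (famS ..) T =
      ∑ p : 𝒱 × Fin 4, ∑ q : 𝒱 × Fin 4, ∑ s : 𝒮,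
      tri false false false (stV p.1 p.2) (stV q.1 q.2) (stS s) T •
        (v p.1 p.2 * v q.1 q.2 * sc s) := rfl
  rw [e, sum_pair_pair]
  refine sum_congr rfl fun a _ => sum_congr rfl fun b _ => sum_congr rfl fun s _ => ?_
  have h : ∀ μ ν, tri false false false (stV a μ) (stV b ν) (stS s) T =
      if μ = ν then η μ * cK T a b s else 0 := tri_vec_vec hT hs (𝓜.vec_v a) (𝓜.vec_v b)
    (inv_S 𝓜 s)
  simp only [h, ite_smul, zero_smul, sum_ite_eq, mem_univ, if_true, mK, smul_sum, smul_smul]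
  exact sum_congr rfl fun μ _ => by rw [mul_comm]

lemma sector_R : sector (famV I₁ I₂ I₃ I₄) (famDS ..) (famS ..) T =
    ∑ a, ∑ t, ∑ s, cR T a t s • mR a t s := by
  have e : sector (famV I₁ I₂ I₃ I₄) (famDS ..) (famS ..) T =
      ∑ p : 𝒱 × Fin 4, ∑ q : 𝒮 × Fin 4, ∑ s : 𝒮,
      tri false false false (stV p.1 p.2) (stDS q.1 q.2) (stS s) T •
        (v p.1 p.2 * η q.2 • optJet (scField q.1) (Finsupp.single q.2 1) * sc s) := rfl
  rw [e, sum_pair_pair]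
  refine sum_congr rfl fun a _ => sum_congr rfl fun t _ => sum_congr rfl fun s _ => ?_
  have h : ∀ μ ν, tri false false false (stV a μ) (stDS t ν) (stS s) T =
      if μ = ν then η μ * cR T a t s else 0 := tri_vec_vec hT hs (𝓜.vec_v a) (vec_S 𝓜 t)
    (inv_S 𝓜 s)
  simp only [h, ite_smul, zero_smul, sum_ite_eq, mem_univ, if_true]
  simp only [mR, d_sc, smul_sum, smul_smul, smul_mul_assoc, mul_smul_comm]
  refine sum_congr rfl fun μ _ => ?_
  congr 1
  linear_combination cR T a t s * η_mul_self μ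

lemma sector_D : sector (famDV I₁ I₂ I₃ I₄) (famS ..) (famS ..) T =
    ∑ a, ∑ s, ∑ t, cD T a s t • mD a s t := by
  have e : sector (famDV I₁ I₂ I₃ I₄) (famS ..) (famS ..) T =
      ∑ p : (𝒱 × Fin 4) × Fin 4, ∑ s : 𝒮, ∑ t : 𝒮,
      tri false false false (stDV p.1.1 p.2 p.1.2) (stS s) (stS t) T •
        (η p.2 • jet (.v p.1.1 p.1.2) (Finsupp.single p.2 1) * sc s * sc t) := rfl
  rw [e, sum_ten]
  refine sum_congr rfl fun a _ => sum_congr rfl fun s _ => sum_congr rfl fun t _ => ?_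
  have h : ∀ μ ν, tri false false false (stDV a μ ν) (stS s) (stS t) T =
      if μ = ν then η μ * cD T a s t else 0 := tri_ten hT hs (𝓜.ten_v a) (inv_S 𝓜 s)
    (inv_S 𝓜 t)
  simp only [h, ite_smul, zero_smul, sum_ite_eq, mem_univ, if_true]
  simp only [mD, d_v, smul_sum, smul_smul, smul_mul_assoc]
  refine sum_congr rfl fun μ _ => ?_
  congr 1
  linear_combination cD T a s t * η_mul_self μ

lemma sector_X : sector (famDV I₁ I₂ I₃ I₄) (famU ..) (famUt ..) T =
    ∑ c, ∑ a, ∑ b, cX T c a b • mX c a b := by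
  have e : sector (famDV I₁ I₂ I₃ I₄) (famU ..) (famUt ..) T =
      ∑ p : (𝒱 × Fin 4) × Fin 4, ∑ s : 𝒱, ∑ t : 𝒱,
      tri false true true (stDV p.1.1 p.2 p.1.2) (stU s) (stUt t) T •
        (η p.2 • jet (.v p.1.1 p.1.2) (Finsupp.single p.2 1) * u s * ut t) := rfl
  rw [e, sum_ten]
  refine sum_congr rfl fun a _ => sum_congr rfl fun s _ => sum_congr rfl fun t _ => ?_
  have h : ∀ μ ν, tri false true true (stDV a μ ν) (stU s) (stUt t) T =
      if μ = ν then η μ * cX T a s t else 0 := tri_ten hT hs (𝓜.ten_v a)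
    (𝓜.inv_scalar (g := .u s) trivial) (𝓜.inv_scalar (g := .ut t) trivial)
  simp only [h, ite_smul, zero_smul, sum_ite_eq, mem_univ, if_true]
  simp only [mX, d_v, smul_sum, smul_smul, smul_mul_assoc]
  refine sum_congr rfl fun μ _ => ?_
  congr 1
  linear_combination cX T a s t * η_mul_self μ

lemma sector_Y : sector (famDU I₁ I₂ I₃ I₄) (famV ..) (famUt ..) T =
    ∑ a, ∑ c, ∑ b, cY T a c b • mY a c b := by
  have e : sector (famDU I₁ I₂ I₃ I₄) (famV ..) (famUt ..) T =
      ∑ p : 𝒱 × Fin 4, ∑ q : 𝒱 × Fin 4, ∑ s : 𝒱,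
      tri true false true (stDU p.1 p.2) (stV q.1 q.2) (stUt s) T •
        (η p.2 • jet (.u p.1) (Finsupp.single p.2 1) * v q.1 q.2 * ut s) := rfl
  rw [e, sum_pair_pair]
  refine sum_congr rfl fun a _ => sum_congr rfl fun t _ => sum_congr rfl fun s _ => ?_
  have h : ∀ μ ν, tri true false true (stDU a μ) (stV t ν) (stUt s) T =
      if μ = ν then η μ * cY T a t s else 0 := tri_vec_vec hT hs
    (𝓜.vec_scalar (g := .u a) trivial) (𝓜.vec_v t) (𝓜.inv_scalar (g := .ut s) trivial)
  simp only [h, ite_smul, zero_smul, sum_ite_eq, mem_univ, if_true]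
  simp only [mY, d_u, smul_sum, smul_smul, smul_mul_assoc]
  refine sum_congr rfl fun μ _ => ?_
  congr 1
  linear_combination cY T a t s * η_mul_self μ

lemma sector_Z : sector (famDUt I₁ I₂ I₃ I₄) (famV ..) (famU ..) T =
    ∑ b, ∑ c, ∑ a, cZ T b c a • mZ b c a := by
  have e : sector (famDUt I₁ I₂ I₃ I₄) (famV ..) (famU ..) T =
      ∑ p : 𝒱 × Fin 4, ∑ q : 𝒱 × Fin 4, ∑ s : 𝒱,
      tri true false true (stDUt p.1 p.2) (stV q.1 q.2) (stU s) T •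
        (η p.2 • jet (.ut p.1) (Finsupp.single p.2 1) * v q.1 q.2 * u s) := rfl
  rw [e, sum_pair_pair]
  refine sum_congr rfl fun a _ => sum_congr rfl fun t _ => sum_congr rfl fun s _ => ?_
  have h : ∀ μ ν, tri true false true (stDUt a μ) (stV t ν) (stU s) T =
      if μ = ν then η μ * cZ T a t s else 0 := tri_vec_vec hT hs
    (𝓜.vec_scalar (g := .ut a) trivial) (𝓜.vec_v t) (𝓜.inv_scalar (g := .u s) trivial)
  simp only [h, ite_smul, zero_smul, sum_ite_eq, mem_univ, if_true]
  simp only [mZ, d_ut, smul_sum, smul_smul, smul_mul_assoc]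
  refine sum_congr rfl fun μ _ => ?_
  congr 1
  linear_combination cZ T a t s * η_mul_self μ

/-- The sectors which contain no invariants. -/
lemma sector_zero_of : sector (famV I₁ I₂ I₃ I₄) (famV ..) (famV ..) T = 0 ∧
    sector (famV I₁ I₂ I₃ I₄) (famS ..) (famS ..) T = 0 ∧
    sector (famV I₁ I₂ I₃ I₄) (famV ..) (famDS ..) T = 0 ∧
    sector (famDV I₁ I₂ I₃ I₄) (famV ..) (famS ..) T = 0 ∧
    sector (famDS I₁ I₂ I₃ I₄) (famS ..) (famS ..) T = 0 ∧
    sector (famV I₁ I₂ I₃ I₄) (famU ..) (famUt ..) T = 0 ∧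
    sector (famDU I₁ I₂ I₃ I₄) (famUt ..) (famS ..) T = 0 ∧
    sector (famDUt I₁ I₂ I₃ I₄) (famU ..) (famS ..) T = 0 ∧
    sector (famDS I₁ I₂ I₃ I₄) (famU ..) (famUt ..) T = 0 := by
  have key : ∀ {x : ℂ} {y : 𝒥}, x = 0 → x • y = 0 := fun h => by rw [h, zero_smul]
  refine ⟨?_, ?_, ?_, ?_, ?_, ?_, ?_, ?_, ?_⟩ <;>
    refine sum_eq_zero fun i _ => sum_eq_zero fun j _ => sum_eq_zero fun k _ => key ?_
  · exact tri_vec_vec_vec hT hs (𝓜.vec_v i.1) (𝓜.vec_v j.1) (𝓜.vec_v k.1) i.2 j.2 k.2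
  · exact tri_vec hT hs (𝓜.vec_v i.1) (inv_S 𝓜 j) (inv_S 𝓜 k) i.2
  · exact tri_vec_vec_vec hT hs (𝓜.vec_v i.1) (𝓜.vec_v j.1) (vec_S 𝓜 k.1) i.2 j.2 k.2
  · exact tri_ten_vec hT hs (𝓜.ten_v i.1.1) (𝓜.vec_v j.1) (inv_S 𝓜 k) i.2 i.1.2 j.2
  · exact tri_vec hT hs (vec_S 𝓜 i.1) (inv_S 𝓜 j) (inv_S 𝓜 k) i.2
  · exact tri_vec hT hs (𝓜.vec_v i.1) (𝓜.inv_scalar (g := .u j) trivial)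
      (𝓜.inv_scalar (g := .ut k) trivial) i.2
  · exact tri_vec hT hs (𝓜.vec_scalar (g := .u i.1) trivial) (𝓜.inv_scalar (g := .ut j) trivial)
      (inv_S 𝓜 k) i.2
  · exact tri_vec hT hs (𝓜.vec_scalar (g := .ut i.1) trivial) (𝓜.inv_scalar (g := .u j) trivial)
      (inv_S 𝓜 k) i.2
  · exact tri_vec hT hs (vec_S 𝓜 i.1) (𝓜.inv_scalar (g := .u j) trivial)
      (𝓜.inv_scalar (g := .ut k) trivial) i.2

end

lemma sum_sign {X : Type*} [AddCommMonoid X] (f : ℤˣ → X) : ∑ ε, f ε = f 1 + f (-1) := by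
  rw [show (univ : Finset ℤˣ) = {1, -1} from rfl, Finset.sum_pair (by decide)]

lemma sum_perm_seven {A B C D E F G X : Type*} [Fintype A] [Fintype B] [Fintype C] [Fintype D]
    [Fintype E] [Fintype F] [Fintype G] [AddCommMonoid X] (f : A → B → C → D → E → F → G → X) :
    ∑ a, ∑ b, ∑ c, ∑ d, ∑ e, ∑ p, ∑ g, f a b c d e p g =
      ∑ c, ∑ p, ∑ g, ∑ a, ∑ b, ∑ d, ∑ e, f a b c d e p g := by
  simp only [← Fintype.sum_prod_type']
  exact Fintype.sum_equiv ⟨fun x => (x.2.2.1, x.2.2.2.2.2.1, x.2.2.2.2.2.2, x.1, x.2.1, x.2.2.2.1,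
      x.2.2.2.2.1), fun y => (y.2.2.2.1, y.2.2.2.2.1, y.1, y.2.2.2.2.2.1, y.2.2.2.2.2.2, y.2.1,
      y.2.2.1), fun _ => rfl, fun _ => rfl⟩ _ _ fun _ => rfl

lemma Model.chiral_decomposition (𝓜 : ℳ) (a b : ℂ) : a • (1 : 𝕄) + b • 𝓜.γ₅ =
      ∑ ε : ℤˣ, (a + ((ε : ℤ) : ℂ) * b) • 𝓜.γε ε := by
  rw [sum_sign]
  simp only [Model.γε, Units.val_one, Units.val_neg, Int.cast_one, Int.cast_neg, one_mul]
  module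

section

variable {T : Jet I₁ I₂ I₃ I₄} (hT : T ∈ lowTrilin I₁ I₂ I₃ I₄) {𝓜 : Model I₁ I₂ I₃ I₄}
  (hs : 𝓜.IsScalar T)
include hT hs

lemma exists_vectorCurrent : ∃ t : 𝒱 → ℤˣ → Matrix I₄ I₄ ℂ, ∀ a A B α β ρ,
    tri true true false (stPsibar A α) (stPsi B β) (stV a ρ) T =
      ∑ ε, t a ε A B * (𝓜.γ ρ * 𝓜.γε ε) α β := by
  choose x y h using fun a A B => tri_spin_vec hT hs
    (𝓜.cospin_psibar A) (𝓜.spin_psi B) (𝓜.vec_v a)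
  refine ⟨fun a ε A B => x a A B + ((ε : ℤ) : ℂ) * y a A B, fun a A B α β ρ => ?_⟩
  rw [h, 𝓜.chiral_decomposition, mul_sum, Matrix.sum_apply]
  simp only [Matrix.mul_smul, Matrix.smul_apply, smul_eq_mul]

lemma exists_scalarCurrent : ∃ c : 𝒮 → ℤˣ → Matrix I₄ I₄ ℂ, ∀ s A B α β,
    tri true true false (stPsibar A α) (stPsi B β) (stS s) T = ∑ ε, c s ε A B * 𝓜.γε ε α β := by
  choose x y h using fun s A B => tri_spin hT hs
    (𝓜.cospin_psibar A) (𝓜.spin_psi B) (inv_S 𝓜 s)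
  refine ⟨fun s ε A B => x s A B + ((ε : ℤ) : ℂ) * y s A B, fun a A B α β => ?_⟩
  rw [h, 𝓜.chiral_decomposition, Matrix.sum_apply]
  simp only [Matrix.smul_apply, smul_eq_mul]

variable [Fintype I₁] [Fintype I₂] [Fintype I₃] [Fintype I₄]

lemma sector_psi_v (t : 𝒱 → ℤˣ → Matrix I₄ I₄ ℂ) (ht : ∀ a A B α β ρ,
    tri true true false (stPsibar A α) (stPsi B β) (stV a ρ) T =
      ∑ ε, t a ε A B * (𝓜.γ ρ * 𝓜.γε ε) α β) :
    sector (famPsibar I₁ I₂ I₃ I₄) (famPsi ..) (famV ..) T =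
      ∑ a, ∑ μ, 𝓜.vectorCurrent (t a) μ * vLow a μ := by
  have e : sector (famPsibar I₁ I₂ I₃ I₄) (famPsi ..) (famV ..) T =
      ∑ p : I₄ × Fin 4, ∑ q : I₄ × Fin 4, ∑ r : 𝒱 × Fin 4,
      tri true true false (stPsibar p.1 p.2) (stPsi q.1 q.2) (stV r.1 r.2) T •
        (psibar p.1 p.2 * psi q.1 q.2 * v r.1 r.2) := rfl
  have hη : ∀ μ (x : ℂ) (y : 𝒥), η μ • (η μ * x) • y = x • y := fun μ x y => by
    rw [smul_smul, ← mul_assoc, η_mul_self, one_mul]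
  rw [e, sum_pair_pair_pair]
  simp only [ht, vLow, Model.vectorCurrent, Model.γUp, Model.bilinear, sum_mul,
    smul_mul_assoc, mul_smul_comm, sum_smul, smul_sum,
    Matrix.smul_apply, smul_eq_mul, mul_left_comm _ (η _), hη]
  exact sum_perm_seven _

lemma sector_psi_s (c : 𝒮 → ℤˣ → Matrix I₄ I₄ ℂ) (hc : ∀ s A B α β,
    tri true true false (stPsibar A α) (stPsi B β) (stS s) T = ∑ ε, c s ε A B * 𝓜.γε ε α β) :
    sector (famPsibar I₁ I₂ I₃ I₄) (famPsi ..) (famS ..) T = ∑ s, 𝓜.scalarCurrent (c s) * sc s := by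
  have e : sector (famPsibar I₁ I₂ I₃ I₄) (famPsi ..) (famS ..) T =
      ∑ p : I₄ × Fin 4, ∑ q : I₄ × Fin 4, ∑ s : 𝒮,
      tri true true false (stPsibar p.1 p.2) (stPsi q.1 q.2) (stS s) T •
        (psibar p.1 p.2 * psi q.1 q.2 * sc s) := rfl
  rw [e, sum_pair_pair]
  simp only [hc, Model.scalarCurrent, Model.bilinear, sum_mul, smul_mul_assoc, sum_smul]
  simp only [← Fintype.sum_prod_type']
  exact Fintype.sum_equiv ⟨fun x => (x.2.2.1, x.2.2.2.2.2, x.1, x.2.1, x.2.2.2.1,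
      x.2.2.2.2.1), fun y => (y.2.2.1, y.2.2.2.1, y.1, y.2.2.2.2.1, y.2.2.2.2.2,
      y.2.1), fun _ => rfl, fun _ => rfl⟩ _ _ fun _ => rfl

omit hT hs in
lemma sector_S : sector (famS I₁ I₂ I₃ I₄) (famS ..) (famS ..) T =
    ∑ s, ∑ t, ∑ r, cS T s t r • mS s t r := rfl

omit hT hs in
lemma sector_W : sector (famU I₁ I₂ I₃ I₄) (famUt ..) (famS ..) T =
    ∑ a, ∑ b, ∑ s, cW T a b s • mW a b s := rfl

omit hT in
/-- The normal form of an invariant expression of ghost number zero. -/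
lemma normal_form (hT : T ∈ cubic _ _ _ _ 4 0) (t : 𝒱 → ℤˣ → Matrix I₄ I₄ ℂ)
    (ht : ∀ a A B α β ρ, tri true true false (stPsibar A α) (stPsi B β) (stV a ρ) T =
      ∑ ε, t a ε A B * (𝓜.γ ρ * 𝓜.γε ε) α β)
    (c : 𝒮 → ℤˣ → Matrix I₄ I₄ ℂ)
    (hc : ∀ s A B α β, tri true true false (stPsibar A α) (stPsi B β) (stS s) T =
      ∑ ε, c s ε A B * 𝓜.γε ε α β) :
    T = (1 / 2 : ℂ) • ∑ c, ∑ a, ∑ b, cA T c a b • mA c a b + ∑ c, ∑ a, ∑ b, cB T c a b • mB c a b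
      + (1 / 2 : ℂ) • ∑ c, ∑ a, ∑ b, cE T c a b • mE c a b
      + (1 / 2 : ℂ) • ∑ a, ∑ b, ∑ s, cK T a b s • mK a b s
      + ∑ a, ∑ t, ∑ s, cR T a t s • mR a t s
      + (1 / 2 : ℂ) • ∑ a, ∑ s, ∑ t, cD T a s t • mD a s t
      + (1 / 6 : ℂ) • ∑ s, ∑ t, ∑ r, cS T s t r • mS s t r
      + ∑ c, ∑ a, ∑ b, cX T c a b • mX c a b
      + ∑ a, ∑ c, ∑ b, cY T a c b • mY a c b
      + ∑ b, ∑ c, ∑ a, cZ T b c a • mZ b c a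
      + ∑ a, ∑ b, ∑ s, cW T a b s • mW a b s
      + ∑ a, ∑ μ, 𝓜.vectorCurrent (t a) μ * vLow a μ
      + ∑ s, 𝓜.scalarCurrent (c s) * sc s := by
  have hl := cubic_le_lowTrilin _ hT
  have h := sum_sector hT
  obtain ⟨z1, z2, z3, z4, z5, z6, z7, z8, z9⟩ := sector_zero_of hl hs
  rw [z1, z2, z3, z4, z5, z6, z7, z8, z9, sector_A hl hs, sector_K hl hs, sector_R hl hs,
    sector_D hl hs, sector_X hl hs, sector_Y hl hs, sector_Z hl hs, sector_S, sector_W,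
    sector_psi_v hl hs t ht, sector_psi_s hl hs c hc] at h
  have hsw : ∑ c, ∑ a, ∑ b, cB T c b a • (mB c b a : 𝒥) = ∑ c, ∑ a, ∑ b, cB T c a b • mB c a b :=
    sum_ext fun _ => sum_comm
  simp only [sum_add_distrib, hsw] at h
  have h6 : T = (1 / 6 : ℂ) • (6 : ℂ) • T := by rw [smul_smul]; norm_num
  refine h6.trans ?_
  rw [h]
  module

end

/-! ### Plane waves -/

/-- The derivatives of the plane wave of momentum `p` at the origin. -/
def mono (p : 𝕍) (J : 𝔻) : ℂ := ∏ μ, p μ ^ J μ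

lemma mono_add (p : 𝕍) (J K : 𝔻) : mono p (J + K) = mono p J * mono p K := by
  simp [mono, pow_add, Finset.prod_mul_distrib]

lemma mono_zero (p : 𝕍) : mono p 0 = 1 := by simp [mono]

lemma mono_single (p : 𝕍) (ρ : Fin 4) (n : ℕ) : mono p (Finsupp.single ρ n) = p ρ ^ n := by
  rw [mono, Finset.prod_eq_single ρ (fun μ _ h => by rw [Finsupp.single_eq_of_ne h, pow_zero])
    (by simp), Finsupp.single_eq_same]

lemma low_cases {J K L : 𝔻} (h : (∑ μ, (J μ : ℚ)) + ∑ μ, (K μ : ℚ) + ∑ μ, (L μ : ℚ) ≤ 1) :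
    (J = 0 ∧ K = 0 ∧ L = 0) ∨ (∃ ρ, J = Finsupp.single ρ 1 ∧ K = 0 ∧ L = 0) ∨
    (∃ ρ, J = 0 ∧ K = Finsupp.single ρ 1 ∧ L = 0) ∨
    (∃ ρ, J = 0 ∧ K = 0 ∧ L = Finsupp.single ρ 1) := by
  have h' : (∑ μ, J μ) + ∑ μ, K μ + ∑ μ, L μ ≤ 1 := by exact_mod_cast h
  have z : ∀ J : 𝔻, ∑ μ, J μ = 0 → J = 0 := fun J h => by
    ext μ
    exact Finset.sum_eq_zero_iff.1 h μ (mem_univ μ)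
  have l : ∀ J : 𝔻, ∑ μ, J μ ≤ 1 → J = 0 ∨ ∃ ρ, J = Finsupp.single ρ 1 := fun J h =>
    JetVar.low_of_sum_le (x := (⟨.u (.inl ()), J⟩ : JetVar Unit Unit Unit Unit))
      (by exact_mod_cast h)
  have s : ∀ ρ : Fin 4, ∑ μ, (Finsupp.single ρ 1 : 𝔻) μ = 1 := fun ρ => by
    simp [Finsupp.single_apply]
  rcases l J (by omega) with rfl | ⟨ρ, rfl⟩
  · rcases l K (by omega) with rfl | ⟨ρ, rfl⟩
    · rcases l L (by omega) with rfl | ⟨ρ, rfl⟩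
      · exact .inl ⟨rfl, rfl, rfl⟩
      · exact .inr (.inr (.inr ⟨ρ, rfl, rfl, rfl⟩))
    · rw [s] at h'
      exact .inr (.inr (.inl ⟨ρ, rfl, rfl, z L (by omega)⟩))
  · rw [s] at h'
    exact .inr (.inl ⟨ρ, rfl, z K (by omega), z L (by omega)⟩)

lemma sum_der1_single (p : 𝕍) (ρ : Fin 4) :
    ∑ σ, η σ * p σ * der1 σ (Finsupp.single ρ 1) = p ρ := by
  rw [sum_eq_single ρ]
  · simp [der1]
    linear_combination p ρ * η_mul_self ρ
  · intro σ _ h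
    have : ¬ (Finsupp.single ρ 1 : 𝔻) = Finsupp.single σ 1 := fun e =>
      h ((Finsupp.single_left_injective one_ne_zero) e).symm
    rw [der1, if_neg this, mul_zero]
  · simp

lemma sum_der1_zero (p : 𝕍) : ∑ σ, η σ * p σ * der1 σ 0 = 0 := by
  refine sum_eq_zero fun σ _ => ?_
  have : ¬ (0 : 𝔻) = Finsupp.single σ 1 := fun e =>
    one_ne_zero (Finsupp.single_eq_zero.1 e.symm)
  rw [der1, if_neg this, mul_zero]

lemma mono_expand {J K L : 𝔻}
    (h : (∑ μ, (J μ : ℚ)) + ∑ μ, (K μ : ℚ) + ∑ μ, (L μ : ℚ) ≤ 1) (p q r : 𝕍) :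
    mono p J * mono q K * mono r L = der0 J * der0 K * der0 L
      + (∑ σ, η σ * p σ * der1 σ J) * der0 K * der0 L
      + der0 J * (∑ σ, η σ * q σ * der1 σ K) * der0 L
      + der0 J * der0 K * (∑ σ, η σ * r σ * der1 σ L) := by
  have d1 : ∀ ρ : Fin 4, der0 (Finsupp.single ρ 1) = 0 := fun ρ => by simp [der0]
  have d0 : der0 0 = 1 := by simp [der0]
  rcases low_cases h with ⟨rfl, rfl, rfl⟩ | ⟨ρ, rfl, rfl, rfl⟩ | ⟨ρ, rfl, rfl, rfl⟩ |
    ⟨ρ, rfl, rfl, rfl⟩ <;>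
  simp only [sum_der1_single, sum_der1_zero, d0, d1, mono_zero, mono_single] <;> ring

lemma ev_filt_pure_jet (p : Bool) (φ : ℱ → ℂ) (χ : (Fin 4 →₀ ℕ) → ℂ) (f : ℱ) (J : 𝔻) :
    ev (filt p (pure φ χ)) (jet f J) = (if f.odd = p then φ f else 0) * χ J := by
  rw [ev_jet, filt, pure]
  simp only [ite_mul, zero_mul]

lemma tri_wave {T : 𝒥} {g : ℤ} (hT : T ∈ cubic _ _ _ _ 4 g) (p q r : Bool)
    (φ₁ φ₂ φ₃ : ℱ → ℂ) (k₁ k₂ k₃ : 𝕍) :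
    tri p q r (pure φ₁ (mono k₁)) (pure φ₂ (mono k₂)) (pure φ₃ (mono k₃)) T =
      tri p q r (pure φ₁ der0) (pure φ₂ der0) (pure φ₃ der0) T
      + ∑ σ, η σ * k₁ σ * tri p q r (pure φ₁ (der1 σ)) (pure φ₂ der0) (pure φ₃ der0) T
      + ∑ σ, η σ * k₂ σ * tri p q r (pure φ₁ der0) (pure φ₂ (der1 σ)) (pure φ₃ der0) T
      + ∑ σ, η σ * k₃ σ * tri p q r (pure φ₁ der0) (pure φ₂ der0) (pure φ₃ (der1 σ)) T := by
  induction hT using Submodule.span_induction with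
  | mem A hA =>
    obtain ⟨⟨x, J⟩, ⟨y, K⟩, ⟨z, L⟩, rfl, hd, -, -⟩ := hA
    have l1 := x.one_le_dim
    have l2 := y.one_le_dim
    have l3 := z.one_le_dim
    simp only [JetVar.dim] at hd
    have e := fun p q r => mono_expand (J := J) (K := K) (L := L) (by linarith) p q r
    have hx := jet_mem_lin x J
    have hy := jet_mem_lin y K
    have hz := jet_mem_lin z L
    simp only [tri_mul _ _ _ hx hy hz, ev_filt_pure_jet]
    have e1 := e k₁ k₂ k₃
    have e2 := e k₁ k₃ k₂
    have e3 := e k₂ k₁ k₃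
    have e4 := e k₂ k₃ k₁
    have e5 := e k₃ k₁ k₂
    have e6 := e k₃ k₂ k₁
    simp only [Fin.sum_univ_four] at e1 e2 e3 e4 e5 e6 ⊢
    generalize (if x.odd = p then φ₁ x else 0) = x1
    generalize (if x.odd = q then φ₂ x else 0) = x2
    generalize (if x.odd = r then φ₃ x else 0) = x3
    generalize (if y.odd = p then φ₁ y else 0) = y1
    generalize (if y.odd = q then φ₂ y else 0) = y2
    generalize (if y.odd = r then φ₃ y else 0) = y3
    generalize (if z.odd = p then φ₁ z else 0) = z1
    generalize (if z.odd = q then φ₂ z else 0) = z2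
    generalize (if z.odd = r then φ₃ z else 0) = z3
    linear_combination x1 * y2 * z3 * e1 + sgn q r * (x1 * y3 * z2 * e2)
      + sgn p q * (x2 * y1 * z3 * e3) + sgn p q * sgn p r * (x2 * y3 * z1 * e4)
      + sgn p r * sgn q r * (x3 * y1 * z2 * e5)
      + sgn p q * sgn p r * sgn q r * (x3 * y2 * z1 * e6)
  | zero => simp
  | add X Y _ _ h1 h2 =>
    simp only [map_add, mul_add, sum_add_distrib, h1, h2]
    ring
  | smul c X _ h => simp only [map_smul, smul_eq_mul, h, mul_add, mul_sum, mul_left_comm]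

/-! ### Polarized plane waves -/

/-- The pairing of a covector with a vector. -/
def dot (p e : 𝕍) : ℂ := ∑ μ, p μ * e μ

/-- The Minkowski product. -/
def mink (e e' : 𝕍) : ℂ := ∑ μ, η μ * (e μ * e' μ)

/-- The contraction with the totally antisymmetric tensor. -/
def vol (p e e' e'' : 𝕍) : ℂ :=
  ∑ ρ, ∑ σ, ∑ μ, ∑ ν, η ρ * lc ρ σ μ ν * (p ρ * e σ * e' μ * e'' ν)

lemma contract_four (A B C E : ℂ) (p e e' e'' : 𝕍) :
    ∑ ρ, η ρ * p ρ * ∑ σ, e σ * ∑ μ, e' μ * ∑ ν, e'' ν *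
      (A * ((if ρ = σ then η ρ else 0) * (if μ = ν then η μ else 0))
      + B * ((if ρ = μ then η ρ else 0) * (if σ = ν then η σ else 0))
      + C * ((if ρ = ν then η ρ else 0) * (if σ = μ then η σ else 0)) + E * lc ρ σ μ ν) =
    A * (dot p e * mink e' e'') + B * (dot p e' * mink e e'') + C * (dot p e'' * mink e e')
      + E * vol p e e' e'' := by
  have dm : ∀ p e e' e'' : Fin 4 → ℂ, dot p e * mink e' e'' =
      ∑ μ, ∑ ν, p μ * e μ * (η ν * (e' ν * e'' ν)) := fun _ _ _ _ => sum_mul_sum ..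
  simp only [mul_add, sum_add_distrib, dm]
  refine congrArg₂ _ (congrArg₂ _ (congrArg₂ _ ?_ ?_) ?_) ?_
  · simp only [mul_sum, mul_ite, ite_mul, mul_zero, zero_mul,
      sum_ite_eq, mem_univ, if_true, sum_const_zero, Finset.sum_ite_irrel]
    refine sum_ext fun μ => sum_ext fun ν => ?_
    linear_combination A * p μ * e μ * η ν * e' ν * e'' ν * η_mul_self μ
  · simp only [mul_sum, mul_ite, ite_mul, mul_zero, zero_mul, sum_ite_eq, mem_univ, if_true]
    refine sum_ext fun μ => sum_ext fun ν => ?_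
    linear_combination B * p μ * e' μ * η ν * e ν * e'' ν * η_mul_self μ
  · simp only [mul_sum, mul_ite, ite_mul, mul_zero, zero_mul,
      sum_ite_eq, mem_univ, if_true, sum_const_zero, Finset.sum_ite_irrel]
    refine sum_ext fun μ => sum_ext fun ν => ?_
    linear_combination C * p μ * e'' μ * η ν * e ν * e' ν * η_mul_self μ
  · simp only [vol, mul_sum]
    refine sum_ext fun _ => sum_ext fun _ => sum_ext fun _ => sum_ext fun _ => ?_
    ring

def vpol (a : 𝒱) (e : 𝕍) (f : ℱ) : ℂ := ∑ μ, e μ * ind (.v a μ) f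

abbrev wV (a : 𝒱) (e p : 𝕍) : 𝒬 := pure (vpol a e) (mono p)
abbrev wU (a : 𝒱) (p : 𝕍) : 𝒬 := pure (ind (.u a)) (mono p)
abbrev wUt (a : 𝒱) (p : 𝕍) : 𝒬 := pure (ind (.ut a)) (mono p)
abbrev wS (s : 𝒮) (p : 𝕍) : 𝒬 := optState (scField s) (mono p)

def optInd (f : Option ℱ) : ℱ → ℂ := f.elim (fun _ => 0) ind

lemma optState_eq (f : Option ℱ) (χ : (Fin 4 →₀ ℕ) → ℂ) : optState f χ = pure (optInd f) χ := by
  cases f with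
  | none => ext x; simp [optState, optInd, pure]
  | some f => rfl

lemma pure_vpol (a : 𝒱) (e : 𝕍) (χ : (Fin 4 →₀ ℕ) → ℂ) :
    pure (I₃ := I₃) (I₄ := I₄) (vpol a e) χ = fun x => ∑ μ, e μ * pure (ind (.v a μ)) χ x := by
  ext x
  simp only [pure, vpol, sum_mul, mul_assoc]

section

variable {T : Jet I₁ I₂ I₃ I₄} (hT : T ∈ trilin I₁ I₂ I₃ I₄)
include hT

lemma tri_vpol_left {p q r : Bool} (a : 𝒱) (e : 𝕍) (χ : (Fin 4 →₀ ℕ) → ℂ)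
    (g h : 𝒬) : tri p q r (pure (vpol a e) χ) g h T =
      ∑ μ, e μ * tri p q r (pure (ind (.v a μ)) χ) g h T := by rw [pure_vpol, tri_sum_left hT]

lemma tri_vpol_mid {p q r : Bool} (a : 𝒱) (e : 𝕍) (χ : (Fin 4 →₀ ℕ) → ℂ)
    (g h : 𝒬) : tri p q r g (pure (vpol a e) χ) h T =
      ∑ μ, e μ * tri p q r g (pure (ind (.v a μ)) χ) h T := by rw [pure_vpol, tri_sum_mid hT]

lemma tri_vpol_right {p q r : Bool} (a : 𝒱) (e : 𝕍) (χ : (Fin 4 →₀ ℕ) → ℂ)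
    (g h : 𝒬) : tri p q r g h (pure (vpol a e) χ) T =
      ∑ μ, e μ * tri p q r g h (pure (ind (.v a μ)) χ) T := by
  rw [tri_swap_right hT, tri_vpol_mid hT, mul_sum]
  refine sum_ext fun μ => ?_
  rw [tri_swap_right (p := p) (q := r) (r := q) hT]
  ring

end

section

variable (𝓜 : Model I₁ I₂ I₃ I₄) (a : I₁ ⊕ I₂)

lemma inv_U : 𝓜.Inv (stU a) := 𝓜.inv_scalar (g := .u a) trivial

lemma inv_Ut : 𝓜.Inv (stUt a) := 𝓜.inv_scalar (g := .ut a) trivial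

lemma vec_U : 𝓜.Vec (stDU a) := 𝓜.vec_scalar (g := .u a) trivial

lemma vec_Ut : 𝓜.Vec (stDUt a) := 𝓜.vec_scalar (g := .ut a) trivial

end

section

variable {T : Jet I₁ I₂ I₃ I₄} (hT : T ∈ cubic I₁ I₂ I₃ I₄ 4 0) {𝓜 : Model I₁ I₂ I₃ I₄}
  (hs : 𝓜.IsScalar T)
include hT hs

lemma tri_wave_vvv (a b c : 𝒱) (e₁ e₂ e₃ k₁ k₂ k₃ : 𝕍) :
    tri false false false (wV a e₁ k₁) (wV b e₂ k₂) (wV c e₃ k₃) T =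
      cA T a b c * (dot k₁ e₁ * mink e₂ e₃) + cB T a b c * (dot k₁ e₂ * mink e₁ e₃)
      + cB T a c b * (dot k₁ e₃ * mink e₁ e₂) + cE T a b c * vol k₁ e₁ e₂ e₃
      + (cA T b a c * (dot k₂ e₂ * mink e₁ e₃) + cB T b a c * (dot k₂ e₁ * mink e₂ e₃)
      + cB T b c a * (dot k₂ e₃ * mink e₂ e₁) + cE T b a c * vol k₂ e₂ e₁ e₃)
      + (cA T c a b * (dot k₃ e₃ * mink e₁ e₂) + cB T c a b * (dot k₃ e₁ * mink e₃ e₂)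
      + cB T c b a * (dot k₃ e₂ * mink e₃ e₁) + cE T c a b * vol k₃ e₃ e₁ e₂) := by
  have hl := cubic_le_lowTrilin _ hT
  have ht := lowTrilin_le_trilin hl
  have key : ∀ (a b c : 𝒱) (e₁ e₂ e₃ k : 𝕍), ∑ σ, η σ * k σ *
      tri false false false (pure (vpol a e₁) (der1 σ)) (pure (vpol b e₂) der0)
        (pure (vpol c e₃) der0) T =
      cA T a b c * (dot k e₁ * mink e₂ e₃) + cB T a b c * (dot k e₂ * mink e₁ e₃)
      + cB T a c b * (dot k e₃ * mink e₁ e₂) + cE T a b c * vol k e₁ e₂ e₃ := fun a b c e₁ e₂ e₃ k => by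
    rw [← contract_four]
    refine sum_ext fun σ => ?_
    rw [tri_vpol_left ht]
    congr 1
    refine sum_ext fun μ => ?_
    rw [tri_vpol_mid ht]
    congr 1
    refine sum_ext fun ν => ?_
    rw [tri_vpol_right ht]
    congr 1
    refine sum_ext fun l => ?_
    rw [tri_vvv hl hs]
  have h0 : tri false false false (pure (vpol a e₁) der0) (pure (vpol b e₂) der0)
      (pure (vpol c e₃) der0) T = 0 := by
    simp only [tri_vpol_left ht, tri_vpol_mid ht, tri_vpol_right ht,
      tri_vec_vec_vec hl hs (𝓜.vec_v a) (𝓜.vec_v b)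
        (𝓜.vec_v c), mul_zero, sum_const_zero]
  rw [tri_wave hT, h0, key, zero_add]
  congr 1
  · congr 1
    rw [← key]
    refine sum_ext fun σ => ?_
    rw [tri_swap_left ht]
    simp [sgn]
  · rw [← key]
    refine sum_ext fun σ => ?_
    rw [tri_swap_right ht,
      tri_swap_left ht]
    simp [sgn]

lemma contract_two (A : ℂ) (e e' : 𝕍) :
    ∑ μ, e μ * ∑ ν, e' ν * (if μ = ν then η μ * A else 0) = A * mink e e' := by
  simp only [mink, mul_sum, mul_ite, mul_zero, sum_ite_eq, mem_univ, if_true]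
  exact sum_ext fun μ => by ring

lemma contract_dot (A : ℂ) (p e : 𝕍) :
    ∑ σ, η σ * p σ * ∑ μ, e μ * (if σ = μ then η σ * A else 0) = A * dot p e := by
  simp only [dot, mul_sum, mul_ite, mul_zero, sum_ite_eq, mem_univ, if_true]
  exact sum_ext fun μ => by linear_combination A * p μ * e μ * η_mul_self μ

lemma tri_wave_vvs (a b : 𝒱) (s : 𝒮) (e₁ e₂ k₁ k₂ k₃ : 𝕍) :
    tri false false false (wV a e₁ k₁) (wV b e₂ k₂) (wS s k₃) T = cK T a b s * mink e₁ e₂ := by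
  have hl := cubic_le_lowTrilin _ hT
  have ht := lowTrilin_le_trilin hl
  rw [wS, optState_eq, tri_wave hT]
  simp only [← optState_eq]
  have h1 : ∀ σ, tri false false false (pure (vpol a e₁) (der1 σ)) (pure (vpol b e₂) der0)
      (stS s) T = 0 := fun σ => by
    simp only [tri_vpol_left ht, tri_vpol_mid ht, tri_ten_vec
      hl hs (𝓜.ten_v a) (𝓜.vec_v b) (inv_S 𝓜 s), mul_zero, sum_const_zero]
  have h2 : ∀ σ, tri false false false (pure (vpol a e₁) der0) (pure (vpol b e₂) (der1 σ))
      (stS s) T = 0 := fun σ => by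
    rw [tri_swap_left ht]
    simp only [tri_vpol_left ht, tri_vpol_mid ht, tri_ten_vec
      hl hs (𝓜.ten_v b) (𝓜.vec_v a) (inv_S 𝓜 s), mul_zero, sum_const_zero]
  have h3 : ∀ σ, tri false false false (pure (vpol a e₁) der0) (pure (vpol b e₂) der0)
      (stDS s σ) T = 0 := fun σ => by
    simp only [tri_vpol_left ht, tri_vpol_mid ht, tri_vec_vec_vec
      (r := false) hl hs (𝓜.vec_v a) (𝓜.vec_v b) (vec_S 𝓜 s), mul_zero, sum_const_zero]
  simp only [h1, h2, h3, mul_zero, sum_const_zero, add_zero]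
  rw [tri_vpol_left ht, ← contract_two hT hs]
  refine sum_ext fun μ => ?_
  rw [tri_vpol_mid ht]
  congr 1
  refine sum_ext fun ν => ?_
  rw [tri_vec_vec hl hs (𝓜.vec_v a) (𝓜.vec_v b) (inv_S 𝓜 s)]
  rfl

lemma tri_wave_vss (a : 𝒱) (s t : 𝒮) (e k₁ k₂ k₃ : 𝕍) :
    tri false false false (wV a e k₁) (wS s k₂) (wS t k₃) T =
      cD T a s t * dot k₁ e + cR T a s t * dot k₂ e + cR T a t s * dot k₃ e := by
  have hl := cubic_le_lowTrilin _ hT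
  have ht := lowTrilin_le_trilin hl
  rw [wS, wS, optState_eq, optState_eq, tri_wave hT]
  simp only [← optState_eq]
  have h0 : tri false false false (pure (vpol a e) der0) (stS s) (stS t) T = 0 := by
    simp only [tri_vpol_left ht, tri_vec
      hl hs (𝓜.vec_v a) (inv_S 𝓜 s) (inv_S 𝓜 t), mul_zero, sum_const_zero]
  have h1 : ∀ σ, tri false false false (pure (vpol a e) (der1 σ)) (stS s) (stS t) T =
      ∑ μ, e μ * (if σ = μ then η σ * cD T a s t else 0) := fun σ => by
    rw [tri_vpol_left ht]
    refine sum_ext fun μ => ?_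
    rw [tri_ten hl hs (𝓜.ten_v a) (inv_S 𝓜 s) (inv_S 𝓜 t)]
    rfl
  have h2 : ∀ s t σ, tri false false false (pure (vpol a e) der0) (stDS s σ) (stS t) T =
      ∑ μ, e μ * (if σ = μ then η σ * cR T a s t else 0) := fun s t σ => by
    rw [tri_vpol_left ht]
    refine sum_ext fun μ => ?_
    rw [tri_vec_vec hl hs (𝓜.vec_v a) (vec_S 𝓜 s)
      (inv_S 𝓜 t)]
    by_cases h : σ = μ
    · subst h; rfl
    · rw [if_neg h, if_neg (Ne.symm h)]
  have h3 : ∀ σ, tri false false false (pure (vpol a e) der0) (stS s) (stDS t σ) T =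
      tri false false false (pure (vpol a e) der0) (stDS t σ) (stS s) T := fun σ => by
    rw [tri_swap_right ht]
    simp [sgn]
  simp only [h0, h1, h2, h3, contract_dot hT hs, zero_add]

lemma tri_wave_sss (s t r : 𝒮) (k₁ k₂ k₃ : 𝕍) :
    tri false false false (wS s k₁) (wS t k₂) (wS r k₃) T = cS T s t r := by
  have hl := cubic_le_lowTrilin _ hT
  have ht := lowTrilin_le_trilin hl
  rw [wS, wS, wS, optState_eq, optState_eq, optState_eq, tri_wave hT]
  simp only [← optState_eq]
  have h1 : ∀ s t r σ, tri false false false (stDS s σ) (stS t) (stS r) T = 0 := fun s t r σ =>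
    tri_vec hl hs (vec_S 𝓜 s) (inv_S 𝓜 t) (inv_S 𝓜 r) σ
  have h2 : ∀ s t r σ, tri false false false (stS s) (stDS t σ) (stS r) T = 0 := fun s t r σ => by
    rw [tri_swap_left ht, h1, mul_zero]
  have h3 : ∀ s t r σ, tri false false false (stS s) (stS t) (stDS r σ) T = 0 := fun s t r σ => by
    rw [tri_swap_right ht, h2, mul_zero]
  simp only [h1, h2, h3, mul_zero, sum_const_zero, add_zero]
  rfl

lemma tri_wave_vuut (c a b : 𝒱) (e k₁ k₂ k₃ : 𝕍) :
    tri false true true (wV c e k₁) (wU a k₂) (wUt b k₃) T =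
      cX T c a b * dot k₁ e + cY T a c b * dot k₂ e - cZ T b c a * dot k₃ e := by
  have hl := cubic_le_lowTrilin _ hT
  have ht := lowTrilin_le_trilin hl
  rw [tri_wave hT]
  have h0 : tri false true true (pure (vpol c e) der0) (stU a) (stUt b) T = 0 := by
    simp only [tri_vpol_left ht, tri_vec
      hl hs (𝓜.vec_v c) (inv_U 𝓜 a) (inv_Ut 𝓜 b), mul_zero, sum_const_zero]
  have h1 : ∀ σ, tri false true true (pure (vpol c e) (der1 σ)) (stU a) (stUt b) T =
      ∑ μ, e μ * (if σ = μ then η σ * cX T c a b else 0) := fun σ => by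
    rw [tri_vpol_left ht]
    refine sum_ext fun μ => ?_
    rw [tri_ten hl hs (𝓜.ten_v c) (inv_U 𝓜 a) (inv_Ut 𝓜 b)]
    rfl
  have h2 : ∀ σ, tri false true true (pure (vpol c e) der0) (stDU a σ) (stUt b) T =
      ∑ μ, e μ * (if σ = μ then η σ * cY T a c b else 0) := fun σ => by
    rw [tri_vpol_left ht]
    refine sum_ext fun μ => ?_
    rw [tri_swap_left ht,
      tri_vec_vec hl hs (vec_U 𝓜 a) (𝓜.vec_v c) (inv_Ut 𝓜 b)]
    simp [sgn, cY]
  have h3 : ∀ σ, tri false true true (pure (vpol c e) der0) (stU a) (stDUt b σ) T =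
      ∑ μ, e μ * (if σ = μ then η σ * -cZ T b c a else 0) := fun σ => by
    rw [tri_vpol_left ht]
    refine sum_ext fun μ => ?_
    rw [tri_swap_right ht,
      tri_swap_left ht,
      tri_vec_vec hl hs (vec_Ut 𝓜 b) (𝓜.vec_v c) (inv_U 𝓜 a)]
    simp [sgn, cZ]
  simp only [h0, h1, h2, h3, contract_dot hT hs, zero_add]
  ring

lemma tri_wave_uuts (a b : 𝒱) (s : 𝒮) (k₁ k₂ k₃ : 𝕍) :
    tri true true false (wU a k₁) (wUt b k₂) (wS s k₃) T = cW T a b s := by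
  have hl := cubic_le_lowTrilin _ hT
  have ht := lowTrilin_le_trilin hl
  rw [wS, optState_eq, tri_wave hT]
  simp only [← optState_eq]
  have h1 : ∀ σ, tri true true false (stDU a σ) (stUt b) (stS s) T = 0 := fun σ =>
    tri_vec hl hs (vec_U 𝓜 a) (inv_Ut 𝓜 b) (inv_S 𝓜 s) σ
  have h2 : ∀ σ, tri true true false (stU a) (stDUt b σ) (stS s) T = 0 := fun σ => by
    rw [tri_swap_left ht,
      tri_vec hl hs (vec_Ut 𝓜 b) (inv_U 𝓜 a) (inv_S 𝓜 s), mul_zero]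
  have h3 : ∀ σ, tri true true false (stU a) (stUt b) (stDS s σ) T = 0 := fun σ => by
    rw [tri_swap_right ht,
      tri_swap_left ht,
      tri_vec hl hs (vec_S 𝓜 s) (inv_U 𝓜 a) (inv_Ut 𝓜 b), mul_zero,
      mul_zero]
  simp only [h1, h2, h3, mul_zero, sum_const_zero, add_zero]
  rfl

end

/-! ### The gauge charge on plane waves -/

/-- The mass in the Klein-Gordon equation of a field. -/
def Model.mass (𝓜 : ℳ) : ℱ → ℂ
  | .v a _ => 𝓜.m a
  | .u a => 𝓜.m a
  | .ut a => 𝓜.m a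
  | .Phi b => 𝓜.m (.inr b)
  | .phi j => 𝓜.mS j
  | .psi A _ => 𝓜.mD A
  | .psibar A _ => 𝓜.mD A

lemma ev_kleinGordon (φ : ℱ → ℂ) (p : 𝕍) (f : ℱ) (m : ℂ)
    (J : 𝔻) : ev (pure φ (mono p)) (Model.kleinGordon f m J) =
      mono p J * (φ f * (mink p p + m ^ 2)) := by
  simp only [Model.kleinGordon, map_add, map_smul, ev_jet, pure, mono_add, mono_single, smul_eq_mul,
    mink, Fin.sum_univ_four]
  ring

lemma Model.onShell_pure (𝓜 : ℳ) {φ : ℱ → ℂ} {p : Fin 4 → ℂ}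
    (h : ∀ f, φ f * (mink p p + 𝓜.mass f ^ 2) = 0) (h1 : ∀ A α, φ (.psi A α) = 0)
    (h2 : ∀ A α, φ (.psibar A α) = 0) : 𝓜.OnShell (pure φ (mono p)) := fun E hE => by
  cases hE with
  | v a μ J => rw [ev_kleinGordon]; exact mul_eq_zero_of_right _ (h (.v a μ))
  | u a J => rw [ev_kleinGordon]; exact mul_eq_zero_of_right _ (h (.u a))
  | ut a J => rw [ev_kleinGordon]; exact mul_eq_zero_of_right _ (h (.ut a))
  | Phi a J => rw [ev_kleinGordon]; exact mul_eq_zero_of_right _ (h (.Phi a))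
  | phi a J => rw [ev_kleinGordon]; exact mul_eq_zero_of_right _ (h (.phi a))
  | psi A α J => simp [pure, h1]
  | psibar A α J => simp [pure, h2]

/-- The state obtained by the action of the gauge charge. -/
def Model.Q (𝓜 : ℳ) (f : 𝒬) : 𝒬 := fun x => ev f (𝓜.gaugeVar x)

lemma tri_d {B : 𝒥} (hB : B ∈ trilin _ _ _ _) (p q r : Bool)
    (φ₁ φ₂ φ₃ : ℱ → ℂ) (k₁ k₂ k₃ : 𝕍) (μ : Fin 4) :
    tri p q r (pure φ₁ (mono k₁)) (pure φ₂ (mono k₂)) (pure φ₃ (mono k₃)) (d μ B) =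
      (k₁ μ + k₂ μ + k₃ μ) *
        tri p q r (pure φ₁ (mono k₁)) (pure φ₂ (mono k₂)) (pure φ₃ (mono k₃)) B := by
  have e : ∀ (φ : ℱ → ℂ) (k : 𝕍),
      (fun x : 𝒳 => ev (pure φ (mono k)) (jet x.field (x.J + Finsupp.single μ 1))) =
        fun x => k μ * pure φ (mono k) x + 0 * pure φ (mono k) x := fun φ k => by
    ext x
    simp only [ev_jet, pure, mono_add, mono_single]
    ring
  rw [d, tri_superDerivation _ _ _ _ _ _ _ hB]
  simp only [e, tri_add_left hB, tri_add_mid hB, tri_add_right hB, Bool.false_xor, sgn,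
    Bool.false_and]
  simp
  ring

lemma Model.IsInteraction.tri_eq_zero {𝓜 : ℳ} {T : 𝒥}
    {Tv : Fin 4 → 𝒥} (hT : 𝓜.IsInteraction T Tv) (p q r : Bool)
    {φ₁ φ₂ φ₃ : ℱ → ℂ} {k₁ k₂ k₃ : Fin 4 → ℂ}
    (h₁ : 𝓜.OnShell (pure φ₁ (mono k₁))) (h₂ : 𝓜.OnShell (pure φ₂ (mono k₂)))
    (h₃ : 𝓜.OnShell (pure φ₃ (mono k₃))) (hk : ∀ μ, k₁ μ + k₂ μ + k₃ μ = 0) :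
    tri (!p) q r (𝓜.Q (pure φ₁ (mono k₁))) (pure φ₂ (mono k₂)) (pure φ₃ (mono k₃)) T
    + sgn true p * tri p (!q) r (pure φ₁ (mono k₁)) (𝓜.Q (pure φ₂ (mono k₂))) (pure φ₃ (mono k₃)) T
    + sgn true p * sgn true q *
      tri p q (!r) (pure φ₁ (mono k₁)) (pure φ₂ (mono k₂)) (𝓜.Q (pure φ₃ (mono k₃))) T = 0 := by
  have h := tri_congr (p := p) (q := q) (r := r) h₁ h₂ h₃ hT.gauge
  rw [map_smul, map_sum] at h
  simp only [tri_d (cubic_le_trilin _ _ (hT.memv _)), hk, zero_mul, sum_const_zero, smul_zero] at h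
  rw [Model.dQ, tri_superDerivation _ _ _ _ _ _ _ (cubic_le_trilin _ _ hT.mem)] at h
  simp only [Bool.true_xor] at h
  exact h

/-- The mass of a scalar field. -/
def Model.mSc (𝓜 : ℳ) : 𝒮 → ℂ
  | .inl a => 𝓜.m a
  | .inr j => 𝓜.mS j

lemma optInd_scField_psi (s : 𝒮) (A : I₄) (α : Fin 4) :
    optInd (scField s) (.psi A α) = 0 ∧ optInd (scField s) (.psibar A α) = 0 := by
  rcases s with (a | b) | j <;> simp [optInd, scField, ind]

section

variable (𝓜 : Model I₁ I₂ I₃ I₄) {p : Fin 4 → ℂ}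

lemma onShell_wV {a : 𝒱} (e : 𝕍) (h : mink p p + 𝓜.m a ^ 2 = 0) : 𝓜.OnShell (wV a e p) := by
  refine 𝓜.onShell_pure (fun f => ?_) (by simp [vpol, ind]) (by simp [vpol, ind])
  cases f with
  | v b μ =>
    by_cases hb : b = a
    · subst hb; exact mul_eq_zero_of_right _ h
    · simp [vpol, ind, hb]
  | _ => simp [vpol, ind]

lemma onShell_wU {a : 𝒱} (h : mink p p + 𝓜.m a ^ 2 = 0) : 𝓜.OnShell (wU a p) := by
  refine 𝓜.onShell_pure (fun f => ?_) (by simp [ind]) (by simp [ind])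
  cases f with
  | u b =>
    by_cases hb : b = a
    · subst hb; exact mul_eq_zero_of_right _ h
    · simp [ind, hb]
  | _ => simp [ind]

lemma onShell_wS {s : 𝒮} (h : mink p p + 𝓜.mSc s ^ 2 = 0) : 𝓜.OnShell (wS s p) := by
  rw [wS, optState_eq]
  refine 𝓜.onShell_pure (fun f => ?_) (fun A α => (optInd_scField_psi s A α).1)
    (fun A α => (optInd_scField_psi s A α).2)
  rcases s with (a | b) | j
  · simp [optInd, scField]
  · by_cases hf : f = .Phi b
    · subst hf; exact mul_eq_zero_of_right _ h
    · simp [optInd, scField, ind, hf]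
  · by_cases hf : f = .phi j
    · subst hf; exact mul_eq_zero_of_right _ h
    · simp [optInd, scField, ind, hf]

attribute [local simp] Model.Q Model.gaugeVar pure ind vpol wS optState scField jetPhi Model.m

lemma Q_wU (a : 𝒱) (p : 𝕍) : 𝓜.Q (wU a p) = fun x =>
    I * wV a (fun μ => η μ * p μ) p x + (I * 𝓜.m a) * wS (.inl a) p x := by
  ext ⟨f, J⟩
  cases f with
  | v b μ =>
    by_cases hb : b = a
    · subst hb
      rcases b with b | b <;>
      simp [mono_add, mono_single] <;> ring
    · rcases a with a | a <;>
      simp [hb]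
  | Phi b =>
    rcases a with a | a
    · simp
    · by_cases hb : b = a
      · subst hb
        simp
      · simp [hb]
  | ut b =>
    rcases a with a | a <;> rcases b with b | b <;> simp
  | _ =>
    rcases a with a | a <;> simp

lemma Q_wV (a : 𝒱) (e p : 𝕍) : 𝓜.Q (wV a e p) = fun x =>
    (-I * dot p e) * wUt a p x + 0 * wUt a p x := by
  ext ⟨f, J⟩
  cases f with
  | ut b =>
    by_cases hb : b = a
    · subst hb
      rcases b with b | b <;>
      simp [mono_add, mono_single, dot, Fin.sum_univ_four] <;> ring
    · rcases b with b | b <;>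
      simp [hb]
  | v b μ => simp
  | Phi b => simp
  | _ => simp

lemma Q_wS_inl (a : 𝒱) (p : 𝕍) : 𝓜.Q (wS (.inl a) p) = fun x =>
    (-I * 𝓜.m a) * wUt a p x + 0 * wUt a p x := by
  ext ⟨f, J⟩
  rcases a with a | a
  · cases f with
    | ut b => rcases b with b | b <;> simp
    | _ => simp
  · cases f with
    | ut b =>
      rcases b with b | b
      · simp
      · by_cases hb : b = a
        · subst hb
          simp
          ring
        · simp [hb]
    | _ => simp

lemma Q_wS_inr (j : I₃) (p : 𝕍) :
    𝓜.Q (wS (I₄ := I₄) (.inr j) p) = fun _ => 0 := by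
  ext ⟨f, J⟩
  cases f with
  | ut b => rcases b with b | b <;> simp
  | _ => simp

end

/-! ### The consequences of gauge invariance for the coefficients -/

lemma vol_eq (p e e' e'' : 𝕍) : vol p e e' e'' =
    ∑ ρ, η ρ * p ρ * ∑ σ, e σ * ∑ μ, e' μ * ∑ ν, e'' ν * lc ρ σ μ ν := by
  simp only [vol, mul_sum]
  refine sum_ext fun _ => sum_ext fun _ => sum_ext fun _ => sum_ext fun _ => ?_
  ring

lemma vol_explicit (p e e' e'' : 𝕍) : vol p e e' e'' =
    (p 0 * e 1 + p 1 * e 0) * (e' 2 * e'' 3 - e' 3 * e'' 2)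
    - (p 0 * e 2 + p 2 * e 0) * (e' 1 * e'' 3 - e' 3 * e'' 1)
    + (p 0 * e 3 + p 3 * e 0) * (e' 1 * e'' 2 - e' 2 * e'' 1)
    - (p 1 * e 2 - p 2 * e 1) * (e' 0 * e'' 3 - e' 3 * e'' 0)
    + (p 1 * e 3 - p 3 * e 1) * (e' 0 * e'' 2 - e' 2 * e'' 0)
    - (p 2 * e 3 - p 3 * e 2) * (e' 0 * e'' 1 - e' 1 * e'' 0) := by
  rw [vol_eq]
  simp only [Fin.sum_univ_four]
  simp [lc, η]
  ring

lemma dot_η (p e : 𝕍) : mink (fun μ => η μ * p μ) e = dot p e := by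
  refine sum_ext fun μ => ?_
  linear_combination p μ * e μ * η_mul_self μ

lemma dot_η' (p q : 𝕍) : dot p (fun μ => η μ * q μ) = mink p q := sum_ext fun μ => by ring

lemma mink_comm (p q : 𝕍) : mink p q = mink q p := sum_ext fun μ => by ring

section

variable {T : Jet I₁ I₂ I₃ I₄} {Tv : Fin 4 → Jet I₁ I₂ I₃ I₄} {𝓜 : Model I₁ I₂ I₃ I₄}
  (hT : 𝓜.IsInteraction T Tv)
include hT

lemma gauge_uvv (a b c : 𝒱) {k₁ k₂ k₃ : Fin 4 → ℂ} (e₂ e₃ : 𝕍)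
    (h₁ : mink k₁ k₁ + 𝓜.m a ^ 2 = 0) (h₂ : mink k₂ k₂ + 𝓜.m b ^ 2 = 0)
    (h₃ : mink k₃ k₃ + 𝓜.m c ^ 2 = 0) (hk : ∀ μ, k₁ μ + k₂ μ + k₃ μ = 0) :
    cA T a b c * (mink k₁ k₁ * mink e₂ e₃) + cB T a b c * (dot k₁ e₂ * dot k₁ e₃)
      + cB T a c b * (dot k₁ e₃ * dot k₁ e₂) + cE T a b c * vol k₁ (fun μ => η μ * k₁ μ) e₂ e₃
      + (cA T b a c * (dot k₂ e₂ * dot k₁ e₃) + cB T b a c * (mink k₂ k₁ * mink e₂ e₃)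
      + cB T b c a * (dot k₂ e₃ * dot k₁ e₂) + cE T b a c * vol k₂ e₂ (fun μ => η μ * k₁ μ) e₃)
      + (cA T c a b * (dot k₃ e₃ * dot k₁ e₂) + cB T c a b * (mink k₃ k₁ * mink e₂ e₃)
      + cB T c b a * (dot k₃ e₂ * dot k₁ e₃) + cE T c a b * vol k₃ e₃ (fun μ => η μ * k₁ μ) e₂)
      + 𝓜.m a * (cK T b c (.inl a) * mink e₂ e₃)
      + dot k₂ e₂ * (cX T c a b * dot k₃ e₃ + cY T a c b * dot k₁ e₃ - cZ T b c a * dot k₂ e₃)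
      + dot k₃ e₃ * (cX T b a c * dot k₂ e₂ + cY T a b c * dot k₁ e₂ - cZ T c b a * dot k₃ e₂)
      = 0 := by
  have ht := cubic_le_trilin _ _ hT.mem
  have h := hT.tri_eq_zero true false false (onShell_wU 𝓜 h₁) (onShell_wV 𝓜 e₂ h₂)
    (onShell_wV 𝓜 e₃ h₃) hk
  rw [Q_wU, Q_wV, Q_wV, tri_add_left ht, tri_add_mid ht, tri_add_right ht] at h
  simp only [Bool.not_true, Bool.not_false] at h
  rw [tri_wave_vvv hT.mem hT.scalar, tri_swap_left ht,
    tri_swap_right ht,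
    tri_wave_vvs hT.mem hT.scalar,
    tri_swap_right ht,
    tri_swap_left ht,
    tri_wave_vuut hT.mem hT.scalar,
    tri_swap_left ht,
    tri_wave_vuut hT.mem hT.scalar] at h
  simp only [sgn, Bool.and_false, Bool.and_true, Bool.and_self, dot_η, dot_η',
    mink_comm _ (fun μ => η μ * k₁ μ), if_true, Bool.false_eq_true, if_false] at h
  rw [mink_comm e₃ e₂] at h
  linear_combination -I * h + (cA T a b c * (mink k₁ k₁ * mink e₂ e₃) + cB T a b c * (dot k₁ e₂ * dot k₁ e₃)
      + cB T a c b * (dot k₁ e₃ * dot k₁ e₂) + cE T a b c * vol k₁ (fun μ => η μ * k₁ μ) e₂ e₃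
      + (cA T b a c * (dot k₂ e₂ * dot k₁ e₃) + cB T b a c * (mink k₂ k₁ * mink e₂ e₃)
      + cB T b c a * (dot k₂ e₃ * dot k₁ e₂) + cE T b a c * vol k₂ e₂ (fun μ => η μ * k₁ μ) e₃)
      + (cA T c a b * (dot k₃ e₃ * dot k₁ e₂) + cB T c a b * (mink k₃ k₁ * mink e₂ e₃)
      + cB T c b a * (dot k₃ e₂ * dot k₁ e₃) + cE T c a b * vol k₃ e₃ (fun μ => η μ * k₁ μ) e₂)
      + 𝓜.m a * (cK T b c (.inl a) * mink e₂ e₃)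
      + dot k₂ e₂ * (cX T c a b * dot k₃ e₃ + cY T a c b * dot k₁ e₃ - cZ T b c a * dot k₂ e₃)
      + dot k₃ e₃ * (cX T b a c * dot k₂ e₂ + cY T a b c * dot k₁ e₂ - cZ T c b a * dot k₃ e₂)) * Complex.I_sq

/-- The coefficient with which the scalar field `s` contributes the anti-ghost `ũ_s`. -/
def ghostPart (𝓜 : ℳ) (F : 𝒱 → ℂ) : 𝒮 → ℂ
  | .inl c => 𝓜.m c * F c
  | .inr _ => 0

lemma gauge_uvs (a b : 𝒱) (s : 𝒮) {k₁ k₂ k₃ : Fin 4 → ℂ} (e : 𝕍)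
    (h₁ : mink k₁ k₁ + 𝓜.m a ^ 2 = 0) (h₂ : mink k₂ k₂ + 𝓜.m b ^ 2 = 0)
    (h₃ : mink k₃ k₃ + 𝓜.mSc s ^ 2 = 0) (hk : ∀ μ, k₁ μ + k₂ μ + k₃ μ = 0) :
    cK T a b s * dot k₁ e + 𝓜.m a * (cD T b (.inl a) s * dot k₂ e + cR T b (.inl a) s * dot k₁ e
      + cR T b s (.inl a) * dot k₃ e) + cW T a b s * dot k₂ e
      + ghostPart 𝓜 (fun c => cX T b a c * dot k₂ e + cY T a b c * dot k₁ e
        - cZ T c b a * dot k₃ e) s = 0 := by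
  have ht := cubic_le_trilin _ _ hT.mem
  have oS := onShell_wS 𝓜 h₃
  have hQ : ∃ w : ℂ, tri true false true (wU a k₁) (wV b e k₂) (𝓜.Q (wS s k₃)) T =
      -I * w ∧ w = ghostPart 𝓜 (fun c => cX T b a c * dot k₂ e + cY T a b c * dot k₁ e
        - cZ T c b a * dot k₃ e) s := by
    refine ⟨_, ?_, rfl⟩
    rcases s with c | j
    · rw [Q_wS_inl, tri_add_right ht, tri_swap_left ht,
        tri_wave_vuut hT.mem hT.scalar]
      simp [sgn, ghostPart]
      ring
    · rw [Q_wS_inr, tri_zero_right ht]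
      simp [ghostPart]
  obtain ⟨w, hw, hw'⟩ := hQ
  rw [← hw']
  have h := hT.tri_eq_zero true false false (onShell_wU 𝓜 h₁) (onShell_wV 𝓜 e h₂)
    (φ₃ := optInd (scField s)) (k₃ := k₃) (by rw [← optState_eq]; exact oS) hk
  rw [← optState_eq, Q_wU, Q_wV, tri_add_left ht, tri_add_mid ht] at h
  simp only [Bool.not_true, Bool.not_false] at h
  rw [hw, tri_wave_vvs hT.mem hT.scalar, tri_swap_left ht,
    tri_wave_vss hT.mem hT.scalar, tri_wave_uuts hT.mem hT.scalar] at h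
  simp only [sgn, Bool.and_false, Bool.and_self, dot_η, if_true, Bool.false_eq_true, if_false] at h
  linear_combination -I * h + (cK T a b s * dot k₁ e + 𝓜.m a * (cD T b (.inl a) s * dot k₂ e + cR T b (.inl a) s * dot k₁ e
      + cR T b s (.inl a) * dot k₃ e) + cW T a b s * dot k₂ e + w) * Complex.I_sq

lemma gauge_uss (a : 𝒱) (s t : 𝒮) {k₁ k₂ k₃ : Fin 4 → ℂ}
    (h₁ : mink k₁ k₁ + 𝓜.m a ^ 2 = 0) (h₂ : mink k₂ k₂ + 𝓜.mSc s ^ 2 = 0)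
    (h₃ : mink k₃ k₃ + 𝓜.mSc t ^ 2 = 0) (hk : ∀ μ, k₁ μ + k₂ μ + k₃ μ = 0) :
    cD T a s t * mink k₁ k₁ + cR T a s t * mink k₂ k₁ + cR T a t s * mink k₃ k₁
      + 𝓜.m a * cS T (.inl a) s t + ghostPart 𝓜 (fun c => cW T a c t) s
      + ghostPart 𝓜 (fun c => cW T a c s) t = 0 := by
  have ht := cubic_le_trilin _ _ hT.mem
  have o2 := onShell_wS 𝓜 h₂
  have o3 := onShell_wS 𝓜 h₃
  have hQ : ∀ (s t : 𝒮) (k₂ k₃ : 𝕍),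
      tri true true false (wU a k₁) (𝓜.Q (wS s k₂)) (wS t k₃) T =
      -I * ghostPart 𝓜 (fun c => cW T a c t) s := fun s t k₂ k₃ => by
    rcases s with c | j
    · rw [Q_wS_inl, tri_add_mid ht, tri_wave_uuts hT.mem hT.scalar]
      simp [ghostPart]
      ring
    · rw [Q_wS_inr, tri_zero_mid ht]
      simp [ghostPart]
  have h := hT.tri_eq_zero true false false (onShell_wU 𝓜 h₁)
    (φ₂ := optInd (scField s)) (k₂ := k₂) (by rw [← optState_eq]; exact o2)
    (φ₃ := optInd (scField t)) (k₃ := k₃) (by rw [← optState_eq]; exact o3) hk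
  rw [← optState_eq, ← optState_eq, Q_wU, tri_add_left ht] at h
  simp only [Bool.not_true, Bool.not_false] at h
  rw [tri_swap_right (p := true) (q := true) (r := false) ht, hQ, hQ,
    tri_wave_vss hT.mem hT.scalar, tri_wave_sss hT.mem hT.scalar] at h
  simp only [sgn, Bool.and_false, Bool.and_self, dot_η', if_true, Bool.false_eq_true, if_false] at h
  linear_combination -I * h + (cD T a s t * mink k₁ k₁ + cR T a s t * mink k₂ k₁ + cR T a t s * mink k₃ k₁
      + 𝓜.m a * cS T (.inl a) s t + ghostPart 𝓜 (fun c => cW T a c t) s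
      + ghostPart 𝓜 (fun c => cW T a c s) t) * Complex.I_sq

end

/-- Three momenta with given squares and vanishing sum; `j` is a square root of `-1`. -/
def mom₂ (m₂ : ℂ) : Fin 4 → ℂ := ![(1 - m₂ ^ 2) / 2, -(1 + m₂ ^ 2) / 2, 0, 0]

def mom₃ (j m₁ m₂ m₃ : ℂ) : Fin 4 → ℂ :=
  ![(m₂ ^ 2 + m₃ ^ 2 - m₁ ^ 2) / 2, (m₂ ^ 2 + m₃ ^ 2 - m₁ ^ 2) / 2, (1 + m₃ ^ 2) / 2,
    -(j * (1 - m₃ ^ 2)) / 2]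

def mom₁ (j m₁ m₂ m₃ : ℂ) (μ : Fin 4) : ℂ := -mom₂ m₂ μ - mom₃ j m₁ m₂ m₃ μ

/-- A polarization with given scalar products with the momenta. -/
def polar (j A B : ℂ) : Fin 4 → ℂ := ![A, -A, B, B * j]

lemma mink_explicit (p q : 𝕍) :
    mink p q = p 0 * q 0 - p 1 * q 1 - p 2 * q 2 - p 3 * q 3 := by
  simp [mink, Fin.sum_univ_four, η]
  ring

lemma dot_explicit (p q : 𝕍) : dot p q = p 0 * q 0 + p 1 * q 1 + p 2 * q 2 + p 3 * q 3 := by simp [dot, Fin.sum_univ_four]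

section

variable {j : ℂ} (hj : j ^ 2 = -1) (m₁ m₂ m₃ A B C D : ℂ)

lemma mom_sum (μ : Fin 4) : mom₁ j m₁ m₂ m₃ μ + mom₂ m₂ μ + mom₃ j m₁ m₂ m₃ μ = 0 := by
  simp [mom₁]
  ring

lemma mink_mom₂ : mink (mom₂ m₂) (mom₂ m₂) + m₂ ^ 2 = 0 := by
  rw [mink_explicit]
  simp [mom₂]
  ring

lemma dot_mom₂ : dot (mom₂ m₂) (polar j A B) = A := by
  rw [dot_explicit]
  simp [mom₂, polar]
  ring

include hj

lemma mink_polar : mink (polar j A B) (polar j C D) = 0 := by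
  rw [mink_explicit]
  simp [polar]
  linear_combination (-(B * D)) * hj

lemma mink_mom₃ : mink (mom₃ j m₁ m₂ m₃) (mom₃ j m₁ m₂ m₃) + m₃ ^ 2 = 0 := by
  rw [mink_explicit]
  simp [mom₃]
  linear_combination (-(1 - m₃ ^ 2) ^ 2 / 4) * hj

lemma mink_mom₁ : mink (mom₁ j m₁ m₂ m₃) (mom₁ j m₁ m₂ m₃) + m₁ ^ 2 = 0 := by
  rw [mink_explicit]
  simp [mom₁, mom₂, mom₃]
  linear_combination (-(1 - m₃ ^ 2) ^ 2 / 4) * hj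

lemma dot_mom₃ : dot (mom₃ j m₁ m₂ m₃) (polar j A B) = B := by
  rw [dot_explicit]
  simp [mom₃, polar]
  linear_combination (-(1 - m₃ ^ 2) * B / 2) * hj

lemma dot_mom₁ : dot (mom₁ j m₁ m₂ m₃) (polar j A B) = -A - B := by
  rw [dot_explicit]
  simp [mom₁, mom₂, mom₃, polar]
  linear_combination ((1 - m₃ ^ 2) * B / 2) * hj

lemma mink_mom₂₁ : mink (mom₂ m₂) (mom₁ j m₁ m₂ m₃) = (m₁ ^ 2 + m₂ ^ 2 - m₃ ^ 2) / 2 := by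
  rw [mink_explicit]
  simp [mom₁, mom₂, mom₃]
  ring

lemma mink_mom₃₁ : mink (mom₃ j m₁ m₂ m₃) (mom₁ j m₁ m₂ m₃) = (m₁ ^ 2 + m₃ ^ 2 - m₂ ^ 2) / 2 := by
  rw [mink_explicit]
  simp [mom₁, mom₂, mom₃]
  linear_combination ((1 - m₃ ^ 2) ^ 2 / 4) * hj

lemma vol_mom₂ : vol (mom₂ m₂) (polar j A B) (fun μ => η μ * mom₁ j m₁ m₂ m₃ μ) (polar j C D) =
    -j * (A * D - B * C) := by
  rw [vol_explicit]
  simp [mom₁, mom₂, mom₃, polar, η]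
  ring

lemma vol_mom₃ : vol (mom₃ j m₁ m₂ m₃) (polar j C D) (fun μ => η μ * mom₁ j m₁ m₂ m₃ μ)
    (polar j A B) = -j * (A * D - B * C) := by
  rw [vol_explicit]
  simp [mom₁, mom₂, mom₃, polar, η]
  ring

end

lemma vol_self (p e e' : 𝕍) : vol p (fun μ => η μ * p μ) e e' = 0 := by
  rw [vol_explicit]
  simp [η]
  ring

section

variable {T : Jet I₁ I₂ I₃ I₄} {Tv : Fin 4 → Jet I₁ I₂ I₃ I₄} {𝓜 : Model I₁ I₂ I₃ I₄}
  (hT : 𝓜.IsInteraction T Tv) (a b c : I₁ ⊕ I₂)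
include hT

lemma gauge_uvv_polar {j : ℂ} (hj : j ^ 2 = -1) (A B C D : ℂ) :
    cB T a b c * ((-A - B) * (-C - D)) + cB T a c b * ((-A - B) * (-C - D))
      + cA T b a c * (A * (-C - D)) + cB T b c a * (C * (-A - B))
      + cA T c a b * (D * (-A - B)) + cB T c b a * (B * (-C - D))
      - (cE T b a c + cE T c a b) * (j * (A * D - B * C))
      + A * (cX T c a b * D + cY T a c b * (-C - D) - cZ T b c a * C)
      + D * (cX T b a c * A + cY T a b c * (-A - B) - cZ T c b a * B) = 0 := by
  have h := gauge_uvv hT a b c (polar j A B) (polar j C D)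
    (mink_mom₁ hj (𝓜.m a) (𝓜.m b) (𝓜.m c)) (mink_mom₂ (𝓜.m b))
    (mink_mom₃ hj (𝓜.m a) (𝓜.m b) (𝓜.m c)) (mom_sum _ _ _)
  rw [vol_self, vol_mom₂ hj, vol_mom₃ hj, mink_polar hj] at h
  simp only [dot_mom₁ hj, dot_mom₂, dot_mom₃ hj] at h
  linear_combination h

lemma gauge_B : cB T a b c + cB T a c b = cB T b c a + cB T c b a := by
  have h := gauge_uvv_polar hT a b c (j := I) (by simp) 0 1 1 0
  have h' := gauge_uvv_polar hT a b c (j := -I) (by simp) 0 1 1 0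
  linear_combination (h + h') / 2

lemma gauge_Z : cB T a b c + cB T a c b - cA T b a c - cB T b c a - cY T a c b - cZ T b c a = 0 := by
  have h := gauge_uvv_polar hT a b c (j := I) (by simp) 1 0 1 0
  linear_combination h

lemma gauge_X : cB T a b c + cB T a c b - cA T b a c - cA T c a b + cX T c a b + cX T b a c
    - cY T a c b - cY T a b c = 0 := by
  have h := gauge_uvv_polar hT a b c (j := I) (by simp) 1 0 0 1
  have h' := gauge_uvv_polar hT a b c (j := -I) (by simp) 1 0 0 1
  linear_combination (h + h') / 2

lemma gauge_E : cE T b a c + cE T c a b = 0 := by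
  have h := gauge_uvv_polar hT a b c (j := I) (by simp) 1 0 0 1
  have h' := gauge_uvv_polar hT a b c (j := -I) (by simp) 1 0 0 1
  have hI : I * (cE T b a c + cE T c a b) = 0 := by linear_combination (h' - h) / 2
  exact (mul_eq_zero.1 hI).resolve_left Complex.I_ne_zero

lemma gauge_W (s : 𝒮) : cW T a b s = cK T a b s + 𝓜.m a * (cR T b (.inl a) s - cD T b (.inl a) s)
    - ghostPart 𝓜 (fun c => cX T b a c - cY T a b c) s := by
  have hj : I ^ 2 = -1 := by simp
  have h := gauge_uvs hT a b s (polar I 1 0)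
    (mink_mom₁ hj (𝓜.m a) (𝓜.m b) (𝓜.mSc s)) (mink_mom₂ (𝓜.m b))
    (mink_mom₃ hj (𝓜.m a) (𝓜.m b) (𝓜.mSc s)) (mom_sum _ _ _)
  simp only [dot_mom₁ hj, dot_mom₂, dot_mom₃ hj] at h
  rcases s with c | j <;> simp only [ghostPart] at h ⊢ <;> linear_combination h

lemma gauge_K (s : 𝒮) : cK T a b s = 𝓜.m a * (cR T b s (.inl a) - cR T b (.inl a) s)
    - ghostPart 𝓜 (fun c => cY T a b c + cZ T c b a) s := by
  have hj : I ^ 2 = -1 := by simp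
  have h := gauge_uvs hT a b s (polar I 0 1)
    (mink_mom₁ hj (𝓜.m a) (𝓜.m b) (𝓜.mSc s)) (mink_mom₂ (𝓜.m b))
    (mink_mom₃ hj (𝓜.m a) (𝓜.m b) (𝓜.mSc s)) (mom_sum _ _ _)
  simp only [dot_mom₁ hj, dot_mom₂, dot_mom₃ hj] at h
  rcases s with c | j <;> simp only [ghostPart] at h ⊢ <;> linear_combination -h

lemma gauge_S (s t : 𝒮) : 𝓜.m a * cS T (.inl a) s t =
    𝓜.m a ^ 2 * (cD T a s t - (cR T a s t + cR T a t s) / 2)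
    + (𝓜.mSc t ^ 2 - 𝓜.mSc s ^ 2) * ((cR T a s t - cR T a t s) / 2)
    - ghostPart 𝓜 (fun c => cW T a c t) s - ghostPart 𝓜 (fun c => cW T a c s) t := by
  have hj : I ^ 2 = -1 := by simp
  have h := gauge_uss hT a s t (mink_mom₁ hj (𝓜.m a) (𝓜.mSc s) (𝓜.mSc t)) (mink_mom₂ (𝓜.mSc s))
    (mink_mom₃ hj (𝓜.m a) (𝓜.mSc s) (𝓜.mSc t)) (mom_sum _ _ _)
  rw [mink_mom₂₁ hj, mink_mom₃₁ hj] at h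
  linear_combination h - cD T a s t * mink_mom₁ hj (𝓜.m a) (𝓜.mSc s) (𝓜.mSc t)

end

section

variable {T : Jet I₁ I₂ I₃ I₄} (hT : T ∈ trilin I₁ I₂ I₃ I₄)
include hT

lemma cA_symm (c a b : 𝒱) : cA T c b a = cA T c a b := by
  rw [cA, tri_swap_right hT]
  simp [sgn, cA]

lemma cK_symm (a b : 𝒱) (s : 𝒮) : cK T b a s = cK T a b s := by
  rw [cK, tri_swap_left hT]
  simp [sgn, cK]

lemma cD_symm (a : 𝒱) (s t : 𝒮) : cD T a t s = cD T a s t := by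
  rw [cD, tri_swap_right hT]
  simp [sgn, cD]

lemma cS_symm_left (s t r : 𝒮) : cS T t s r = cS T s t r := by
  rw [cS, tri_swap_left hT]
  simp [sgn, cS]

lemma cS_symm_right (s t r : 𝒮) : cS T s r t = cS T s t r := by
  rw [cS, tri_swap_right hT]
  simp [sgn, cS]

lemma cE_antisymm {𝓜 : ℳ} (hl : T ∈ lowTrilin _ _ _ _) (hs : 𝓜.IsScalar T)
    (c a b : 𝒱) : cE T c b a = -cE T c a b := by
  rw [cE, tri_swap_right hT, tri_vvv hl hs]
  simp [sgn, show (0 : Fin 4) ≠ 3 by decide, show (0 : Fin 4) ≠ 2 by decide,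
    show (1 : Fin 4) ≠ 2 by decide, show (1 : Fin 4) ≠ 3 by decide,
    show (3 : Fin 4) ≠ 2 by decide]
  norm_num [lc]

end

/-! ### Equality modulo the equations of motion -/

namespace Model.OnShellEq

variable {𝓜 : Model I₁ I₂ I₃ I₄} {A B C D : Jet I₁ I₂ I₃ I₄}

lemma refl (A : 𝒥) : 𝓜.OnShellEq A A := by
  unfold Model.OnShellEq
  rw [sub_self]
  exact zero_mem _

lemma of_eq (h : A = B) : 𝓜.OnShellEq A B := h ▸ refl A

lemma symm (h : 𝓜.OnShellEq A B) : 𝓜.OnShellEq B A := by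
  unfold Model.OnShellEq at *
  rw [← neg_sub]
  exact neg_mem h

lemma trans (h : 𝓜.OnShellEq A B) (h' : 𝓜.OnShellEq B C) : 𝓜.OnShellEq A C := by
  unfold Model.OnShellEq at *
  rw [← sub_add_sub_cancel A B C]
  exact add_mem h h'

lemma add (h : 𝓜.OnShellEq A B) (h' : 𝓜.OnShellEq C D) : 𝓜.OnShellEq (A + C) (B + D) := by
  unfold Model.OnShellEq at *
  rw [add_sub_add_comm]
  exact add_mem h h'

lemma mul_left (X : 𝒥) (h : 𝓜.OnShellEq A B) : 𝓜.OnShellEq (X * A) (X * B) := by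
  unfold Model.OnShellEq at *
  rw [← mul_sub]
  exact TwoSidedIdeal.mul_mem_left _ _ _ h

lemma mul_right (X : 𝒥) (h : 𝓜.OnShellEq A B) : 𝓜.OnShellEq (A * X) (B * X) := by
  unfold Model.OnShellEq at *
  rw [← sub_mul]
  exact TwoSidedIdeal.mul_mem_right _ _ _ h

lemma smul (c : ℂ) (h : 𝓜.OnShellEq A B) : 𝓜.OnShellEq (c • A) (c • B) := by
  rw [Algebra.smul_def, Algebra.smul_def]
  exact h.mul_left _

lemma sum {ι : Type*} (s : Finset ι) {F G : ι → 𝒥}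
    (h : ∀ i ∈ s, 𝓜.OnShellEq (F i) (G i)) : 𝓜.OnShellEq (∑ i ∈ s, F i) (∑ i ∈ s, G i) := by
  classical
  induction s using Finset.induction_on with
  | empty => exact of_eq rfl
  | insert i s hi ih =>
    rw [Finset.sum_insert hi, Finset.sum_insert hi]
    exact (h i (Finset.mem_insert_self i s)).add (ih fun k hk => h k (Finset.mem_insert_of_mem hk))

lemma of_eom (h : 𝓜.IsEOM (A - B)) : 𝓜.OnShellEq A B := TwoSidedIdeal.subset_span h

end Model.OnShellEq

/-! ### The currents -/

section

variable (𝓜 : Model I₁ I₂ I₃ I₄)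

lemma dirac_psi (A : I₄) (α : Fin 4) : 𝓜.OnShellEq
    (∑ μ, ∑ β, 𝓜.γUp μ α β • d μ (psi A β)) ((-I * 𝓜.mD A) • psi A α) := by
  have h : 𝓜.IsEOM (I • (∑ μ, ∑ β, 𝓜.γUp μ α β • d μ (psi A β)) - 𝓜.mD A • psi A α) := by
    simp only [psi, d_jet]
    exact .psi A α 0
  have e := Model.OnShellEq.smul (-I) (Model.OnShellEq.of_eom h)
  rwa [smul_smul, smul_smul, neg_mul, Complex.I_mul_I, neg_neg, one_smul] at e

lemma dirac_psibar (A : I₄) (α : Fin 4) : 𝓜.OnShellEq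
    (∑ μ, ∑ β, 𝓜.γUp μ β α • d μ (psibar A β)) ((I * 𝓜.mD A) • psibar A α) := by
  have h : 𝓜.IsEOM (I • (∑ μ, ∑ β, 𝓜.γUp μ β α • d μ (psibar A β)) + 𝓜.mD A • psibar A α) := by
    simp only [psibar, d_jet]
    exact .psibar A α 0
  have e := Model.OnShellEq.smul (-I) (Model.OnShellEq.of_eom
    ((sub_neg_eq_add _ (𝓜.mD A • psibar A α)).symm ▸ h))
  refine .trans (.symm (.trans (.symm e) (.of_eq ?_))) (.of_eq ?_)
  · rw [smul_smul, neg_mul, Complex.I_mul_I, neg_neg, one_smul]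
  · module

lemma γ_mul_γε (μ : Fin 4) (ε : ℤˣ) : 𝓜.γ μ * 𝓜.γε ε = 𝓜.γε (-ε) * 𝓜.γ μ := by
  have h := 𝓜.γ₅_anticomm μ
  simp only [Model.γε, mul_smul_comm, smul_mul_assoc, mul_add, add_mul, mul_one, one_mul,
    Units.val_neg, Int.cast_neg, neg_smul, smul_neg, neg_mul, h, neg_neg]

lemma γUp_mul_γε (μ : Fin 4) (ε : ℤˣ) : 𝓜.γUp μ * 𝓜.γε ε = 𝓜.γε (-ε) * 𝓜.γUp μ := by
  rw [Model.γUp, smul_mul_assoc, mul_smul_comm, γ_mul_γε]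

variable [Fintype I₄]

lemma d_bilinear (μ : Fin 4) (k : Matrix I₄ I₄ ℂ) (Γ : 𝕄) :
    d μ (Model.bilinear (I₁ := I₁) (I₂ := I₂) (I₃ := I₃) k Γ) =
      ∑ A, ∑ B, ∑ α, ∑ β, (k A B * Γ α β) • (d μ (psibar A α) * psi B β)
      + ∑ A, ∑ B, ∑ α, ∑ β, (k A B * Γ α β) • (psibar A α * d μ (psi B β)) := by
  simp only [Model.bilinear, map_sum, map_smul, d_mul, smul_add, sum_add_distrib]

lemma sum_perm_six' {A B C D E G X : Type*} [Fintype A] [Fintype B] [Fintype C] [Fintype D]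
    [Fintype E] [Fintype G] [AddCommMonoid X] (f : A → B → C → D → E → G → X) :
    ∑ a, ∑ b, ∑ c, ∑ d, ∑ e, ∑ g, f a b c d e g = ∑ b, ∑ c, ∑ g, ∑ e, ∑ a, ∑ d, f a b c d e g := by
  simp only [← Fintype.sum_prod_type']
  exact Fintype.sum_equiv ⟨fun x => (x.2.1, x.2.2.1, x.2.2.2.2.2, x.2.2.2.2.1, x.1, x.2.2.2.1),
      fun y => (y.2.2.2.2.1, y.1, y.2.1, y.2.2.2.2.2, y.2.2.2.1, y.2.2.1), fun _ => rfl,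
      fun _ => rfl⟩ _ _ fun _ => rfl

lemma sum_perm_six'' {A B C D E G X : Type*} [Fintype A] [Fintype B] [Fintype C] [Fintype D]
    [Fintype E] [Fintype G] [AddCommMonoid X] (f : A → B → C → D → E → G → X) :
    ∑ a, ∑ b, ∑ c, ∑ d, ∑ e, ∑ g, f a b c d e g = ∑ b, ∑ c, ∑ d, ∑ g, ∑ a, ∑ e, f a b c d e g := by
  simp only [← Fintype.sum_prod_type']
  exact Fintype.sum_equiv ⟨fun x => (x.2.1, x.2.2.1, x.2.2.2.1, x.2.2.2.2.2, x.1, x.2.2.2.2.1),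
      fun y => (y.2.2.2.2.1, y.1, y.2.1, y.2.2.1, y.2.2.2.2.2, y.2.2.2.1), fun _ => rfl,
      fun _ => rfl⟩ _ _ fun _ => rfl

lemma divergence_bilinear (k : Matrix I₄ I₄ ℂ) {Γ Γ' : 𝕄} (h : ∀ μ, 𝓜.γUp μ * Γ = Γ' * 𝓜.γUp μ) :
    𝓜.OnShellEq (∑ μ, d μ (Model.bilinear k (𝓜.γUp μ * Γ)))
      (Model.bilinear (.of fun A B => I * 𝓜.mD A * k A B) Γ
        + Model.bilinear (.of fun A B => -I * 𝓜.mD B * k A B) Γ') := by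
  simp only [d_bilinear, sum_add_distrib]
  refine .add ?_ ?_
  · have e : ∑ μ, ∑ A, ∑ B, ∑ α, ∑ β, (k A B * (𝓜.γUp μ * Γ) α β) •
        (d μ (psibar A α) * psi B β : 𝒥) = ∑ A, ∑ B, ∑ δ, ∑ β,
        (k A B * Γ δ β) • ((∑ μ, ∑ α, 𝓜.γUp μ α δ • d μ (psibar A α)) * psi B β) := by
      simp only [Matrix.mul_apply, mul_sum, sum_smul, sum_mul,
        smul_sum, smul_mul_assoc, smul_smul]
      rw [sum_perm_six']
      refine sum_ext fun _ => sum_ext fun _ =>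
        sum_ext fun _ => sum_ext fun _ =>
        sum_ext fun _ => sum_ext fun _ => ?_
      congr 1
      ring
    rw [e]
    simp only [Model.bilinear, Matrix.of_apply]
    refine .sum _ fun A _ => .sum _ fun B _ => .sum _ fun α _ => .sum _ fun β _ => ?_
    refine .trans (.smul _ (.mul_right _ (dirac_psibar 𝓜 A α))) (.of_eq ?_)
    rw [smul_mul_assoc, smul_smul]
    congr 1
    ring
  · have e : ∑ μ, ∑ A, ∑ B, ∑ α, ∑ β, (k A B * (𝓜.γUp μ * Γ) α β) •
        (psibar A α * d μ (psi B β) : 𝒥) = ∑ A, ∑ B, ∑ α, ∑ δ,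
        (k A B * Γ' α δ) • (psibar A α * (∑ μ, ∑ β, 𝓜.γUp μ δ β • d μ (psi B β))) := by
      simp only [h]
      simp only [Matrix.mul_apply, mul_sum, sum_smul, smul_sum, mul_smul_comm, smul_smul]
      rw [sum_perm_six'']
      refine sum_ext fun _ => sum_ext fun _ =>
        sum_ext fun _ => sum_ext fun _ =>
        sum_ext fun _ => sum_ext fun _ => ?_
      congr 1
      ring
    rw [e]
    simp only [Model.bilinear, Matrix.of_apply]
    refine .sum _ fun A _ => .sum _ fun B _ => .sum _ fun α _ => .sum _ fun β _ => ?_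
    refine .trans (.smul _ (.mul_left _ (dirac_psi 𝓜 B β))) (.of_eq ?_)
    rw [mul_smul_comm, smul_smul]
    congr 1
    ring

lemma bilinear_add (k k' : Matrix I₄ I₄ ℂ) (Γ : 𝕄) :
    Model.bilinear (I₁ := I₁) (I₂ := I₂) (I₃ := I₃) (k + k') Γ =
      Model.bilinear k Γ + Model.bilinear k' Γ := by
  simp only [Model.bilinear, Matrix.add_apply, add_mul, add_smul, sum_add_distrib]

/-- The mass term in the divergence of a current. -/
def massTerm (t : ℤˣ → Matrix I₄ I₄ ℂ) (ε : ℤˣ) : Matrix I₄ I₄ ℂ := .of fun A B =>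
  I * (𝓜.mD A * t ε A B - t (-ε) A B * 𝓜.mD B)

lemma divergence_vectorCurrent (t : ℤˣ → Matrix I₄ I₄ ℂ) :
    𝓜.OnShellEq (∑ μ, d μ (𝓜.vectorCurrent t μ))
      (𝓜.scalarCurrent (massTerm 𝓜 t)) := by
  have e : ∑ μ, d μ (𝓜.vectorCurrent t μ) =
      ∑ ε, ∑ μ, d μ (Model.bilinear (t ε) (𝓜.γUp μ * 𝓜.γε ε)) := by
    simp only [Model.vectorCurrent, map_sum]
    exact sum_comm
  rw [e]
  refine .trans (.sum _ fun ε _ => divergence_bilinear 𝓜 (t ε) fun μ => γUp_mul_γε 𝓜 μ ε)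
    (.of_eq ?_)
  rw [Model.scalarCurrent, sum_sign, sum_sign, neg_neg]
  have e' : ∀ ε, massTerm 𝓜 t ε = .of (fun A B => I * 𝓜.mD A * t ε A B)
      + .of (fun A B => -I * 𝓜.mD B * t (-ε) A B) := fun ε => by
    ext A B
    simp only [massTerm, Matrix.add_apply, Matrix.of_apply]
    ring
  rw [e', e', bilinear_add, bilinear_add, neg_neg]
  abel

end

/-! ### Dirac waves -/

section

variable (𝓜 : Model I₁ I₂ I₃ I₄)

/-- `γ^μ k_μ`. -/
def Model.slash (k : 𝕍) : 𝕄 := ∑ μ, k μ • 𝓜.γUp μ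

lemma slash_sq (k : 𝕍) : 𝓜.slash k * 𝓜.slash k = mink k k • 1 := by
  have h : (2 : ℂ) • (𝓜.slash k * 𝓜.slash k) = (2 : ℂ) • (mink k k • 1) := by
    have e1 : 𝓜.slash k * 𝓜.slash k = ∑ μ, ∑ ν, (η μ * k μ * (η ν * k ν)) • (𝓜.γ μ * 𝓜.γ ν) := by
      simp only [Model.slash, Model.γUp, sum_mul_sum, smul_mul_assoc, mul_smul_comm, smul_smul]
      refine sum_ext fun μ => sum_ext fun ν => ?_
      congr 1
      ring
    have e2 : 𝓜.slash k * 𝓜.slash k = ∑ μ, ∑ ν, (η μ * k μ * (η ν * k ν)) • (𝓜.γ ν * 𝓜.γ μ) := by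
      rw [e1, sum_comm]
      refine sum_ext fun μ => sum_ext fun ν => ?_
      congr 1
      ring
    rw [two_smul]
    nth_rewrite 1 [e1]
    rw [e2]
    simp only [← sum_add_distrib, ← smul_add, 𝓜.clifford, mul_ite, mul_zero, smul_smul,
      ite_smul, smul_ite, smul_zero, zero_smul, sum_ite_eq, mem_univ, if_true, mink, sum_smul,
      smul_sum]
    refine sum_ext fun μ => ?_
    congr 1
    linear_combination (2 * η μ * k μ ^ 2 : ℂ) * η_mul_self μ
  exact smul_right_injective _ (two_ne_zero' ℂ) h

lemma slash_neg (k : 𝕍) : 𝓜.slash (fun μ => -k μ) = -𝓜.slash k := by simp [Model.slash]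

/-- Momenta of mass `M` whose difference points in the first space direction. -/
def diracMom (s M : ℂ) : Fin 4 → ℂ := ![(1 - M ^ 2) / 2, s * (1 + M ^ 2) / 2, 0, 0]

lemma mink_diracMom {s : ℂ} (hs : s ^ 2 = 1) (M : ℂ) :
    mink (diracMom s M) (diracMom s M) = -M ^ 2 := by
  rw [mink_explicit]
  simp [diracMom]
  linear_combination (-(1 + M ^ 2) ^ 2 / 4) * hs

lemma slash_diracMom (M : ℂ) : 𝓜.slash (diracMom 1 M) - 𝓜.slash (diracMom (-1) M) =
    -(1 + M ^ 2) • 𝓜.γ 1 := by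
  simp [Model.slash, Model.γUp, Fin.sum_univ_four, diracMom, η]
  module

lemma one_add_sq_ne_zero (r : ℝ) : -(1 + (r : ℂ) ^ 2) ≠ 0 := by
  rw [neg_ne_zero]
  have : (1 + r ^ 2 : ℝ) ≠ 0 := by positivity
  exact_mod_cast this

lemma γ_one_sq : 𝓜.γ 1 * 𝓜.γ 1 = -1 := by
  have h := 𝓜.clifford 1 1
  rw [if_pos rfl, ← two_smul ℂ, mul_smul] at h
  have h' := smul_right_injective _ (two_ne_zero' ℂ) h
  rw [h']
  simp [η]

lemma eq_zero_of_mul_dirac (r : ℝ) {Y : 𝕄}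
    (h : ∀ k, mink k k = -(r : ℂ) ^ 2 → Y * (I • 𝓜.slash k + (r : ℂ) • 1) = 0) : Y = 0 := by
  have h1 : ∀ k, mink k k = -(r : ℂ) ^ 2 → Y * 𝓜.slash k = 0 := fun k hk => by
    have a := h k hk
    have b := h (fun μ => -k μ) (by simpa [mink] using hk)
    rw [slash_neg] at b
    have e : (2 * I) • (Y * 𝓜.slash k) =
        Y * (I • 𝓜.slash k + (r : ℂ) • 1) - Y * (I • -𝓜.slash k + (r : ℂ) • 1) := by
      rw [← mul_sub, ← mul_smul_comm]
      congr 1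
      module
    rw [a, b, sub_zero] at e
    exact (smul_eq_zero.1 e).resolve_left (by simp)
  have h2 : Y * (-(1 + (r : ℂ) ^ 2) • 𝓜.γ 1) = 0 := by
    rw [← slash_diracMom, mul_sub, h1 _ (mink_diracMom (by norm_num) _),
      h1 _ (mink_diracMom (by norm_num) _), sub_zero]
  rw [mul_smul_comm] at h2
  have h3 := (smul_eq_zero.1 h2).resolve_left (one_add_sq_ne_zero r)
  have h4 : Y * 𝓜.γ 1 * 𝓜.γ 1 = 0 := by rw [h3, zero_mul]
  rw [mul_assoc, γ_one_sq, mul_neg, mul_one] at h4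
  exact neg_eq_zero.1 h4

lemma eq_zero_of_dirac_mul (r : ℝ) {Y : 𝕄}
    (h : ∀ k, mink k k = -(r : ℂ) ^ 2 → (I • 𝓜.slash k - (r : ℂ) • 1) * Y = 0) : Y = 0 := by
  have h1 : ∀ k, mink k k = -(r : ℂ) ^ 2 → 𝓜.slash k * Y = 0 := fun k hk => by
    have a := h k hk
    have b := h (fun μ => -k μ) (by simpa [mink] using hk)
    rw [slash_neg] at b
    have e : (2 * I) • (𝓜.slash k * Y) =
        (I • 𝓜.slash k - (r : ℂ) • 1) * Y - (I • -𝓜.slash k - (r : ℂ) • 1) * Y := by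
      rw [← sub_mul, ← smul_mul_assoc]
      congr 1
      module
    rw [a, b, sub_zero] at e
    exact (smul_eq_zero.1 e).resolve_left (by simp)
  have h2 : (-(1 + (r : ℂ) ^ 2) • 𝓜.γ 1) * Y = 0 := by
    rw [← slash_diracMom, sub_mul, h1 _ (mink_diracMom (by norm_num) _),
      h1 _ (mink_diracMom (by norm_num) _), sub_zero]
  rw [smul_mul_assoc] at h2
  have h3 := (smul_eq_zero.1 h2).resolve_left (one_add_sq_ne_zero r)
  have h4 : 𝓜.γ 1 * (𝓜.γ 1 * Y) = 0 := by rw [h3, mul_zero]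
  rw [← mul_assoc, γ_one_sq, neg_mul, one_mul] at h4
  exact neg_eq_zero.1 h4

/-- Solutions of the Dirac equation and of its conjugate. -/
def Model.IsSpinor (M : ℂ) (k w : 𝕍) : Prop :=
  mink k k = -M ^ 2 ∧ (I • 𝓜.slash k) *ᵥ w = M • w

def Model.IsCospinor (M : ℂ) (k w : 𝕍) : Prop :=
  mink k k = -M ^ 2 ∧ w ᵥ* (I • 𝓜.slash k) = (-M) • w

lemma dirac_sq {M : ℂ} {k : Fin 4 → ℂ} (hk : mink k k = -M ^ 2) :
    (I • 𝓜.slash k) * (I • 𝓜.slash k) = M ^ 2 • 1 := by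
  rw [smul_mul_smul_comm, slash_sq, smul_smul, hk, Complex.I_mul_I]
  congr 1
  ring

lemma eq_zero_of_spinors (r s : ℝ) {X : 𝕄}
    (h : ∀ k w k' w', 𝓜.IsCospinor r k' w' → 𝓜.IsSpinor s k w → w' ⬝ᵥ (X *ᵥ w) = 0) : X = 0 := by
  refine eq_zero_of_mul_dirac 𝓜 s fun k hk => eq_zero_of_dirac_mul 𝓜 r fun k' hk' => ?_
  ext i j
  set P := I • 𝓜.slash k + (s : ℂ) • (1 : 𝕄) with hP
  set P' := I • 𝓜.slash k' - (r : ℂ) • (1 : 𝕄) with hP'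
  have e1 : (I • 𝓜.slash k) * P = (s : ℂ) • P := by
    rw [hP, mul_add, dirac_sq 𝓜 hk, mul_smul_comm, mul_one]
    module
  have e2 : P' * (I • 𝓜.slash k') = (-(r : ℂ)) • P' := by
    rw [hP', sub_mul, dirac_sq 𝓜 hk', smul_mul_assoc, one_mul]
    module
  have := h k (fun β => P β j) k' (fun α => P' i α) ⟨hk', ?_⟩ ⟨hk, ?_⟩
  · rw [Matrix.zero_apply, ← this, Matrix.mul_apply]
    refine sum_ext fun l => ?_
    rw [Matrix.mul_apply]
    rfl
  · ext l
    exact congrFun (congrFun e2 i) l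
  · ext l
    exact congrFun (congrFun e1 l) j

lemma γε_independent {x : ℤˣ → ℂ} (h : ∑ ε, x ε • 𝓜.γε ε = 0) (ε : ℤˣ) : x ε = 0 := by
  have key : ∀ ε : ℤˣ, 𝓜.γ₅ * 𝓜.γε ε = ((ε : ℤ) : ℂ) • 𝓜.γε ε := fun ε => by
    rcases Int.units_eq_one_or ε with rfl | rfl <;>
    simp only [Model.γε, mul_smul_comm, mul_add, mul_one, 𝓜.γ₅_sq, Units.val_one, Units.val_neg,
      Int.cast_one, Int.cast_neg] <;> module
  have h5 := congrArg (fun X => 𝓜.γ₅ * X) h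
  rw [sum_sign] at h
  simp only [sum_sign, mul_add, mul_smul_comm, key, Units.val_one, Units.val_neg,
    Int.cast_one, Int.cast_neg, mul_zero] at h5
  have ne : ∀ ε : ℤˣ, 𝓜.γε ε ≠ 0 := fun ε h0 => by
    have h1 : 𝓜.γε (-ε) * 𝓜.γ 1 = 0 := by rw [← γ_mul_γε, h0, mul_zero]
    have h2 : 𝓜.γε (-ε) * 𝓜.γ 1 * 𝓜.γ 1 = 0 := by rw [h1, zero_mul]
    rw [mul_assoc, γ_one_sq, mul_neg, mul_one, neg_eq_zero] at h2
    have h3 : 𝓜.γε ε + 𝓜.γε (-ε) = 1 := by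
      simp only [Model.γε, Units.val_neg, Int.cast_neg]
      module
    rw [h0, h2, add_zero] at h3
    exact zero_ne_one h3
  have a : (2 * x 1) • 𝓜.γε 1 = 0 := by
    have : (2 * x 1) • 𝓜.γε 1 = (x 1 • 𝓜.γε 1 + x (-1) • 𝓜.γε (-1)) +
      (x 1 • (1 : ℂ) • 𝓜.γε 1 + x (-1) • (-1 : ℂ) • 𝓜.γε (-1)) := by module
    rw [this, h, h5, add_zero]
  have b : (2 * x (-1)) • 𝓜.γε (-1) = 0 := by
    have : (2 * x (-1)) • 𝓜.γε (-1) = (x 1 • 𝓜.γε 1 + x (-1) • 𝓜.γε (-1)) -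
      (x 1 • (1 : ℂ) • 𝓜.γε 1 + x (-1) • (-1 : ℂ) • 𝓜.γε (-1)) := by module
    rw [this, h, h5, sub_zero]
  rcases Int.units_eq_one_or ε with rfl | rfl
  · simpa using (smul_eq_zero.1 a).resolve_right (ne 1)
  · simpa using (smul_eq_zero.1 b).resolve_right (ne (-1))

end

/-! ### Gauge invariance of the fermionic terms -/

def spinPol (A : I₄) (w : 𝕍) (f : ℱ) : ℂ := ∑ α, w α * ind (.psi A α) f
def cospinPol (A : I₄) (w : 𝕍) (f : ℱ) : ℂ := ∑ α, w α * ind (.psibar A α) f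

/-- The part of a state without derivatives. -/
def lowPart (f : 𝒬) : 𝒬 := fun x => if x.J = 0 then f x else 0

/-- The state lives on Dirac fields. -/
def IsDiracState (f : 𝒬) : Prop := ∀ x : 𝒳, f x ≠ 0 → x.field.dim = 3 / 2

lemma isDiracState_psi (A : I₄) (w : 𝕍) (χ : (Fin 4 →₀ ℕ) → ℂ) :
    IsDiracState (pure (spinPol (I₁ := I₁) (I₂ := I₂) (I₃ := I₃) A w) χ) := by
  rintro ⟨f, J⟩ h
  cases f <;> first | rfl | exact absurd (by simp [pure, spinPol, ind]) h

lemma isDiracState_psibar (A : I₄) (w : 𝕍) (χ : (Fin 4 →₀ ℕ) → ℂ) :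
    IsDiracState (pure (cospinPol (I₁ := I₁) (I₂ := I₂) (I₃ := I₃) A w) χ) := by
  rintro ⟨f, J⟩ h
  cases f <;> first | rfl | exact absurd (by simp [pure, cospinPol, ind]) h

lemma dirac_mul {f g h : 𝒬} (hf : IsDiracState f) (hg : IsDiracState g)
    {x y z : 𝒳} (hd : x.dim + y.dim + z.dim ≤ 4) :
    f x * g y * h z = lowPart f x * lowPart g y * lowPart h z := by
  by_cases hx : f x = 0
  · simp [lowPart, hx]
  by_cases hy : g y = 0
  · simp [lowPart, hy]
  have h1 := hf x hx
  have h2 := hg y hy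
  have h3 := z.field.one_le_dim
  have n1 := x.sum_J_nonneg
  have n2 := y.sum_J_nonneg
  have n3 := z.sum_J_nonneg
  simp only [JetVar.dim] at hd
  have z0 : ∀ x : 𝒳, ∑ μ, (x.J μ : ℚ) ≤ 0 → x.J = 0 := fun x h => by
    have h' : ∑ μ, x.J μ ≤ 0 := by exact_mod_cast h
    ext μ
    exact Finset.sum_eq_zero_iff.1 (Nat.le_zero.1 h') μ (mem_univ μ)
  rw [lowPart, lowPart, lowPart, if_pos (z0 x (by linarith)), if_pos (z0 y (by linarith)),
    if_pos (z0 z (by linarith))]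

lemma tri_lowPart {f g : 𝒬} (hf : IsDiracState f) (hg : IsDiracState g)
    (h : 𝒬) {n : ℤ} {A : 𝒥} (hA : A ∈ cubic _ _ _ _ 4 n)
    (p q r : Bool) : tri p q r f g h A = tri p q r (lowPart f) (lowPart g) (lowPart h) A := by
  induction hA using Submodule.span_induction with
  | mem A hA =>
    obtain ⟨⟨x, J⟩, ⟨y, K⟩, ⟨z, L⟩, rfl, hd, -, -⟩ := hA
    have hx := jet_mem_lin x J
    have hy := jet_mem_lin y K
    have hz := jet_mem_lin z L
    have fl : ∀ p (f : 𝒬), IsDiracState f → IsDiracState (filt p f) := fun p f hf x hx => by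
      refine hf x fun h0 => hx ?_
      simp [filt, h0]
    have lw : ∀ p (f : 𝒬), lowPart (filt p f) = filt p (lowPart f) := fun p f => by
      ext x
      simp only [lowPart, filt]
      split_ifs <;> rfl
    simp only [tri_mul _ _ _ hx hy hz, ev_jet]
    rw [dirac_mul (fl p f hf) (fl q g hg) (by simpa using hd)]
    have e2 := dirac_mul (h := filt r h) (fl p f hf) (fl q g hg)
      (x := ⟨x, J⟩) (y := ⟨z, L⟩) (z := ⟨y, K⟩) (by linarith)
    have e3 := dirac_mul (h := filt r h) (fl p f hf) (fl q g hg)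
      (x := ⟨y, K⟩) (y := ⟨x, J⟩) (z := ⟨z, L⟩) (by linarith)
    have e4 := dirac_mul (h := filt r h) (fl p f hf) (fl q g hg)
      (x := ⟨z, L⟩) (y := ⟨x, J⟩) (z := ⟨y, K⟩) (by linarith)
    have e5 := dirac_mul (h := filt r h) (fl p f hf) (fl q g hg)
      (x := ⟨y, K⟩) (y := ⟨z, L⟩) (z := ⟨x, J⟩) (by linarith)
    have e6 := dirac_mul (h := filt r h) (fl p f hf) (fl q g hg)
      (x := ⟨z, L⟩) (y := ⟨y, K⟩) (z := ⟨x, J⟩) (by linarith)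
    simp only [lw] at e2 e3 e4 e5 e6 ⊢
    linear_combination sgn q r * e2 + sgn p q * e3 + sgn p q * sgn p r * e4
      + sgn p r * sgn q r * e5 + sgn p q * sgn p r * sgn q r * e6
  | zero => simp
  | add X Y _ _ h1 h2 => simp only [map_add, h1, h2]
  | smul c X _ h => simp only [map_smul, h]

/-- A solution of the Klein-Gordon equation with given first derivatives. -/
def kgWave (m : ℂ) (k : 𝕍) (J : 𝔻) : ℂ :=
  (k 1 ^ 2 + k 2 ^ 2 + k 3 ^ 2 - m ^ 2) ^ (J 0 / 2) * k 0 ^ (J 0 % 2) * k 1 ^ J 1 * k 2 ^ J 2 *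
    k 3 ^ J 3

lemma kgWave_zero (m : ℂ) (k : 𝕍) : kgWave m k 0 = 1 := by simp [kgWave]

lemma kgWave_single (m : ℂ) (k : 𝕍) (μ : Fin 4) :
    kgWave m k (Finsupp.single μ 1) = k μ := by fin_cases μ <;> simp [kgWave]

lemma kgWave_eom (m : ℂ) (k : 𝕍) (J : 𝔻) :
    ∑ μ, η μ * kgWave m k (J + Finsupp.single μ 2) + m ^ 2 * kgWave m k J = 0 := by
  simp [Fin.sum_univ_four, kgWave, Finsupp.single_apply, η, pow_add, pow_succ]
  ring

section

variable (𝓜 : Model I₁ I₂ I₃ I₄)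

lemma onShell_spinor {B : I₄} {k w : Fin 4 → ℂ} (h : 𝓜.IsSpinor (𝓜.mD B) k w) :
    𝓜.OnShell (pure (spinPol B w) (mono k)) := fun E hE => by
  cases hE with
  | psi A α J =>
    by_cases hA : A = B
    · subst hA
      have e := congrFun h.2 α
      simp only [Model.slash, Matrix.mulVec, dotProduct, Matrix.smul_apply,
        Matrix.add_apply, smul_eq_mul, Pi.smul_apply, Fin.sum_univ_four] at e
      simp [pure, spinPol, ind, mono_add, mono_single, Fin.sum_univ_four]
      linear_combination mono k J * e
    · simp [pure, spinPol, ind, hA]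
  | _ => simp [ev_kleinGordon, pure, spinPol, ind]

lemma onShell_cospinor {B : I₄} {k w : Fin 4 → ℂ} (h : 𝓜.IsCospinor (𝓜.mD B) k w) :
    𝓜.OnShell (pure (cospinPol B w) (mono k)) := fun E hE => by
  cases hE with
  | psibar A α J =>
    by_cases hA : A = B
    · subst hA
      have e := congrFun h.2 α
      simp only [Model.slash, Matrix.vecMul, dotProduct, Matrix.smul_apply,
        Matrix.add_apply, smul_eq_mul, Pi.smul_apply, Fin.sum_univ_four] at e
      simp [pure, cospinPol, ind, mono_add, mono_single, Fin.sum_univ_four]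
      linear_combination mono k J * e
    · simp [pure, cospinPol, ind, hA]
  | _ => simp [ev_kleinGordon, pure, cospinPol, ind]

lemma onShell_kgWave (a : 𝒱) (k : 𝕍) :
    𝓜.OnShell (pure (ind (.u a)) (kgWave (𝓜.m a) k)) := fun E hE => by
  cases hE with
  | u b J =>
    by_cases hb : b = a
    · subst hb
      simpa [Model.kleinGordon, pure, ind] using kgWave_eom (𝓜.m b) k J
    · simp [Model.kleinGordon, pure, ind, hb]
  | _ => simp [Model.kleinGordon, pure, ind]

end

section

variable {T : Jet I₁ I₂ I₃ I₄} (hT : T ∈ trilin I₁ I₂ I₃ I₄)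
include hT

lemma tri_spinPol {p q r : Bool} (A B : I₄) (w' w : 𝕍) (h : 𝒬) :
    tri p q r (pure (cospinPol A w') der0) (pure (spinPol B w) der0) h T =
      w' ⬝ᵥ (Matrix.of fun α β => tri p q r (stPsibar A α) (stPsi B β) h T) *ᵥ w := by
  have e1 : pure (I₁ := I₁) (I₂ := I₂) (I₃ := I₃) (cospinPol A w') der0 =
      fun x => ∑ α, w' α * stPsibar A α x := by
    ext x
    simp only [pure, cospinPol, sum_mul, mul_assoc]
  have e2 : pure (I₁ := I₁) (I₂ := I₂) (I₃ := I₃) (spinPol B w) der0 =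
      fun x => ∑ α, w α * stPsi B α x := by
    ext x
    simp only [pure, spinPol, sum_mul, mul_assoc]
  rw [e1, e2, tri_sum_left hT]
  refine sum_ext fun α => ?_
  rw [tri_sum_mid hT]
  congr 1
  exact sum_ext fun β => mul_comm _ _

end

section

variable {T : Jet I₁ I₂ I₃ I₄} {Tv : Fin 4 → Jet I₁ I₂ I₃ I₄} {𝓜 : Model I₁ I₂ I₃ I₄}
  (hT : 𝓜.IsInteraction T Tv)

lemma lowPart_pure (φ : ℱ → ℂ) {χ : (Fin 4 →₀ ℕ) → ℂ} (h : χ 0 = 1) :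
    lowPart (pure φ χ) = pure φ der0 := by
  ext x
  simp only [lowPart, pure, der0]
  split_ifs with h0
  · rw [h0, h]
  · rw [mul_zero]

lemma Q_dirac (𝓜 : ℳ) {φ : ℱ → ℂ} (χ : (Fin 4 →₀ ℕ) → ℂ)
    (h : ∀ f, φ f ≠ 0 → f.dim = 3 / 2) : 𝓜.Q (pure φ χ) = fun _ => 0 := by
  have z : ∀ f : ℱ, f.dim = 1 → φ f = 0 := fun f hf => by
    by_contra h0
    have := h f h0
    rw [hf] at this
    norm_num at this
  ext ⟨f, J⟩
  cases f with
  | v a μ => simp [Model.Q, Model.gaugeVar, pure, z (.u a) rfl]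
  | ut a =>
    rcases a with a | a
    · simp [Model.Q, Model.gaugeVar, pure, jetPhi, z (.v (.inl a) _) rfl]
    · simp [Model.Q, Model.gaugeVar, pure, jetPhi, z (.v (.inr a) _) rfl, z (.Phi a) rfl]
  | Phi b => simp [Model.Q, Model.gaugeVar, pure, z (.u (.inr b)) rfl]
  | _ => simp [Model.Q, Model.gaugeVar]

lemma lowPart_Q_kgWave (𝓜 : ℳ) (a : 𝒱) (k : 𝕍) :
    lowPart (𝓜.Q (pure (ind (.u a)) (kgWave (𝓜.m a) k))) = fun x =>
      I * pure (vpol a (fun μ => η μ * k μ)) der0 x + (I * 𝓜.m a) * stS (.inl a) x := by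
  ext ⟨f, J⟩
  by_cases hJ : J = 0
  · subst hJ
    cases f with
    | v b μ =>
      by_cases hb : b = a
      · subst hb
        rcases b with b | b <;>
        simp [lowPart, Model.Q, Model.gaugeVar, pure, ind, vpol, kgWave_single, optState, scField, der0] <;> ring
      · rcases a with a | a <;>
        simp [lowPart, Model.Q, Model.gaugeVar, pure, ind, vpol, optState, scField, hb]
    | Phi b =>
      rcases a with a | a
      · simp [lowPart, Model.Q, Model.gaugeVar, pure, ind, vpol, optState, scField]
      · by_cases hb : b = a
        · subst hb
          simp [lowPart, Model.Q, Model.gaugeVar, pure, ind, vpol, optState, scField, der0, kgWave_zero]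
        · simp [lowPart, Model.Q, Model.gaugeVar, pure, ind, vpol, optState, scField, hb]
    | ut b =>
      rcases a with a | a <;> rcases b with b | b <;>
        simp [lowPart, Model.Q, Model.gaugeVar, pure, ind, vpol, optState, scField, jetPhi]
    | _ =>
      rcases a with a | a <;>
        simp [lowPart, Model.Q, Model.gaugeVar, pure, ind, vpol, optState, scField]
  · rcases a with a | a <;> simp [lowPart, hJ, pure, der0, optState, scField]

lemma tri_d_dirac {B : 𝒥} {n : ℤ} (hB : B ∈ cubic _ _ _ _ 4 n) (A A' : I₄)
    (a : 𝒱) (w w' k k' l : 𝕍) (m : ℂ) (μ : Fin 4) :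
    tri true true true (pure (cospinPol A w') (mono k')) (pure (spinPol A' w) (mono k))
      (pure (ind (.u a)) (kgWave m l)) (d μ B) = (k' μ + k μ + l μ) *
    tri true true true (pure (cospinPol A w') der0) (pure (spinPol A' w) der0) (stU a) B := by
  have ht := cubic_le_trilin _ _ hB
  have e : ∀ (φ : ℱ → ℂ) (k : 𝕍),
      (fun x : 𝒳 => ev (pure φ (mono k)) (jet x.field (x.J + Finsupp.single μ 1))) =
        fun x => k μ * pure φ (mono k) x + 0 * pure φ (mono k) x := fun φ k => by
    ext x
    simp only [ev_jet, pure, mono_add, mono_single]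
    ring
  have hp := isDiracState_psibar (I₁ := I₁) (I₂ := I₂) (I₃ := I₃) A w' (mono k')
  have hq := isDiracState_psi (I₁ := I₁) (I₂ := I₂) (I₃ := I₃) A' w (mono k)
  have e' : lowPart (fun x : 𝒳 =>
      ev (pure (ind (.u a)) (kgWave m l)) (jet x.field (x.J + Finsupp.single μ 1))) =
      fun x => l μ * stU a x + 0 * stU a x := by
    ext ⟨f, J⟩
    by_cases hJ : J = 0
    · subst hJ
      simp [lowPart, pure, kgWave_single, der0]
      ring
    · simp [lowPart, pure, der0, hJ]
  rw [d, tri_superDerivation _ _ _ _ _ _ _ ht]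
  simp only [e, tri_add_left ht, tri_add_mid ht, Bool.false_xor, sgn, Bool.false_and]
  rw [tri_lowPart hp hq _ hB, tri_lowPart hp hq _ hB true true true,
    lowPart_pure _ (mono_zero _), lowPart_pure _ (mono_zero _), lowPart_pure _ (kgWave_zero _ _), e',
    tri_add_right ht]
  simp
  ring

include hT in
lemma gauge_dirac (a : 𝒱) (A B : I₄) {k k' w w' : Fin 4 → ℂ}
    (h' : 𝓜.IsCospinor (𝓜.mD A) k' w') (h : 𝓜.IsSpinor (𝓜.mD B) k w) :
    tri true true false (pure (cospinPol A w') der0) (pure (spinPol B w) der0)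
      (pure (vpol a (fun μ => η μ * (-k μ - k' μ))) der0) T
    + 𝓜.m a * tri true true false (pure (cospinPol A w') der0) (pure (spinPol B w) der0)
      (stS (.inl a)) T = 0 := by
  have ht := cubic_le_trilin _ _ hT.mem
  have hp := isDiracState_psibar (I₁ := I₁) (I₂ := I₂) (I₃ := I₃) A w' (mono k')
  have hq := isDiracState_psi (I₁ := I₁) (I₂ := I₂) (I₃ := I₃) B w (mono k)
  have g := tri_congr (p := true) (q := true) (r := true) (onShell_cospinor 𝓜 h')
    (onShell_spinor 𝓜 h) (onShell_kgWave 𝓜 a (fun μ => -k μ - k' μ)) hT.gauge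
  rw [map_smul, map_sum] at g
  have z : ∀ μ, k' μ + k μ + (-k μ - k' μ) = 0 := fun μ => by ring
  simp only [tri_d_dirac (hT.memv _), z, zero_mul, sum_const_zero, smul_zero] at g
  rw [Model.dQ, tri_superDerivation _ _ _ _ _ _ _ ht] at g
  have q1 := Q_dirac 𝓜 (mono k') (φ := cospinPol A w')
    fun f hf => isDiracState_psibar A w' (fun _ => 1) ⟨f, 0⟩ (by simpa [pure] using hf)
  have q2 := Q_dirac 𝓜 (mono k) (φ := spinPol B w)
    fun f hf => isDiracState_psi B w (fun _ => 1) ⟨f, 0⟩ (by simpa [pure] using hf)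
  unfold Model.Q at q1 q2
  rw [q1, q2, tri_zero_left ht, tri_zero_mid ht, tri_lowPart hp hq _ hT.mem,
    lowPart_pure _ (mono_zero _), lowPart_pure _ (mono_zero _)] at g
  have q3 := lowPart_Q_kgWave 𝓜 a (fun μ => -k μ - k' μ)
  unfold Model.Q at q3
  rw [q3] at g
  simp only [Bool.true_xor, Bool.not_true] at g
  rw [tri_add_right ht] at g
  simp only [sgn, Bool.and_true, if_true] at g
  linear_combination -I * g + (tri true true false (pure (cospinPol A w') der0) (pure (spinPol B w) der0)
      (pure (vpol a (fun μ => η μ * (-k μ - k' μ))) der0) T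
    + 𝓜.m a * tri true true false (pure (cospinPol A w') der0) (pure (spinPol B w) der0)
      (stS (.inl a)) T) * Complex.I_sq

end

/-! ### The coupling relation of the Dirac fields and the divergence of the currents -/

section

variable (𝓜 : Model I₁ I₂ I₃ I₄)

lemma cospinor_slash {M : ℂ} {k w : Fin 4 → ℂ} (h : 𝓜.IsCospinor M k w) (X : 𝕄) (w' : 𝕍) :
    w ⬝ᵥ (𝓜.slash k * X) *ᵥ w' = I * M * (w ⬝ᵥ X *ᵥ w') := by
  have e := h.2
  rw [Matrix.vecMul_smul] at e
  have e' : w ᵥ* 𝓜.slash k = (I * M) • w := by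
    have := congrArg (fun x => (-I) • x) e
    simp only [smul_smul, neg_mul, Complex.I_mul_I, neg_neg, one_smul] at this
    rw [this]
    congr 1
    ring
  rw [← Matrix.mulVec_mulVec, Matrix.dotProduct_mulVec, e', smul_dotProduct, smul_eq_mul]

lemma slash_spinor {M : ℂ} {k w : Fin 4 → ℂ} (h : 𝓜.IsSpinor M k w) (X : 𝕄) (w' : 𝕍) :
    w' ⬝ᵥ (X * 𝓜.slash k) *ᵥ w = -(I * M) * (w' ⬝ᵥ X *ᵥ w) := by
  have e := h.2
  rw [Matrix.smul_mulVec] at e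
  have e' : 𝓜.slash k *ᵥ w = (-(I * M)) • w := by
    have := congrArg (fun x => (-I) • x) e
    simp only [smul_smul, neg_mul, Complex.I_mul_I, neg_neg, one_smul] at this
    rw [this]
  rw [← Matrix.mulVec_mulVec, e', Matrix.mulVec_smul, dotProduct_smul, smul_eq_mul]

lemma slash_mul_γε (k : 𝕍) (ε : ℤˣ) : 𝓜.slash k * 𝓜.γε ε = 𝓜.γε (-ε) * 𝓜.slash k := by
  simp only [Model.slash, sum_mul, mul_sum, smul_mul_assoc, mul_smul_comm, γUp_mul_γε]

/-- Coefficients of a bilinear are determined by its values on solutions of the Dirac equation. -/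
lemma eq_zero_of_dirac_waves {A B : I₄} {x : ℤˣ → ℂ}
    (h : ∀ k w k' w', 𝓜.IsCospinor (𝓜.mD A) k' w' → 𝓜.IsSpinor (𝓜.mD B) k w →
      ∑ ε, x ε * (w' ⬝ᵥ 𝓜.γε ε *ᵥ w) = 0) (ε : ℤˣ) : x ε = 0 := by
  refine γε_independent 𝓜 (eq_zero_of_spinors 𝓜 (𝓜.massD A) (𝓜.massD B) fun k w k' w' h' h0 => ?_) ε
  rw [Matrix.sum_mulVec, dotProduct_sum]
  simp only [Matrix.smul_mulVec, dotProduct_smul, smul_eq_mul]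
  exact h k w k' w' h' h0

end

section

variable {T : Jet I₁ I₂ I₃ I₄} {Tv : Fin 4 → Jet I₁ I₂ I₃ I₄} {𝓜 : Model I₁ I₂ I₃ I₄}

lemma gauge_current (hT : 𝓜.IsInteraction T Tv) {t : 𝒱 → ℤˣ → Matrix I₄ I₄ ℂ}
    (ht : ∀ a A B α β ρ, tri true true false (stPsibar A α) (stPsi B β) (stV a ρ) T =
      ∑ ε, t a ε A B * (𝓜.γ ρ * 𝓜.γε ε) α β)
    {c : 𝒮 → ℤˣ → Matrix I₄ I₄ ℂ}
    (hc : ∀ s A B α β, tri true true false (stPsibar A α) (stPsi B β) (stS s) T =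
      ∑ ε, c s ε A B * 𝓜.γε ε α β) (a : 𝒱) (ε : ℤˣ) (A B : I₄) :
    I * (𝓜.mD A * t a ε A B - t a (-ε) A B * 𝓜.mD B) = 𝓜.m a * c (.inl a) ε A B := by
  rw [← sub_eq_zero]
  refine eq_zero_of_dirac_waves 𝓜 (A := A) (B := B) (x := fun ε => I *
    (𝓜.mD A * t a ε A B - t a (-ε) A B * 𝓜.mD B) - 𝓜.m a * c (.inl a) ε A B)
    (fun k w k' w' h' h => ?_) ε
  have hl := cubic_le_trilin _ _ hT.mem
  have g := gauge_dirac hT a A B h' h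
  rw [tri_vpol_right hl] at g
  simp only [tri_spinPol hl, ht, hc] at g
  have e1 : ∀ ρ, (Matrix.of fun α β => ∑ ε, t a ε A B * (𝓜.γ ρ * 𝓜.γε ε) α β) =
      ∑ ε, t a ε A B • (𝓜.γ ρ * 𝓜.γε ε) := fun ρ => by
    ext α β
    simp [Matrix.sum_apply]
  have e2 : (Matrix.of fun α β => ∑ ε, c (.inl a) ε A B * 𝓜.γε ε α β) =
      ∑ ε, c (.inl a) ε A B • 𝓜.γε ε := by
    ext α β
    simp [Matrix.sum_apply]
  have e3 : ∑ μ, (η μ * (-k μ - k' μ)) * (w' ⬝ᵥ (∑ ε, t a ε A B • (𝓜.γ μ * 𝓜.γε ε)) *ᵥ w) =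
      ∑ ε, t a ε A B * (w' ⬝ᵥ (𝓜.slash (fun μ => -k μ - k' μ) * 𝓜.γε ε) *ᵥ w) := by
    simp only [Model.slash, Model.γUp, sum_mul, smul_mul_assoc, Matrix.sum_mulVec,
      dotProduct_sum, Matrix.smul_mulVec, dotProduct_smul, smul_eq_mul, mul_sum]
    rw [sum_comm]
    refine sum_ext fun _ => sum_ext fun _ => ?_
    ring
  have e4 : ∀ ε, w' ⬝ᵥ (𝓜.slash (fun μ => -k μ - k' μ) * 𝓜.γε ε) *ᵥ w =
      I * 𝓜.mD B * (w' ⬝ᵥ 𝓜.γε (-ε) *ᵥ w)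
      - I * 𝓜.mD A * (w' ⬝ᵥ 𝓜.γε ε *ᵥ w) := fun ε => by
    have : 𝓜.slash (fun μ => -k μ - k' μ) * 𝓜.γε ε =
        -(𝓜.γε (-ε) * 𝓜.slash k) - 𝓜.slash k' * 𝓜.γε ε := by
      rw [← slash_mul_γε, ← sub_eq_zero]
      simp only [Model.slash, sub_smul, neg_smul, sum_sub_distrib, sum_neg_distrib,
        sub_mul, neg_mul]
      abel
    rw [this, Matrix.sub_mulVec, Matrix.neg_mulVec, dotProduct_sub, dotProduct_neg,
      slash_spinor 𝓜 h, cospinor_slash 𝓜 h']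
    ring
  simp only [e1, e2] at g
  rw [e3] at g
  simp only [e4, Matrix.smul_mulVec, dotProduct_smul,
    smul_eq_mul, sum_sign, neg_neg, Matrix.add_mulVec, dotProduct_add] at g ⊢
  linear_combination -g

variable [Fintype I₄]

lemma tri_bilinear (A B : I₄) (w w' : 𝕍) (b : 𝒱) {χ₁ χ₂ χ₃ : (Fin 4 →₀ ℕ) → ℂ}
    (h₁ : χ₁ 0 = 1) (h₂ : χ₂ 0 = 1) (h₃ : χ₃ 0 = 1) (k : Matrix I₄ I₄ ℂ)
    (Γ : 𝕄) :
    tri true true true (pure (cospinPol (I₃ := I₃) A w') χ₁) (pure (spinPol B w) χ₂)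
      (pure (ind (.u b)) χ₃) (Model.bilinear k Γ * u b) = k A B * (w' ⬝ᵥ Γ *ᵥ w) := by
  classical
  simp only [Model.bilinear, sum_mul, map_sum, smul_mul_assoc, map_smul]
  have e : ∀ C D α β, tri true true true (pure (cospinPol (I₃ := I₃) A w') χ₁)
      (pure (spinPol B w) χ₂) (pure (ind (.u b)) χ₃) (psibar C α * psi D β * u b) =
      if C = A then (if D = B then w' α * w β else 0) else 0 := fun C D α β => by
    rw [psibar, psi, u, tri_mul _ _ _ (jet_mem_lin (.psibar C α) 0) (jet_mem_lin (.psi D β) 0)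
      (jet_mem_lin (.u b) 0)]
    by_cases hC : C = A <;> by_cases hD : D = B <;>
    simp [filt, pure, cospinPol, spinPol, ind, Field.odd, h₁, h₂, h₃, hC, hD]
  simp only [e]
  simp [dotProduct, Matrix.mulVec, mul_sum]
  refine sum_ext fun _ => sum_ext fun _ => ?_
  ring

lemma scalarCurrent_eq_zero {y : ℤˣ → Matrix I₄ I₄ ℂ} [Nonempty 𝒱]
    (h : 𝓜.OnShellEq (𝓜.scalarCurrent y) 0) (ε : ℤˣ) : y ε = 0 := by
  ext A B
  obtain ⟨b⟩ := ‹Nonempty 𝒱›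
  refine eq_zero_of_dirac_waves 𝓜 (A := A) (B := B) (x := fun ε => y ε A B) (fun k w k' w' h' h0 => ?_) ε
  have g := tri_congr (p := true) (q := true) (r := true) (onShell_cospinor 𝓜 h')
    (onShell_spinor 𝓜 h0) (onShell_kgWave 𝓜 b 0) (h.mul_right (u b))
  rw [zero_mul, map_zero, Model.scalarCurrent, sum_mul, map_sum] at g
  simpa only [tri_bilinear _ _ _ _ _ (mono_zero _) (mono_zero _) (kgWave_zero _ _)] using g

lemma scalarCurrent_add_smul (s t : ℤˣ → Matrix I₄ I₄ ℂ) (c : ℂ) :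
    𝓜.scalarCurrent (fun ε => s ε + c • t ε) =
      𝓜.scalarCurrent s + c • 𝓜.scalarCurrent t := by
  simp only [Model.scalarCurrent, Model.bilinear, Matrix.add_apply, Matrix.smul_apply, add_mul,
    smul_eq_mul, mul_assoc, add_smul, sum_add_distrib, smul_sum, smul_smul]

/-- The divergence of the current of `t` is proportional to the scalar current of `s` precisely when
the matrices are related by the mass matrix. -/
lemma divergence_vectorCurrent_iff (a : 𝒱) (t s : ℤˣ → Matrix I₄ I₄ ℂ) :
    𝓜.OnShellEq (∑ μ, d μ (𝓜.vectorCurrent t μ)) (𝓜.m a • 𝓜.scalarCurrent s) ↔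
      ∀ ε A B, I * (𝓜.mD A * t ε A B - t (-ε) A B * 𝓜.mD B) = 𝓜.m a * s ε A B := by
  have hd := divergence_vectorCurrent 𝓜 t
  constructor
  · intro h ε A B
    have : Nonempty 𝒱 := ⟨a⟩
    have h0 : 𝓜.OnShellEq (𝓜.scalarCurrent fun ε => massTerm 𝓜 t ε + (-𝓜.m a) • s ε) 0 := by
      rw [scalarCurrent_add_smul]
      exact (hd.symm.trans h |>.add (.refl _)).trans (.of_eq (by rw [← add_smul, add_neg_cancel, zero_smul]))
    have := congrFun (congrFun (scalarCurrent_eq_zero h0 ε) A) B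
    simp only [massTerm, Matrix.add_apply, Matrix.smul_apply, Matrix.of_apply, smul_eq_mul,
      Matrix.zero_apply] at this
    linear_combination this
  · intro h
    refine hd.trans (.of_eq ?_)
    have e : massTerm 𝓜 t = fun ε => 0 + 𝓜.m a • s ε := by
      ext ε A B
      simpa [massTerm] using h ε A B
    rw [e, scalarCurrent_add_smul]
    simp [Model.scalarCurrent, Model.bilinear]

end

/-! ### Rules of calculation -/

lemma jet_neg_smul (c : ℂ) (X : 𝒥) : (-c) • X = -(c • X) := by module

lemma even_comm {X Y : 𝒥} (hX : X ∈ lin _ _ _ _ false) : X * Y = Y * X :=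
  (commute_of_mem_lin_false hX Y).eq

lemma even_left_comm {X Y Z : 𝒥} (hX : X ∈ lin _ _ _ _ false) :
    X * (Y * Z) = Y * (X * Z) := (commute_of_mem_lin_false hX Y).left_comm Z

lemma odd_mul {X Y : 𝒥} (hX : X ∈ lin _ _ _ _ true)
    (hY : Y ∈ lin _ _ _ _ true) : X * Y = (-1 : ℂ) • (Y * X) := by
  rw [lin_mul_lin hX hY]
  simp [sgn]

lemma odd_mul_left {X Y Z : 𝒥} (hX : X ∈ lin _ _ _ _ true)
    (hY : Y ∈ lin _ _ _ _ true) : X * (Y * Z) = (-1 : ℂ) • (Y * (X * Z)) := by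
  rw [← mul_assoc, odd_mul hX hY, smul_mul_assoc, mul_assoc]

lemma jet_sub (X Y : 𝒥) : X - Y = X + (-1 : ℂ) • Y := by module

lemma d_comm {p : Bool} {X : 𝒥} (hX : X ∈ lin _ _ _ _ p) (μ ν : Fin 4) :
    d μ (d ν X) = d ν (d μ X) := by
  induction hX using Submodule.span_induction with
  | mem X hX =>
    obtain ⟨f, J, -, rfl⟩ := hX
    rw [d_jet, d_jet, d_jet, d_jet, add_right_comm]
  | zero => simp
  | add X Y _ _ h1 h2 => simp only [map_add, h1, h2]
  | smul c X _ h => simp only [map_smul, h]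

lemma u_mem (a : 𝒱) : u a ∈ lin I₁ I₂ I₃ I₄ true := jet_mem_lin (.u a) 0
lemma ut_mem (a : 𝒱) : ut a ∈ lin I₁ I₂ I₃ I₄ true := jet_mem_lin (.ut a) 0
lemma psi_mem (A : I₄) (α : Fin 4) : psi A α ∈ lin I₁ I₂ I₃ I₄ true := jet_mem_lin (.psi A α) 0
lemma psibar_mem (A : I₄) (α : Fin 4) : psibar A α ∈ lin I₁ I₂ I₃ I₄ true :=
  jet_mem_lin (.psibar A α) 0
lemma Phi_mem (a : 𝒱) : Phi a ∈ lin I₁ I₂ I₃ I₄ false := by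
  rcases a with a | a
  · exact zero_mem _
  · exact jet_mem_lin (.Phi a) 0
lemma phi_mem (j : I₃) : phi j ∈ lin I₁ I₂ I₃ I₄ false := jet_mem_lin (.phi j) 0

@[simp] theorem sc_inl (a : 𝒱) : sc (.inl a) = (Phi a : 𝒥) := by rcases a with a | a <;> rfl
@[simp] theorem sc_inr (j : I₃) : sc (.inr j) = (phi j : 𝒥) := rfl

lemma sc_mem (s : 𝒮) : sc s ∈ lin I₁ I₂ I₃ I₄ false := by
  rcases s with a | j
  · rw [sc_inl]
    exact Phi_mem a
  · exact phi_mem j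

section

variable (𝓜 : Model I₁ I₂ I₃ I₄)

/-- The gauge mass `m_a` of the scalar `Φ_a`; it vanishes for `φ_j`. -/
def Model.mGh : 𝒮 → ℂ := Sum.elim 𝓜.m fun _ => 0

/-- The ghost paired with a scalar. -/
def uGh : 𝒮 → 𝒥 := Sum.elim u fun _ => 0

lemma uGh_mem (s : 𝒮) : uGh s ∈ lin I₁ I₂ I₃ I₄ true := by
  rcases s with a | j
  · exact u_mem a
  · exact zero_mem _

lemma dQ_mul_even {X Y : 𝒥} (hX : X ∈ lin I₁ I₂ I₃ I₄ false) :
    𝓜.dQ (X * Y) = 𝓜.dQ X * Y + X * 𝓜.dQ Y := by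
  rw [Model.dQ, superDerivation_lin_mul hX]
  simp [sgn]

lemma dQ_mul_odd {X Y : 𝒥} (hX : X ∈ lin I₁ I₂ I₃ I₄ true) :
    𝓜.dQ (X * Y) = 𝓜.dQ X * Y + (-1 : ℂ) • (X * 𝓜.dQ Y) := by
  rw [Model.dQ, superDerivation_lin_mul hX]
  simp [sgn]

lemma dQ_jet (f : ℱ) (J : 𝔻) : 𝓜.dQ (jet f J) = 𝓜.gaugeVar ⟨f, J⟩ :=
  superDerivation_jet f J

lemma d_jetPhi (a : 𝒱) (J : 𝔻) (μ : Fin 4) :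
    d μ (jetPhi a J : 𝒥) = jetPhi a (J + Finsupp.single μ 1) := by
  rcases a with a | a
  · exact map_zero _
  · exact d_jet μ _ _

lemma dQ_d {p : Bool} {X : 𝒥} (hX : X ∈ lin I₁ I₂ I₃ I₄ p) (μ : Fin 4) :
    𝓜.dQ (d μ X) = d μ (𝓜.dQ X) := by
  induction hX using Submodule.span_induction with
  | mem X hX =>
    obtain ⟨f, J, -, rfl⟩ := hX
    rw [d_jet, dQ_jet, dQ_jet]
    cases f <;> simp [Model.gaugeVar, d_jet, d_jetPhi, add_right_comm]
  | zero => simp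
  | add X Y _ _ h1 h2 => simp only [map_add, h1, h2]
  | smul c X _ h => simp only [map_smul, h]

lemma dQ_v (a : 𝒱) (μ : Fin 4) : 𝓜.dQ (v a μ : 𝒥) = (I * η μ) • d μ (u a) := by
  rw [v, u, dQ_jet, d_jet]
  rfl

lemma dQ_u (a : 𝒱) : 𝓜.dQ (u a : 𝒥) = 0 := dQ_jet 𝓜 _ _

lemma dQ_ut (a : 𝒱) : 𝓜.dQ (ut a : 𝒥) = (-I) • ((∑ μ, d μ (v a μ)) + 𝓜.m a • sc (.inl a)) := by
  rw [ut, dQ_jet, sc_inl]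
  simp only [v, d_jet]
  rfl

lemma dQ_sc (s : 𝒮) : 𝓜.dQ (sc s : 𝒥) = (I * 𝓜.mGh s) • uGh s := by
  rcases s with (a | a) | j
  · simp [Model.mGh, Model.m, Phi, jetPhi]
  · exact dQ_jet 𝓜 (.Phi a) 0
  · simp [sc_inr, phi, dQ_jet, Model.gaugeVar, Model.mGh]

lemma dQ_psi (A : I₄) (α : Fin 4) : 𝓜.dQ (psi A α : 𝒥) = 0 := dQ_jet 𝓜 _ _

lemma dQ_psibar (A : I₄) (α : Fin 4) : 𝓜.dQ (psibar A α : 𝒥) = 0 := dQ_jet 𝓜 _ _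

lemma box_of_eom {f : ℱ} {m : ℂ} (h : 𝓜.IsEOM (Model.kleinGordon f m 0)) :
    𝓜.OnShellEq (∑ μ, η μ • d μ (d μ (jet f 0))) (-m ^ 2 • jet f 0) := by
  refine .of_eom ?_
  have : ∑ μ, η μ • d μ (d μ (jet f 0)) - -m ^ 2 • jet f 0 = Model.kleinGordon f m 0 := by
    rw [jet_neg_smul, sub_neg_eq_add, Model.kleinGordon]
    simp only [d_jet, add_assoc, ← Finsupp.single_add]
  rwa [this]

lemma box_v (a : 𝒱) (ν : Fin 4) :
    𝓜.OnShellEq (∑ μ, η μ • d μ (d μ (v a ν))) (-𝓜.m a ^ 2 • v a ν) := box_of_eom 𝓜 (.v a ν 0)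

lemma box_ut (a : 𝒱) :
    𝓜.OnShellEq (∑ μ, η μ • d μ (d μ (ut a))) (-𝓜.m a ^ 2 • ut a) := box_of_eom 𝓜 (.ut a 0)

lemma box_sc (s : 𝒮) : 𝓜.OnShellEq (∑ μ, η μ • d μ (d μ (sc s))) (-𝓜.mSc s ^ 2 • sc s) := by
  rcases s with (a | a) | j
  · exact .of_eq (by simp [Phi, jetPhi])
  · exact box_of_eom 𝓜 (.Phi a 0)
  · exact box_of_eom 𝓜 (.phi j 0)

end

/-! ### Gauge variation of the Yang-Mills terms -/

lemma even_comm' {X Y : 𝒥} (hY : Y ∈ lin _ _ _ _ false) : X * Y = Y * X := (even_comm hY).symm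

lemma even_left_comm' {X Y Z : 𝒥} (hY : Y ∈ lin _ _ _ _ false) :
    X * (Y * Z) = Y * (X * Z) := (even_left_comm hY).symm

section

variable (𝓜 : Model I₁ I₂ I₃ I₄)

lemma dQ_mB (c b a : 𝒱) : 𝓜.dQ (mB c b a : 𝒥) = I • ((∑ ρ, ∑ μ, d ρ (d μ (u c)) * v b ρ * v a μ)
      + (∑ ρ, ∑ μ, (η μ * η ρ) • (d ρ (v c μ) * d ρ (u b) * v a μ))
      + ∑ ρ, ∑ μ, d ρ (v c μ) * v b ρ * d μ (u a)) := by
  simp only [mB, map_sum, map_smul, mul_assoc, dQ_mul_even 𝓜 (d_mem_lin (v_mem _ _) _),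
    dQ_mul_even 𝓜 (v_mem _ _), dQ_d 𝓜 (v_mem _ _), dQ_v, map_smul, ← sum_add_distrib,
    smul_sum]
  refine sum_ext fun ρ => sum_ext fun μ => ?_
  simp only [smul_mul_assoc, mul_smul_comm, smul_add, mul_add, smul_smul]
  simp only [mul_left_comm _ I, η_mul_self, mul_one]
  module

lemma dQ_mZ (c b a : 𝒱) : 𝓜.dQ (mZ c b a : 𝒥) = (-I) • ((∑ μ, ∑ ν, d μ (d ν (v c ν)) * v b μ * u a)
      + 𝓜.m c • (∑ μ, d μ (sc (.inl c)) * v b μ * u a)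
      + ∑ μ, η μ • (d μ (ut c) * d μ (u b) * u a)) := by
  simp only [mZ, map_sum, map_smul, mul_assoc, dQ_mul_odd 𝓜 (d_mem_lin (ut_mem _) _),
    dQ_mul_even 𝓜 (v_mem _ _), dQ_d 𝓜 (ut_mem _), dQ_v, dQ_u, dQ_ut, map_smul, map_add, map_sum,
    ← sum_add_distrib, smul_sum]
  refine sum_ext fun μ => ?_
  simp only [smul_mul_assoc, mul_smul_comm, smul_add, add_mul, smul_smul, sum_mul,
    smul_sum, mul_zero, add_zero]
  module

lemma mul_odd_cycle {X Y Z : 𝒥} (hX : X ∈ lin _ _ _ _ true)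
    (hY : Y ∈ lin _ _ _ _ true) (hZ : Z ∈ lin _ _ _ _ true) : X * Y * Z = Z * X * Y := by
  rw [mul_assoc, odd_mul hY hZ, mul_smul_comm, ← mul_assoc, odd_mul hX hZ, smul_mul_assoc,
    smul_smul]
  norm_num

lemma divergence_ymCurrent (a b c : 𝒱) :
    ∑ μ, d μ ((∑ ν, u a * vLow b ν * fieldStrength c ν μ) - (1 / 2 : ℂ) • (u a * u b * dUp μ (ut c)) :
      𝒥) =
    (∑ ρ, ∑ μ, d ρ (v c μ) * v b ρ * d μ (u a))
    + (-1 : ℂ) • (∑ ρ, ∑ μ, (η μ * η ρ) • (d ρ (v c μ) * d ρ (u a) * v b μ))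
    + (∑ μ, ∑ ν, u a * d μ (v b ν) * d ν (v c μ))
    + (-1 : ℂ) • (∑ μ, ∑ ν, (η ν * η μ) • (u a * d μ (v b ν) * d μ (v c ν)))
    + (∑ μ, ∑ ν, d μ (d ν (v c ν)) * v b μ * u a)
    + (-1 : ℂ) • (∑ ν, η ν • (u a * v b ν * ∑ μ, η μ • d μ (d μ (v c ν))))
    + (-1 / 2 : ℂ) • (∑ μ, η μ • (d μ (ut c) * d μ (u a) * u b))
    + (1 / 2 : ℂ) • (∑ μ, η μ • (d μ (ut c) * d μ (u b) * u a))
    + (-1 / 2 : ℂ) • (u a * u b * ∑ μ, η μ • d μ (d μ (ut c))) := by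
  have e : ∀ μ, d μ ((∑ ν, u a * vLow b ν * fieldStrength c ν μ)
      - (1 / 2 : ℂ) • (u a * u b * dUp μ (ut c)) : 𝒥) =
      (∑ ρ, d ρ (v c μ) * v b ρ * d μ (u a))
      + (-1 : ℂ) • (∑ ν, (η ν * η μ) • (d μ (v c ν) * d μ (u a) * v b ν))
      + (∑ ν, u a * d μ (v b ν) * d ν (v c μ))
      + (-1 : ℂ) • (∑ ν, (η ν * η μ) • (u a * d μ (v b ν) * d μ (v c ν)))
      + (∑ ν, d ν (d μ (v c μ)) * v b ν * u a)
      + (-1 : ℂ) • (∑ ν, η ν • (u a * v b ν * η μ • d μ (d μ (v c ν))))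
      + (-1 / 2 : ℂ) • (η μ • (d μ (ut c) * d μ (u a) * u b))
      + (1 / 2 : ℂ) • (η μ • (d μ (ut c) * d μ (u b) * u a))
      + (-1 / 2 : ℂ) • (u a * u b * η μ • d μ (d μ (ut c))) := fun μ => by
    rw [jet_sub, map_add, map_sum, map_smul, map_smul]
    have e1 : ∀ ν, d μ (u a * vLow b ν * fieldStrength c ν μ : 𝒥) = d ν (v c μ) * v b ν * d μ (u a)
        + (-1 : ℂ) • ((η ν * η μ) • (d μ (v c ν) * d μ (u a) * v b ν))
        + u a * d μ (v b ν) * d ν (v c μ)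
        + (-1 : ℂ) • ((η ν * η μ) • (u a * d μ (v b ν) * d μ (v c ν)))
        + d ν (d μ (v c μ)) * v b ν * u a
        + (-1 : ℂ) • (η ν • (u a * v b ν * η μ • d μ (d μ (v c ν)))) := fun ν => by
      have c1 : d μ (u a) * (v b ν * d ν (v c μ)) = (d ν (v c μ) * (v b ν * d μ (u a)) : 𝒥) := by
        rw [even_left_comm' (v_mem b ν), even_comm' (d_mem_lin (v_mem c μ) ν),
          even_left_comm' (d_mem_lin (v_mem c μ) ν)]
      have c2 : d μ (u a) * (v b ν * d μ (v c ν)) = (d μ (v c ν) * (d μ (u a) * v b ν) : 𝒥) := by rw [even_comm (v_mem b ν), even_left_comm' (d_mem_lin (v_mem c ν) μ)]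
      have c3 : u a * (v b ν * d ν (d μ (v c μ))) = (d ν (d μ (v c μ)) * (v b ν * u a) : 𝒥) := by
        rw [← mul_assoc, even_comm' (d_mem_lin (d_mem_lin (v_mem c μ) μ) ν), even_comm' (v_mem b ν)]
      simp only [vLow, fieldStrength, dUp, jet_sub, d_mul, map_add, map_smul, smul_mul_assoc,
        mul_smul_comm, mul_add, smul_add, smul_smul, mul_assoc,
        η_mul_self, one_smul, d_comm (v_mem c μ) μ ν, c1, c2, c3]
      module
    have e2 : d μ (u a * u b * dUp μ (ut c) : 𝒥) =
        η μ • (d μ (ut c) * d μ (u a) * u b) + (-1 : ℂ) • (η μ • (d μ (ut c) * d μ (u b) * u a))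
        + u a * u b * η μ • d μ (d μ (ut c)) := by
      have o := fun a : 𝒱 => d_mem_lin (u_mem (I₃ := I₃) (I₄ := I₄) a) μ
      have o' := d_mem_lin (ut_mem (I₃ := I₃) (I₄ := I₄) c) μ
      simp only [dUp, d_mul, map_smul, add_mul, mul_smul_comm]
      rw [mul_odd_cycle (o a) (u_mem b) o', mul_odd_cycle (u_mem a) (o b) o',
        mul_assoc _ (u a), odd_mul (u_mem a) (o b)]
      simp only [mul_smul_comm, smul_add, mul_assoc, smul_smul]
      module
    simp only [e1, e2, sum_add_distrib, smul_sum, smul_add]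
    module
  have e3 : ∑ ν, η ν • (u a * v b ν * ∑ μ, η μ • d μ (d μ (v c ν))) =
      ∑ μ, ∑ ν, η ν • (u a * v b ν * η μ • d μ (d μ (v c ν)) : 𝒥) := by
    simp only [mul_sum, smul_sum]
    exact sum_comm
  have e4 : ∑ ρ, ∑ μ, d ρ (v c μ) * v b ρ * d μ (u a) =
      ∑ μ, ∑ ρ, (d ρ (v c μ) * v b ρ * d μ (u a) : 𝒥) := sum_comm
  have e5 : ∑ μ, ∑ ν, d μ (d ν (v c ν)) * v b μ * u a =
      ∑ ν, ∑ μ, (d μ (d ν (v c ν)) * v b μ * u a : 𝒥) := sum_comm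
  rw [e3, e4, e5]
  simp only [e, sum_add_distrib, smul_sum, mul_sum]

/-! ### Gauge variation of the terms with scalars -/

/-- The vector field and the antighost paired with a scalar. -/
def vGh (s : 𝒮) (μ : Fin 4) : 𝒥 := Sum.elim (fun a => v a μ) (fun _ => 0) s
def utGh : 𝒮 → 𝒥 := Sum.elim ut fun _ => 0

lemma vGh_mem (s : 𝒮) (μ : Fin 4) : vGh s μ ∈ lin I₁ I₂ I₃ I₄ false := by
  rcases s with a | j
  · exact v_mem a μ
  · exact zero_mem _

lemma utGh_mem (s : 𝒮) : utGh s ∈ lin I₁ I₂ I₃ I₄ true := by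
  rcases s with a | j
  · exact ut_mem a
  · exact zero_mem _

lemma dQ_vGh (s : 𝒮) (μ : Fin 4) : 𝓜.dQ (vGh s μ : 𝒥) = (I * η μ) • d μ (uGh s) := by
  rcases s with a | j
  · exact dQ_v 𝓜 a μ
  · simp [vGh, uGh]

lemma dQ_utGh (s : 𝒮) : 𝓜.mGh s • 𝓜.dQ (utGh s : 𝒥) =
    𝓜.mGh s • ((-I) • ((∑ μ, d μ (vGh s μ)) + 𝓜.mGh s • sc s)) := by
  rcases s with a | j
  · exact congrArg _ (dQ_ut 𝓜 a)
  · simp [Model.mGh]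

/-- The terms of the Lagrangian with two fields of the scalar sector. -/
def Model.scalarTerm (a : 𝒱) (t s : 𝒮) : 𝒥 :=
  (∑ μ, sc s * (d μ (sc t) * v a μ))
    + (-𝓜.mGh t) • (∑ μ, η μ • (sc s * (vGh t μ * v a μ))) + 𝓜.mGh t • (sc s * (utGh t * u a))

/-- The corresponding terms of `T^μ`. -/
def Model.scalarTermVec (a : 𝒱) (t s : 𝒮) (μ : Fin 4) : 𝒥 :=
  sc s * (dUp μ (sc t) * u a) + (-𝓜.mGh t) • (sc s * (vGh t μ * u a))

lemma dQ_scalarTerm (a : 𝒱) (t s : 𝒮) : 𝓜.dQ (𝓜.scalarTerm a t s : 𝒥) = I • (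
      (∑ μ, η μ • (sc s * (d μ (sc t) * d μ (u a))))
      + 𝓜.mGh s • (∑ μ, d μ (sc t) * (v a μ * uGh s))
      + (-𝓜.mGh t) • (∑ μ, sc s * (vGh t μ * d μ (u a)))
      + (-(𝓜.mGh t * 𝓜.mGh s)) • (∑ μ, η μ • (vGh t μ * (v a μ * uGh s)))
      + (𝓜.mGh t * 𝓜.mGh s) • (uGh s * (utGh t * u a))
      + (-𝓜.mGh t) • (∑ μ, sc s * (d μ (vGh t μ) * u a))
      + (-𝓜.mGh t ^ 2) • (sc s * (sc t * u a))) := by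
  have e1 : ∀ μ, 𝓜.dQ (sc s * (d μ (sc t) * v a μ) : 𝒥) = I • (
      η μ • (sc s * (d μ (sc t) * d μ (u a))) + 𝓜.mGh s • (d μ (sc t) * (v a μ * uGh s))
      + 𝓜.mGh t • (sc s * (v a μ * d μ (uGh t)))) := by
    intro μ
    rw [dQ_mul_even 𝓜 (sc_mem s), dQ_mul_even 𝓜 (d_mem_lin (sc_mem t) μ), dQ_d 𝓜 (sc_mem t),
      dQ_sc, dQ_sc, dQ_v]
    have c1 : uGh s * (d μ (sc t) * v a μ) = (d μ (sc t) * (v a μ * uGh s) : 𝒥) := by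
      rw [even_left_comm' (d_mem_lin (sc_mem t) μ), even_comm' (v_mem a μ)]
    simp only [map_smul, smul_mul_assoc, mul_smul_comm, mul_add, c1,
      even_comm' (X := d μ (uGh t)) (v_mem a μ)]
    module
  have e2 : ∀ μ, 𝓜.dQ (sc s * (vGh t μ * v a μ) : 𝒥) = (I * η μ) • (
      𝓜.mGh s • (η μ • (vGh t μ * (v a μ * uGh s)))
      + (sc s * (v a μ * d μ (uGh t))) + (sc s * (vGh t μ * d μ (u a)))) := by
    intro μ
    rw [dQ_mul_even 𝓜 (sc_mem s), dQ_mul_even 𝓜 (vGh_mem t μ), dQ_sc, dQ_v, dQ_vGh]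
    have c1 : uGh s * (vGh t μ * v a μ) = (vGh t μ * (v a μ * uGh s) : 𝒥) := by
      rw [even_left_comm' (vGh_mem t μ), even_comm' (v_mem a μ)]
    simp only [smul_mul_assoc, mul_smul_comm, mul_add, c1,
      even_comm' (X := d μ (uGh t)) (v_mem a μ), smul_add, smul_smul, mul_assoc,
      mul_left_comm (η μ) (𝓜.mGh s), η_mul_self, mul_one]
    module
  have e3 : 𝓜.mGh t • 𝓜.dQ (sc s * (utGh t * u a) : 𝒥) = I • (
      (𝓜.mGh t * 𝓜.mGh s) • (uGh s * (utGh t * u a))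
      + (-𝓜.mGh t) • (∑ μ, sc s * (d μ (vGh t μ) * u a))
      + (-𝓜.mGh t ^ 2) • (sc s * (sc t * u a))) := by
    have : 𝓜.mGh t • 𝓜.dQ (sc s * (utGh t * u a) : 𝒥) = 𝓜.mGh t • (𝓜.dQ (sc s) * (utGh t * u a))
        + sc s * ((𝓜.mGh t • 𝓜.dQ (utGh t)) * u a) := by
      rw [dQ_mul_even 𝓜 (sc_mem s), dQ_mul_odd 𝓜 (utGh_mem t), dQ_u]
      simp only [mul_zero, smul_zero, add_zero, smul_add, smul_mul_assoc, mul_smul_comm]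
    rw [this, dQ_utGh, dQ_sc]
    simp only [smul_mul_assoc, mul_smul_comm, smul_add, mul_add, add_mul, sum_mul, mul_sum]
    module
  have e4 : ∀ X : Fin 4 → 𝒥, (∑ μ, η μ • (I * η μ) • X μ) = I • ∑ μ, X μ := fun X => by
    simp only [smul_smul, smul_sum, mul_left_comm (η _), η_mul_self, mul_one]
  simp only [Model.scalarTerm, map_add, map_smul, map_sum, e1, e2, e3, e4]
  simp only [sum_add_distrib, smul_add, ← smul_sum]
  module

lemma divergence_scalarTermVec (a : 𝒱) (t s : 𝒮) : ∑ μ, d μ (𝓜.scalarTermVec a t s μ : 𝒥) =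
      (∑ μ, η μ • (d μ (sc s) * (d μ (sc t) * u a)))
      + sc s * ((∑ μ, η μ • d μ (d μ (sc t))) * u a)
      + (∑ μ, η μ • (sc s * (d μ (sc t) * d μ (u a))))
      + (-𝓜.mGh t) • (∑ μ, d μ (sc s) * (vGh t μ * u a))
      + (-𝓜.mGh t) • (∑ μ, sc s * (d μ (vGh t μ) * u a))
      + (-𝓜.mGh t) • (∑ μ, sc s * (vGh t μ * d μ (u a))) := by
  simp only [Model.scalarTermVec, dUp, map_add, map_smul, d_mul, mul_add, smul_mul_assoc,
    mul_smul_comm, smul_add, sum_add_distrib, sum_mul, mul_sum,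
    smul_sum]
  abel

end

/-! ### Gauge invariance of the Lagrangian -/

section

variable {A B C X : Type*} [Fintype A] [Fintype B] [Fintype C] [AddCommMonoid X]

lemma sum_rot (F : A → B → C → X) : ∑ a, ∑ b, ∑ c, F a b c = ∑ c, ∑ a, ∑ b, F a b c := by
  simp only [← Fintype.sum_prod_type']
  exact Fintype.sum_equiv ⟨fun x => (x.2.2, x.1, x.2.1), fun y => (y.2.1, y.2.2, y.1), fun _ => rfl,
    fun _ => rfl⟩ _ _ fun _ => rfl

lemma sum_swap_outer (F : A → B → C → X) : ∑ a, ∑ b, ∑ c, F a b c = ∑ c, ∑ b, ∑ a, F a b c := by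
  rw [sum_rot]
  exact sum_ext fun _ => sum_comm

end

section

variable {A C : Type*} [Fintype A] [Fintype C]

lemma sum_antisymm_left {f : A → A → C → ℂ} (hf : ∀ a b c, f b a c = -f a b c)
    {M : A → A → C → 𝒥} (hM : ∀ a b c, M b a c = M a b c) :
    ∑ a, ∑ b, ∑ c, f a b c • M a b c = 0 := by
  have h : ∑ a, ∑ b, ∑ c, f a b c • M a b c = (-1 : ℂ) • ∑ a, ∑ b, ∑ c, f a b c • M a b c := by
    conv_lhs => rw [sum_comm]
    simp only [smul_sum, smul_smul]
    refine sum_ext fun a => sum_ext fun b => sum_ext fun c => ?_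
    rw [hf, hM, neg_one_mul]
  have h2 : (2 : ℂ) • (∑ a, ∑ b, ∑ c, f a b c • M a b c) = 0 := by
    rw [two_smul]
    nth_rewrite 1 [h]
    module
  exact (smul_eq_zero_iff_right (two_ne_zero' ℂ)).1 h2

lemma sum_antisymm_right {f : C → A → A → ℂ} (hf : ∀ c a b, f c b a = -f c a b)
    {M : C → A → A → 𝒥} (hM : ∀ c a b, M c b a = M c a b) :
    ∑ c, ∑ a, ∑ b, f c a b • M c a b = 0 := by
  rw [← sum_rot fun a b c => f c a b • M c a b]
  exact sum_antisymm_left (f := fun a b c => f c a b) (M := fun a b c => M c a b)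
    (fun a b c => hf c a b) (fun a b c => hM c a b)

end

lemma ym_combine {A : Type*} [Fintype A] {f : A → A → A → ℂ} (hf : ∀ a b e, f b a e = -f a b e)
    (hf' : ∀ a b e, f a e b = -f a b e) (G₁ G₂ G₃ H₁ H₂ H₃ K₁ K₂ N₁ N₂ : A → A → A → 𝒥)
    (g₁ : ∀ a b e, G₁ b a e = G₁ a b e) (k₁ : ∀ a b e, K₁ a e b = K₁ a b e)
    (k₂ : ∀ a b e, K₂ a e b = K₂ a b e) :
    ∑ a, ∑ b, ∑ e, f a b e • (G₁ a b e + G₂ a b e + G₃ a b e + H₁ a b e + H₂ a b e + H₃ a b e) =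
      (∑ a, ∑ b, ∑ e, f a b e • (G₃ a b e + (-1 : ℂ) • G₂ b a e + K₁ a b e + (-1 : ℂ) • K₂ a b e
        + H₁ a b e + (-1 : ℂ) • N₁ a b e + (-1 / 2 : ℂ) • H₃ b a e + (1 / 2 : ℂ) • H₃ a b e
        + (-1 / 2 : ℂ) • N₂ a b e))
      + ∑ a, ∑ b, ∑ e, f a b e • (H₂ a b e + N₁ a b e + (1 / 2 : ℂ) • N₂ a b e) := by
  have z1 := sum_antisymm_left hf g₁
  have z2 := sum_antisymm_left hf (M := fun a b e => G₂ a b e + G₂ b a e) fun a b e => add_comm _ _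
  have z3 := sum_antisymm_left hf (M := fun a b e => H₃ a b e + H₃ b a e) fun a b e => add_comm _ _
  have z4 := sum_antisymm_right hf' k₁
  have z5 := sum_antisymm_right hf' k₂
  have h : (∑ a, ∑ b, ∑ e, f a b e • G₁ a b e) + (∑ a, ∑ b, ∑ e, f a b e • (G₂ a b e + G₂ b a e))
      + (1 / 2 : ℂ) • (∑ a, ∑ b, ∑ e, f a b e • (H₃ a b e + H₃ b a e))
      + (-1 : ℂ) • (∑ a, ∑ b, ∑ e, f a b e • K₁ a b e) + ∑ a, ∑ b, ∑ e, f a b e • K₂ a b e = 0 := by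
    rw [z1, z2, z3, z4, z5]
    simp
  rw [← add_zero (_ + _), ← h]
  simp only [smul_sum, ← sum_add_distrib]
  refine sum_ext fun a => sum_ext fun b => sum_ext fun e => ?_
  module

section

variable [Fintype I₁] [Fintype I₂] [Fintype I₃] (𝓜 : Model I₁ I₂ I₃ I₄)

/-- The Yang-Mills part of the Lagrangian and of `T^μ`. -/
def ymLagrangian (f : 𝒱 → 𝒱 → 𝒱 → ℂ) : 𝒥 :=
  ∑ a, ∑ b, ∑ e, f a b e • (mB e b a + (-1 : ℂ) • mZ e b a)

def ymVec (f : 𝒱 → 𝒱 → 𝒱 → ℂ) (μ : Fin 4) : 𝒥 :=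
  ∑ a, ∑ b, ∑ e, f a b e •
    ((∑ ν, u a * vLow b ν * fieldStrength e ν μ) - (1 / 2 : ℂ) • (u a * u b * dUp μ (ut e)))

/-- The part with two fields of the scalar sector. -/
def Model.scalarLagrangian (r : 𝒱 → 𝒮 → 𝒮 → ℂ) : 𝒥 := ∑ a, ∑ t, ∑ s, r a t s • 𝓜.scalarTerm a t s

def Model.scalarVec (r : 𝒱 → 𝒮 → 𝒮 → ℂ) (μ : Fin 4) :
    𝒥 := ∑ a, ∑ t, ∑ s, r a t s • 𝓜.scalarTermVec a t s μ

/-- Monomials in the gauge variation. -/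
def gM1 (a b : 𝒱) (s : 𝒮) : 𝒥 := ∑ μ, d μ (sc s) * (v b μ * u a)
def gM2 (e b a : 𝒱) : 𝒥 := ∑ μ, η μ • (v b μ * (v a μ * u e))
def gM3 (e b a : 𝒱) : 𝒥 := u e * (ut b * u a)
def gM4 (a : 𝒱) (t s : 𝒮) : 𝒥 := sc s * (sc t * u a)

variable {f : I₁ ⊕ I₂ → I₁ ⊕ I₂ → I₁ ⊕ I₂ → ℂ} (hf : ∀ a b e, f b a e = -f a b e)
  (hf' : ∀ a b e, f a e b = -f a b e)
include hf hf'

omit [Fintype I₃] in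
lemma dQ_ymLagrangian : 𝓜.OnShellEq (𝓜.dQ (ymLagrangian f))
    (I • ((∑ μ, d μ (ymVec f μ)) + ∑ a, ∑ b, ∑ e, f a b e • (
      𝓜.m e • gM1 a b (.inl e) + (-𝓜.m e ^ 2) • gM2 a b e + (1 / 2 * 𝓜.m e ^ 2) • gM3 a e b))) := by
  have e1 : 𝓜.dQ (ymLagrangian f : 𝒥) = I • ∑ a, ∑ b, ∑ e, f a b e • (
      (∑ ρ, ∑ μ, d ρ (d μ (u e)) * v b ρ * v a μ)
      + (∑ ρ, ∑ μ, (η μ * η ρ) • (d ρ (v e μ) * d ρ (u b) * v a μ))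
      + (∑ ρ, ∑ μ, d ρ (v e μ) * v b ρ * d μ (u a))
      + (∑ μ, ∑ ν, d μ (d ν (v e ν)) * v b μ * u a)
      + 𝓜.m e • (∑ μ, d μ (sc (.inl e)) * v b μ * u a)
      + ∑ μ, η μ • (d μ (ut e) * d μ (u b) * u a)) := by
    simp only [ymLagrangian, map_sum, map_smul, map_add, dQ_mB, dQ_mZ, smul_sum (r := I) (s := univ (α := 𝒱))]
    refine sum_ext fun a => sum_ext fun b => sum_ext fun e => ?_
    module
  have e2 : ∑ μ, d μ (ymVec f μ : 𝒥) = ∑ a, ∑ b, ∑ e, f a b e • ∑ μ, d μ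
      ((∑ ν, u a * vLow b ν * fieldStrength e ν μ) - (1 / 2 : ℂ) • (u a * u b * dUp μ (ut e))) := by
    simp only [ymVec, map_sum, map_smul, smul_sum]
    rw [sum_comm]
    refine sum_ext fun a => ?_
    rw [sum_comm]
    exact sum_ext fun a => sum_comm
  have e3 : 𝓜.dQ (ymLagrangian f : 𝒥) = I • ((∑ μ, d μ (ymVec f μ))
      + ∑ a, ∑ b, ∑ e, f a b e • (𝓜.m e • (∑ μ, d μ (sc (.inl e)) * v b μ * u a)
      + (∑ ν, η ν • (u a * v b ν * ∑ μ, η μ • d μ (d μ (v e ν))))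
      + (1 / 2 : ℂ) • (u a * u b * ∑ μ, η μ • d μ (d μ (ut e))))) := by
    rw [e1, e2]
    simp only [divergence_ymCurrent]
    refine congrArg _ (ym_combine hf hf' (fun a b e => ∑ ρ, ∑ μ, d ρ (d μ (u e)) * v b ρ * v a μ)
      (fun a b e => ∑ ρ, ∑ μ, (η μ * η ρ) • (d ρ (v e μ) * d ρ (u b) * v a μ))
      (fun a b e => ∑ ρ, ∑ μ, d ρ (v e μ) * v b ρ * d μ (u a))
      (fun a b e => ∑ μ, ∑ ν, d μ (d ν (v e ν)) * v b μ * u a)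
      (fun a b e => 𝓜.m e • (∑ μ, d μ (sc (.inl e)) * v b μ * u a))
      (fun a b e => ∑ μ, η μ • (d μ (ut e) * d μ (u b) * u a))
      (fun a b e => ∑ μ, ∑ ν, u a * d μ (v b ν) * d ν (v e μ))
      (fun a b e => ∑ μ, ∑ ν, (η ν * η μ) • (u a * d μ (v b ν) * d μ (v e ν)))
      (fun a b e => ∑ ν, η ν • (u a * v b ν * ∑ μ, η μ • d μ (d μ (v e ν))))
      (fun a b e => u a * u b * ∑ μ, η μ • d μ (d μ (ut e))) ?_ ?_ ?_)
    · intro a b e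
      rw [sum_comm]
      refine sum_ext fun ρ => sum_ext fun μ => ?_
      rw [d_comm (u_mem e) μ ρ, mul_assoc, even_comm (v_mem a μ), mul_assoc]
    · intro a b e
      rw [sum_comm]
      refine sum_ext fun ρ => sum_ext fun μ => ?_
      rw [mul_assoc, even_comm (d_mem_lin (v_mem e ρ) μ), mul_assoc]
    · intro a b e
      refine sum_ext fun ρ => sum_ext fun μ => ?_
      rw [mul_assoc, even_comm (d_mem_lin (v_mem e μ) ρ), mul_assoc]
  rw [e3]
  refine .smul _ (.add (.refl _) (.sum _ fun a _ => .sum _ fun b _ => .sum _ fun e _ => .smul _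
    (.add (.add (.of_eq ?_) (.trans (.sum _ fun ν _ => .smul _ (.mul_left _ (box_v 𝓜 e ν)))
      (.of_eq ?_))) (.trans (.smul _ (.mul_left _ (box_ut 𝓜 e))) (.of_eq ?_)))))
  · simp only [gM1, mul_assoc]
  · simp only [gM2, smul_sum, mul_smul_comm]
    refine sum_ext fun μ => ?_
    rw [even_comm' (X := u a) (v_mem b μ), mul_assoc, even_comm' (X := u a) (v_mem e μ)]
    module
  · rw [gM3, odd_mul (ut_mem e) (u_mem b), mul_assoc]
    simp only [mul_smul_comm]
    module

end

section

variable [Fintype I₁] [Fintype I₂] [Fintype I₃] (𝓜 : Model I₁ I₂ I₃ I₄)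

lemma sum_sc {M : Type*} [AddCommMonoid M] (F : 𝒮 → M) :
    ∑ s, F s = ∑ a, F (.inl a) + ∑ j, F (.inr j) := Fintype.sum_sum_type F

omit [Fintype I₁] [Fintype I₂] [Fintype I₃] in
lemma mGh_inl (a : 𝒱) : 𝓜.mGh (.inl a) = 𝓜.m a := rfl

omit [Fintype I₁] [Fintype I₂] [Fintype I₃] in
lemma mGh_inr (j : I₃) : 𝓜.mGh (.inr j) = 0 := rfl

lemma sum_mGh {M : Type*} [AddCommMonoid M] [Module ℂ M] (F : 𝒮 → M) :
    ∑ s, 𝓜.mGh s • F s = ∑ a, 𝓜.m a • F (.inl a) := by simp [Fintype.sum_sum_type, Model.mGh]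

/-- Masses enter the scalar terms only through the equations of motion of `φ_j`. -/
def Model.mPhi (s : 𝒮) : ℂ := 𝓜.mSc s ^ 2 - 𝓜.mGh s ^ 2

omit [Fintype I₁] [Fintype I₂] [Fintype I₃] in
lemma mPhi_inl (a : 𝒱) : 𝓜.mPhi (.inl a) = 0 := by simp [Model.mPhi, Model.mSc, Model.mGh]

omit [Fintype I₁] [Fintype I₂] [Fintype I₃] in
lemma mPhi_inr (j : I₃) : 𝓜.mPhi (.inr j) = 𝓜.mS j ^ 2 := by simp [Model.mPhi, Model.mSc, Model.mGh]

lemma dQ_scalarLagrangian {r : 𝒱 → 𝒮 → 𝒮 → ℂ}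
    (hr : ∀ a t s, r a s t = -r a t s) : 𝓜.OnShellEq (𝓜.dQ (𝓜.scalarLagrangian r))
    (I • ((∑ μ, d μ (𝓜.scalarVec r μ))
      + ((∑ a, ∑ b, ∑ s, (𝓜.m b * r a (.inl b) s + 𝓜.m a * r b s (.inl a)) • gM1 a b s)
      + (∑ a, ∑ b, ∑ e, (-(𝓜.m b * 𝓜.m e * r a (.inl b) (.inl e))) • gM2 e b a)
      + (∑ a, ∑ b, ∑ e, (𝓜.m b * 𝓜.m e * r a (.inl b) (.inl e)) • gM3 e b a)
      + ∑ a, ∑ t, ∑ s, (𝓜.mPhi t * r a t s) • gM4 a t s))) := by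
  have e1 : 𝓜.dQ (𝓜.scalarLagrangian r : 𝒥) = I • ((∑ μ, d μ (𝓜.scalarVec r μ))
      + ∑ a, ∑ t, ∑ s, r a t s • (𝓜.mGh s • (∑ μ, d μ (sc t) * (v a μ * uGh s))
      + (-(𝓜.mGh t * 𝓜.mGh s)) • (∑ μ, η μ • (vGh t μ * (v a μ * uGh s)))
      + (𝓜.mGh t * 𝓜.mGh s) • (uGh s * (utGh t * u a))
      + (-𝓜.mGh t ^ 2) • (sc s * (sc t * u a))
      + (-1 : ℂ) • (sc s * ((∑ μ, η μ • d μ (d μ (sc t))) * u a))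
      + 𝓜.mGh t • (∑ μ, d μ (sc s) * (vGh t μ * u a)))) := by
    have e2 : ∑ μ, d μ (𝓜.scalarVec r μ : 𝒥) = ∑ a, ∑ t, ∑ s, r a t s • ∑ μ, d μ
        (𝓜.scalarTermVec a t s μ) := by
      simp only [Model.scalarVec, map_sum, map_smul, smul_sum]
      rw [sum_comm]
      refine sum_ext fun a => ?_
      rw [sum_comm]
      exact sum_ext fun a => sum_comm
    have z : ∑ a, ∑ t, ∑ s, r a t s • (∑ μ, η μ • (d μ (sc s) * (d μ (sc t) * u a))) = (0 : 𝒥) := by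
      refine sum_antisymm_right hr fun a t s => sum_ext fun μ => ?_
      rw [even_left_comm (d_mem_lin (sc_mem t) μ)]
    rw [e2, ← sub_eq_zero]
    refine Eq.trans ?_ ((congrArg ((-I) • ·) z).trans (smul_zero _))
    simp only [Model.scalarLagrangian, map_sum, map_smul, dQ_scalarTerm, divergence_scalarTermVec,
      ← sum_add_distrib, smul_sum (s := univ (α := 𝒱)),
      smul_sum (s := univ (α := 𝒮)), ← sum_sub_distrib]
    refine sum_ext fun a => sum_ext fun t => sum_ext fun s => ?_
    generalize (∑ μ, η μ • (d μ (sc s) * (d μ (sc t) * u a)) : 𝒥) = x1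
    generalize (∑ μ, η μ • (sc s * (d μ (sc t) * d μ (u a))) : 𝒥) = x2
    generalize (∑ μ, sc s * (d μ (vGh t μ) * u a) : 𝒥) = x3
    generalize (∑ μ, sc s * (vGh t μ * d μ (u a)) : 𝒥) = x4
    generalize (∑ μ, d μ (sc s) * (vGh t μ * u a) : 𝒥) = x5
    generalize (∑ μ, d μ (sc t) * (v a μ * uGh s) : 𝒥) = x6
    generalize (∑ μ, η μ • (vGh t μ * (v a μ * uGh s)) : 𝒥) = x7
    module
  have e2 : ∑ a, ∑ b, ∑ s, (𝓜.m b * r a (.inl b) s + 𝓜.m a * r b s (.inl a)) • (gM1 a b s : 𝒥) =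
      (∑ a, ∑ t, ∑ s, r a t s • 𝓜.mGh t • ∑ μ, d μ (sc s) * (vGh t μ * u a))
      + ∑ a, ∑ t, ∑ s, r a t s • 𝓜.mGh s • ∑ μ, d μ (sc t) * (v a μ * uGh s) := by
    have h1 : ∑ a, ∑ t, ∑ s, r a t s • 𝓜.mGh t • ∑ μ, d μ (sc s) * (vGh t μ * u a) =
        ∑ a, ∑ b, ∑ s, (𝓜.m b * r a (.inl b) s) • (gM1 a b s : 𝒥) := by
      simp only [smul_comm _ (𝓜.mGh _), ← smul_sum (r := 𝓜.mGh _), sum_mGh]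
      simp only [smul_sum (s := univ (α := 𝒮)), smul_smul]
      rfl
    have h2 : ∑ a, ∑ t, ∑ s, r a t s • 𝓜.mGh s • ∑ μ, d μ (sc t) * (v a μ * uGh s) =
        ∑ a, ∑ b, ∑ s, (𝓜.m a * r b s (.inl a)) • (gM1 a b s : 𝒥) := by
      simp only [smul_comm _ (𝓜.mGh _), sum_mGh]
      rw [sum_rot]
      simp only [smul_smul]
      rfl
    rw [h1, h2]
    simp only [add_smul, sum_add_distrib]
  have e3 : ∑ a, ∑ b, ∑ e, (-(𝓜.m b * 𝓜.m e * r a (.inl b) (.inl e))) •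
      (gM2 e b a : 𝒥) = ∑ a, ∑ t, ∑ s, r a t s • (-(𝓜.mGh t * 𝓜.mGh s)) •
      (∑ μ, η μ • (vGh t μ * (v a μ * uGh s))) := by
    simp only [sum_sc, mGh_inl, mGh_inr, mul_zero, zero_mul, neg_zero, zero_smul, smul_zero,
      sum_const_zero, add_zero]
    refine sum_ext fun a => sum_ext fun b => sum_ext fun e => ?_
    rw [smul_smul]
    congr 1
    ring
  have e4 : ∑ a, ∑ b, ∑ e, (𝓜.m b * 𝓜.m e * r a (.inl b) (.inl e)) •
      (gM3 e b a : 𝒥) = ∑ a, ∑ t, ∑ s, r a t s • (𝓜.mGh t * 𝓜.mGh s) •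
      (uGh s * (utGh t * u a)) := by
    simp only [sum_sc, mGh_inl, mGh_inr, mul_zero, zero_mul, zero_smul, smul_zero,
      sum_const_zero, add_zero]
    refine sum_ext fun a => sum_ext fun b => sum_ext fun e => ?_
    rw [smul_smul]
    congr 1
    ring
  rw [e1, e2, e3, e4]
  refine .smul _ (.add (.refl _) ?_)
  simp only [← sum_add_distrib]
  refine .sum _ fun a _ => .sum _ fun t _ => .sum _ fun s _ => ?_
  refine .trans (.smul _ (.add (.add (.refl _) (.smul _ (.mul_left _ (.mul_right _ (box_sc 𝓜 t)))))
    (.refl _))) (.of_eq ?_)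
  rw [smul_mul_assoc, mul_smul_comm, Model.mPhi, gM4]
  module

end

lemma eq_zero_of_add_self {X : 𝒥} (h : X + X = 0) : X = 0 := by
  rw [← two_smul ℂ] at h
  exact (smul_eq_zero_iff_right (two_ne_zero' ℂ)).1 h

section

variable [Fintype I₁] [Fintype I₂] [Fintype I₃] (𝓜 : Model I₁ I₂ I₃ I₄)

/-- The relations between the structure constants in a uniform notation: `r` combines `f'_{abc}`,
`f'_{jbc}` and `f'_{jkc}`. -/
structure Model.GaugeRelations (f : 𝒱 → 𝒱 → 𝒱 → ℂ) (r : 𝒱 → 𝒮 → 𝒮 → ℂ) : Prop where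
  f_left : ∀ a b e, f b a e = -f a b e
  f_right : ∀ a b e, f a e b = -f a b e
  r_antisymm : ∀ a t s, r a s t = -r a t s
  mass : ∀ b e s, 𝓜.m b * r e (.inl b) s - 𝓜.m e * r b (.inl e) s =
    𝓜.mGh s * Sum.elim (fun a => f a b e) (fun _ => 0) s

variable {𝓜} {f : I₁ ⊕ I₂ → I₁ ⊕ I₂ → I₁ ⊕ I₂ → ℂ}
  {r : I₁ ⊕ I₂ → (I₁ ⊕ I₂) ⊕ I₃ → (I₁ ⊕ I₂) ⊕ I₃ → ℂ} (h : 𝓜.GaugeRelations f r)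
include h

omit [Fintype I₁] [Fintype I₂] [Fintype I₃] in
lemma Model.GaugeRelations.f_cycle (a b e : 𝒱) : f e a b = f a b e := by
  rw [h.f_left, h.f_right, neg_neg]

omit [Fintype I₁] [Fintype I₂] [Fintype I₃] in
lemma Model.GaugeRelations.mass_inl (a b e : 𝒱) :
    𝓜.m b * r e (.inl b) (.inl a) - 𝓜.m e * r b (.inl e) (.inl a) = 𝓜.m a * f a b e :=
  h.mass b e (.inl a)

lemma cancel_gM1 : ∑ a, ∑ b, ∑ e, (f a b e * 𝓜.m e) • (gM1 a b (.inl e) : 𝒥)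
    + ∑ a, ∑ b, ∑ s, (𝓜.m b * r a (.inl b) s + 𝓜.m a * r b s (.inl a)) • gM1 a b s = 0 := by
  have e : ∀ a b s, 𝓜.m b * r a (.inl b) s + 𝓜.m a * r b s (.inl a) =
      𝓜.mGh s * Sum.elim (fun e => f e b a) (fun _ => 0) s := fun a b s => by
    rw [← h.mass, h.r_antisymm b (.inl a) s]
    ring
  simp only [e, mul_smul, sum_mGh, ← sum_add_distrib]
  refine sum_eq_zero fun a _ => sum_eq_zero fun b _ => sum_eq_zero fun c _ => ?_
  rw [Sum.elim_inl, ← h.f_cycle, h.f_right c b a]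
  module

lemma cancel_gM2 : ∑ a, ∑ b, ∑ e, (f a b e * -𝓜.m e ^ 2) • (gM2 a b e : 𝒥)
    + ∑ a, ∑ b, ∑ e, (-(𝓜.m b * 𝓜.m e * r a (.inl b) (.inl e))) • gM2 e b a = 0 := by
  have e1 : ∑ a, ∑ b, ∑ e, (f a b e * -𝓜.m e ^ 2) • (gM2 a b e : 𝒥) =
      ∑ e, ∑ a, ∑ b, (f e a b * -𝓜.m b ^ 2) • gM2 e a b := rfl
  have e2 : ∑ a, ∑ b, ∑ e, (-(𝓜.m b * 𝓜.m e * r a (.inl b) (.inl e))) • (gM2 e b a : 𝒥) =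
      ∑ e, ∑ a, ∑ b, (-(𝓜.m b * 𝓜.m e * r a (.inl b) (.inl e))) • gM2 e b a := sum_rot _
  have e3 : ∀ e a b, (gM2 e b a : 𝒥) = gM2 e a b := fun e a b =>
    sum_ext fun μ => by rw [even_left_comm (v_mem b μ)]
  rw [e1, e2]
  simp only [e3, ← sum_add_distrib, ← add_smul]
  refine sum_antisymm_right (fun e a b => ?_) fun e a b => e3 _ _ _
  have m1 := h.mass_inl b e a
  have m2 := h.mass_inl a e b
  rw [h.f_cycle] at m1 m2
  rw [h.f_right e a b] at m2 ⊢
  rw [h.r_antisymm e (.inl a) (.inl b)] at m2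
  rw [h.r_antisymm b (.inl e) (.inl a), h.r_antisymm a (.inl e) (.inl b)]
  linear_combination 𝓜.m a * m2 + 𝓜.m b * m1

lemma cancel_gM3 : ∑ a, ∑ b, ∑ e, (f a b e * (1 / 2 * 𝓜.m e ^ 2)) • (gM3 a e b : 𝒥)
    + ∑ a, ∑ b, ∑ e, (𝓜.m b * 𝓜.m e * r a (.inl b) (.inl e)) • gM3 e b a = 0 := by
  have e1 : ∑ a, ∑ b, ∑ e, (f a b e * (1 / 2 * 𝓜.m e ^ 2)) • (gM3 a e b : 𝒥) =
      ∑ b, ∑ e, ∑ a, (f e a b * (1 / 2 * 𝓜.m b ^ 2)) • gM3 e b a := sum_rot _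
  have e2 : ∑ a, ∑ b, ∑ e, (𝓜.m b * 𝓜.m e * r a (.inl b) (.inl e)) • (gM3 e b a : 𝒥) =
      ∑ b, ∑ e, ∑ a, (𝓜.m b * 𝓜.m e * r a (.inl b) (.inl e)) • gM3 e b a := by rw [sum_rot, sum_rot]
  have e3 : ∀ e b a, (gM3 a b e : 𝒥) = (-1 : ℂ) • gM3 e b a := fun e b a => by
    rw [gM3, odd_mul_left (u_mem a) (ut_mem b), odd_mul (u_mem a) (u_mem e), gM3,
      odd_mul_left (u_mem e) (ut_mem b), mul_smul_comm]
  rw [e1, e2]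
  simp only [← sum_add_distrib, ← add_smul]
  refine sum_eq_zero fun b _ => eq_zero_of_add_self ?_
  nth_rewrite 1 [sum_comm]
  simp only [← sum_add_distrib]
  refine sum_eq_zero fun e _ => sum_eq_zero fun a _ => ?_
  rw [e3 e b a, smul_smul, ← add_smul]
  refine (congrArg (· • _) ?_).trans (zero_smul ℂ _)
  have m1 := h.mass_inl b e a
  rw [h.f_cycle] at m1
  rw [h.f_left e a b, h.r_antisymm e (.inl a) (.inl b), h.r_antisymm a (.inl e) (.inl b)]
  linear_combination -𝓜.m b * m1

lemma cancel_gM4 {S : 𝒮 → 𝒮 → 𝒮 → ℂ}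
    (hS : ∀ a t s, 𝓜.m a * S (.inl a) t s = (𝓜.mPhi s - 𝓜.mPhi t) * r a t s) :
    ∑ a, ∑ t, ∑ s, (𝓜.mPhi t * r a t s) • (gM4 a t s : 𝒥)
    + ∑ a, ∑ t, ∑ s, (1 / 2 * (𝓜.m a * S (.inl a) t s)) • gM4 a t s = 0 := by
  simp only [hS, ← sum_add_distrib, ← add_smul]
  refine sum_antisymm_right (fun a t s => ?_) fun a t s => ?_
  · rw [h.r_antisymm]
    ring
  · rw [gM4, even_left_comm (sc_mem t), gM4]

omit h in
lemma dQ_potential {S : 𝒮 → 𝒮 → 𝒮 → ℂ}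
    (s1 : ∀ s t p, S t s p = S s t p) (s2 : ∀ s t p, S s p t = S s t p) :
    𝓜.dQ ((1 / 6 : ℂ) • ∑ s, ∑ t, ∑ p, S s t p • (mS s t p : 𝒥)) =
      I • ∑ a, ∑ t, ∑ s, (1 / 2 * (𝓜.m a * S (.inl a) t s)) • gM4 a t s := by
  have e : ∀ s t p, 𝓜.dQ (mS s t p : 𝒥) = I • (
      𝓜.mGh s • (sc p * (sc t * uGh s)) + 𝓜.mGh t • (sc p * (sc s * uGh t))
      + 𝓜.mGh p • (sc t * (sc s * uGh p))) := fun s t p => by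
    rw [mS, mul_assoc, dQ_mul_even 𝓜 (sc_mem s), dQ_mul_even 𝓜 (sc_mem t), dQ_sc, dQ_sc, dQ_sc]
    have c1 : uGh s * (sc t * sc p) = (sc p * (sc t * uGh s) : 𝒥) := by
      rw [even_comm (sc_mem t), even_left_comm' (sc_mem p), even_comm' (sc_mem t)]
    have c2 : sc s * (uGh t * sc p) = (sc p * (sc s * uGh t) : 𝒥) := by
      rw [even_comm' (sc_mem p), even_left_comm' (sc_mem p)]
    simp only [smul_mul_assoc, mul_smul_comm, mul_add, c1, c2, even_left_comm (X := sc s) (sc_mem s)]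
    module
  set G : 𝒮 → 𝒮 → 𝒮 → 𝒥 := fun s t p => S s t p • 𝓜.mGh s • (sc p * (sc t * uGh s)) with hG
  have e1 : ∑ s, ∑ t, ∑ p, S s t p • 𝓜.mGh t • (sc p * (sc s * uGh t) : 𝒥) =
      ∑ s, ∑ t, ∑ p, G s t p := by
    rw [sum_comm]
    refine sum_ext fun s => sum_ext fun t => sum_ext fun p => ?_
    rw [hG, s1]
  have e2 : ∑ s, ∑ t, ∑ p, S s t p • 𝓜.mGh p • (sc t * (sc s * uGh p) : 𝒥) =
      ∑ s, ∑ t, ∑ p, G s t p := by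
    rw [sum_rot]
    refine sum_ext fun s => sum_ext fun t => sum_ext fun p => ?_
    rw [hG, s2 t s p, s1 s t p]
  have e3 : ∑ s, ∑ t, ∑ p, G s t p = ∑ a, ∑ t, ∑ s, (𝓜.m a * S (.inl a) t s) • (gM4 a t s : 𝒥) := by
    simp only [hG, smul_comm _ (𝓜.mGh _), ← smul_sum (r := 𝓜.mGh _), sum_mGh]
    simp only [smul_sum (s := univ (α := 𝒮)), smul_smul]
    rfl
  simp only [map_smul, map_sum, e, smul_comm _ I, ← smul_sum (r := I)]
  congr 1
  simp only [smul_add, sum_add_distrib, e1, e2]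
  simp only [mul_smul, ← smul_sum (r := (1 / 2 : ℂ))]
  simp only [← mul_smul, ← e3, hG]
  module

end

/-! ### The currents in the Lagrangian -/

section

variable [Fintype I₁] [Fintype I₂] [Fintype I₃] [Fintype I₄] (𝓜 : Model I₁ I₂ I₃ I₄)

omit [Fintype I₁] [Fintype I₂] [Fintype I₃] in
lemma dQ_bilinear_mul (k : Matrix I₄ I₄ ℂ) (Γ : 𝕄) (X : 𝒥) :
    𝓜.dQ (Model.bilinear k Γ * X) = Model.bilinear k Γ * 𝓜.dQ X := by
  simp only [Model.bilinear, sum_mul, map_sum, map_smul, smul_mul_assoc, mul_assoc,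
    dQ_mul_odd 𝓜 (psibar_mem _ _), dQ_mul_odd 𝓜 (psi_mem _ _), dQ_psi, dQ_psibar, zero_mul,
    zero_add, mul_smul_comm, smul_smul, mul_one, mul_neg, neg_neg]

omit [Fintype I₁] [Fintype I₂] [Fintype I₃] in
lemma dQ_vectorCurrent_mul (t : ℤˣ → Matrix I₄ I₄ ℂ) (μ : Fin 4) (X : 𝒥) :
    𝓜.dQ (𝓜.vectorCurrent t μ * X) = 𝓜.vectorCurrent t μ * 𝓜.dQ X := by
  simp only [Model.vectorCurrent, sum_mul, map_sum, dQ_bilinear_mul]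

omit [Fintype I₁] [Fintype I₂] [Fintype I₃] in
lemma dQ_scalarCurrent_mul (s : ℤˣ → Matrix I₄ I₄ ℂ) (X : 𝒥) :
    𝓜.dQ (𝓜.scalarCurrent s * X) = 𝓜.scalarCurrent s * 𝓜.dQ X := by
  simp only [Model.scalarCurrent, sum_mul, map_sum, dQ_bilinear_mul]

/-- The part of the Lagrangian with Dirac fields. -/
def Model.diracLagrangian (t : 𝒱 → ℤˣ → Matrix I₄ I₄ ℂ) (c : 𝒮 → ℤˣ → Matrix I₄ I₄ ℂ) : 𝒥 :=
  (∑ a, ∑ μ, 𝓜.vectorCurrent (t a) μ * vLow a μ) + ∑ s, 𝓜.scalarCurrent (c s) * sc s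

lemma dQ_diracLagrangian {t : 𝒱 → ℤˣ → Matrix I₄ I₄ ℂ} {c : 𝒮 → ℤˣ → Matrix I₄ I₄ ℂ} (h : ∀ a ε A B,
      I * (𝓜.mD A * t a ε A B - t a (-ε) A B * 𝓜.mD B) = 𝓜.m a * c (.inl a) ε A B) :
    𝓜.OnShellEq (𝓜.dQ (𝓜.diracLagrangian t c))
      (I • ∑ μ, d μ (∑ a, 𝓜.vectorCurrent (t a) μ * u a)) := by
  have e1 : 𝓜.dQ (𝓜.diracLagrangian t c : 𝒥) = I • ∑ a, ((∑ μ, 𝓜.vectorCurrent (t a) μ * d μ (u a))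
        + (𝓜.m a • 𝓜.scalarCurrent (c (.inl a))) * u a) := by
    simp only [Model.diracLagrangian, map_add, map_sum, dQ_vectorCurrent_mul, dQ_scalarCurrent_mul,
      vLow, map_smul, dQ_v, dQ_sc, mul_smul_comm, mul_smul, ← smul_sum (r := I),
      sum_add_distrib, smul_add, sum_mGh, smul_mul_assoc]
    congr 1
    simp only [smul_comm (η _) I, ← smul_sum (r := I)]
    congr 1
    refine sum_ext fun a => sum_ext fun μ => ?_
    rw [smul_smul, η_mul_self, one_smul]
  have e2 : ∑ μ, d μ (∑ a, 𝓜.vectorCurrent (t a) μ * u a : 𝒥) = ∑ a,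
      ((∑ μ, 𝓜.vectorCurrent (t a) μ * d μ (u a))
        + (∑ μ, d μ (𝓜.vectorCurrent (t a) μ)) * u a) := by
    simp only [map_sum, d_mul, sum_mul, ← sum_add_distrib]
    rw [sum_comm]
    exact sum_ext fun a => sum_ext fun μ => add_comm _ _
  rw [e1, e2]
  exact .smul _ (.sum _ fun a _ => .add (.refl _) (.mul_right _
    ((divergence_vectorCurrent_iff a (t a) (c (.inl a))).2 (h a)).symm))

/-! ### Gauge invariance -/

/-- The interaction Lagrangian in the uniform notation. -/
def Model.lagrangian (f : 𝒱 → 𝒱 → 𝒱 → ℂ) (r : 𝒱 → 𝒮 → 𝒮 → ℂ) (S : 𝒮 → 𝒮 → 𝒮 → ℂ)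
    (t : 𝒱 → ℤˣ → Matrix I₄ I₄ ℂ) (c : 𝒮 → ℤˣ → Matrix I₄ I₄ ℂ) :
    𝒥 :=
  ymLagrangian f + 𝓜.scalarLagrangian r + ((1 / 6 : ℂ) • ∑ s, ∑ t, ∑ p, S s t p • StandardModel.mS s t p)
    + 𝓜.diracLagrangian t c

def Model.lagrangianVec (f : 𝒱 → 𝒱 → 𝒱 → ℂ) (r : 𝒱 → 𝒮 → 𝒮 → ℂ)
    (t : 𝒱 → ℤˣ → Matrix I₄ I₄ ℂ) (μ : Fin 4) : 𝒥 :=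
  ymVec f μ + 𝓜.scalarVec r μ + ∑ a, 𝓜.vectorCurrent (t a) μ * u a

variable {𝓜} {f : I₁ ⊕ I₂ → I₁ ⊕ I₂ → I₁ ⊕ I₂ → ℂ}
  {r : I₁ ⊕ I₂ → (I₁ ⊕ I₂) ⊕ I₃ → (I₁ ⊕ I₂) ⊕ I₃ → ℂ} (h : 𝓜.GaugeRelations f r)
include h

lemma Model.GaugeRelations.dQ_lagrangian {S : 𝒮 → 𝒮 → 𝒮 → ℂ}
    (s1 : ∀ s t p, S t s p = S s t p) (s2 : ∀ s t p, S s p t = S s t p)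
    (hS : ∀ a t s, 𝓜.m a * S (.inl a) t s = (𝓜.mPhi s - 𝓜.mPhi t) * r a t s)
    {t : 𝒱 → ℤˣ → Matrix I₄ I₄ ℂ} {c : 𝒮 → ℤˣ → Matrix I₄ I₄ ℂ}
    (hc : ∀ a ε A B, I * (𝓜.mD A * t a ε A B - t a (-ε) A B * 𝓜.mD B) = 𝓜.m a * c (.inl a) ε A B) :
    𝓜.OnShellEq (𝓜.dQ (𝓜.lagrangian f r S t c)) (I • ∑ μ, d μ (𝓜.lagrangianVec f r t μ)) := by
  have e := ((dQ_ymLagrangian 𝓜 h.f_left h.f_right).add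
    (dQ_scalarLagrangian 𝓜 h.r_antisymm)).add (.of_eq (dQ_potential (𝓜 := 𝓜) s1 s2))
    |>.add (dQ_diracLagrangian 𝓜 hc)
  simp only [← map_add] at e
  refine e.trans (.of_eq ?_)
  have z1 := cancel_gM1 (I₃ := I₃) (I₄ := I₄) h
  have z2 := cancel_gM2 (I₃ := I₃) (I₄ := I₄) h
  have z3 := cancel_gM3 (I₃ := I₃) (I₄ := I₄) h
  have z4 := cancel_gM4 (I₄ := I₄) h hS
  have q : ∑ a, ∑ b, ∑ e, f a b e • (𝓜.m e • gM1 a b (.inl e) + (-𝓜.m e ^ 2) • gM2 a b e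
      + (1 / 2 * 𝓜.m e ^ 2) • (gM3 a e b : 𝒥)) =
      (∑ a, ∑ b, ∑ e, (f a b e * 𝓜.m e) • gM1 a b (.inl e))
      + (∑ a, ∑ b, ∑ e, (f a b e * -𝓜.m e ^ 2) • gM2 a b e)
      + ∑ a, ∑ b, ∑ e, (f a b e * (1 / 2 * 𝓜.m e ^ 2)) • gM3 a e b := by
    simp only [smul_add, smul_smul, sum_add_distrib]
  rw [q]
  simp only [Model.lagrangianVec, map_add, sum_add_distrib]
  rw [add_comm] at z1 z2 z3 z4
  rw [eq_neg_of_add_eq_zero_left z1, eq_neg_of_add_eq_zero_left z2, eq_neg_of_add_eq_zero_left z3,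
    eq_neg_of_add_eq_zero_right z4]
  generalize (∑ a, ∑ b, ∑ e, (f a b e * 𝓜.m e) • (gM1 a b (.inl e) : 𝒥)) = x1
  generalize (∑ a, ∑ b, ∑ e, (f a b e * -𝓜.m e ^ 2) • (gM2 a b e : 𝒥)) = x2
  generalize (∑ a, ∑ b, ∑ e, (f a b e * (1 / 2 * 𝓜.m e ^ 2)) • (gM3 a e b : 𝒥)) = x3
  module

/-! ### The second equation of the ladder -/

omit h [Fintype I₁] [Fintype I₂] [Fintype I₃] [Fintype I₄] in
lemma dQ_fieldStrength (a : 𝒱) (μ ν : Fin 4) : 𝓜.dQ (fieldStrength a μ ν : 𝒥) = 0 := by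
  rw [fieldStrength, dUp, dUp, map_sub, map_smul, map_smul, dQ_d 𝓜 (v_mem _ _),
    dQ_d 𝓜 (v_mem _ _), dQ_v, dQ_v, map_smul, map_smul, d_comm (u_mem a)]
  module

omit h [Fintype I₁] [Fintype I₂] [Fintype I₃] [Fintype I₄] in
lemma dQ_Tten (c : Couplings I₁ I₂ I₃ I₄) [Fintype I₁] [Fintype I₂] (μ ν : Fin 4) :
    𝓜.dQ (Model.Tten c μ ν : 𝒥) = 0 := by
  simp [Model.Tten, mul_assoc, dQ_mul_odd 𝓜 (u_mem _), dQ_u, dQ_fieldStrength]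

omit h [Fintype I₃] [Fintype I₄] in
lemma dQ_ymVec (hf : ∀ a b e, f b a e = -f a b e) (μ : Fin 4) : 𝓜.OnShellEq (𝓜.dQ (ymVec f μ))
    (I • ((∑ ν, d ν ((1 / 2 : ℂ) • ∑ a, ∑ b, ∑ e, f a b e • (u a * u b * fieldStrength e μ ν)))
    + ∑ a, ∑ b, ∑ e, f a b e • ((1 / 2 * 𝓜.m e) • (u a * (dUp μ (sc (.inl e)) * u b))
      + (-(1 / 2 * 𝓜.m e ^ 2)) • (u a * (v e μ * u b))))) := by
  have e1 : ∀ a b e, 𝓜.dQ ((∑ ν, u a * vLow b ν * fieldStrength e ν μ)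
      - (1 / 2 : ℂ) • (u a * u b * dUp μ (ut e)) : 𝒥) = I • (
      (∑ ν, u a * d ν (u b) * fieldStrength e μ ν)
      + (1 / 2 * 𝓜.m e) • (u a * (dUp μ (sc (.inl e)) * u b))
      + (1 / 2 : ℂ) • ∑ ν, η μ • (u a * (u b * d μ (d ν (v e ν))))) := fun a b e => by
    have a1 : ∀ ν, 𝓜.dQ (u a * (vLow b ν * fieldStrength e ν μ) : 𝒥) =
        I • (u a * d ν (u b) * fieldStrength e μ ν) := fun ν => by
      have : fieldStrength e ν μ = (-1 : ℂ) • (fieldStrength e μ ν : 𝒥) := by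
        rw [fieldStrength, fieldStrength]
        module
      rw [dQ_mul_odd 𝓜 (u_mem a), dQ_u, vLow, smul_mul_assoc, map_smul, dQ_mul_even 𝓜 (v_mem b ν),
        dQ_fieldStrength, dQ_v, this]
      simp only [zero_mul, mul_zero, zero_add, add_zero, smul_mul_assoc, mul_smul_comm, smul_smul,
        mul_assoc, smul_zero]
      congr 1
      linear_combination I * η_mul_self ν
    have a2 : 𝓜.dQ (u a * (u b * dUp μ (ut e)) : 𝒥) = (-I) • (
        (𝓜.m e) • (u a * (dUp μ (sc (.inl e)) * u b))
        + ∑ ν, η μ • (u a * (u b * d μ (d ν (v e ν))))) := by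
      rw [dQ_mul_odd 𝓜 (u_mem a), dQ_mul_odd 𝓜 (u_mem b), dQ_u, dQ_u, dUp, map_smul,
        dQ_d 𝓜 (ut_mem e), dQ_ut, dUp]
      have c1 : u b * d μ (sc (.inl e)) = (d μ (sc (.inl e)) * u b : 𝒥) :=
        even_comm' (d_mem_lin (sc_mem _) μ)
      simp only [zero_mul, mul_zero, smul_mul_assoc, mul_smul_comm, map_smul,
        map_add, map_sum, mul_add, smul_add, mul_sum, c1, ← smul_sum]
      module
    rw [jet_sub, map_add, map_sum, map_smul, map_smul]
    simp only [mul_assoc (u a), a1, a2, ← smul_sum (r := I)]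
    module
  have e2 : ∀ a b e, ∑ ν, d ν (u a * u b * fieldStrength e μ ν : 𝒥) =
      (∑ ν, u a * d ν (u b) * fieldStrength e μ ν) + (∑ ν, d ν (u a) * u b * fieldStrength e μ ν)
      + ((∑ ν, η μ • (u a * (u b * d μ (d ν (v e ν)))))
      + (-1 : ℂ) • (u a * (u b * ∑ ν, η ν • d ν (d ν (v e μ))))) := fun a b e => by
    simp only [mul_sum, smul_sum, ← sum_add_distrib]
    refine sum_ext fun ν => ?_
    simp only [d_mul, fieldStrength, dUp, jet_sub, map_add, map_smul, d_comm (v_mem e ν) μ ν, mul_add,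
      mul_smul_comm, mul_assoc]
    module
  have z : ∑ a, ∑ b, ∑ e, f a b e • ((∑ ν, u a * d ν (u b) * fieldStrength e μ ν)
      + (-1 : ℂ) • (∑ ν, d ν (u a) * u b * fieldStrength e μ ν)) = (0 : 𝒥) := by
    refine sum_antisymm_left hf fun a b e => ?_
    simp only [smul_sum, ← sum_add_distrib]
    refine sum_ext fun ν => ?_
    rw [odd_mul (u_mem b) (d_mem_lin (u_mem a) ν), odd_mul (d_mem_lin (u_mem b) ν) (u_mem a)]
    simp only [smul_mul_assoc]
    module
  have e3 : 𝓜.dQ (ymVec f μ : 𝒥) = I • ((∑ ν, d ν ((1 / 2 : ℂ) •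
      ∑ a, ∑ b, ∑ e, f a b e • (u a * u b * fieldStrength e μ ν)))
    + ∑ a, ∑ b, ∑ e, f a b e • ((1 / 2 * 𝓜.m e) • (u a * (dUp μ (sc (.inl e)) * u b))
      + (1 / 2 : ℂ) • (u a * (u b * ∑ ν, η ν • d ν (d ν (v e μ)))))) := by
    have e4 : ∑ ν, d ν ((1 / 2 : ℂ) • ∑ a, ∑ b, ∑ e, f a b e •
        (u a * u b * fieldStrength e μ ν) : 𝒥) = (1 / 2 : ℂ) • ∑ a, ∑ b, ∑ e,
        f a b e • ∑ ν, d ν (u a * u b * fieldStrength e μ ν) := by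
      simp only [map_sum, map_smul, ← smul_sum (r := (1 / 2 : ℂ)), smul_sum (r := f _ _ _)]
      rw [sum_comm]
      congr 1
      refine sum_ext fun a => ?_
      rw [sum_comm]
      exact sum_ext fun a => sum_comm
    rw [e4, ← sub_eq_zero]
    refine Eq.trans ?_ ((congrArg ((1 / 2 * I) • ·) z).trans (smul_zero _))
    simp only [ymVec, map_sum, map_smul, e1, e2]
    simp only [← sum_add_distrib (s := univ (α := 𝒱)), smul_sum (s := univ (α := 𝒱)),
      ← sum_sub_distrib]
    refine sum_ext fun a => sum_ext fun b => sum_ext fun e => ?_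
    generalize (∑ ν, u a * d ν (u b) * fieldStrength e μ ν : 𝒥) = x1
    generalize (∑ ν, d ν (u a) * u b * fieldStrength e μ ν : 𝒥) = x2
    generalize (∑ ν, η μ • (u a * (u b * d μ (d ν (v e ν)))) : 𝒥) = x3
    generalize (u a * (u b * ∑ ν, η ν • d ν (d ν (v e μ))) : 𝒥) = x4
    module
  rw [e3]
  refine .smul _ (.add (.refl _) (.sum _ fun a _ => .sum _ fun b _ => .sum _ fun e _ => .smul _
    (.add (.refl _) (.trans (.smul _ (.mul_left _ (.mul_left _ (box_v 𝓜 e μ)))) (.of_eq ?_)))))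
  rw [even_comm (v_mem e μ)]
  simp only [mul_smul_comm]
  module

end

section

variable [Fintype I₁] [Fintype I₂] [Fintype I₃] [Fintype I₄] {𝓜 : Model I₁ I₂ I₃ I₄}

/-- The combination `d^μ Φ_a - m_a v_a^μ`. -/
def Model.stueckelberg (𝓜 : ℳ) (t : 𝒮) (μ : Fin 4) : 𝒥 := dUp μ (sc t) + (-𝓜.mGh t) • vGh t μ

omit [Fintype I₁] [Fintype I₂] [Fintype I₃] [Fintype I₄] in
lemma stueckelberg_mem (t : 𝒮) (μ : Fin 4) : 𝓜.stueckelberg t μ ∈ lin _ _ _ _ false :=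
  add_mem (smul_mem_lin _ (d_mem_lin (sc_mem t) μ)) (smul_mem_lin _ (vGh_mem t μ))

omit [Fintype I₁] [Fintype I₂] [Fintype I₃] [Fintype I₄] in
lemma dQ_stueckelberg (t : 𝒮) (μ : Fin 4) : 𝓜.dQ (𝓜.stueckelberg t μ : 𝒥) = 0 := by
  rw [Model.stueckelberg, map_add, map_smul, dUp, map_smul, dQ_d 𝓜 (sc_mem t), dQ_sc, dQ_vGh,
    map_smul]
  module

omit [Fintype I₁] [Fintype I₂] [Fintype I₃] [Fintype I₄] in
lemma dQ_scalarTermVec (a : 𝒱) (t s : 𝒮) (μ : Fin 4) : 𝓜.dQ (𝓜.scalarTermVec a t s μ : 𝒥) =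
      I • 𝓜.mGh s • (uGh s * (𝓜.stueckelberg t μ * u a)) := by
  have e : 𝓜.scalarTermVec a t s μ = (sc s * (𝓜.stueckelberg t μ * u a) : 𝒥) := by
    simp only [Model.scalarTermVec, Model.stueckelberg, add_mul, mul_add, smul_mul_assoc,
      mul_smul_comm]
  rw [e, dQ_mul_even 𝓜 (sc_mem s), dQ_mul_even 𝓜 (stueckelberg_mem t μ), dQ_stueckelberg, dQ_u,
    dQ_sc, zero_mul, mul_zero, add_zero, mul_zero, add_zero, smul_mul_assoc, mul_smul]

omit [Fintype I₄] in
lemma cancel_ghost {f : 𝒱 → 𝒱 → 𝒱 → ℂ} {r : 𝒱 → 𝒮 → 𝒮 → ℂ} (h : 𝓜.GaugeRelations f r)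
    {N : 𝒱 → 𝒮 → 𝒱 → 𝒥}
    (hN : ∀ e t a, N a t e = (-1 : ℂ) • N e t a) :
    (∑ a, ∑ b, ∑ e, (f a b e * (1 / 2 * 𝓜.m e)) • N a (.inl e) b)
      + ∑ a, ∑ t, ∑ e, (𝓜.m e * r a t (.inl e)) • N e t a = 0 := by
  have e1 : ∀ t, (2 : ℂ) • (∑ e, ∑ a, (𝓜.m e * r a t (.inl e)) • N e t a) = 𝓜.mGh t •
      ∑ e, ∑ a, (-Sum.elim (fun b => f b e a) (fun _ => 0) t) • N e t a := fun t => by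
    rw [two_smul]
    nth_rewrite 1 [sum_comm]
    simp only [← sum_add_distrib, smul_sum]
    refine sum_ext fun e => sum_ext fun a => ?_
    rw [hN e t a, smul_smul, smul_smul, ← add_smul]
    congr 1
    have := h.mass e a t
    rw [h.r_antisymm a t (.inl e), h.r_antisymm e t (.inl a)] at this
    linear_combination -this
  have e2 : ∑ a, ∑ t, ∑ e, (𝓜.m e * r a t (.inl e)) • N e t a =
      ∑ t, ∑ e, ∑ a, (𝓜.m e * r a t (.inl e)) • N e t a := by rw [sum_rot, sum_rot]
  have e3 : ∑ a, ∑ b, ∑ e, (f a b e * (1 / 2 * 𝓜.m e)) • N a (.inl e) b =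
      ∑ b, ∑ e, ∑ a, (f e a b * (1 / 2 * 𝓜.m b)) • N e (.inl b) a := sum_rot _
  refine (smul_eq_zero_iff_right (two_ne_zero' ℂ)).1 ?_
  rw [smul_add, e2, e3, smul_sum (f := fun t => ∑ e, ∑ a, (𝓜.m e * r a t (.inl e)) • N e t a)]
  simp only [e1, sum_mGh]
  simp only [smul_sum, ← sum_add_distrib]
  refine sum_eq_zero fun b _ => sum_eq_zero fun e _ => sum_eq_zero fun a _ => ?_
  rw [Sum.elim_inl, h.f_cycle e a b]
  module

lemma Model.GaugeRelations.dQ_lagrangianVec {f : 𝒱 → 𝒱 → 𝒱 → ℂ}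
    {r : 𝒱 → 𝒮 → 𝒮 → ℂ} (h : 𝓜.GaugeRelations f r)
    (t : 𝒱 → ℤˣ → Matrix I₄ I₄ ℂ) (μ : Fin 4) :
    𝓜.OnShellEq (𝓜.dQ (𝓜.lagrangianVec f r t μ)) (I • ∑ ν, d ν
      ((1 / 2 : ℂ) • ∑ a, ∑ b, ∑ e, f a b e • (u a * u b * fieldStrength e μ ν))) := by
  rw [Model.lagrangianVec, map_add, map_add]
  have e1 : 𝓜.dQ (∑ a, 𝓜.vectorCurrent (t a) μ * u a : 𝒥) = 0 := by
    simp [dQ_vectorCurrent_mul, dQ_u]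
  have e2 : 𝓜.dQ (𝓜.scalarVec r μ : 𝒥) = I • ∑ a, ∑ t, ∑ e,
      (𝓜.m e * r a t (.inl e)) • (u e * (𝓜.stueckelberg t μ * u a)) := by
    simp only [Model.scalarVec, map_sum, map_smul, dQ_scalarTermVec, smul_comm _ I,
      ← smul_sum (r := I)]
    simp only [smul_comm _ (𝓜.mGh _), sum_mGh]
    simp only [smul_smul]
    rfl
  rw [e1, e2, add_zero]
  refine ((dQ_ymVec h.f_left μ).add (.refl _)).trans (.of_eq ?_)
  have z := cancel_ghost h (N := fun e t a => u e * (𝓜.stueckelberg t μ * u a)) fun e t a => by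
    rw [even_left_comm' (stueckelberg_mem t μ), odd_mul (u_mem a) (u_mem e), mul_smul_comm,
      even_left_comm (stueckelberg_mem t μ)]
  have e3 : ∀ a b e, (1 / 2 * 𝓜.m e) • (u a * (dUp μ (sc (.inl e)) * u b))
      + (-(1 / 2 * 𝓜.m e ^ 2)) • (u a * (v e μ * u b)) =
      (1 / 2 * 𝓜.m e) • (u a * (𝓜.stueckelberg (.inl e) μ * u b) : 𝒥) := fun a b e => by
    have : (vGh (.inl e) μ : 𝒥) = v e μ := rfl
    simp only [Model.stueckelberg, add_mul, mul_add, smul_mul_assoc, mul_smul_comm, mGh_inl, this]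
    module
  simp only [e3, smul_smul]
  rw [← smul_add, add_assoc, z, add_zero]

end

/-! ### The interaction Lagrangian in the uniform notation -/

/-- The constants `f'_{abc}`, `f'_{jbc}`, `f'_{jkc}` in a uniform notation. -/
def Couplings.r (c : Couplings I₁ I₂ I₃ I₄) (a : 𝒱) : 𝒮 → 𝒮 → ℂ
  | .inl b, .inl e => c.fp e b a
  | .inl (.inr b), .inr j => c.fSp j (.inr b) a
  | .inr j, .inl (.inr b) => -c.fSp j (.inr b) a
  | .inl (.inl _), .inr _ => 0
  | .inr _, .inl (.inl _) => 0
  | .inr k, .inr j => c.fSSp j k a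

/-- The scalar couplings of the Dirac fields. -/
def Couplings.src (c : Couplings I₁ I₂ I₃ I₄) : 𝒮 → ℤˣ → Matrix I₄ I₄ ℂ := Sum.elim c.s c.sS

section

variable [Fintype I₁] [Fintype I₂] [Fintype I₃] [Fintype I₄] (𝓜 : Model I₁ I₂ I₃ I₄)
  (c : Couplings I₁ I₂ I₃ I₄)

/-- The self-interaction of the scalars. -/
def Couplings.potential : 𝒥 :=
  (1 / 2 : ℂ) • (∑ j, ∑ b, ∑ e, c.fSpp j b e • (phi j * Phi b * Phi e))
  + (1 / 2 : ℂ) • (∑ j, ∑ k, ∑ e, c.fSSpp j k e • (phi j * phi k * Phi e))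
  + (1 / 6 : ℂ) • (∑ j, ∑ k, ∑ l, c.lam j k l • (phi j * phi k * phi l))

lemma ymLagrangian_eq (hf : ∀ a b e, c.f b a e = -c.f a b e) : ∑ a, ∑ b, ∑ e, c.f a b e •
      ((1 / 2 : ℂ) • (∑ μ, ∑ ν, vLow a μ * vLow b ν * fieldStrength e ν μ)
        + ∑ μ, u a * v b μ * d μ (ut e)) = (ymLagrangian c.f : 𝒥) := by
  have e1 : ∀ a b e : 𝒱, ∑ μ, ∑ ν, vLow a μ * vLow b ν * fieldStrength e ν μ =
      (mB e b a : 𝒥) + (-1 : ℂ) • mB e a b := fun a b e => by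
    have x1 : (mB e b a : 𝒥) = ∑ μ, ∑ ν, η μ • (d ν (v e μ) * v b ν * v a μ) := sum_comm
    rw [x1, mB]
    simp only [smul_sum, ← sum_add_distrib]
    refine sum_ext fun μ => sum_ext fun ν => ?_
    have c1 : v a μ * v b ν * d ν (v e μ) = (d ν (v e μ) * v b ν * v a μ : 𝒥) := by
      rw [even_comm' (d_mem_lin (v_mem e μ) ν), even_comm (v_mem a μ), mul_assoc]
    have c2 : v a μ * v b ν * d μ (v e ν) = (d μ (v e ν) * v a μ * v b ν : 𝒥) := by
      rw [even_comm' (d_mem_lin (v_mem e ν) μ), mul_assoc]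
    simp only [vLow, fieldStrength, dUp, jet_sub, mul_add, mul_smul_comm, smul_mul_assoc, c1, c2,
      smul_smul]
    have h1 : η ν * (η ν * η μ) = η μ := by rw [← mul_assoc, η_mul_self, one_mul]
    have h2 : η μ * (η μ * η ν) = η ν := by rw [← mul_assoc, η_mul_self, one_mul]
    rw [h1, show -1 * η μ * (η ν * η μ) = -1 * η ν by rw [mul_assoc, mul_comm (η ν), h2]]
  have e2 : ∀ a b e : 𝒱, ∑ μ, u a * v b μ * d μ (ut e) =
      (-1 : ℂ) • (mZ e b a : 𝒥) := fun a b e => by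
    rw [mZ, smul_sum]
    refine sum_ext fun μ => ?_
    rw [even_comm' (v_mem b μ), mul_assoc, odd_mul (u_mem a) (d_mem_lin (ut_mem e) μ),
      mul_smul_comm, even_left_comm (v_mem b μ), mul_assoc]
  have z := sum_antisymm_left hf (M := fun a b e => (mB e b a + mB e a b : 𝒥))
    fun a b e => add_comm _ _
  rw [ymLagrangian, ← sub_eq_zero]
  refine Eq.trans ?_ ((congrArg ((-1 / 2 : ℂ) • ·) z).trans (smul_zero _))
  simp only [e1, e2, smul_sum (s := univ (α := 𝒱)), ← sum_sub_distrib]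
  refine sum_ext fun a => sum_ext fun b => sum_ext fun e => ?_
  module

omit [Fintype I₄] in
lemma sum_r {X : 𝒱 → 𝒮 → 𝒮 → 𝒥} (h1 : ∀ a b j, X a (.inl (.inl b)) (.inr j) = 0)
    (h2 : ∀ a b j, X a (.inr j) (.inl (.inl b)) = 0) :
    ∑ a, ∑ t, ∑ s, c.r a t s • X a t s = (∑ a, ∑ b, ∑ e, c.fp a b e • X e (.inl b) (.inl a))
      + (∑ j, ∑ b, ∑ e, c.fSp j b e • X e (.inl b) (.inr j))
      - (∑ j, ∑ b, ∑ e, c.fSp j b e • X e (.inr j) (.inl b))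
      + (∑ j, ∑ k, ∑ e, c.fSSp j k e • X e (.inr k) (.inr j)) := by
  rw [sum_swap_outer (fun a b e => c.fp a b e • X e (.inl b) (.inl a)),
    sum_swap_outer (fun j b e => c.fSp j b e • X e (.inl b) (.inr j)),
    sum_rot (fun j b e => c.fSp j b e • X e (.inr j) (.inl b)),
    sum_swap_outer (fun j k e => c.fSSp j k e • X e (.inr k) (.inr j))]
  simp only [Fintype.sum_sum_type, sum_add_distrib, Couplings.r, jet_neg_smul,
    sum_neg_distrib, h1, h2, smul_zero, sum_const_zero]
  abel

lemma scalarLagrangian_eq : 𝓜.scalarLagrangian c.r = (∑ a, ∑ b, ∑ e, c.fp a b e •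
    ((∑ μ, Phi a * d μ (Phi b) * v e μ) - 𝓜.m b • (∑ μ, Phi a * vLow b μ * v e μ)
      + 𝓜.m b • (Phi a * ut b * u e)))
  + (∑ j, ∑ b, ∑ e, c.fSp j b e • (phi j *
    ((∑ μ, d μ (Phi b) * v e μ) - 𝓜.m b • (∑ μ, v b μ * vLow e μ) + 𝓜.m b • (ut b * u e))))
  - (∑ j, ∑ b, ∑ e, c.fSp j b e • (∑ μ, d μ (phi j) * Phi b * v e μ))
  + (∑ j, ∑ k, ∑ e, c.fSSp j k e • (∑ μ, phi j * d μ (phi k) * v e μ) : 𝒥) := by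
  have t1 : ∀ a b e, 𝓜.scalarTerm e (.inl b) (.inl a) = ((∑ μ, Phi a * d μ (Phi b) * v e μ)
      - 𝓜.m b • (∑ μ, Phi a * vLow b μ * v e μ) + 𝓜.m b • (Phi a * ut b * u e) :
      𝒥) := fun a b e => by
    simp only [Model.scalarTerm, sc_inl, mGh_inl, vGh, utGh, Sum.elim_inl, vLow, mul_assoc,
      smul_mul_assoc, mul_smul_comm, jet_sub]
    module
  have t2 : ∀ j b e, 𝓜.scalarTerm e (.inl b) (.inr j) = (phi j *
    ((∑ μ, d μ (Phi b) * v e μ) - 𝓜.m b • (∑ μ, v b μ * vLow e μ) + 𝓜.m b • (ut b * u e)) :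
      𝒥) := fun j b e => by
    simp only [Model.scalarTerm, sc_inl, sc_inr, mGh_inl, vGh, utGh, Sum.elim_inl, vLow, mul_add,
      mul_smul_comm, jet_sub, mul_sum]
    module
  have t3 : ∀ j b e, 𝓜.scalarTerm e (.inr j) (.inl b) = (∑ μ, d μ (phi j) * Phi b * v e μ :
      𝒥) := fun j b e => by
    simp only [Model.scalarTerm, sc_inl, sc_inr, mGh_inr, neg_zero, zero_smul, add_zero, mul_assoc]
    exact sum_ext fun μ => even_left_comm (Phi_mem b)
  have t4 : ∀ j k e, 𝓜.scalarTerm e (.inr k) (.inr j) = (∑ μ, phi j * d μ (phi k) * v e μ :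
      𝒥) := fun j k e => by
    simp only [Model.scalarTerm, sc_inr, mGh_inr, neg_zero, zero_smul, add_zero, mul_assoc]
  rw [Model.scalarLagrangian, sum_r c (by simp [t2, Phi, jetPhi, Model.m])
    (by simp [t3, Phi, jetPhi])]
  simp only [t1, t2, t3, t4]

lemma Tint_eq (hf : ∀ a b e, c.f b a e = -c.f a b e) : 𝓜.Tint c =
    ymLagrangian c.f + 𝓜.scalarLagrangian c.r + c.potential + 𝓜.diracLagrangian c.t c.src := by
  have e1 : ∀ j, phi j * 𝓜.scalarCurrent (c.sS j) =
      (𝓜.scalarCurrent (c.sS j) * phi j : 𝒥) := fun j => even_comm (phi_mem j)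
  simp only [Model.Tint, ← ymLagrangian_eq c hf, scalarLagrangian_eq, Couplings.potential,
    Model.diracLagrangian, sum_sc, Couplings.src, Sum.elim_inl, Sum.elim_inr, sc_inl, sc_inr, e1]
  abel

lemma Tvec_eq (μ : Fin 4) : 𝓜.Tvec c μ = 𝓜.lagrangianVec c.f c.r c.t μ := by
  have t1 : ∀ a b e, 𝓜.scalarTermVec e (.inl b) (.inl a) μ =
      (Phi a * dUp μ (Phi b) * u e - 𝓜.m b • (Phi a * v b μ * u e) : 𝒥) := fun a b e => by
    simp only [Model.scalarTermVec, sc_inl, mGh_inl, vGh, Sum.elim_inl, mul_assoc, jet_sub]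
    module
  have t2 : ∀ j b e, 𝓜.scalarTermVec e (.inl b) (.inr j) μ =
      (phi j * (dUp μ (Phi b) * u e - 𝓜.m b • (v b μ * u e)) : 𝒥) := fun j b e => by
    simp only [Model.scalarTermVec, sc_inl, sc_inr, mGh_inl, vGh, Sum.elim_inl, mul_add,
      mul_smul_comm, jet_sub]
    module
  have t3 : ∀ j b e, 𝓜.scalarTermVec e (.inr j) (.inl b) μ =
      (dUp μ (phi j) * Phi b * u e : 𝒥) := fun j b e => by
    simp only [Model.scalarTermVec, sc_inl, sc_inr, mGh_inr, neg_zero, zero_smul, add_zero, dUp,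
      mul_assoc, smul_mul_assoc, mul_smul_comm, even_left_comm (Phi_mem b)]
  have t4 : ∀ j k e, 𝓜.scalarTermVec e (.inr k) (.inr j) μ =
      (phi j * dUp μ (phi k) * u e : 𝒥) := fun j k e => by
    simp only [Model.scalarTermVec, sc_inr, mGh_inr, neg_zero, zero_smul, add_zero, mul_assoc]
  rw [Model.lagrangianVec, Model.scalarVec, sum_r c (by simp [t2, Phi, jetPhi, Model.m, dUp])
    (by simp [t3, Phi, jetPhi])]
  simp only [Model.Tvec, t1, t2, t3, t4, ymVec]
  abel

end

lemma mS_symm_left (s t p : 𝒮) : (mS t s p : 𝒥) = mS s t p := by rw [mS, mS, even_comm (sc_mem t)]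

lemma mS_symm_right (s t p : 𝒮) : (mS s p t : 𝒥) = mS s t p := by
  rw [mS, mS, mul_assoc, mul_assoc, even_comm (sc_mem p)]

lemma potential_eq [Fintype I₁] [Fintype I₂] [Fintype I₃] {c : Couplings I₁ I₂ I₃ I₄}
    {S : 𝒮 → 𝒮 → 𝒮 → ℂ}
    (s1 : ∀ s t p, S t s p = S s t p) (s2 : ∀ s t p, S s p t = S s t p)
    (h0 : ∀ a b e : I₂, S (.inl (.inr a)) (.inl (.inr b)) (.inl (.inr e)) = 0)
    (h1 : ∀ j (b e : I₂), c.fSpp j (.inr b) (.inr e) = S (.inr j) (.inl (.inr b)) (.inl (.inr e)))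
    (h2 : ∀ j k (e : I₂), c.fSSpp j k (.inr e) = S (.inr j) (.inr k) (.inl (.inr e)))
    (h3 : ∀ j k l, c.lam j k l = S (.inr j) (.inr k) (.inr l)) :
    c.potential = (1 / 6 : ℂ) • ∑ s, ∑ t, ∑ p, S s t p • (mS s t p : 𝒥) := by
  let Y : 𝒮 → 𝒮 → 𝒮 → 𝒥 := fun s t p => S s t p • mS s t p
  have y1 : ∀ s t p, Y t s p = Y s t p := fun s t p => by simp only [Y, s1 s t p, mS_symm_left s t p]
  have y2 : ∀ s t p, Y s p t = Y s t p := fun s t p => by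
    simp only [Y, s2 s t p, mS_symm_right s t p]
  have k0 : ∀ a b e, Y (.inl a) (.inl b) (.inl e) = 0 := by
    rintro (a | a) (b | b) (e | e) <;> simp [Y, mS, Phi, jetPhi, h0]
  have k1 : ∀ j b e, c.fSpp j b e • (phi j * Phi b * Phi e) = Y (.inr j) (.inl b) (.inl e) := by
    rintro j (b | b) (e | e) <;> simp [Y, mS, Phi, jetPhi, h1]
  have k2 : ∀ j k e, c.fSSpp j k e • (phi j * phi k * Phi e) = Y (.inr j) (.inr k) (.inl e) := by
    rintro j k (e | e) <;> simp [Y, mS, Phi, jetPhi, h2]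
  have k3 : ∀ j k l, c.lam j k l • (phi j * phi k * phi l) = Y (.inr j) (.inr k) (.inr l) := by
    simp [Y, mS, h3]
  have z1 : ∑ a, ∑ b, ∑ j, Y (.inl a) (.inl b) (.inr j) =
      ∑ j, ∑ b, ∑ e, Y (.inr j) (.inl b) (.inl e) := by
    rw [sum_rot]
    simp only [y2 _ (.inr _) (.inl _), y1 (.inr _) (.inl _)]
  have z2 : ∑ a, ∑ j, ∑ b, Y (.inl a) (.inr j) (.inl b) =
      ∑ j, ∑ b, ∑ e, Y (.inr j) (.inl b) (.inl e) := by
    rw [sum_comm]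
    simp only [y1 (.inr _) (.inl _)]
  have z3 : ∑ a, ∑ j, ∑ k, Y (.inl a) (.inr j) (.inr k) =
      ∑ j, ∑ k, ∑ e, Y (.inr j) (.inr k) (.inl e) := by
    rw [← sum_rot]
    simp only [y1 (.inr _) (.inl _), y2 _ (.inr _) (.inl _)]
  have z4 : ∑ j, ∑ a, ∑ k, Y (.inr j) (.inl a) (.inr k) =
      ∑ j, ∑ k, ∑ e, Y (.inr j) (.inr k) (.inl e) := by
    refine sum_ext fun j => ?_
    rw [sum_comm]
    simp only [y2 _ (.inr _) (.inl _)]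
  change _ = (1 / 6 : ℂ) • ∑ s, ∑ t, ∑ p, Y s t p
  simp only [Couplings.potential, k1, k2, k3, sum_sc, sum_add_distrib, k0, z1, z2, z3, z4,
    sum_const_zero]
  generalize ∑ j, ∑ b, ∑ e, Y (.inr j) (.inl b) (.inl e) = A
  generalize ∑ j, ∑ k, ∑ e, Y (.inr j) (.inr k) (.inl e) = B
  module

/-- The coefficients of the self-interaction of the scalars. -/
def Couplings.S (c : Couplings I₁ I₂ I₃ I₄) : 𝒮 → 𝒮 → 𝒮 → ℂ
  | .inr j, .inl (.inr b), .inl (.inr e) => c.fSpp j (.inr b) (.inr e)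
  | .inl (.inr b), .inr j, .inl (.inr e) => c.fSpp j (.inr b) (.inr e)
  | .inl (.inr b), .inl (.inr e), .inr j => c.fSpp j (.inr b) (.inr e)
  | .inr j, .inr k, .inl (.inr e) => c.fSSpp j k (.inr e)
  | .inr j, .inl (.inr e), .inr k => c.fSSpp j k (.inr e)
  | .inl (.inr e), .inr j, .inr k => c.fSSpp j k (.inr e)
  | .inr j, .inr k, .inr l => c.lam j k l
  | _, _, _ => 0

namespace Couplings.Relations

variable {𝓜 : Model I₁ I₂ I₃ I₄} {c : Couplings I₁ I₂ I₃ I₄} (h : c.Relations 𝓜)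
include h

lemma gaugeRelations : 𝓜.GaugeRelations c.f c.r where
  f_left := h.f_antisymm_left
  f_right := h.f_antisymm_right
  r_antisymm := by
    rintro a ((t | t) | t) ((s | s) | s) <;> simp only [Couplings.r, neg_neg, neg_zero]
    all_goals first | exact h.fp_antisymm _ _ _ | exact h.fSSp_antisymm _ _ _
  mass := by
    rintro b e ((s | s) | s)
    · simp [Couplings.r, h.fp_massless, mGh_inl, Model.m]
    · exact h.fp_mass s b e
    · have h0 : ∀ a : I₁, 𝓜.m (.inl a) = 0 := fun _ => rfl
      rcases b with b | b <;> rcases e with e | e <;>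
        simp only [Couplings.r, mGh_inr, h0, mul_zero, zero_mul, sub_zero, zero_sub]
      · simpa [h0] using h.fSp_mass s e (.inl b)
      · simpa [h0] using h.fSp_mass s b (.inl e)
      · exact h.fSp_mass s b (.inr e)

lemma fSpp_symm (j) (b e : I₂) : c.fSpp j (.inr e) (.inr b) = c.fSpp j (.inr b) (.inr e) := by
  have m0 : ∀ b : I₂, 𝓜.m (.inr b) ≠ 0 := fun b => by simp [Model.m, (𝓜.massV_pos b).ne']
  have := h.fSp_mass j b (.inr e)
  rw [h.fSpp_eq, h.fSpp_eq]
  field_simp [m0 b, m0 e]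
  linear_combination -𝓜.mS j ^ 2 * this

lemma fSSpp_symm (j k) (e : I₂) : c.fSSpp k j (.inr e) = c.fSSpp j k (.inr e) := by
  rw [h.fSSpp_eq, h.fSSpp_eq]
  ring

lemma S_symm_left (s t p) : c.S t s p = c.S s t p := by
  rcases s with (s | s) | s <;> rcases t with (t | t) | t <;> rcases p with (p | p) | p <;>
    simp only [Couplings.S]
  all_goals first | exact h.fSpp_symm _ _ _ | exact h.fSSpp_symm _ _ _ | exact h.lam_symm_left _ _ _

lemma S_symm_right (s t p) : c.S s p t = c.S s t p := by
  rcases s with (s | s) | s <;> rcases t with (t | t) | t <;> rcases p with (p | p) | p <;>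
    simp only [Couplings.S]
  all_goals first | exact h.fSpp_symm _ _ _ | exact h.fSSpp_symm _ _ _ | exact h.lam_symm_right _ _ _

lemma S_mass (a t s) : 𝓜.m a * c.S (.inl a) t s = (𝓜.mPhi s - 𝓜.mPhi t) * c.r a t s := by
  have m0 : ∀ b : I₂, 𝓜.m (.inr b) ≠ 0 := fun b => by simp [Model.m, (𝓜.massV_pos b).ne']
  have h0 : ∀ a : I₁, 𝓜.m (.inl a) = 0 := fun _ => rfl
  have k1 : ∀ j (a b : I₂), 𝓜.m (.inr a) * c.fSpp j (.inr b) (.inr a) =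
      𝓜.mS j ^ 2 * c.fSp j (.inr b) (.inr a) := fun j a b => by
    rw [h.fSpp_eq]
    field_simp [m0 a]
  have k2 : ∀ j k (a : I₂), 𝓜.m (.inr a) * c.fSSpp j k (.inr a) =
      (𝓜.mS j ^ 2 - 𝓜.mS k ^ 2) * c.fSSp j k (.inr a) := fun j k a => by
    rw [h.fSSpp_eq_diff]
    field_simp [m0 a]
  have k3 : ∀ j (a : I₁) (b : I₂), 𝓜.m (.inr b) * c.fSp j (.inr b) (.inl a) = 0 := fun j a b => by
    simpa [h0] using h.fSp_mass j b (.inl a)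
  have k4 : ∀ j (a : I₁) (b : I₂), c.fSp j (.inr b) (.inl a) = 0 := fun j a b =>
    (mul_eq_zero.1 (k3 j a b)).resolve_left (m0 b)
  rcases a with a | a <;> rcases s with (s | s) | s <;> rcases t with (t | t) | t <;>
    simp only [Couplings.S, Couplings.r, mPhi_inl, mPhi_inr, h0, sub_self, zero_mul, mul_zero, k4,
      neg_zero, sub_zero, zero_sub]
  · rw [← h.fSSp_massless]
  · rw [h.fSpp_symm, k1, neg_mul_neg]
  · rw [h.fSpp_symm, k1]
  · rw [h.fSSpp_symm, k2]

end Couplings.Relations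

/-! ### Lorentz covariance -/

lemma lc_swap (μ ν ρ σ : Fin 4) : lc ν μ ρ σ = -lc μ ν ρ σ ∧ lc μ ρ ν σ = -lc μ ν ρ σ ∧
    lc μ ν σ ρ = -lc μ ν ρ σ := by
  have h : ∀ μ ν ρ σ : Fin 4, ((μ : ℤ) - ν) * (ρ - ν) * (σ - ν) * (ρ - μ) * (σ - μ) * (σ - ρ) / 12 =
        -(((ν : ℤ) - μ) * (ρ - μ) * (σ - μ) * (ρ - ν) * (σ - ν) * (σ - ρ) / 12) ∧
      ((ρ : ℤ) - μ) * (ν - μ) * (σ - μ) * (ν - ρ) * (σ - ρ) * (σ - ν) / 12 =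
        -(((ν : ℤ) - μ) * (ρ - μ) * (σ - μ) * (ρ - ν) * (σ - ν) * (σ - ρ) / 12) ∧
      ((ν : ℤ) - μ) * (σ - μ) * (ρ - μ) * (σ - ν) * (ρ - ν) * (ρ - σ) / 12 =
        -(((ν : ℤ) - μ) * (ρ - μ) * (σ - μ) * (ρ - ν) * (σ - ν) * (σ - ρ) / 12) := by decide
  simp only [lc]
  exact_mod_cast h μ ν ρ σ

lemma sum_lc_mul (Λ : 𝕄) (α β κ δ : Fin 4) :
    ∑ μ, ∑ ν, ∑ ρ, ∑ σ, lc μ ν ρ σ * (Λ μ α * Λ ν β * Λ ρ κ * Λ σ δ) = lc α β κ δ * Λ.det := by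
  rw [eq_lc (C := fun α β κ δ => ∑ μ, ∑ ν, ∑ ρ, ∑ σ, lc μ ν ρ σ * (Λ μ α * Λ ν β * Λ ρ κ * Λ σ δ))]
  · congr 1
    rw [Matrix.det_succ_row_zero]
    simp [Matrix.det_fin_three, Fin.sum_univ_four, lc, Fin.succAbove]
    ring
  · intro α β κ δ
    rw [sum_comm]
    simp only [← sum_neg_distrib]
    refine sum_ext fun μ => sum_ext fun ν => sum_ext fun ρ => sum_ext fun σ => ?_
    rw [(lc_swap μ ν ρ σ).1]
    ring
  · intro α β κ δ
    simp only [← sum_neg_distrib]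
    refine sum_ext fun μ => ?_
    rw [sum_comm]
    refine sum_ext fun ν => sum_ext fun ρ => sum_ext fun σ => ?_
    rw [(lc_swap μ ν ρ σ).2.1]
    ring
  · intro α β κ δ
    simp only [← sum_neg_distrib]
    refine sum_ext fun μ => sum_ext fun ν => ?_
    rw [sum_comm]
    refine sum_ext fun ρ => sum_ext fun σ => ?_
    rw [(lc_swap μ ν ρ σ).2.2]
    ring

lemma Model.γ₅_eq_lc (𝓜 : ℳ) :
    ∑ μ, ∑ ν, ∑ ρ, ∑ σ, lc μ ν ρ σ • (𝓜.γUp μ * (𝓜.γUp ν * (𝓜.γUp ρ * 𝓜.γUp σ))) =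
      (24 * I) • 𝓜.γ₅ := by
  simp [Fin.sum_univ_four, lc, Model.γUp, η, Model.γ₅, mul_assoc, 𝓜.γ_order]
  match_scalars
  linear_combination (-24 : ℂ) * Complex.I_sq

section

variable {𝓜 : Model I₁ I₂ I₃ I₄}

lemma sum_four_comm {M : Type*} [AddCommMonoid M]
    (F : Fin 4 → Fin 4 → Fin 4 → Fin 4 → Fin 4 → Fin 4 → Fin 4 → Fin 4 → M) :
    ∑ μ, ∑ ν, ∑ ρ, ∑ σ, ∑ α, ∑ β, ∑ κ, ∑ δ, F μ ν ρ σ α β κ δ =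
      ∑ α, ∑ β, ∑ κ, ∑ δ, ∑ μ, ∑ ν, ∑ ρ, ∑ σ, F μ ν ρ σ α β κ δ := by
  have h := sum_comm (s := univ) (t := univ) (f := fun (x y : Fin 4 × Fin 4 × Fin 4 × Fin 4) =>
      F x.1 x.2.1 x.2.2.1 x.2.2.2 y.1 y.2.1 y.2.2.1 y.2.2.2)
  simpa only [Fintype.sum_prod_type] using h

lemma sum_three_comm {M : Type*} [AddCommMonoid M]
    (F : Fin 4 → Fin 4 → Fin 4 → Fin 4 → Fin 4 → Fin 4 → M) :
    ∑ ν, ∑ ρ, ∑ σ, ∑ β, ∑ κ, ∑ δ, F ν ρ σ β κ δ = ∑ β, ∑ κ, ∑ δ, ∑ ν, ∑ ρ, ∑ σ, F ν ρ σ β κ δ := by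
  have h := sum_comm (s := univ) (t := univ)
    (f := fun (x y : Fin 4 × Fin 4 × Fin 4) => F x.1 x.2.1 x.2.2 y.1 y.2.1 y.2.2)
  simpa only [Fintype.sum_prod_type] using h

lemma lc_contract {M : Type*} [AddCommMonoid M] [Module ℂ M] (Λ : 𝕄)
    (P : Fin 4 → Fin 4 → Fin 4 → Fin 4 → M) :
    ∑ μ, ∑ ν, ∑ ρ, ∑ σ, lc μ ν ρ σ • (∑ α, ∑ β, ∑ κ, ∑ δ,
      (Λ μ α * Λ ν β * Λ ρ κ * Λ σ δ) • P α β κ δ) =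
      Λ.det • ∑ α, ∑ β, ∑ κ, ∑ δ, lc α β κ δ • P α β κ δ := by
  simp only [smul_sum, smul_smul]
  rw [sum_four_comm]
  simp only [← sum_smul, sum_lc_mul, mul_comm Λ.det]

namespace Model.IsLorentzPair

variable {Λ : Matrix (Fin 4) (Fin 4) ℝ} {S : Matrix (Fin 4) (Fin 4) ℂ} (h : 𝓜.IsLorentzPair Λ S)
include h

lemma sum_η (α β : Fin 4) : ∑ μ, η μ * ((Λ μ α : ℂ) * Λ μ β) = if α = β then η α else 0 := by
  have := congrFun₂ h.lorentz α β
  rw [diagonal_eq_ηr] at this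
  simp only [Matrix.mul_apply, Matrix.transpose_apply, Matrix.diagonal_apply] at this
  have := congrArg (fun x : ℝ => (x : ℂ)) this
  simp only [Complex.ofReal_sum, Complex.ofReal_mul, ηr_cast, apply_ite (fun x : ℝ => (x : ℂ)),
    Complex.ofReal_zero] at this
  rw [← this]
  exact sum_ext fun μ => by simp; ring

lemma sum_η' (ρ τ : Fin 4) : ∑ μ, η μ * ((Λ ρ μ : ℂ) * Λ τ μ) = if ρ = τ then η ρ else 0 := by
  have h1 : Λ * Λ⁻¹ = 1 := Matrix.mul_nonsing_inv _ (by simp [h.proper])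
  have := congrArg (fun x : ℝ => (x : ℂ) * η τ) (congrFun₂ h1 ρ τ)
  simp only [Matrix.mul_apply, lorentz_inv_apply h.lorentz, Matrix.one_apply, Complex.ofReal_sum,
    Complex.ofReal_mul, ηr_cast, apply_ite (fun x : ℝ => (x : ℂ)), Complex.ofReal_zero,
    Complex.ofReal_one, ite_mul, one_mul, zero_mul, sum_mul] at this
  refine Eq.trans (sum_ext fun μ => ?_) (this.trans ?_)
  · linear_combination (-(η μ * Λ ρ μ * Λ τ μ) : ℂ) * η_mul_self τ
  · split_ifs with e <;> simp [e]

lemma det_cast : (Λ.map (fun x : ℝ => (x : ℂ))).det = 1 := by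
  have : (Λ.map (Complex.ofRealHom)).det = Complex.ofRealHom Λ.det := (RingHom.map_det _ _).symm
  rw [h.proper, map_one] at this
  exact this

lemma inv_mul : S⁻¹ * S = 1 := Matrix.nonsing_inv_mul _ h.unit

lemma mul_inv : S * S⁻¹ = 1 := Matrix.mul_nonsing_inv _ h.unit

lemma conj_mul (X Y : 𝕄) : S⁻¹ * (X * Y) * S = (S⁻¹ * X * S) * (S⁻¹ * Y * S) := by
  rw [mul_assoc (S⁻¹ * X), mul_assoc S⁻¹ Y, ← mul_assoc S, h.mul_inv, one_mul]
  simp only [mul_assoc]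

lemma conj_γ₅ : S⁻¹ * 𝓜.γ₅ * S = 𝓜.γ₅ := by
  have e := congrArg (S⁻¹ * · * S) 𝓜.γ₅_eq_lc
  simp only [mul_sum, sum_mul, mul_smul_comm, smul_mul_assoc, h.conj_mul, h.spin] at e
  have e2 := lc_contract (Λ.map (fun x : ℝ => (x : ℂ)))
    fun α β κ δ => 𝓜.γUp α * (𝓜.γUp β * (𝓜.γUp κ * 𝓜.γUp δ))
  rw [h.det_cast, one_smul, 𝓜.γ₅_eq_lc] at e2
  refine smul_right_injective _ (show 24 * I ≠ 0 by simp) (e.symm.trans (Eq.trans ?_ e2))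
  simp only [ Matrix.map_apply, mul_assoc]
  refine sum_ext fun μ => sum_ext fun ν => sum_ext fun ρ => sum_ext fun σ => congrArg _ ?_
  simp only [smul_sum, smul_smul, ← Fintype.sum_prod_type']
  refine Fintype.sum_equiv ⟨fun x => (x.2.2.2, x.2.2.1, x.2.1, x.1),
    fun x => (x.2.2.2, x.2.2.1, x.2.1, x.1), fun _ => rfl, fun _ => rfl⟩ _ _ fun x => ?_
  dsimp only [Equiv.coe_fn_mk]
  congr 1
  ring

lemma conj_γε (ε : ℤˣ) : S⁻¹ * 𝓜.γε ε * S = 𝓜.γε ε := by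
  simp only [Model.γε, mul_smul_comm, smul_mul_assoc, mul_add, add_mul, mul_one, h.inv_mul,
    h.conj_γ₅]

end Model.IsLorentzPair

/-- The components of a Lorentz vector. -/
def Vec (Λ : Matrix (Fin 4) (Fin 4) ℝ) (L : 𝒥 →ₐ[ℂ] 𝒥)
    (A : Fin 4 → 𝒥) : Prop := ∀ μ, L (A μ) = ∑ ν, (Λ μ ν : ℂ) • A ν

/-- The components of a Lorentz tensor of rank two. -/
def Ten (Λ : Matrix (Fin 4) (Fin 4) ℝ) (L : 𝒥 →ₐ[ℂ] 𝒥) (A : Fin 4 → Fin 4 → 𝒥) : Prop :=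
  ∀ μ ν, L (A μ ν) = ∑ α, (Λ μ α : ℂ) • ∑ β, (Λ ν β : ℂ) • A α β

section

variable {Λ : Matrix (Fin 4) (Fin 4) ℝ} {L : Jet I₁ I₂ I₃ I₄ →ₐ[ℂ] Jet I₁ I₂ I₃ I₄}
  {A B : Fin 4 → Jet I₁ I₂ I₃ I₄} {C D : Fin 4 → Fin 4 → Jet I₁ I₂ I₃ I₄} {X Y : Jet I₁ I₂ I₃ I₄}

lemma Vec.zero : Vec Λ L 0 := fun μ => by simp

lemma Vec.add (hA : Vec Λ L A) (hB : Vec Λ L B) : Vec Λ L fun μ => A μ + B μ := fun μ => by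
  simp only [map_add, hA μ, hB μ, smul_add, sum_add_distrib]

lemma Vec.smul (hA : Vec Λ L A) (c : ℂ) : Vec Λ L fun μ => c • A μ := fun μ => by
  simp only [map_smul, hA μ, smul_sum, smul_comm c]

lemma Vec.sum {ι : Type*} (s : Finset ι) {A : ι → Fin 4 → 𝒥}
    (h : ∀ i, Vec Λ L (A i)) : Vec Λ L fun μ => ∑ i ∈ s, A i μ := fun μ => by
  simp only [map_sum, fun i => h i μ, smul_sum]
  exact sum_comm

lemma Vec.mul_right (hA : Vec Λ L A) (hX : L X = X) : Vec Λ L fun μ => A μ * X := fun μ => by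
  simp only [map_mul, hX, hA μ, sum_mul, smul_mul_assoc]

lemma Vec.mul_left (hA : Vec Λ L A) (hX : L X = X) : Vec Λ L fun μ => X * A μ := fun μ => by
  simp only [map_mul, hX, hA μ, mul_sum, mul_smul_comm]

lemma Vec.mul (hA : Vec Λ L A) (hB : Vec Λ L B) : Ten Λ L fun μ ν => A μ * B ν := fun μ ν => by
  rw [map_mul, hA μ, hB ν, sum_mul]
  refine sum_ext fun α => ?_
  rw [smul_mul_assoc, mul_sum]
  simp only [mul_smul_comm]

lemma Ten.swap (hC : Ten Λ L C) : Ten Λ L fun μ ν => C ν μ := fun μ ν => by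
  simp only [hC ν μ, smul_sum, smul_comm (Λ ν _ : ℂ)]
  exact sum_comm

lemma Ten.add (hC : Ten Λ L C) (hD : Ten Λ L D) : Ten Λ L fun μ ν => C μ ν + D μ ν :=
  fun μ ν => by simp only [map_add, hC μ ν, hD μ ν, smul_add, sum_add_distrib]

lemma Ten.smul (hC : Ten Λ L C) (c : ℂ) : Ten Λ L fun μ ν => c • C μ ν := fun μ ν => by
  simp only [map_smul, hC μ ν, smul_sum, smul_comm c]

end

section

variable {Λ : Matrix (Fin 4) (Fin 4) ℝ} {S : Matrix (Fin 4) (Fin 4) ℂ} (h : 𝓜.IsLorentzPair Λ S)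
  {L : Jet I₁ I₂ I₃ I₄ →ₐ[ℂ] Jet I₁ I₂ I₃ I₄} {A B : Fin 4 → Jet I₁ I₂ I₃ I₄}
include h

lemma sum_η_contract {M : Type*} [AddCommMonoid M] [Module ℂ M] (P : Fin 4 → Fin 4 → M) :
    ∑ μ, η μ • ∑ α, (Λ μ α : ℂ) • ∑ β, (Λ μ β : ℂ) • P α β = ∑ μ, η μ • P μ μ := by
  simp only [smul_sum, smul_smul]
  rw [sum_comm]
  refine sum_ext fun α => ?_
  rw [sum_comm]
  simp only [← sum_smul, h.sum_η, ite_smul, zero_smul]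
  simp

lemma Ten.trace {C : Fin 4 → Fin 4 → 𝒥} (hC : Ten Λ L C) :
    L (∑ μ, η μ • C μ μ) = ∑ μ, η μ • C μ μ := by
  rw [map_sum]
  simp only [map_smul, hC _ _]
  exact sum_η_contract h C

lemma Vec.contract (hA : Vec Λ L A) (hB : Vec Λ L B) :
    L (∑ μ, η μ • (A μ * B μ)) = ∑ μ, η μ • (A μ * B μ) := (hA.mul hB).trace h

lemma Ten.contract {C : Fin 4 → Fin 4 → 𝒥} (hC : Ten Λ L C) (hB : Vec Λ L B) :
    Vec Λ L fun σ => ∑ ρ, η ρ • (C ρ σ * B ρ) := fun σ => by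
  refine Eq.trans ?_ (sum_ext fun ν => congrArg _ (sum_η_contract h fun α β => C α ν * B β))
  simp only [map_sum, map_smul, map_mul, hC _ _, hB _, sum_mul, mul_sum,
    smul_sum, smul_mul_assoc, mul_smul_comm, smul_smul]
  simp only [← Fintype.sum_prod_type']
  refine Fintype.sum_equiv ⟨fun x => (x.2.2.2, x.1, x.2.2.1, x.2.1),
    fun x => (x.2.1, x.2.2.2, x.2.2.1, x.1), fun _ => rfl, fun _ => rfl⟩ _ _ fun x => ?_
  dsimp only [Equiv.coe_fn_mk]
  congr 1
  ring

lemma lc_contract_three (P : Fin 4 → Fin 4 → Fin 4 → 𝒥) (ρ : Fin 4) :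
    ∑ σ, ∑ μ, ∑ ν, (η ρ * lc ρ σ μ ν) • ∑ α, ∑ β, ∑ κ, ((Λ σ α : ℂ) * Λ μ β * Λ ν κ) • P α β κ =
      ∑ τ, (Λ ρ τ : ℂ) • ∑ α, ∑ β, ∑ κ, (η τ * lc τ α β κ) • P α β κ := by
  have key : ∀ α β κ, ∑ τ, (Λ ρ τ : ℂ) * (η τ * lc τ α β κ) =
      ∑ σ, ∑ μ, ∑ ν, (η ρ * lc ρ σ μ ν) * ((Λ σ α : ℂ) * Λ μ β * Λ ν κ) := fun α β κ => by
    have e := fun τ => sum_lc_mul (Λ.map (fun x : ℝ => (x : ℂ))) τ α β κ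
    simp only [h.det_cast, mul_one, Matrix.map_apply] at e
    simp only [← e, mul_sum]
    rw [sum_comm]
    have e2 : ∀ ρ', ∑ τ, ∑ σ, ∑ μ, ∑ ν, (Λ ρ τ : ℂ) * (η τ * (lc ρ' σ μ ν *
        (Λ ρ' τ * Λ σ α * Λ μ β * Λ ν κ))) = (∑ τ, η τ * ((Λ ρ τ : ℂ) * Λ ρ' τ)) *
        ∑ σ, ∑ μ, ∑ ν, lc ρ' σ μ ν * (Λ σ α * Λ μ β * Λ ν κ) := fun ρ' => by
      rw [sum_mul]
      refine sum_ext fun τ => ?_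
      simp only [mul_sum]
      exact sum_ext fun σ => sum_ext fun μ => sum_ext fun ν => by ring
    simp only [e2, h.sum_η', ite_mul, zero_mul]
    simp only [sum_ite_eq, mem_univ, if_true, mul_sum, mul_assoc]
  have e1 : ∑ τ, (Λ ρ τ : ℂ) • ∑ α, ∑ β, ∑ κ, (η τ * lc τ α β κ) • P α β κ =
      ∑ α, ∑ β, ∑ κ, (∑ τ, (Λ ρ τ : ℂ) * (η τ * lc τ α β κ)) • P α β κ := by
    simp only [smul_sum, sum_smul, smul_smul, ← Fintype.sum_prod_type']
    exact Fintype.sum_equiv ⟨fun x => (x.2.1, x.2.2.1, x.2.2.2, x.1),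
      fun x => (x.2.2.2, x.1, x.2.1, x.2.2.1), fun _ => rfl, fun _ => rfl⟩ _ _ fun _ => rfl
  rw [e1]
  simp only [key, smul_sum, sum_smul, smul_smul]
  exact sum_three_comm _

end

section

variable {Λ : Matrix (Fin 4) (Fin 4) ℝ} {S : Matrix (Fin 4) (Fin 4) ℂ} (h : 𝓜.IsLorentzPair Λ S)

lemma lorentzHom_jet (f : ℱ) (J : 𝔻) :
    lorentzHom Λ S (jet f J) = lorentzVar Λ S ⟨f, J⟩ := extendHom_jet _ _ _ _

lemma lorentzHom_u (a : 𝒱) : lorentzHom Λ S (u a : 𝒥) = u a :=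
  (lorentzHom_jet _ _).trans (lorentzJet_zero _ _)

lemma lorentzHom_ut (a : 𝒱) : lorentzHom Λ S (ut a : 𝒥) = ut a :=
  (lorentzHom_jet _ _).trans (lorentzJet_zero _ _)

lemma lorentzHom_sc (s : 𝒮) : lorentzHom Λ S (sc s : 𝒥) = sc s := by
  rcases s with (a | a) | j
  · exact map_zero _
  · exact (lorentzHom_jet (.Phi a) 0).trans (lorentzJet_zero _ _)
  · exact (lorentzHom_jet (.phi j) 0).trans (lorentzJet_zero _ _)

lemma vec_v (a : 𝒱) : Vec Λ (lorentzHom Λ S) (v a : Fin 4 → 𝒥) := fun μ => by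
  simp only [v, lorentzHom_jet, lorentzVar, lorentzJet_zero]

include h

lemma lorentzJet_dUp (f : ℱ) (μ : Fin 4) : η μ • lorentzJet Λ f (Finsupp.single μ 1) =
      ∑ ν, (Λ μ ν : ℂ) • (η ν • jet f (Finsupp.single ν 1)) := by
  simp only [lorentzJet_single, lorentz_inv_apply h.lorentz, Complex.ofReal_mul, ηr_cast,
    smul_sum, smul_smul]
  refine sum_ext fun ν => ?_
  congr 1
  linear_combination (η ν * Λ μ ν : ℂ) * η_mul_self μ

lemma vec_ut (a : 𝒱) : Vec Λ (lorentzHom Λ S) fun μ => (dUp μ (ut a) : 𝒥) := fun μ => by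
  simp only [dUp, d_ut, map_smul, lorentzHom_jet, lorentzVar]
  exact lorentzJet_dUp h _ μ

lemma vec_sc (s : 𝒮) : Vec Λ (lorentzHom Λ S) fun μ => (dUp μ (sc s) : 𝒥) := fun μ => by
  simp only [dUp, d_sc, map_smul]
  rcases s with (a | a) | j
  · simp [optJet, scField]
  · change η μ • lorentzHom Λ S (jet (.Phi a) _) = ∑ ν, _ • η ν • jet (.Phi a) _
    rw [lorentzHom_jet]
    exact lorentzJet_dUp h _ μ
  · change η μ • lorentzHom Λ S (jet (.phi j) _) = ∑ ν, _ • η ν • jet (.phi j) _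
    rw [lorentzHom_jet]
    exact lorentzJet_dUp h _ μ

lemma ten_v (a : 𝒱) : Ten Λ (lorentzHom Λ S) fun μ ν => (dUp μ (v a ν) : 𝒥) := fun μ ν => by
  simp only [dUp, d_v, map_smul, lorentzHom_jet, lorentzVar]
  rw [smul_sum]
  simp only [smul_comm (η μ), lorentzJet_dUp h]
  simp only [smul_sum, smul_comm (Λ ν _ : ℂ)]
  exact sum_comm

end

section

variable [Fintype I₄] {Λ : Matrix (Fin 4) (Fin 4) ℝ} {S : Matrix (Fin 4) (Fin 4) ℂ}
  (h : 𝓜.IsLorentzPair Λ S)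

open Model

lemma lorentzHom_bilinear (k : Matrix I₄ I₄ ℂ) (Γ : 𝕄) :
    lorentzHom Λ S (bilinear k Γ : 𝒥) = bilinear k (S⁻¹ * Γ * S) := by
  simp only [bilinear, map_sum, map_smul, map_mul, psi, psibar, lorentzHom_jet, lorentzVar,
    lorentzJet_zero, sum_mul, mul_sum, smul_mul_assoc, mul_smul_comm,
    Matrix.mul_apply, sum_smul, smul_sum, smul_smul]
  refine sum_ext fun A => sum_ext fun B => ?_
  simp only [← Fintype.sum_prod_type']
  refine Fintype.sum_equiv ⟨fun x => (x.2.2.2, x.2.2.1, x.2.1, x.1),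
    fun x => (x.2.2.2, x.2.2.1, x.2.1, x.1), fun _ => rfl, fun _ => rfl⟩ _ _ fun x => ?_
  dsimp only [Equiv.coe_fn_mk]
  congr 1
  ring

lemma bilinear_sum {ι : Type*} [Fintype ι] (k : Matrix I₄ I₄ ℂ) (c : ι → ℂ) (Γ : ι → 𝕄) :
    (bilinear k (∑ i, c i • Γ i) : 𝒥) = ∑ i, c i • bilinear k (Γ i) := by
  simp only [bilinear, Matrix.sum_apply, Matrix.smul_apply, mul_sum, sum_smul,
    smul_sum, smul_smul, smul_eq_mul, ← Fintype.sum_prod_type']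
  refine Fintype.sum_equiv ⟨fun x => (x.2.2.2.2, x.1, x.2.1, x.2.2.1, x.2.2.2.1),
    fun x => (x.2.1, x.2.2.1, x.2.2.2.1, x.2.2.2.2, x.1), fun _ => rfl, fun _ => rfl⟩ _ _
    fun x => ?_
  dsimp only [Equiv.coe_fn_mk]
  congr 1
  ring

include h

lemma lorentzHom_scalarCurrent (s : ℤˣ → Matrix I₄ I₄ ℂ) :
    lorentzHom Λ S (𝓜.scalarCurrent s) = 𝓜.scalarCurrent s := by
  simp only [Model.scalarCurrent, map_sum, lorentzHom_bilinear, h.conj_γε]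

lemma vec_vectorCurrent (t : ℤˣ → Matrix I₄ I₄ ℂ) :
    Vec Λ (lorentzHom Λ S) (𝓜.vectorCurrent t) := fun μ => by
  simp only [Model.vectorCurrent, map_sum, lorentzHom_bilinear, h.conj_mul, h.conj_γε, h.spin,
    sum_mul, smul_mul_assoc, bilinear_sum, smul_sum]
  exact sum_comm

end

section

variable [Fintype I₁] [Fintype I₂] [Fintype I₃] [Fintype I₄]
  {Λ : Matrix (Fin 4) (Fin 4) ℝ} {S : Matrix (Fin 4) (Fin 4) ℂ} (h : 𝓜.IsLorentzPair Λ S)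
include h

lemma vec_vGh (s : 𝒮) : Vec Λ (lorentzHom Λ S) (vGh s : Fin 4 → 𝒥) := by
  rcases s with s | s
  exacts [vec_v s, Vec.zero]

lemma lorentzHom_lagrangian (f r P t c) :
    lorentzHom Λ S (𝓜.lagrangian f r P t c : 𝒥) = 𝓜.lagrangian f r P t c := by
  have k1 : ∀ c a b, lorentzHom Λ S (mB c a b : 𝒥) = mB c a b := fun c a b => by
    have e : (mB c a b : 𝒥) = ∑ μ, η μ • ((∑ ρ, η ρ • (dUp ρ (v c μ) * v a ρ)) * v b μ) := by
      rw [mB, sum_comm]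
      simp only [dUp, sum_mul, smul_sum, smul_mul_assoc, smul_smul, η_mul_self, mul_one]
    rw [e]
    exact ((ten_v h c).contract h (vec_v a)).contract h (vec_v b)
  have k2 : ∀ b c a, lorentzHom Λ S (mZ b c a : 𝒥) = mZ b c a := fun b c a => by
    have e : (mZ b c a : 𝒥) = (∑ μ, η μ • (dUp μ (ut b) * v c μ)) * u a := by
      simp only [mZ, dUp, sum_mul, smul_mul_assoc, smul_smul, η_mul_self, one_smul]
    rw [e, map_mul, (vec_ut h b).contract h (vec_v c), lorentzHom_u]
  have k3 : ∀ a t s, lorentzHom Λ S (𝓜.scalarTerm a t s : 𝒥) = 𝓜.scalarTerm a t s := fun a t s => by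
    have e : (𝓜.scalarTerm a t s : 𝒥) = sc s * (∑ μ, η μ • (dUp μ (sc t) * v a μ))
        + (-𝓜.mGh t) • (sc s * (∑ μ, η μ • (vGh t μ * v a μ)))
        + 𝓜.mGh t • (sc s * (utGh t * u a)) := by
      simp only [Model.scalarTerm, dUp, mul_sum, smul_mul_assoc, mul_smul_comm, smul_smul,
        η_mul_self, one_smul]
    have e1 : lorentzHom Λ S (utGh t : 𝒥) = utGh t := by
      rcases t with t | t
      exacts [lorentzHom_ut t, map_zero _]
    rw [e]
    simp only [map_add, map_smul, map_mul, lorentzHom_sc, (vec_sc h t).contract h (vec_v a),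
      (vec_vGh h t).contract h (vec_v a), lorentzHom_u, e1]
  have k4 : ∀ s t p, lorentzHom Λ S (StandardModel.mS s t p : 𝒥) =
      StandardModel.mS s t p := fun s t p => by simp only [StandardModel.mS, map_mul, lorentzHom_sc]
  have k5 : ∀ a, lorentzHom Λ S (∑ μ, 𝓜.vectorCurrent (t a) μ * vLow a μ) =
      ∑ μ, 𝓜.vectorCurrent (t a) μ * vLow a μ := fun a => by
    simpa only [vLow, mul_smul_comm] using (vec_vectorCurrent h (t a)).contract h (vec_v a)
  have k6 : lorentzHom Λ S (𝓜.diracLagrangian t c) = 𝓜.diracLagrangian t c := by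
    rw [Model.diracLagrangian, map_add, map_sum, map_sum]
    simp only [k5, map_mul, lorentzHom_scalarCurrent h, lorentzHom_sc]
  simp only [Model.lagrangian, ymLagrangian, Model.scalarLagrangian, map_add, map_sum, map_smul,
    k1, k2, k3, k4, k6]

lemma ten_fieldStrength (a : 𝒱) : Ten Λ (lorentzHom Λ S) (fieldStrength a : Fin 4 → Fin 4 → 𝒥) := by
  have := (ten_v h a).add ((ten_v h a).swap.smul (-1))
  convert this using 3
  rw [fieldStrength, jet_sub]

lemma vec_lagrangianVec (f r t) : Vec Λ (lorentzHom Λ S) (𝓜.lagrangianVec f r t : Fin 4 → 𝒥) := by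
  have k1 : ∀ a b e, Vec Λ (lorentzHom Λ S) fun μ => ((∑ ν, u a * vLow b ν * fieldStrength e ν μ)
      - (1 / 2 : ℂ) • (u a * u b * dUp μ (ut e)) : 𝒥) := fun a b e => by
    have := (((ten_fieldStrength h e).contract h (vec_v b)).mul_left (lorentzHom_u a)).add
      (((vec_ut h e).mul_left (X := u a * u b)
        (by simp only [map_mul, lorentzHom_u])).smul (-(1 / 2)))
    convert this using 2 with μ
    rw [jet_sub, mul_sum, smul_smul, neg_one_mul]
    congr 1
    refine sum_ext fun ν => ?_
    rw [vLow, mul_smul_comm, smul_mul_assoc, mul_smul_comm, mul_assoc, even_comm (v_mem b ν)]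
  have k2 : ∀ a t s, Vec Λ (lorentzHom Λ S) (𝓜.scalarTermVec a t s : Fin 4 → 𝒥) := fun a t s => by
    exact (((vec_sc h t).mul_right (lorentzHom_u a)).mul_left (lorentzHom_sc s)).add
      ((((vec_vGh h t).mul_right (lorentzHom_u a)).mul_left (lorentzHom_sc s)).smul _)
  exact ((Vec.sum _ fun a => Vec.sum _ fun b => Vec.sum _ fun e => (k1 a b e).smul _).add
    (Vec.sum _ fun a => Vec.sum _ fun t => Vec.sum _ fun s => (k2 a t s).smul _)).add
    (Vec.sum _ fun a => (vec_vectorCurrent h (t a)).mul_right (lorentzHom_u a))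

end

end

/-! ### Dimension and ghost number -/

variable (I₁ I₂ I₃ I₄) in
/-- Linear combinations of jet variables of given dimension, ghost number and fermion number. -/
def graded (D : ℚ) (g f : ℤ) : Submodule ℂ (Jet I₁ I₂ I₃ I₄) :=
  Submodule.span ℂ {X | ∃ x : JetVar I₁ I₂ I₃ I₄, X = jet x.field x.J ∧
    x.dim = D ∧ x.field.gh = g ∧ x.field.fermion = f}

lemma mul_mem_cubic {D₁ D₂ D₃ w : ℚ} {g₁ g₂ g₃ g f₁ f₂ f₃ : ℤ} {X Y Z : 𝒥}
    (hX : X ∈ graded _ _ _ _ D₁ g₁ f₁) (hY : Y ∈ graded _ _ _ _ D₂ g₂ f₂)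
    (hZ : Z ∈ graded _ _ _ _ D₃ g₃ f₃) (hD : D₁ + D₂ + D₃ ≤ w) (hg : g₁ + g₂ + g₃ = g)
    (hf : f₁ + f₂ + f₃ = 0) : X * Y * Z ∈ cubic _ _ _ _ w g := by
  have h := Submodule.mul_mem_mul (Submodule.mul_mem_mul hX hY) hZ
  rw [graded, graded, graded, Submodule.span_mul_span, Submodule.span_mul_span] at h
  refine Submodule.span_mono ?_ h
  rintro _ ⟨_, ⟨_, ⟨x, rfl, rfl, rfl, rfl⟩, _, ⟨y, rfl, rfl, rfl, rfl⟩, rfl⟩, _,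
    ⟨z, rfl, rfl, rfl, rfl⟩, rfl⟩
  exact ⟨x, y, z, rfl, hD, hg, hf⟩

lemma mul_mem_cubic' {D₁ D₂ D₃ w : ℚ} {g₁ g₂ g₃ g f₁ f₂ f₃ : ℤ} {X Y Z : 𝒥}
    (hX : X ∈ graded _ _ _ _ D₁ g₁ f₁) (hY : Y ∈ graded _ _ _ _ D₂ g₂ f₂)
    (hZ : Z ∈ graded _ _ _ _ D₃ g₃ f₃) (hD : D₁ + D₂ + D₃ ≤ w) (hg : g₁ + g₂ + g₃ = g)
    (hf : f₁ + f₂ + f₃ = 0) : X * (Y * Z) ∈ cubic _ _ _ _ w g := by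
  rw [← mul_assoc]
  exact mul_mem_cubic hX hY hZ hD hg hf

lemma jet_mem_graded (f : ℱ) (J : 𝔻) :
    jet f J ∈ graded _ _ _ _ (f.dim + ∑ μ, (J μ : ℚ)) f.gh f.fermion :=
  Submodule.subset_span ⟨⟨f, J⟩, rfl, rfl, rfl, rfl⟩

lemma jet_zero_mem_graded (f : ℱ) : jet f 0 ∈ graded _ _ _ _ f.dim f.gh f.fermion := by simpa using jet_mem_graded f 0

lemma d_mem_graded {D : ℚ} {g f : ℤ} {X : 𝒥} (hX : X ∈ graded _ _ _ _ D g f)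
    (μ : Fin 4) : d μ X ∈ graded _ _ _ _ (D + 1) g f := by
  refine Submodule.span_induction (p := fun X _ => d μ X ∈ graded _ _ _ _ (D + 1) g f)
    ?_ ?_ ?_ ?_ hX
  · rintro _ ⟨⟨F, J⟩, rfl, rfl, rfl, rfl⟩
    rw [d_jet]
    have := jet_mem_graded F (J + Finsupp.single μ 1)
    simpa [JetVar.dim, sum_add_distrib, Finsupp.single_apply, add_assoc] using this
  · simp
  · intro X Y _ _ hX hY
    rw [map_add]
    exact add_mem hX hY
  · intro c X _ hX
    rw [map_smul]
    exact smul_mem _ _ hX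

lemma v_mem_graded (a : 𝒱) (μ : Fin 4) : v a μ ∈ graded I₁ I₂ I₃ I₄ 1 0 0 :=
  jet_zero_mem_graded (.v a μ)

lemma u_mem_graded (a : 𝒱) : u a ∈ graded I₁ I₂ I₃ I₄ 1 1 0 := jet_zero_mem_graded (.u a)

lemma ut_mem_graded (a : 𝒱) : ut a ∈ graded I₁ I₂ I₃ I₄ 1 (-1) 0 := jet_zero_mem_graded (.ut a)

lemma sc_mem_graded (s : 𝒮) : sc s ∈ graded I₁ I₂ I₃ I₄ 1 0 0 := by
  rcases s with (s | s) | s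
  exacts [Submodule.zero_mem _, jet_zero_mem_graded (.Phi s), jet_zero_mem_graded (.phi s)]

lemma vGh_mem_graded (s : 𝒮) (μ : Fin 4) : vGh s μ ∈ graded I₁ I₂ I₃ I₄ 1 0 0 := by
  rcases s with s | s
  exacts [v_mem_graded s μ, Submodule.zero_mem _]

lemma utGh_mem_graded (s : 𝒮) : utGh s ∈ graded I₁ I₂ I₃ I₄ 1 (-1) 0 := by
  rcases s with s | s
  exacts [ut_mem_graded s, Submodule.zero_mem _]

section

variable [Fintype I₁] [Fintype I₂] [Fintype I₃] [Fintype I₄] (𝓜 : Model I₁ I₂ I₃ I₄)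

lemma bilinear_mul_mem (k : Matrix I₄ I₄ ℂ) (Γ : 𝕄) {g : ℤ}
    {X : 𝒥} (hX : X ∈ graded I₁ I₂ I₃ I₄ 1 g 0) :
    Model.bilinear k Γ * X ∈ cubic I₁ I₂ I₃ I₄ 4 g := by
  simp only [Model.bilinear, sum_mul, smul_mul_assoc]
  exact sum_mem fun A _ => sum_mem fun B _ => Submodule.sum_mem _
    fun α _ => sum_mem fun β _ => smul_mem _ _
    (mul_mem_cubic (jet_zero_mem_graded (.psibar A α)) (jet_zero_mem_graded (.psi B β)) hX
      (by norm_num [Field.dim]) (by simp [Field.gh]) (by simp [Field.fermion]))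

lemma lagrangian_mem (f r P t c) : 𝓜.lagrangian f r P t c ∈ cubic I₁ I₂ I₃ I₄ 4 0 := by
  refine add_mem (add_mem (add_mem ?_ ?_) ?_)
    (add_mem ?_ ?_)
  · refine sum_mem fun a _ => sum_mem fun b _ => Submodule.sum_mem _
      fun e _ => smul_mem _ _ (add_mem ?_ (smul_mem _ _ ?_))
    · exact sum_mem fun μ _ => sum_mem fun ν _ => smul_mem _ _
        (mul_mem_cubic (d_mem_graded (v_mem_graded _ _) _) (v_mem_graded _ _) (v_mem_graded _ _)
          (by norm_num) rfl rfl)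
    · exact sum_mem fun μ _ => mul_mem_cubic (d_mem_graded (ut_mem_graded _) _)
        (v_mem_graded _ _) (u_mem_graded _) (by norm_num) rfl rfl
  · refine sum_mem fun a _ => sum_mem fun t _ => Submodule.sum_mem _
      fun s _ => smul_mem _ _ (add_mem (add_mem ?_
        (smul_mem _ _ ?_)) (smul_mem _ _ ?_))
    · exact sum_mem fun μ _ => mul_mem_cubic' (sc_mem_graded _)
        (d_mem_graded (sc_mem_graded _) _) (v_mem_graded _ _) (by norm_num) rfl rfl
    · exact sum_mem fun μ _ => smul_mem _ _ (mul_mem_cubic' (sc_mem_graded _)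
        (vGh_mem_graded _ _) (v_mem_graded _ _) (by norm_num) rfl rfl)
    · exact mul_mem_cubic' (sc_mem_graded _) (utGh_mem_graded _) (u_mem_graded _) (by norm_num)
        rfl rfl
  · exact smul_mem _ _ (sum_mem fun s _ => sum_mem fun t _ =>
      sum_mem fun p _ => smul_mem _ _ (mul_mem_cubic (sc_mem_graded _)
        (sc_mem_graded _) (sc_mem_graded _) (by norm_num) rfl rfl))
  · refine sum_mem fun a _ => sum_mem fun μ _ => ?_
    rw [Model.vectorCurrent, sum_mul]
    exact sum_mem fun ε _ => bilinear_mul_mem _ _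
      (smul_mem _ _ (v_mem_graded a μ))
  · refine sum_mem fun s _ => ?_
    rw [Model.scalarCurrent, sum_mul]
    exact sum_mem fun ε _ => bilinear_mul_mem _ _ (sc_mem_graded s)

lemma lagrangianVec_mem (f r t μ) : 𝓜.lagrangianVec f r t μ ∈ cubic I₁ I₂ I₃ I₄ 4 1 := by
  refine add_mem (add_mem ?_ ?_) ?_
  · refine sum_mem fun a _ => sum_mem fun b _ => Submodule.sum_mem _
      fun e _ => smul_mem _ _ (Submodule.sub_mem _ ?_ (smul_mem _ _ ?_))
    · exact sum_mem fun ν _ => mul_mem_cubic (u_mem_graded a)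
        (smul_mem _ _ (v_mem_graded b ν)) (Submodule.sub_mem _
          (smul_mem _ _ (d_mem_graded (v_mem_graded e μ) ν))
          (smul_mem _ _ (d_mem_graded (v_mem_graded e ν) μ))) (by norm_num) rfl rfl
    · exact mul_mem_cubic (u_mem_graded a) (u_mem_graded b)
        (smul_mem _ _ (d_mem_graded (ut_mem_graded e) μ)) (by norm_num) rfl rfl
  · refine sum_mem fun a _ => sum_mem fun t _ => Submodule.sum_mem _
      fun s _ => smul_mem _ _ (add_mem ?_ (smul_mem _ _ ?_))
    · exact mul_mem_cubic' (sc_mem_graded _) (smul_mem _ _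
        (d_mem_graded (sc_mem_graded _) _)) (u_mem_graded _) (by norm_num) rfl rfl
    · exact mul_mem_cubic' (sc_mem_graded _) (vGh_mem_graded _ _) (u_mem_graded _) (by norm_num)
        rfl rfl
  · refine sum_mem fun a _ => ?_
    rw [Model.vectorCurrent, sum_mul]
    exact sum_mem fun ε _ => bilinear_mul_mem _ _ (u_mem_graded a)

variable {𝓜} {c : Couplings I₁ I₂ I₃ I₄} (h : c.Relations 𝓜)
include h

lemma Couplings.Relations.Tint_eq : 𝓜.Tint c = 𝓜.lagrangian c.f c.r c.S c.t c.src := by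
  rw [StandardModel.Tint_eq 𝓜 c h.f_antisymm_left, potential_eq h.S_symm_left h.S_symm_right
    (fun _ _ _ => rfl) (fun _ _ _ => rfl) (fun _ _ _ => rfl) (fun _ _ _ => rfl)]
  rfl

lemma Couplings.Relations.isInteraction : 𝓜.IsInteraction (𝓜.Tint c) (𝓜.Tvec c) where
  mem := by
    rw [h.Tint_eq]
    exact lagrangian_mem 𝓜 _ _ _ _ _
  memv μ := by
    rw [Tvec_eq]
    exact lagrangianVec_mem 𝓜 _ _ _ μ
  scalar Λ S hL := by
    rw [h.Tint_eq]
    exact lorentzHom_lagrangian hL _ _ _ _ _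
  vector Λ S hL := by
    have e : 𝓜.Tvec c = 𝓜.lagrangianVec c.f c.r c.t := funext fun μ => Tvec_eq 𝓜 c μ
    rw [e]
    exact vec_lagrangianVec hL _ _ _
  gauge := by
    simp only [h.Tint_eq, Tvec_eq]
    exact h.gaugeRelations.dQ_lagrangian h.S_symm_left h.S_symm_right h.S_mass h.current

lemma Couplings.Relations.dQ_Tvec (μ : Fin 4) :
    𝓜.OnShellEq (𝓜.dQ (𝓜.Tvec c μ)) (I • ∑ ν, d ν (Model.Tten c μ ν)) := by
  rw [Tvec_eq]
  exact h.gaugeRelations.dQ_lagrangianVec c.t μ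

end

/-! ### Relative coboundaries -/

section

variable [Fintype I₁] [Fintype I₂] [Fintype I₃] (𝓜 : Model I₁ I₂ I₃ I₄)

lemma divergence_vvv (x y z : 𝒱) : ∑ μ, d μ (v x μ * ∑ ν, η ν • (v y ν * v z ν)) =
    (mA x y z + mB y x z + mB z x y : 𝒥) := by
  simp only [mA, mB, ← sum_add_distrib]
  refine sum_ext fun μ => ?_
  simp only [d_mul, map_sum, map_smul, mul_sum, mul_smul_comm, smul_add, ← mul_assoc]
  refine sum_ext fun ν => ?_
  rw [even_comm (v_mem x μ) (Y := d μ (v y ν)), even_comm' (d_mem_lin (v_mem z ν) μ)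
    (X := v x μ * v y ν), ← mul_assoc, add_mul, smul_add,
    add_assoc]

lemma divergence_uvut (a c b : 𝒱) : ∑ μ, d μ (u a * v c μ * ut b) =
    (mY a c b + mX c a b + (-1 : ℂ) • mZ b c a : 𝒥) := by
  simp only [mY, mX, mZ, smul_sum, ← sum_add_distrib]
  refine sum_ext fun μ => ?_
  simp only [d_mul, add_mul]
  rw [even_comm' (d_mem_lin (v_mem c μ) μ) (X := u a), even_comm' (v_mem c μ) (X := u a),
    mul_assoc (v c μ), odd_mul (u_mem a) (d_mem_lin (ut_mem b) μ), mul_smul_comm, ← mul_assoc,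
    even_comm (v_mem c μ)]

lemma divergence_vss (a : 𝒱) (s t : 𝒮) : ∑ μ, d μ (v a μ * sc s * sc t) =
    (mD a s t + mR a s t + mR a t s : 𝒥) := by
  simp only [mD, mR, ← sum_add_distrib]
  refine sum_ext fun μ => ?_
  simp only [d_mul, add_mul]
  rw [mul_assoc (v a μ) (sc s), even_comm (sc_mem s), ← mul_assoc]

lemma dQ_utvv (a b c : 𝒱) : 𝓜.dQ (∑ μ, η μ • (ut c * (v a μ * v b μ))) =
    (-I) • (mA c a b + 𝓜.m c • mK a b (.inl c) + (-1 : ℂ) • mY a b c + (-1 : ℂ) • mY b a c :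
      𝒥) := by
  have e : ∀ μ, 𝓜.dQ (η μ • (ut c * (v a μ * v b μ))) = (-I) •
      ((∑ ρ, η μ • (d ρ (v c ρ) * v a μ * v b μ)) + 𝓜.m c • (η μ • (v a μ * v b μ * sc (.inl c)))
        + (-1 : ℂ) • (d μ (u a) * v b μ * ut c) + (-1 : ℂ) • (d μ (u b) * v a μ * ut c) :
        𝒥) := fun μ => by
    have h1 : ut c * (d μ (u a) * v b μ) = (-1 : ℂ) • (d μ (u a) * v b μ * ut c : 𝒥) := by
      rw [odd_mul_left (ut_mem c) (d_mem_lin (u_mem a) μ), even_comm' (v_mem b μ), mul_assoc]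
    have h2 : ut c * (v a μ * d μ (u b)) = (-1 : ℂ) • (d μ (u b) * v a μ * ut c : 𝒥) := by
      rw [even_left_comm' (v_mem a μ), odd_mul (ut_mem c) (d_mem_lin (u_mem b) μ), mul_smul_comm,
        even_left_comm (v_mem a μ), mul_assoc]
    have h3 : ∀ ρ, d ρ (v c ρ) * (v a μ * v b μ) = (d ρ (v c ρ) * v a μ * v b μ :
        𝒥) := fun ρ => (mul_assoc _ _ _).symm
    rw [map_smul, dQ_mul_odd 𝓜 (ut_mem c), dQ_mul_even 𝓜 (v_mem a μ), dQ_ut, dQ_v, dQ_v]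
    simp only [smul_mul_assoc, mul_smul_comm, mul_add, add_mul, sum_mul, h1, h2, h3,
      even_comm (sc_mem (.inl c))]
    rw [← smul_sum]
    have := η_mul_self μ
    have hI := Complex.I_sq
    match_scalars <;> first | ring1 | linear_combination (I) * this
  simp only [map_sum, e, ← smul_sum (r := -I), sum_add_distrib,
    ← smul_sum (r := 𝓜.m c), ← smul_sum (r := (-1 : ℂ))]
  rw [sum_comm]
  rfl

lemma dQ_uutut (a b c : 𝒱) : 𝓜.dQ (u a * (ut b * ut c)) =
    I • (mX b a c + 𝓜.m b • mW a c (.inl b) + (-1 : ℂ) • mX c a b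
      + (-1 : ℂ) • 𝓜.m c • mW a b (.inl c) : 𝒥) := by
  have h1 : u a * ((∑ μ, d μ (v b μ)) * ut c) = (mX b a c : 𝒥) := by
    simp only [mX, sum_mul, mul_sum]
    refine sum_ext fun μ => ?_
    rw [even_left_comm' (d_mem_lin (v_mem b μ) μ), mul_assoc]
  have h2 : u a * (ut b * ∑ μ, d μ (v c μ)) = (mX c a b : 𝒥) := by
    simp only [mX, mul_sum]
    refine sum_ext fun μ => ?_
    rw [even_comm' (d_mem_lin (v_mem c μ) μ), even_left_comm' (d_mem_lin (v_mem c μ) μ), mul_assoc]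
  have h3 : u a * (sc (.inl b) * ut c) = (mW a c (.inl b) : 𝒥) := by
    rw [mW, even_comm (sc_mem _), mul_assoc]
  rw [dQ_mul_odd 𝓜 (u_mem a), dQ_mul_odd 𝓜 (ut_mem b), dQ_u, dQ_ut, dQ_ut, zero_mul, zero_add]
  simp only [smul_mul_assoc, mul_smul_comm, mul_add, add_mul, h1, h2, h3, ← mul_assoc (u a) (ut b)]
  rw [show u a * ut b * sc (.inl c) = (mW a b (.inl c) : 𝒥) from rfl]
  module

lemma dQ_utss (a : 𝒱) (s t : 𝒮) : 𝓜.dQ (ut a * (sc s * sc t)) =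
    (-I) • (mD a s t + 𝓜.m a • mS (.inl a) s t + (-1 : ℂ) • 𝓜.mGh s • (uGh s * ut a * sc t)
      + (-1 : ℂ) • 𝓜.mGh t • (uGh t * ut a * sc s) : 𝒥) := by
  have h1 : ut a * (uGh s * sc t) = (-1 : ℂ) • (uGh s * ut a * sc t : 𝒥) := by
    rw [odd_mul_left (ut_mem a) (uGh_mem s), mul_assoc]
  have h2 : ut a * (sc s * uGh t) = (-1 : ℂ) • (uGh t * ut a * sc s : 𝒥) := by
    rw [even_comm (sc_mem s), odd_mul_left (ut_mem a) (uGh_mem t), mul_assoc]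
  rw [dQ_mul_odd 𝓜 (ut_mem a), dQ_mul_even 𝓜 (sc_mem s), dQ_ut, dQ_sc, dQ_sc]
  simp only [smul_mul_assoc, mul_smul_comm, mul_add, add_mul, h1, h2, mD, mS, sum_mul, mul_assoc]
  module

/-- The boundary term of the parity violating expression. -/
def vvvDual (c a b : 𝒱) (ρ : Fin 4) : 𝒥 :=
  ∑ σ, ∑ μ, ∑ ν, (η ρ * lc ρ σ μ ν) • (v c σ * v a μ * v b ν)

lemma divergence_vvvDual (c a b : 𝒱) : ∑ ρ, d ρ (vvvDual c a b ρ) =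
    (mE c a b + (-1 : ℂ) • mE a c b + mE b c a : 𝒥) := by
  have e : ∀ ρ, d ρ (vvvDual c a b ρ) = ∑ σ, ∑ μ, ∑ ν, (η ρ * lc ρ σ μ ν) •
      (d ρ (v c σ) * v a μ * v b ν + d ρ (v a μ) * v c σ * v b ν + d ρ (v b ν) * v c σ * v a μ :
        𝒥) := fun ρ => by
    simp only [vvvDual, map_sum, map_smul, d_mul, add_mul]
    refine sum_ext fun σ => sum_ext fun μ => sum_ext fun ν => ?_
    rw [even_comm (v_mem c σ) (Y := d ρ (v a μ)), even_comm' (d_mem_lin (v_mem b ν) ρ)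
      (X := v c σ * v a μ), ← mul_assoc]
  have e1 : ∑ ρ, ∑ σ, ∑ μ, ∑ ν, (η ρ * lc ρ σ μ ν) • (d ρ (v a μ) * v c σ * v b ν) =
      (-1 : ℂ) • (mE a c b : 𝒥) := by
    simp only [mE, smul_sum, smul_smul]
    refine sum_ext fun ρ => ?_
    rw [sum_comm]
    refine sum_ext fun μ => sum_ext fun σ => sum_ext fun ν => ?_
    rw [(lc_swap ρ μ σ ν).2.1]
    congr 1
    ring
  have e2 : ∑ ρ, ∑ σ, ∑ μ, ∑ ν, (η ρ * lc ρ σ μ ν) • (d ρ (v b ν) * v c σ * v a μ) =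
      (mE b c a : 𝒥) := by
    refine sum_ext fun ρ => ?_
    rw [sum_rot]
    refine sum_ext fun ν => sum_ext fun σ => sum_ext fun μ => ?_
    rw [(lc_swap ρ σ ν μ).2.1, (lc_swap ρ σ μ ν).2.2, neg_neg]
  simp only [e, smul_add, sum_add_distrib, e1, e2]
  rfl

end

/-- The sum of a family of monomials with given coefficients. -/
def comb {A B C : Type*} [Fintype A] [Fintype B] [Fintype C] (α : A → B → C → ℂ)
    (M : A → B → C → 𝒥) : 𝒥 := ∑ a, ∑ b, ∑ c, α a b c • M a b c

section

variable {A B C : Type*} [Fintype A] [Fintype B] [Fintype C] {α β δ : A → B → C → ℂ}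
  {M : A → B → C → Jet I₁ I₂ I₃ I₄}

lemma comb_eq_add {γ : A → B → C → ℂ} (x y z : ℂ)
    (h : ∀ a b c, δ a b c = x * α a b c + y * β a b c + z * γ a b c) :
    comb δ M = x • comb α M + y • comb β M + z • comb γ M := by
  simp only [comb, h, add_smul, mul_smul, sum_add_distrib, ← smul_sum]

lemma map_comb (L : 𝒥 →ₗ[ℂ] 𝒥) : L (comb α M) = comb α fun a b c => L (M a b c) := by simp only [comb, map_sum, map_smul]

lemma comb_swap_right {α : A → B → B → ℂ} (x : ℂ) (h : ∀ a b c, α a c b = x * α a b c)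
    (M : A → B → B → 𝒥) :
    ∑ a, ∑ b, ∑ c, α a b c • M a c b = x • comb α M := by
  rw [comb, smul_sum]
  refine sum_ext fun a => ?_
  rw [sum_comm]
  simp only [smul_sum]
  exact sum_ext fun b => sum_ext fun c => by rw [h, mul_smul]

lemma comb_swap_left {α : B → B → A → ℂ} (x : ℂ) (h : ∀ a b c, α b a c = x * α a b c)
    (M : B → B → A → 𝒥) :
    ∑ a, ∑ b, ∑ c, α a b c • M b a c = x • comb α M := by
  rw [comb, sum_comm]
  simp only [smul_sum]
  exact sum_ext fun b => sum_ext fun c => sum_ext fun a => by rw [h, mul_smul]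

lemma comb_add {N : A → B → C → 𝒥} :
    (comb α fun a b c => M a b c + N a b c) = comb α M + comb α N := by
  simp only [comb, smul_add, sum_add_distrib]

lemma comb_smul (x : ℂ) : (comb α fun a b c => x • M a b c) = x • comb α M := by
  simp only [comb, smul_sum, smul_comm x]

lemma divergence_comb (M : Fin 4 → A → B → C → 𝒥) :
    ∑ μ, d μ (comb α (M μ)) = comb α fun a b c => ∑ μ, d μ (M μ a b c) := by
  simp only [map_comb]
  simp only [comb, smul_sum, ← Fintype.sum_prod_type']
  exact Fintype.sum_equiv ⟨fun x => (x.2.1, x.2.2.1, x.2.2.2, x.1),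
    fun x => (x.2.2.2, x.1, x.2.1, x.2.2.1), fun _ => rfl, fun _ => rfl⟩ _
    (fun x => α x.1 x.2.1 x.2.2.1 • d x.2.2.2 (M x.2.2.2 x.1 x.2.1 x.2.2.1)) fun _ => rfl

end

section

variable [Fintype I₁] [Fintype I₂] [Fintype I₃] (𝓜 : Model I₁ I₂ I₃ I₄)

lemma ymLagrangian_eq_comb (f : 𝒱 → 𝒱 → 𝒱 → ℂ) : (ymLagrangian f : 𝒥) =
      comb (fun c a b => f b a c) mB + (-1 : ℂ) • comb (fun b c a => f a c b) mZ := by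
  simp only [ymLagrangian, comb, smul_add, smul_comm _ (-1 : ℂ), sum_add_distrib,
    ← smul_sum (r := (-1 : ℂ))]
  rw [sum_swap_outer fun a b e => f a b e • mB e b a, sum_swap_outer fun a b e => f a b e • mZ e b a]

lemma sum_mGh_mid (r : 𝒱 → 𝒮 → 𝒮 → ℂ) (X : 𝒱 → 𝒮 → 𝒮 → 𝒥) :
    ∑ a, ∑ t, ∑ s, r a t s • 𝓜.mGh t • X a t s =
      ∑ a, ∑ b, ∑ s, (𝓜.m b * r a (.inl b) s) • X a (.inl b) s := by
  simp only [smul_comm _ (𝓜.mGh _), ← smul_sum (r := 𝓜.mGh _), sum_mGh]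
  simp only [smul_sum (s := univ (α := 𝒮)), smul_smul]

lemma sum_ghostPart (F : 𝒱 → ℂ) (X : 𝒮 → 𝒥) :
    ∑ s, ghostPart 𝓜 F s • X s = ∑ c, F c • 𝓜.m c • X (.inl c) := by
  rw [sum_sc]
  simp [ghostPart, smul_smul, mul_comm]

lemma scalarLagrangian_eq_comb (r : 𝒱 → 𝒮 → 𝒮 → ℂ) : (𝓜.scalarLagrangian r : 𝒥) = comb r mR
      + (-1 : ℂ) • comb (fun a b s => 𝓜.m a * r b (.inl a) s) mK
      + (-1 : ℂ) • comb (fun a b s => 𝓜.m b * r a (.inl b) s) mW := by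
  have e : ∀ a t s, 𝓜.scalarTerm a t s = (mR a t s + (-1 : ℂ) • (𝓜.mGh t • ∑ μ, η μ •
      (sc s * (vGh t μ * v a μ))) + (-1 : ℂ) • (𝓜.mGh t • (u a * utGh t * sc s)) :
      𝒥) := fun a t s => by
    have h1 : ∀ μ, sc s * (d μ (sc t) * v a μ) = (v a μ * d μ (sc t) * sc s : 𝒥) :=
      fun μ => by rw [even_comm (sc_mem s), even_comm (d_mem_lin (sc_mem t) μ)]
    have h2 : sc s * (utGh t * u a) = (-1 : ℂ) • (u a * utGh t * sc s : 𝒥) := by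
      rw [even_comm (sc_mem s)]
      rcases t with t | t
      · rw [utGh, Sum.elim_inl, odd_mul (ut_mem t) (u_mem a), smul_mul_assoc]
      · simp [utGh]
    simp only [Model.scalarTerm, h1, h2, mR]
    module
  have e1 := sum_mGh_mid 𝓜 r fun a t s => ((∑ μ, η μ • (sc s * (vGh t μ * v a μ)))
    + u a * utGh t * sc s : 𝒥)
  have e2 : ∀ a b s, ∑ μ, η μ • (sc s * (v b μ * v a μ)) = (mK b a s : 𝒥) :=
    fun a b s => sum_ext fun μ => by rw [even_comm (sc_mem s)]
  have e3 : comb (fun a b s => 𝓜.m a * r b (.inl a) s) mK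
      + comb (fun a b s => 𝓜.m b * r a (.inl b) s) mW =
      ∑ a, ∑ t, ∑ s, r a t s • 𝓜.mGh t • ((∑ μ, η μ • (sc s * (vGh t μ * v a μ)))
        + u a * utGh t * sc s : 𝒥) := by
    rw [e1]
    simp only [comb, vGh, utGh, Sum.elim_inl, e2, smul_add, sum_add_distrib]
    rw [sum_comm]
    rfl
  rw [add_assoc, ← smul_add, e3, comb]
  simp only [Model.scalarLagrangian, e, smul_sum (s := univ (α := 𝒱)),
    smul_sum (s := univ (α := 𝒮)), ← sum_add_distrib]
  refine sum_ext fun a => sum_ext fun t => sum_ext fun s => ?_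
  module

variable (k G l h : I₁ ⊕ I₂ → I₁ ⊕ I₂ → I₁ ⊕ I₂ → ℂ)
  (ω θ : I₁ ⊕ I₂ → (I₁ ⊕ I₂) ⊕ I₃ → (I₁ ⊕ I₂) ⊕ I₃ → ℂ) (E : I₁ ⊕ I₂ → I₁ ⊕ I₂ → I₁ ⊕ I₂ → ℂ)

/-- A general expression of ghost number `-1` and dimension three. -/
def boundaryQ : 𝒥 :=
  I • comb k (fun a b c => ∑ μ, η μ • (ut c * (v a μ * v b μ)))
    + (-I) • comb h (fun a b c => u a * (ut b * ut c))
    + I • comb ω (fun a s t => ut a * (sc s * sc t))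

/-- A general vector of ghost number `0` and dimension three, up to the factor `i`. -/
def boundaryVec (μ : Fin 4) : 𝒥 :=
  comb G (fun x y z => v x μ * ∑ ν, η ν • (v y ν * v z ν))
    + comb l (fun a c b => u a * v c μ * ut b) + comb θ (fun a s t => v a μ * sc s * sc t)
    + (1 / 6 : ℂ) • comb E (fun c a b => vvvDual c a b μ)

variable {k G l h ω θ E}

lemma dQ_boundaryQ (hk : ∀ a b c, k b a c = k a b c) (hh : ∀ a b c, h a c b = -h a b c)
    (hω : ∀ a s t, ω a t s = ω a s t) : 𝓜.dQ (boundaryQ k h ω) =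
    comb (fun c a b => k a b c) mA + comb (fun a b s => ghostPart 𝓜 (k a b) s) mK
    + (-2 : ℂ) • comb (fun a c b => k a c b) mY + (-2 : ℂ) • comb (fun c a b => h a b c) mX
    + (-2 : ℂ) • comb (fun a b s => ghostPart 𝓜 (h a b) s) mW + comb ω mD
    + comb (fun s t p => ghostPart 𝓜 (fun a => ω a t p) s) mS
    + (-2 : ℂ) • comb (fun a b s => 𝓜.m a * ω b (.inl a) s) mW := by
  have hI : I * -I = 1 := by rw [mul_neg, Complex.I_mul_I, neg_neg]
  have hI' : -I * I = 1 := by rw [neg_mul, Complex.I_mul_I, neg_neg]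
  have a1 : comb k (fun a b c => mA c a b) = (comb (fun c a b => k a b c) mA : 𝒥) := sum_rot _
  have a2 : comb k (fun a b c => 𝓜.m c • mK a b (.inl c)) =
      (comb (fun a b s => ghostPart 𝓜 (k a b) s) mK : 𝒥) := by simp only [comb, sum_ghostPart]
  have a3 : comb k (fun a b c => mY b a c) = (comb k mY : 𝒥) :=
    (comb_swap_left 1 (fun a b c => by rw [hk, one_mul]) mY).trans (one_smul _ _)
  have b1 : comb h (fun a b c => mX c a b) = (comb (fun c a b => h a b c) mX : 𝒥) := sum_rot _
  have b2 : comb h (fun a b c => mX b a c) = (-1 : ℂ) • (comb (fun c a b => h a b c) mX : 𝒥) :=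
    (comb_swap_right (-1) (fun a b c => by rw [hh, neg_one_mul]) fun a b c => mX c a b).trans
      (congrArg _ b1)
  have b3 : comb h (fun a b c => 𝓜.m c • mW a b (.inl c)) =
      (comb (fun a b s => ghostPart 𝓜 (h a b) s) mW : 𝒥) := by simp only [comb, sum_ghostPart]
  have b4 : comb h (fun a b c => 𝓜.m b • mW a c (.inl b)) =
      (-1 : ℂ) • (comb (fun a b s => ghostPart 𝓜 (h a b) s) mW : 𝒥) :=
    (comb_swap_right (-1) (fun a b c => by rw [hh, neg_one_mul]) fun a b c =>
      𝓜.m c • mW a b (.inl c)).trans (congrArg _ b3)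
  have c1 : comb ω (fun a s t => 𝓜.m a • StandardModel.mS (.inl a) s t) =
      (comb (fun s t p => ghostPart 𝓜 (fun a => ω a t p) s) StandardModel.mS : 𝒥) := by
    rw [comb, comb, sum_sc]
    simp [ghostPart, smul_smul, mul_comm]
  have c2 : comb ω (fun a s t => 𝓜.mGh s • (uGh s * ut a * sc t)) =
      (comb (fun a b s => 𝓜.m a * ω b (.inl a) s) mW : 𝒥) := by
    rw [comb, sum_mGh_mid 𝓜 ω fun a s t => uGh s * ut a * sc t, sum_comm]
    rfl
  have c3 : comb ω (fun a s t => 𝓜.mGh t • (uGh t * ut a * sc s)) =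
      (comb (fun a b s => 𝓜.m a * ω b (.inl a) s) mW : 𝒥) :=
    (comb_swap_right 1 (fun a b c => by rw [hω, one_mul]) fun a s t =>
        𝓜.mGh s • (uGh s * ut a * sc t)).trans ((one_smul _ _).trans c2)
  simp only [boundaryQ, map_add, map_smul, map_comb, dQ_utvv, dQ_uutut, dQ_utss, comb_smul,
    comb_add, a1, a2, a3, b1, b2, b3, b4, c1, c2, c3]
  simp only [smul_smul, smul_add, hI, one_smul]
  match_scalars <;> first | ring1 | linear_combination 2 * Complex.I_sq

lemma divergence_boundaryVec (hG : ∀ a b c, G a c b = G a b c) (hθ : ∀ a s t, θ a t s = θ a s t)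
    (hE : ∀ a b c, E b a c = -E a b c) (hE' : ∀ a b c, E a c b = -E a b c) :
    ∑ μ, d μ (boundaryVec G l θ E μ : 𝒥) = comb G mA
    + (2 : ℂ) • comb (fun c a b => G a b c) mB + comb l mY + comb (fun c a b => l a c b) mX
    + (-1 : ℂ) • comb (fun b c a => l a c b) mZ + comb θ mD + (2 : ℂ) • comb θ mR
    + (1 / 2 : ℂ) • comb E mE := by
  have e1 : comb G (fun x y z => mB z x y) = (comb (fun c a b => G a b c) mB : 𝒥) := sum_rot _
  have e2 : comb G (fun x y z => mB y x z) = (comb (fun c a b => G a b c) mB : 𝒥) :=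
    (comb_swap_right 1 (fun a b c => by rw [hG, one_mul]) fun x y z => mB z x y).trans
      ((one_smul _ _).trans e1)
  have e3 : comb θ (fun a s t => mR a t s) = (comb θ mR : 𝒥) :=
    (comb_swap_right 1 (fun a b c => by rw [hθ, one_mul]) _).trans (one_smul _ _)
  have e4 : comb l (fun a c b => mX c a b) = (comb (fun c a b => l a c b) mX : 𝒥) := sum_comm
  have e5 : comb l (fun a c b => mZ b c a) = (comb (fun b c a => l a c b) mZ :
      𝒥) := sum_swap_outer _
  have e6 : comb E (fun c a b => mE a c b) = (-1 : ℂ) • (comb E mE : 𝒥) :=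
    comb_swap_left (-1) (fun a b c => by rw [hE, neg_one_mul]) _
  have e7 : comb E (fun c a b => mE b c a) = (comb E mE : 𝒥) := by
    rw [comb, sum_rot]
    exact sum_ext fun b => sum_ext fun c => sum_ext fun a => by rw [hE', hE, neg_neg]
  simp only [boundaryVec, map_add, map_smul, sum_add_distrib, ← smul_sum,
    divergence_comb, divergence_vvv, divergence_uvut, divergence_vss, divergence_vvvDual,
    comb_add, comb_smul, e1, e2, e3, e4, e5, e6, e7]
  module

end

/-! ### The coupling constants of an interaction Lagrangian -/

section

variable (T : Jet I₁ I₂ I₃ I₄)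

def cG (a b c : 𝒱) : ℂ := (cB T c a b + cB T b a c) / 4

/-- The Yang-Mills coupling. -/
def cF (a b c : 𝒱) : ℂ := (cB T c b a - cB T a b c) / 2

def ck (a b c : 𝒱) : ℂ := cA T c a b / 2 - cG T c a b

def cl (a c b : 𝒱) : ℂ := cY T a c b + 2 * ck T a c b

def ch (a b c : 𝒱) : ℂ := (cl T a c b - cX T c a b) / 2

def cθ (a : 𝒱) (s t : 𝒮) : ℂ := (cR T a s t + cR T a t s) / 4

def cω (a : 𝒱) (s t : 𝒮) : ℂ := cD T a s t / 2 - cθ T a s t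

/-- The coupling of the scalars to the vector fields. -/
def cr (a : 𝒱) (t s : 𝒮) : ℂ := (cR T a t s - cR T a s t) / 2

/-- The self-coupling of the scalars. -/
def cP (𝓜 : ℳ) (s t p : 𝒮) : ℂ :=
  cS T s t p - 2 * (ghostPart 𝓜 (fun a => cω T a t p) s + ghostPart 𝓜 (fun a => cω T a s p) t
    + ghostPart 𝓜 (fun a => cω T a s t) p)

end

section

variable {T : Jet I₁ I₂ I₃ I₄} {Tv : Fin 4 → Jet I₁ I₂ I₃ I₄} {𝓜 : Model I₁ I₂ I₃ I₄}

lemma cG_symm (a b c : 𝒱) : cG T a c b = cG T a b c := by simp only [cG]; ring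

lemma cθ_symm (a : 𝒱) (s t) : cθ T a t s = cθ T a s t := by simp only [cθ]; ring

lemma cr_antisymm (a : 𝒱) (s t) : cr T a s t = -cr T a t s := by simp only [cr]; ring

section

variable (hT : T ∈ trilin I₁ I₂ I₃ I₄)
include hT

lemma ck_symm (a b c : 𝒱) : ck T b a c = ck T a b c := by rw [ck, cA_symm hT, cG_symm, ck]

lemma cω_symm (a : 𝒱) (s t) : cω T a t s = cω T a s t := by rw [cω, cD_symm hT, cθ_symm, cω]

lemma cP_symm_left (s t p) : cP T 𝓜 t s p = cP T 𝓜 s t p := by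
  simp only [cP, cS_symm_left hT s t p, cω_symm hT _ s t]
  ring

lemma cP_symm_right (s t p) : cP T 𝓜 s p t = cP T 𝓜 s t p := by
  simp only [cP, cS_symm_right hT s t p, cω_symm hT _ t p]
  ring

lemma cr_massless (a : 𝒱) (b : I₁) (s : 𝒮) : cr T a (.inl (.inl b)) s = 0 := by
  have h1 : cR T a (.inl (.inl b)) s = 0 :=
    tri_zero_mid hT _ _
  have h2 : cR T a s (.inl (.inl b)) = 0 :=
    tri_zero_right hT _ _
  rw [cr, h1, h2, sub_zero, zero_div]

end

variable (hT : 𝓜.IsInteraction T Tv)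
include hT

lemma cF_antisymm_left (a b c : 𝒱) : cF T b a c = -cF T a b c := by
  simp only [cF]
  linear_combination (1 / 2 : ℂ) * gauge_B hT c a b

omit hT in
lemma cF_antisymm_outer (a b c : 𝒱) : cF T c b a = -cF T a b c := by
  simp only [cF]
  ring

lemma cF_antisymm_right (a b c : 𝒱) : cF T a c b = -cF T a b c := by
  rw [cF_antisymm_outer, cF_antisymm_left hT, cF_antisymm_outer, neg_neg]

lemma cZ_eq (a b c : 𝒱) : cZ T b c a = -cF T a c b - cl T a c b := by
  simp only [cF, cl, ck, cG]
  linear_combination (1 / 2 : ℂ) * gauge_B hT a b c - gauge_Z hT a b c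

lemma ch_antisymm (a b c : 𝒱) : ch T a c b = -ch T a b c := by
  simp only [ch, cl, ck, cG]
  linear_combination (-1 / 2 : ℂ) * gauge_X hT a b c + (1 / 4 : ℂ) * gauge_B hT a b c

lemma cK_eq' (a b : 𝒱) (s) : cK T a b s = -2 * (𝓜.m a * cr T b (.inl a) s)
    + ghostPart 𝓜 (fun c => cF T a b c + 2 * ck T a b c) s := by
  rw [gauge_K hT, cr]
  rcases s with c | j <;> simp only [ghostPart]
  · rw [cZ_eq hT, cl]
    ring
  · ring

/-- The mass relation of the couplings. -/
lemma cr_mass (a b : 𝒱) (s) : 𝓜.m b * cr T a (.inl b) s - 𝓜.m a * cr T b (.inl a) s =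
    ghostPart 𝓜 (fun c => cF T c b a) s := by
  have h1 := cK_symm (cubic_le_trilin _ _ hT.mem) a b s
  rw [cK_eq' hT a b, cK_eq' hT b a] at h1
  rcases s with c | j <;> simp only [ghostPart] at h1 ⊢
  · rw [ck_symm (cubic_le_trilin _ _ hT.mem) a b, cF_antisymm_left hT a b] at h1
    rw [cF_antisymm_outer]
    linear_combination (-1 / 2 : ℂ) * h1
  · linear_combination (-1 / 2 : ℂ) * h1

lemma cK_eq (a b : 𝒱) (s) : cK T a b s = -(𝓜.m a * cr T b (.inl a) s)
    - 𝓜.m b * cr T a (.inl b) s + 2 * ghostPart 𝓜 (ck T a b) s := by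
  have h1 := cr_mass hT a b s
  rw [cK_eq' hT]
  rcases s with c | j <;> simp only [ghostPart] at h1 ⊢
  · rw [cF_antisymm_outer] at h1
    linear_combination h1
  · linear_combination h1

lemma cW_eq (a b : 𝒱) (s) : cW T a b s = -(𝓜.m b * cr T a (.inl b) s)
    - 2 * ghostPart 𝓜 (ch T a b) s - 2 * (𝓜.m a * cω T b (.inl a) s) := by
  rw [gauge_W hT, cK_eq hT]
  rcases s with c | j <;> simp only [ghostPart]
  · have h1 := ch_antisymm hT a b c
    simp only [cω, cθ, cr, ch, cl] at h1 ⊢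
    linear_combination (2 * 𝓜.m c) * h1
  · simp only [cω, cθ, cr]
    ring

lemma cP_mass (a : 𝒱) (s t) : 𝓜.m a * cP T 𝓜 (.inl a) s t = (𝓜.mPhi t - 𝓜.mPhi s) * cr T a s t := by
  have h1 := gauge_S hT a s t
  have e : (cR T a s t - cR T a t s) / 2 = cr T a s t := rfl
  rw [e] at h1
  have hs : ∀ a c, ∀ s : 𝒮, cr T a s c = - cr T a c s := fun a c s => cr_antisymm a s c
  have e2 : cD T a s t = 2 * cω T a s t + (cR T a s t + cR T a t s) / 2 := by
    simp only [cω, cθ]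
    ring
  rw [e2] at h1
  have ho := cω_symm (cubic_le_trilin _ _ hT.mem)
  simp only [cP, Model.mPhi]
  rcases s with s | s <;> rcases t with t | t <;>
    simp only [ghostPart, cW_eq hT, Model.mSc, Model.mGh, Sum.elim_inl, Sum.elim_inr] at h1 ⊢
  · rw [hs a (.inl s) (.inl t), ch_antisymm hT a s t, ho t (.inl s) (.inl a)] at h1
    rw [ho t (.inl s) (.inl a)]
    linear_combination h1
  · linear_combination h1
  · rw [hs a (.inr s) (.inl t)] at h1
    linear_combination h1
  · linear_combination h1

end

/-! ### Interaction Lagrangians up to coboundaries -/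

section

variable [Fintype I₁] [Fintype I₂] [Fintype I₃] [Fintype I₄]
  {T : Jet I₁ I₂ I₃ I₄} {Tv : Fin 4 → Jet I₁ I₂ I₃ I₄} {𝓜 : Model I₁ I₂ I₃ I₄}

lemma comb_cP (hT : T ∈ trilin _ _ _ _) : (1 / 6 : ℂ) • comb (cS T) mS =
    (1 / 6 : ℂ) • comb (cP T 𝓜) mS
      + (comb (fun s t p => ghostPart 𝓜 (fun a => cω T a t p) s) mS : 𝒥) := by
  have ho := cω_symm hT
  have e2 : (comb (fun s t p => ghostPart 𝓜 (fun a => cω T a s p) t) mS : 𝒥) =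
      comb (fun s t p => ghostPart 𝓜 (fun a => cω T a t p) s) mS := by
    rw [comb, sum_comm]
    simp only [mS_symm_left]
    rfl
  have e3 : (comb (fun s t p => ghostPart 𝓜 (fun a => cω T a s t) p) mS : 𝒥) =
      comb (fun s t p => ghostPart 𝓜 (fun a => cω T a s p) t) mS := by
    refine sum_ext fun s => sum_comm.trans ?_
    simp only [mS_symm_right]
  rw [comb_eq_add (δ := cS T) (α := cP T 𝓜) (β := fun s t p => ghostPart 𝓜 (fun a => cω T a t p) s)
    (γ := fun s t p => ghostPart 𝓜 (fun a => cω T a s p) t + ghostPart 𝓜 (fun a => cω T a s t) p)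
    1 2 2 fun s t p => by rw [cP]; ring, comb_eq_add
    (δ := fun s t p => ghostPart 𝓜 (fun a => cω T a s p) t + ghostPart 𝓜 (fun a => cω T a s t) p)
    (α := fun s t p => ghostPart 𝓜 (fun a => cω T a s p) t)
    (β := fun s t p => ghostPart 𝓜 (fun a => cω T a s t) p) (γ := 0) 1 1 0 fun s t p => by
      simp, e3, e2]
  module

lemma decomposition (hT : 𝓜.IsInteraction T Tv) (t : 𝒱 → ℤˣ → Matrix I₄ I₄ ℂ)
    (ht : ∀ a A B α β ρ, tri true true false (stPsibar A α) (stPsi B β) (stV a ρ) T =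
      ∑ ε, t a ε A B * (𝓜.γ ρ * 𝓜.γε ε) α β)
    (c : 𝒮 → ℤˣ → Matrix I₄ I₄ ℂ)
    (hc : ∀ s A B α β, tri true true false (stPsibar A α) (stPsi B β) (stS s) T =
      ∑ ε, c s ε A B * 𝓜.γε ε α β) :
    T = ymLagrangian (cF T) + 𝓜.scalarLagrangian (cr T) + (1 / 6 : ℂ) • comb (cP T 𝓜) mS
      + 𝓜.diracLagrangian t c + 𝓜.dQ (boundaryQ (ck T) (ch T) (cω T))
      + ∑ μ, d μ (boundaryVec (cG T) (cl T) (cθ T) (cE T) μ) := by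
  have h3 := cubic_le_trilin _ _ hT.mem
  have hE := cE_antisymm h3 (cubic_le_lowTrilin _ hT.mem) hT.scalar
  have n := normal_form hT.scalar hT.mem t ht c hc
  rw [ymLagrangian_eq_comb, scalarLagrangian_eq_comb, dQ_boundaryQ 𝓜 (ck_symm h3)
    (ch_antisymm hT) (cω_symm h3), divergence_boundaryVec cG_symm cθ_symm
    (fun a b c => by linear_combination hE b c a + hE a c b - gauge_E hT c b a) hE]
  have eA : (comb (cA T) mA : 𝒥) = (2 : ℂ) • comb (cG T) mA
      + (2 : ℂ) • comb (fun c a b => ck T a b c) mA + (0 : ℂ) • comb (cG T) mA :=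
    comb_eq_add _ _ _ fun a b c => by rw [ck]; ring
  have eB : (comb (cB T) mB : 𝒥) = (1 : ℂ) • comb (fun c a b => cF T b a c) mB
      + (2 : ℂ) • comb (fun c a b => cG T a b c) mB + (0 : ℂ) • comb (cG T) mB :=
    comb_eq_add _ _ _ fun a b c => by rw [cF, cG]; ring
  have eK' : (comb (fun a b s => 𝓜.m b * cr T a (.inl b) s) mK : 𝒥) =
      comb (fun a b s => 𝓜.m a * cr T b (.inl a) s) mK := by
    rw [comb, sum_comm]
    refine sum_ext fun a => sum_ext fun b => sum_ext fun s => congrArg _ ?_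
    exact sum_ext fun μ => by rw [even_comm (v_mem b μ)]
  have eK : (comb (cK T) mK : 𝒥) = (-1 : ℂ) • comb (fun a b s => 𝓜.m a * cr T b (.inl a) s) mK
      + (-1 : ℂ) • comb (fun a b s => 𝓜.m b * cr T a (.inl b) s) mK
      + (2 : ℂ) • comb (fun a b s => ghostPart 𝓜 (ck T a b) s) mK :=
    comb_eq_add _ _ _ fun a b c => by rw [cK_eq hT]; ring
  have eR : (comb (cR T) mR : 𝒥) = (1 : ℂ) • comb (cr T) mR
      + (2 : ℂ) • comb (cθ T) mR + (0 : ℂ) • comb (cr T) mR :=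
    comb_eq_add _ _ _ fun a b c => by rw [cr, cθ]; ring
  have eD : (comb (cD T) mD : 𝒥) = (2 : ℂ) • comb (cω T) mD
      + (2 : ℂ) • comb (cθ T) mD + (0 : ℂ) • comb (cθ T) mD :=
    comb_eq_add _ _ _ fun a b c => by rw [cω]; ring
  have eX : (comb (cX T) mX : 𝒥) = (1 : ℂ) • comb (fun c a b => cl T a c b) mX
      + (-2 : ℂ) • comb (fun c a b => ch T a b c) mX + (0 : ℂ) • comb (cX T) mX :=
    comb_eq_add _ _ _ fun a b c => by rw [ch]; ring
  have eY : (comb (cY T) mY : 𝒥) = (1 : ℂ) • comb (cl T) mY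
      + (-2 : ℂ) • comb (fun a c b => ck T a c b) mY + (0 : ℂ) • comb (cl T) mY :=
    comb_eq_add _ _ _ fun a b c => by rw [cl]; ring
  have eZ : (comb (cZ T) mZ : 𝒥) = (-1 : ℂ) • comb (fun b c a => cF T a c b) mZ
      + (-1 : ℂ) • comb (fun b c a => cl T a c b) mZ + (0 : ℂ) • comb (cZ T) mZ :=
    comb_eq_add _ _ _ fun a b c => by rw [cZ_eq hT]; ring
  have eW : (comb (cW T) mW : 𝒥) = (-1 : ℂ) • comb (fun a b s => 𝓜.m b * cr T a (.inl b) s) mW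
      + (-2 : ℂ) • comb (fun a b s => ghostPart 𝓜 (ch T a b) s) mW
      + (-2 : ℂ) • comb (fun a b s => 𝓜.m a * cω T b (.inl a) s) mW :=
    comb_eq_add _ _ _ fun a b c => by rw [cW_eq hT]; ring
  have eS := comb_cP (𝓜 := 𝓜) h3
  have n' : T = (1 / 2 : ℂ) • comb (cA T) mA + comb (cB T) mB + (1 / 2 : ℂ) • comb (cE T) mE
      + (1 / 2 : ℂ) • comb (cK T) mK + comb (cR T) mR + (1 / 2 : ℂ) • comb (cD T) mD
      + (1 / 6 : ℂ) • comb (cS T) mS + comb (cX T) mX + comb (cY T) mY + comb (cZ T) mZ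
      + comb (cW T) mW + 𝓜.diracLagrangian t c := n.trans (add_assoc _ _ _)
  rw [eS, eA, eB, eK, eK', eR, eD, eX, eY, eZ, eW] at n'
  refine n'.trans ?_
  module

end

section

variable [Fintype I₁] [Fintype I₂] [Fintype I₃] (k G l h E : I₁ ⊕ I₂ → I₁ ⊕ I₂ → I₁ ⊕ I₂ → ℂ)
  (ω θ : I₁ ⊕ I₂ → (I₁ ⊕ I₂) ⊕ I₃ → (I₁ ⊕ I₂) ⊕ I₃ → ℂ)

lemma comb_mem {A B C : Type*} [Fintype A] [Fintype B] [Fintype C] {α : A → B → C → ℂ}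
    {M : A → B → C → 𝒥} {p : Submodule ℂ 𝒥}
    (h : ∀ a b c, M a b c ∈ p) : comb α M ∈ p :=
  sum_mem fun a _ => sum_mem fun b _ => sum_mem fun c _ =>
    smul_mem _ _ (h a b c)

lemma boundaryQ_mem : (boundaryQ k h ω : 𝒥) ∈ cubic _ _ _ _ 3 (-1) := by
  refine add_mem (add_mem (smul_mem _ _ (comb_mem fun a b c => ?_))
    (smul_mem _ _ (comb_mem fun a b c => ?_)))
    (smul_mem _ _ (comb_mem fun a b c => ?_))
  · exact sum_mem fun μ _ => smul_mem _ _ (mul_mem_cubic' (ut_mem_graded _)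
      (v_mem_graded _ _) (v_mem_graded _ _) (by norm_num) rfl rfl)
  · exact mul_mem_cubic' (u_mem_graded _) (ut_mem_graded _) (ut_mem_graded _) (by norm_num) rfl rfl
  · exact mul_mem_cubic' (ut_mem_graded _) (sc_mem_graded _) (sc_mem_graded _) (by norm_num) rfl rfl

lemma boundaryVec_mem (μ : Fin 4) : (boundaryVec G l θ E μ : 𝒥) ∈ cubic _ _ _ _ 3 0 := by
  refine add_mem (add_mem (add_mem (comb_mem fun a b c => ?_)
    (comb_mem fun a b c => ?_)) (comb_mem fun a b c => ?_))
    (smul_mem _ _ (comb_mem fun a b c => ?_))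
  · simp only [mul_sum, mul_smul_comm]
    exact sum_mem fun μ _ => smul_mem _ _ (mul_mem_cubic' (v_mem_graded _ _)
      (v_mem_graded _ _) (v_mem_graded _ _) (by norm_num) rfl rfl)
  · exact mul_mem_cubic (u_mem_graded _) (v_mem_graded _ _) (ut_mem_graded _) (by norm_num) rfl rfl
  · exact mul_mem_cubic (v_mem_graded _ _) (sc_mem_graded _) (sc_mem_graded _) (by norm_num) rfl rfl
  · exact sum_mem fun σ _ => sum_mem fun μ _ => Submodule.sum_mem _
      fun ν _ => smul_mem _ _ (mul_mem_cubic (v_mem_graded _ _) (v_mem_graded _ _)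
        (v_mem_graded _ _) (by norm_num) rfl rfl)

variable {𝓜 : Model I₁ I₂ I₃ I₄} {Λ : Matrix (Fin 4) (Fin 4) ℝ} {S : Matrix (Fin 4) (Fin 4) ℂ}

lemma vec_comb {A B C : Type*} [Fintype A] [Fintype B] [Fintype C] {α : A → B → C → ℂ}
    {M : Fin 4 → A → B → C → 𝒥} {L : 𝒥 →ₐ[ℂ] 𝒥}
    (h : ∀ a b c, Vec Λ L fun μ => M μ a b c) : Vec Λ L fun μ => comb α (M μ) :=
  .sum _ fun a => .sum _ fun b => .sum _ fun c => .smul (h a b c) _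

lemma lorentzHom_boundaryQ (hL : 𝓜.IsLorentzPair Λ S) :
    lorentzHom Λ S (boundaryQ k h ω : 𝒥) = boundaryQ k h ω := by
  have e : ∀ a b c, lorentzHom Λ S (∑ μ, η μ • (ut c * (v a μ * v b μ)) : 𝒥) =
      ∑ μ, η μ • (ut c * (v a μ * v b μ)) := fun a b c => by
    simp only [← mul_smul_comm (η _) (ut c), ← mul_sum, map_mul, lorentzHom_ut]
    rw [Vec.contract hL (vec_v a) (vec_v b)]
  simp only [boundaryQ, map_add, map_smul, ← AlgHom.toLinearMap_apply, map_comb]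
  simp only [AlgHom.toLinearMap_apply, e]
  simp only [map_mul, lorentzHom_u, lorentzHom_ut, lorentzHom_sc]

lemma vec_vvvDual (hL : 𝓜.IsLorentzPair Λ S) (c a b : 𝒱) :
    Vec Λ (lorentzHom Λ S) (vvvDual c a b : Fin 4 → 𝒥) := fun ρ => by
  have e : ∀ σ μ ν, lorentzHom Λ S (v c σ * v a μ * v b ν) = ∑ α, ∑ β, ∑ κ,
      ((Λ σ α : ℂ) * Λ μ β * Λ ν κ) • (v c α * v a β * v b κ : 𝒥) := fun σ μ ν => by
    rw [map_mul, map_mul, vec_v c, vec_v a, vec_v b]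
    rw [sum_mul_sum, sum_mul]
    refine sum_ext fun α => ?_
    rw [sum_mul]
    refine sum_ext fun β => ?_
    rw [mul_sum]
    refine sum_ext fun κ => ?_
    rw [smul_mul_smul_comm, smul_mul_smul_comm]
  simp only [vvvDual, map_sum, map_smul, e]
  exact lc_contract_three hL _ ρ

lemma vec_boundaryVec (hL : 𝓜.IsLorentzPair Λ S) :
    Vec Λ (lorentzHom Λ S) (boundaryVec G l θ E : Fin 4 → 𝒥) := by
  refine ((Vec.add ?_ ?_).add ?_).add (Vec.smul ?_ _)
  · exact vec_comb fun a b c => (vec_v a).mul_right (Vec.contract hL (vec_v b) (vec_v c))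
  · exact vec_comb fun a b c => ((vec_v b).mul_left (lorentzHom_u a)).mul_right (lorentzHom_ut c)
  · exact vec_comb fun a s t => ((vec_v a).mul_right (lorentzHom_sc s)).mul_right (lorentzHom_sc t)
  · exact vec_comb fun a b c => vec_vvvDual hL a b c

end

/-! ### The couplings of an interaction Lagrangian -/

/-- The couplings of an interaction Lagrangian with given currents. -/
def couplings (𝓜 : ℳ) (T : 𝒥) (t : 𝒱 → ℤˣ → Matrix I₄ I₄ ℂ)
    (c : 𝒮 → ℤˣ → Matrix I₄ I₄ ℂ) : Couplings I₁ I₂ I₃ I₄ where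
  f := cF T
  fp a b e := cr T e (.inl b) (.inl a)
  fSp j b e := cr T e (.inl b) (.inr j)
  fSpp j b e := cP T 𝓜 (.inr j) (.inl b) (.inl e)
  fSSp j k e := cr T e (.inr k) (.inr j)
  fSSpp j k e := cP T 𝓜 (.inr j) (.inr k) (.inl e)
  lam j k l := cP T 𝓜 (.inr j) (.inr k) (.inr l)
  t := t
  s a := Sum.elim (fun _ => 0) (fun a => c (.inl (.inr a))) a
  sS j := c (.inr j)

section

variable {T : Jet I₁ I₂ I₃ I₄} {Tv : Fin 4 → Jet I₁ I₂ I₃ I₄} {𝓜 : Model I₁ I₂ I₃ I₄}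
  {t : I₁ ⊕ I₂ → ℤˣ → Matrix I₄ I₄ ℂ} {c : (I₁ ⊕ I₂) ⊕ I₃ → ℤˣ → Matrix I₄ I₄ ℂ}

lemma couplings_r (hT : T ∈ trilin _ _ _ _) : (couplings 𝓜 T t c).r = cr T := by
  have h1 := cr_massless hT
  have h2 : ∀ a (b : I₁) s, cr T a s (.inl (.inl b)) = 0 := fun a b s => by
    rw [cr_antisymm, h1, neg_zero]
  funext a t s
  rcases t with (t | t) | t <;> rcases s with (s | s) | s <;>
    simp only [couplings, Couplings.r, h1, h2]
  exact (cr_antisymm _ _ _).symm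

lemma couplings_relations (hT : 𝓜.IsInteraction T Tv) (h : ∀ a ε A B,
    I * (𝓜.mD A * t a ε A B - t a (-ε) A B * 𝓜.mD B) = 𝓜.m a * c (.inl a) ε A B) :
    (couplings 𝓜 T t c).Relations 𝓜 := by
  have h3 := cubic_le_trilin _ _ hT.mem
  have h0 : ∀ a : I₁, 𝓜.m (.inl a) = 0 := fun _ => rfl
  have m0 : ∀ b : I₂, 𝓜.m (.inr b) ≠ 0 := fun b => by simp [Model.m, (𝓜.massV_pos b).ne']
  have k1 : ∀ j k e, 𝓜.m e * cP T 𝓜 (.inr j) (.inr k) (.inl e) =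
      (𝓜.mS j ^ 2 - 𝓜.mS k ^ 2) * cr T e (.inr k) (.inr j) := fun j k e => by
    rw [← cP_symm_right h3, ← cP_symm_left h3, ← cP_symm_right h3, cP_mass hT, mPhi_inr, mPhi_inr]
  have k2 : ∀ j b e, 𝓜.m e * cP T 𝓜 (.inr j) (.inl b) (.inl e) =
      𝓜.mS j ^ 2 * cr T e (.inl b) (.inr j) := fun j b e => by
    rw [← cP_symm_right h3, ← cP_symm_left h3, ← cP_symm_right h3, cP_mass hT, mPhi_inr, mPhi_inl,
      sub_zero]
  have k3 : ∀ j k (e : I₂), cP T 𝓜 (.inr j) (.inr k) (.inl (.inr e)) = 1 / 𝓜.m (.inr e) *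
      (𝓜.mS j ^ 2 - 𝓜.mS k ^ 2) * cr T (.inr e) (.inr k) (.inr j) := fun j k e => by
    rw [mul_assoc, ← k1]
    field_simp [m0 e]
  constructor
  · exact fun a b e => by
      simp only [couplings]
      rw [cr_antisymm, cr_massless h3, neg_zero]
  · exact fun a ε => rfl
  · exact cF_antisymm_left hT
  · exact cF_antisymm_right hT
  · exact fun a b e => cr_antisymm _ _ _
  · exact fun a b e => (cr_mass hT e b (.inl (.inr a))).trans rfl
  · exact fun j b e => cr_mass hT e (.inr b) (.inr j)
  · rintro (a | a) ε A B
    · refine (h _ _ _ _).trans ?_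
      rw [h0, zero_mul, zero_mul]
    · exact h _ _ _ _
  · intro j b e
    refine mul_left_cancel₀ (m0 e) ((k2 j (.inr b) (.inr e)).trans ?_)
    simp only [couplings]
    field_simp [m0 e]
  · exact fun j k e => cr_antisymm _ _ _
  · intro j k e
    refine (k1 j k (.inl e)).symm.trans ?_
    rw [h0, zero_mul]
  · intro j k e
    refine (k3 j k e).trans ?_
    simp only [couplings]
    rw [cr_antisymm _ (.inr k) (.inr j)]
    ring
  · exact k3
  · exact fun j k l => cP_symm_left h3 _ _ _
  · exact fun j k l => cP_symm_right h3 _ _ _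

variable [Fintype I₁] [Fintype I₂] [Fintype I₃] [Fintype I₄]

lemma couplings_Tint (hT : 𝓜.IsInteraction T Tv) : 𝓜.Tint (couplings 𝓜 T t c) =
    ymLagrangian (cF T) + 𝓜.scalarLagrangian (cr T) + (1 / 6 : ℂ) • comb (cP T 𝓜) mS
      + 𝓜.diracLagrangian t c := by
  have h3 := cubic_le_trilin _ _ hT.mem
  have m0 : ∀ b : I₂, 𝓜.m (.inr b) ≠ 0 := fun b => by simp [Model.m, (𝓜.massV_pos b).ne']
  rw [Tint_eq 𝓜 _ (cF_antisymm_left hT), couplings_r h3, potential_eq (cP_symm_left h3 (𝓜 := 𝓜))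
    (cP_symm_right h3) (fun a b e => (mul_eq_zero.1 ((cP_mass hT _ _ _).trans (by
      rw [mPhi_inl, mPhi_inl, sub_self, zero_mul]))).resolve_left (m0 a)) (fun _ _ _ => rfl)
    (fun _ _ _ => rfl) (fun _ _ _ => rfl)]
  refine congrArg₂ _ rfl ?_
  rw [Model.diracLagrangian, Model.diracLagrangian]
  refine congrArg₂ _ rfl (sum_ext fun s => ?_)
  rcases s with (s | s) | s
  · have : (sc (.inl (.inl s)) : 𝒥) = 0 := rfl
    rw [this, mul_zero, mul_zero]
  · rfl
  · rfl

lemma exists_cohomologous (hT : 𝓜.IsInteraction T Tv) :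
    ∃ c : Couplings I₁ I₂ I₃ I₄, c.Relations 𝓜 ∧ 𝓜.Cohomologous T (𝓜.Tint c) := by
  have hl := cubic_le_lowTrilin _ hT.mem
  obtain ⟨t, ht⟩ := exists_vectorCurrent hl hT.scalar
  obtain ⟨c, hc⟩ := exists_scalarCurrent hl hT.scalar
  refine ⟨couplings 𝓜 T t c, couplings_relations hT (gauge_current hT ht hc),
    boundaryQ (ck T) (ch T) (cω T), fun μ =>
      (-I) • boundaryVec (cG T) (cl T) (cθ T) (cE T) μ, boundaryQ_mem _ _ _,
    fun μ => smul_mem _ _ (boundaryVec_mem _ _ _ _ μ),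
    fun Λ S hL => lorentzHom_boundaryQ _ _ _ hL,
    fun Λ S hL => (vec_boundaryVec _ _ _ _ hL).smul _, .of_eq ?_⟩
  rw [couplings_Tint hT]
  refine (decomposition hT t ht c hc).trans ?_
  simp only [map_smul, ← smul_sum, smul_smul, mul_neg, Complex.I_mul_I, neg_neg, one_smul]

end

end StandardModel

end

theorem mainTheorem4 {I₁ I₂ I₃ I₄ : Type*} [Fintype I₁] [Fintype I₂] [Fintype I₃] [Fintype I₄]
    (𝓜 : StandardModel.Model I₁ I₂ I₃ I₄) :
    (∀ (T : StandardModel.Jet I₁ I₂ I₃ I₄) (Tv : Fin 4 → StandardModel.Jet I₁ I₂ I₃ I₄),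
      𝓜.IsInteraction T Tv →
        ∃ c : StandardModel.Couplings I₁ I₂ I₃ I₄,
          c.Relations 𝓜 ∧ 𝓜.Cohomologous T (𝓜.Tint c)) ∧
    (∀ c : StandardModel.Couplings I₁ I₂ I₃ I₄, c.Relations 𝓜 →
      𝓜.IsInteraction (𝓜.Tint c) (𝓜.Tvec c) ∧
      (∀ μ, 𝓜.OnShellEq (𝓜.dQ (𝓜.Tvec c μ))
        (Complex.I • ∑ ν, StandardModel.d ν (StandardModel.Model.Tten c μ ν))) ∧
      (∀ μ ν, 𝓜.OnShellEq (𝓜.dQ (StandardModel.Model.Tten c μ ν)) 0)) ∧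
    (∀ (a : I₁ ⊕ I₂) (t s : ℤˣ → Matrix I₄ I₄ ℂ),
      𝓜.OnShellEq (∑ μ, StandardModel.d μ (𝓜.vectorCurrent t μ)) (𝓜.m a • 𝓜.scalarCurrent s) ↔
        ∀ ε A B, Complex.I * (𝓜.mD A * t ε A B - t (-ε) A B * 𝓜.mD B) = 𝓜.m a * s ε A B) := by
  exact ⟨fun T Tv hT => StandardModel.exists_cohomologous hT,
    fun c h => ⟨h.isInteraction, fun μ => h.dQ_Tvec μ, fun μ ν =>
      .of_eq (StandardModel.dQ_Tten c μ ν)⟩,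
    fun a t s => StandardModel.divergence_vectorCurrent_iff a t s⟩
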